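/- **Setting.** Let $r\ge 2$, $N\ge 0$, $g\ge 0$, $n\ge 1$ be integers, $\lambda_1,\dots,\lambda_N\in\mathbb C$, and $V(z)=\sum_{j=1}^{r+1}\frac{v_j}{j}z^j$ with $v_j\in\mathbb C$, $v_{r+1}\neq 0$. A *map* is a finite connected graph with at least one edge, embedded in an oriented closed surface so that the complement is a disjoint union of discs (the faces); maps are taken up to orientation-preserving homeomorphism respecting all decorations. The vertices are black (of degree between $3$ and $r+1$), white, or square; each face is adjacent to at most one white vertex. Unmarked faces are decorated by elements of the family $\lambda_1,\dots,\lambda_N$. For a map $G$ of genus $g$ put $\deg G=(r+1)(\#\mathcal E(G)-\#\mathcal V(G))$. Consider the following sets of maps of genus $g$. * $\mathcal F_{g,n}(z_1,\dots,z_n)$ (*unciliated*): only black vertices; $n$ marked faces labelled $1,\dots,n$, the $i$-th decorated by $z_i$; all other faces unmarked. * $\mathcal W_{g,n}(z_1,\dots,z_n)$ (*ciliated*): black vertices and exactly $n$ white vertices, of degree 1, labelled $1,\dots,n$; the face adjacent to the $i$-th white vertex is decorated by $z_i$; all other faces unmarked. * $\mathcal U_{g,n}(u;z_1,\dots,z_n)$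 (*square-ciliated*): as $\mathcal W_{g,n}$, but with exactly one square vertex in addition, of arbitrary positive degree and decorated by $u$, to which the edge of the first white vertex is attached. * $\mathcal S_{g;\underline k}(S_1,\dots,S_n)$ (*multi-ciliated*), where $k_i\ge1$ and $S_i=[z_{i,1},\dots,z_{i,k_i}]$ is cyclically ordered: black vertices and exactly $n$ white vertices labelled $1,\dots,n$; the $i$-th one has degree $k_i$, its corners lie in pairwise distinct faces, and these faces are decorated by $z_{i,1},\dots,z_{i,k_i}$ in clockwise order; all other faces unmarked. The weight $w(G)$ is the product of: for each edge whose two sides lie in faces decorated by $a,b$, the propagator $\mathcal P(a,b)=\frac{a-b}{V'(a)-V'(b)}$, with $\mathcal P(a,a)=1/V''(a)$; for each black vertex whose corners lie in faces decorated by $a_1,\dots,a_d$, the symmetric polynomial $\mathcal V_d(a_1,\dots,a_d)$ which equals $\sum_i\frac{-V'(a_i)}{\prod_{j\ne i}(a_i-a_j)}$ for distinct $a_i$; for the square vertex, $\prod_i\frac1{u-a_i}$ over its corners; white vertices have weight 1. The generating functions $F_{g,n},W_{g,n},U_{g,n},S_{g;\underline k}$ are the sums of $\frac{w(G)}{\#\mathrm{Aut}\,G}\alpha^{-\deg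 G}$ over the respective sets, as formal Laurent series in $\alpha^{-1}$; derivatives, residues and limits are taken coefficientwise. Call a collection of decorations *admissible* if, together with the $\lambda_j$, all its members $a,b$ satisfy $V''(a)\ne0$, and $V'(a)\neq V'(b)$ whenever $a\ne b$. **Theorem.** In each of the four sets there are, for given labels, finitely many maps of each degree, so the generating functions are well defined; and the following hold. 1. For admissible $z_1,\dots,z_n$ (with also $z_1\ne z_2$ if $(g,n)=(0,2)$, and $z_1\neq\lambda_j$ for all $j$ if $(g,n)=(0,1)$) the coefficients of $F_{g,n}$ are holomorphic near $(z_1,\dots,z_n)$, and $$W_{g,n}(z_1,\dots,z_n)=\frac1{V''(z_1)}\frac{\partial}{\partial z_1}\cdots\frac1{V''(z_n)}\frac{\partial}{\partial z_n}F_{g,n}(z_1,\dots,z_n)+\delta_{g,0}\delta_{n,2}\Big(\frac1{V''(z_1)V''(z_2)(z_1-z_2)^2}-\frac1{(V'(z_1)-V'(z_2))^2}\Big)+\delta_{g,0}\delta_{n,1}\sum_{j=1}^N\Big(\frac1{V''(z_1)(z_1-\lambda_j)}-\frac1{V'(z_1)-V'(\lambda_j)}\Big).$$ 2. If $(g,n)\ne(0,1)$,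 $k_1,\dots,k_n\geq 1$, the $z_{i,j}$ are admissible and, for each $i$, $z_{i,1},\dots,z_{i,k_i}$ are pairwise distinct, then $$S_{g;\underline k}(S_1,\dots,S_n)=\sum_{j_1=1}^{k_1}\cdots\sum_{j_n=1}^{k_n}\frac{W_{g,n}(z_{1,j_1},\dots,z_{n,j_n})}{\prod_{m=1}^n\Big(\alpha^{(k_m-1)(r+1)}\prod_{i\neq j_m}\big(V'(z_{m,j_m})-V'(z_{m,i})\big)\Big)}.$$ 3. For admissible $z_1,\dots,z_n$ (each coefficient of $U_{g,n}$ being holomorphic in $u$ in a punctured neighbourhood of $\infty$), $$-\operatorname*{Res}_{u=\infty}du\,V'(u)\,U_{g,n}(u;z_1,\dots,z_n)=\delta_{g,0}\delta_{n,1}\frac{V'(z_1)}{V''(z_1)}\alpha^{r+1},$$ $$-\operatorname*{Res}_{u=\infty}du\,V'(u)(u-z_1)\,U_{g,n}(u;z_1,\dots,z_n)=\frac{V'(z_1)}{V''(z_1)}W_{g,n}(z_1,\dots,z_n)+\delta_{g,0}\delta_{n,1}\frac{N}{V''(z_1)},$$ $$\lim_{u\to\infty}u^2\Big(U_{g,n}(u;z_1,\dots,z_n)-\delta_{g,0}\delta_{n,1}\frac{\alpha^{r+1}}{V''(z_1)(u-z_1)}\Big)=\frac{W_{g,n}(z_1,\dots,z_n)}{V''(z_1)}.$$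 -/

import Mathlib

open scoped Topology

noncomputable section

namespace Kontsevich

/-! ### The potential and the local weights -/

/-- The potential `V(z) = ∑_{j=1}^{r+1} (v_j / j) z^j`. -/
def potential (r : ℕ) (v : ℕ → ℂ) : Polynomial ℂ :=
  ∑ j ∈ Finset.Icc 1 (r + 1), Polynomial.C (v j / (j : ℂ)) * Polynomial.X ^ j

/-- The function `V'`. -/
def dV (r : ℕ) (v : ℕ → ℂ) (z : ℂ) : ℂ :=
  (Polynomial.derivative (potential r v)).eval z

/-- The function `V''`. -/
def ddV (r : ℕ) (v : ℕ → ℂ) (z : ℂ) : ℂ :=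
  (Polynomial.derivative (Polynomial.derivative (potential r v))).eval z

open Classical in
/-- The propagator `P(a, b) = (a - b) / (V'(a) - V'(b))`, with `P(a, a) = 1 / V''(a)`. -/
def propagator (r : ℕ) (v : ℕ → ℂ) (a b : ℂ) : ℂ :=
  if a = b then 1 / ddV r v a else (a - b) / (dV r v a - dV r v b)

open Classical in
/-- The weight `V_d(a_1, …, a_d)` of a black vertex: the symmetric polynomial which at pairwise
distinct arguments is `∑_i - V'(a_i) / ∏_{j ≠ i} (a_i - a_j)`
(see `vertexWeight_of_injective` below), written out as
`- ∑_{j ≥ d} v_j ∑_{l_1 + ⋯ + l_d = j - d} a_1^{l_1} ⋯ a_d^{l_d}`. -/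
def vertexWeight (r : ℕ) (v : ℕ → ℂ) {ι : Type} [Fintype ι] (a : ι → ℂ) : ℂ :=
  -∑ j ∈ Finset.Icc (Fintype.card ι) (r + 1),
    v j * ∑ l ∈ Finset.piAntidiag (Finset.univ : Finset ι) (j - Fintype.card ι), ∏ i, a i ^ l i

/-! Proof that the polynomial `vertexWeight` is given by the stated fraction at distinct arguments. -/

theorem key_poly {ι : Type} [Fintype ι] [DecidableEq ι] [Nonempty ι]
    (a : ι → ℂ) (ha : Function.Injective a) :
    (Polynomial.X : Polynomial ℂ) ^ (Fintype.card ι - 1) =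
      ∑ i, Polynomial.C (∏ j ∈ Finset.univ.erase i, (a i - a j))⁻¹ *
        ∏ j ∈ Finset.univ.erase i, (1 - Polynomial.C (a j) * Polynomial.X) := by
  apply Polynomial.eq_of_infinite_eval_eq
  apply Set.Infinite.mono (s := {0}ᶜ) _ (Set.finite_singleton (0 : ℂ)).infinite_compl
  intro t ht
  have ht : t ≠ 0 := ht
  have h := congrArg (Polynomial.eval t⁻¹)
    (Lagrange.sum_basis (s := Finset.univ) (v := a) ha.injOn Finset.univ_nonempty)
  simp only [Polynomial.eval_finsetSum, Polynomial.eval_one, Lagrange.basis,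
    Lagrange.basisDivisor, Polynomial.eval_prod, Polynomial.eval_mul, Polynomial.eval_C,
    Polynomial.eval_sub, Polynomial.eval_X] at h
  change Polynomial.eval t _ = Polynomial.eval t _
  simp only [Polynomial.eval_pow, Polynomial.eval_X, Polynomial.eval_finsetSum,
    Polynomial.eval_mul, Polynomial.eval_C, Polynomial.eval_prod, Polynomial.eval_sub,
    Polynomial.eval_one]
  conv_lhs => rw [← mul_one (t ^ _), ← h, Finset.mul_sum]
  refine Finset.sum_congr rfl fun i _ => ?_
  have hc : Fintype.card ι - 1 = (Finset.univ.erase i).card := by simp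
  rw [hc, ← Finset.prod_const, ← Finset.prod_inv_distrib, ← Finset.prod_mul_distrib,
    ← Finset.prod_mul_distrib]
  refine Finset.prod_congr rfl fun j _ => ?_
  field_simp

theorem geom_mul (b : ℂ) :
    PowerSeries.mk (fun m => b ^ m) * (1 - PowerSeries.C b * PowerSeries.X) = 1 := by
  ext m
  cases m with
  | zero => simp [mul_sub, ← mul_assoc]
  | succ m => simp [mul_sub, ← mul_assoc, PowerSeries.coeff_succ_mul_X, PowerSeries.coeff_one, pow_succ]

theorem key_series {ι : Type} [Fintype ι] [DecidableEq ι] [Nonempty ι]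
    (a : ι → ℂ) (ha : Function.Injective a) :
    (PowerSeries.X : PowerSeries ℂ) ^ (Fintype.card ι - 1) *
        ∏ i, PowerSeries.mk (fun m => a i ^ m) =
      ∑ i, PowerSeries.C (∏ j ∈ Finset.univ.erase i, (a i - a j))⁻¹ *
        PowerSeries.mk (fun m => a i ^ m) := by
  have h2 := congrArg (Polynomial.coeToPowerSeries.ringHom (R := ℂ)) (key_poly a ha)
  simp only [map_pow, map_sum, map_mul, map_prod, map_sub, map_one,
    Polynomial.coeToPowerSeries.ringHom_apply, Polynomial.coe_X, Polynomial.coe_C] at h2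
  rw [h2, Finset.sum_mul]
  refine Finset.sum_congr rfl fun i _ => ?_
  rw [← Finset.mul_prod_erase Finset.univ _ (Finset.mem_univ i), mul_assoc,
    mul_left_comm (∏ j ∈ Finset.univ.erase i, _), ← Finset.prod_mul_distrib]
  congr 1
  have hone : ∀ j ∈ Finset.univ.erase i, (1 - PowerSeries.C (a j) * PowerSeries.X) *
      PowerSeries.mk (fun m => a j ^ m) = 1 := fun j _ => by rw [mul_comm, geom_mul]
  rw [Finset.prod_congr rfl hone, Finset.prod_const_one, mul_one]

theorem coeff_prod_geom {ι : Type} [Fintype ι] [DecidableEq ι] (a : ι → ℂ) (m : ℕ) :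
    PowerSeries.coeff m (∏ i, PowerSeries.mk (fun m => a i ^ m)) =
      ∑ l ∈ Finset.piAntidiag (Finset.univ : Finset ι) m, ∏ i, a i ^ l i := by
  rw [PowerSeries.coeff_prod]
  refine Finset.sum_bij' (fun l _ => ⇑l) (fun l _ => Finsupp.equivFunOnFinite.symm l) ?_ ?_ ?_ ?_ ?_
  all_goals simp

theorem key_sum {ι : Type} [Fintype ι] [DecidableEq ι] [Nonempty ι]
    (a : ι → ℂ) (ha : Function.Injective a) (m : ℕ) :
    ∑ i, a i ^ m / ∏ j ∈ Finset.univ.erase i, (a i - a j) =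
      if Fintype.card ι ≤ m + 1 then
        ∑ l ∈ Finset.piAntidiag (Finset.univ : Finset ι) (m + 1 - Fintype.card ι), ∏ i, a i ^ l i
      else 0 := by
  have h := congrArg (PowerSeries.coeff m) (key_series a ha)
  rw [PowerSeries.coeff_X_pow_mul', coeff_prod_geom] at h
  simp only [map_sum, PowerSeries.coeff_C_mul, PowerSeries.coeff_mk] at h
  have hp : 0 < Fintype.card ι := Fintype.card_pos
  rw [show m - (Fintype.card ι - 1) = m + 1 - Fintype.card ι by omega] at h
  rw [if_congr (show Fintype.card ι ≤ m + 1 ↔ Fintype.card ι - 1 ≤ m by omega) rfl rfl, h]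
  exact Finset.sum_congr rfl fun i _ => by rw [div_eq_inv_mul]

theorem dV_eq (r : ℕ) (v : ℕ → ℂ) (z : ℂ) :
    dV r v z = ∑ j ∈ Finset.Icc 1 (r + 1), v j * z ^ (j - 1) := by
  simp only [dV, potential, Polynomial.derivative_sum, Polynomial.eval_finsetSum]
  refine Finset.sum_congr rfl fun j hj => ?_
  have hj0 : (j : ℂ) ≠ 0 := by
    have := (Finset.mem_Icc.mp hj).1
    exact_mod_cast (by omega : j ≠ 0)
  rw [Polynomial.derivative_C_mul_X_pow]
  simp only [Polynomial.eval_mul, Polynomial.eval_C, Polynomial.eval_pow, Polynomial.eval_X]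
  field_simp

open Classical in
theorem vertexWeight_of_injective (r : ℕ) (v : ℕ → ℂ) {ι : Type} [Fintype ι] [Nonempty ι]
    (a : ι → ℂ) (ha : Function.Injective a) :
    vertexWeight r v a = ∑ i, -dV r v (a i) / ∏ j ∈ Finset.univ.erase i, (a i - a j) := by
  have hp : 0 < Fintype.card ι := Fintype.card_pos
  have h1 : ∑ i, -dV r v (a i) / ∏ j ∈ Finset.univ.erase i, (a i - a j) =
      -∑ j ∈ Finset.Icc 1 (r + 1), v j *
        ∑ i, a i ^ (j - 1) / ∏ j ∈ Finset.univ.erase i, (a i - a j) := by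
    simp only [dV_eq, neg_div, Finset.sum_neg_distrib, Finset.sum_div, Finset.mul_sum]
    rw [Finset.sum_comm]
    simp only [mul_div_assoc]
  rw [h1, vertexWeight]
  congr 1
  refine Eq.trans ?_ (Finset.sum_subset
    (Finset.Icc_subset_Icc_left (show 1 ≤ Fintype.card ι from hp)) ?_)
  · refine Finset.sum_congr rfl fun j hj => ?_
    have hj1 := (Finset.mem_Icc.mp hj).1
    rw [key_sum a ha, show j - 1 + 1 = j by omega, if_pos hj1]
  · intro j hj hj'
    rw [Finset.mem_Icc] at hj hj'
    rw [key_sum a ha, if_neg (by omega), mul_zero]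

/-! ### Maps

A map on an oriented closed surface is encoded by its rotation system: the darts (half-edges),
the permutation `rot` sending a dart to the next dart counterclockwise around its vertex, and the
fixed-point free involution `opp` exchanging the two halves of an edge.  Vertices are the cycles of
`rot`, edges the cycles of `opp`, faces the cycles of `face = rot⁻¹ ∘ opp`.  A dart `d` also stands
for the corner between `d` and `rot d`; this corner lies in the face which is on the left when one
walks along `d` away from its vertex, that is, in the cycle of `d` under `face`. -/

/-- The types of vertices; white vertices carry a label in `Fin n`. -/
inductive VertexType (n : ℕ) : Type
  | black : VertexType n
  | white (i : Fin n) : VertexType n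
  | square : VertexType n

/-- A map whose vertices are black, white (labelled by `Fin n`) or square, and whose faces are
decorated by a label in `M` (the decorations of the marked faces) or an index in `Fin N` (the index
`j` standing for the decoration `λ_j` of an unmarked face). -/
structure DecoratedMap (n : ℕ) (M : Type) (N : ℕ) : Type where
  /-- the number of darts -/
  size : ℕ
  rot : Equiv.Perm (Fin size)
  opp : Equiv.Perm (Fin size)
  opp_opp : ∀ d, opp (opp d) = d
  opp_ne : ∀ d, opp d ≠ d
  /-- the type of the vertex of a dart -/
  vtype : Fin size → VertexType n
  vtype_rot : ∀ d, vtype (rot d) = vtype d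
  /-- the decoration of the face containing the corner of a dart -/
  deco : Fin size → M ⊕ Fin N
  deco_face : ∀ d, deco (rot.symm (opp d)) = deco d

namespace DecoratedMap

variable {n : ℕ} {M : Type} {N : ℕ}

/-- The face permutation. -/
def face (G : DecoratedMap n M N) : Equiv.Perm (Fin G.size) := G.opp.trans G.rot.symm

abbrev Vertices (G : DecoratedMap n M N) : Type :=
  Quotient (Equiv.Perm.SameCycle.setoid G.rot)

abbrev Edges (G : DecoratedMap n M N) : Type :=
  Quotient (Equiv.Perm.SameCycle.setoid G.opp)

abbrev Faces (G : DecoratedMap n M N) : Type :=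
  Quotient (Equiv.Perm.SameCycle.setoid G.face)

instance {m : ℕ} (p : Equiv.Perm (Fin m)) : Fintype (Quotient (Equiv.Perm.SameCycle.setoid p)) :=
  Fintype.ofFinite _

/-- The corners around a vertex. -/
abbrev Corners (G : DecoratedMap n M N) (x : G.Vertices) : Type :=
  {d : Fin G.size // (Quotient.mk _ d : G.Vertices) = x}

instance {m : ℕ} (s : Setoid (Fin m)) (x : Quotient s) :
    Fintype {d : Fin m // Quotient.mk s d = x} := Fintype.ofFinite _

/-- The degree (valency) of a vertex. -/
def vdeg (G : DecoratedMap n M N) (x : G.Vertices) : ℕ := Fintype.card (G.Corners x)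

/-- The type of a vertex. -/
def vertexType (G : DecoratedMap n M N) (x : G.Vertices) : VertexType n := G.vtype x.out

/-- The graph is non-empty and connected. -/
def Connected (G : DecoratedMap n M N) : Prop :=
  0 < G.size ∧ ∀ d d' : Fin G.size,
    ∃ p ∈ Subgroup.closure ({G.rot, G.opp} : Set (Equiv.Perm (Fin G.size))), p d = d'

/-- Euler's relation `#V - #E + #F = 2 - 2 g`. -/
def HasGenus (G : DecoratedMap n M N) (g : ℕ) : Prop :=
  (Fintype.card G.Vertices : ℤ) - Fintype.card G.Edges + Fintype.card G.Faces = 2 - 2 * (g : ℤ)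

/-- The degree of a map, `(r + 1) (#E - #V)`. -/
def deg (r : ℕ) (G : DecoratedMap n M N) : ℤ :=
  ((r : ℤ) + 1) * ((Fintype.card G.Edges : ℤ) - Fintype.card G.Vertices)

/-- Isomorphisms of decorated maps: bijections of the darts respecting all the structure. -/
@[ext]
structure Iso (G H : DecoratedMap n M N) : Type where
  toEquiv : Fin G.size ≃ Fin H.size
  map_rot : ∀ d, toEquiv (G.rot d) = H.rot (toEquiv d)
  map_opp : ∀ d, toEquiv (G.opp d) = H.opp (toEquiv d)
  map_vtype : ∀ d, H.vtype (toEquiv d) = G.vtype d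
  map_deco : ∀ d, H.deco (toEquiv d) = G.deco d

/-- Being isomorphic. -/
instance isoSetoid (n : ℕ) (M : Type) (N : ℕ) : Setoid (DecoratedMap n M N) where
  r G H := Nonempty (Iso G H)
  iseqv :=
    { refl := fun _ => ⟨⟨Equiv.refl _, fun _ => rfl, fun _ => rfl, fun _ => rfl, fun _ => rfl⟩⟩
      symm := fun {G H} ⟨φ⟩ => ⟨
        { toEquiv := φ.toEquiv.symm
          map_rot := fun d => by
            rw [Equiv.symm_apply_eq, φ.map_rot, Equiv.apply_symm_apply]
          map_opp := fun d => by
            rw [Equiv.symm_apply_eq, φ.map_opp, Equiv.apply_symm_apply]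
          map_vtype := fun d => by rw [← φ.map_vtype, Equiv.apply_symm_apply]
          map_deco := fun d => by rw [← φ.map_deco, Equiv.apply_symm_apply] }⟩
      trans := fun ⟨φ⟩ ⟨ψ⟩ => ⟨
        { toEquiv := φ.toEquiv.trans ψ.toEquiv
          map_rot := fun d => by simp [φ.map_rot, ψ.map_rot]
          map_opp := fun d => by simp [φ.map_opp, ψ.map_opp]
          map_vtype := fun d => by simp [φ.map_vtype, ψ.map_vtype]
          map_deco := fun d => by simp [φ.map_deco, ψ.map_deco] }⟩ }

/-- The number `#Aut(G)` of automorphisms. -/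
def autCard (G : DecoratedMap n M N) : ℕ := Nat.card (Iso G G)

/-- The weight of a map, where the labels of the faces have the complex values given by `val` and a
square vertex is decorated by `u`. -/
def weight (r : ℕ) (v : ℕ → ℂ) (val : M ⊕ Fin N → ℂ) (u : ℂ) (G : DecoratedMap n M N) : ℂ :=
  (∏ e : G.Edges, propagator r v (val (G.deco e.out)) (val (G.deco (G.opp e.out)))) *
  ∏ x : G.Vertices,
    match G.vertexType x with
    | .black => vertexWeight r v (fun c : G.Corners x => val (G.deco c.1))
    | .white _ => 1
    | .square => ∏ c : G.Corners x, 1 / (u - val (G.deco c.1))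

/-! ### The four families of generalised Kontsevich graphs -/

/-- Conditions common to the four families: a connected map of genus `g`, whose black vertices have
degree between `3` and `r + 1`, each face being adjacent to at most one white vertex. -/
structure IsKontsevich (r g : ℕ) (G : DecoratedMap n M N) : Prop where
  connected : G.Connected
  genus : G.HasGenus g
  black_degree : ∀ x : G.Vertices, G.vertexType x = .black → 3 ≤ G.vdeg x ∧ G.vdeg x ≤ r + 1
  face_white : ∀ d d' : Fin G.size, ∀ i j : Fin n, G.face.SameCycle d d' →
    G.vtype d = .white i → G.vtype d' = .white j → G.rot.SameCycle d d'

/-- For each `i` there is exactly one white vertex labelled `i`, and it has degree `k i`. -/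
def HasWhiteVertices (G : DecoratedMap n M N) (k : Fin n → ℕ) : Prop :=
  ∀ i : Fin n, ∃ x : G.Vertices,
    (∀ y : G.Vertices, G.vertexType y = .white i ↔ y = x) ∧ G.vdeg x = k i

/-- The face of `d` is adjacent to the white vertex labelled `i`. -/
def AdjWhite (G : DecoratedMap n M N) (d : Fin G.size) (i : Fin n) : Prop :=
  ∃ d' : Fin G.size, G.face.SameCycle d d' ∧ G.vtype d' = .white i

/-- Unciliated graphs: only black vertices; for each `i` exactly one face is marked by `i`. -/
structure IsUnciliated (r g : ℕ) (G : DecoratedMap n (Fin n) N) : Prop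
    extends IsKontsevich r g G where
  only_black : ∀ d, G.vtype d = .black
  marked : ∀ i : Fin n, ∃ f : G.Faces, ∀ d, G.deco d = .inl i ↔ (Quotient.mk _ d : G.Faces) = f

/-- Ciliated graphs: black vertices and univalent white vertices labelled by `Fin n`; the face
adjacent to the `i`-th white vertex is the `i`-th marked face. -/
structure IsCiliated (r g : ℕ) (G : DecoratedMap n (Fin n) N) : Prop
    extends IsKontsevich r g G where
  no_square : ∀ d, G.vtype d ≠ .square
  white : G.HasWhiteVertices (fun _ => 1)
  marked : ∀ (i : Fin n) (d : Fin G.size), G.deco d = .inl i ↔ G.AdjWhite d i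

/-- Square ciliated graphs: as ciliated graphs, but with exactly one square vertex, which is joined
to the first white vertex by the edge of the latter. -/
structure IsSquareCiliated [NeZero n] (r g : ℕ) (G : DecoratedMap n (Fin n) N) : Prop
    extends IsKontsevich r g G where
  one_square : ∃ x : G.Vertices, ∀ y : G.Vertices, G.vertexType y = .square ↔ y = x
  white : G.HasWhiteVertices (fun _ => 1)
  marked : ∀ (i : Fin n) (d : Fin G.size), G.deco d = .inl i ↔ G.AdjWhite d i
  first_white : ∀ d, G.vtype d = .white 0 → G.vtype (G.opp d) = .square

/-- Multi-ciliated graphs: the `i`-th white vertex has degree `k i` and satisfies the star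
constraint; the faces around it are decorated with the labels `(i, 0), …, (i, k i - 1)` in clockwise
(cyclic) order, and all the other faces are unmarked. -/
structure IsMultiCiliated (k : Fin n → ℕ) (r g : ℕ)
    (G : DecoratedMap n (Σ i : Fin n, Fin (k i)) N) : Prop
    extends IsKontsevich r g G where
  no_square : ∀ d, G.vtype d ≠ .square
  white : G.HasWhiteVertices k
  star : ∀ (i : Fin n) (d d' : Fin G.size), G.vtype d = .white i → G.vtype d' = .white i →
    G.face.SameCycle d d' → d = d'
  clockwise : ∀ (i : Fin n) (d : Fin G.size), G.vtype d = .white i →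
    ∃ j : Fin (k i), G.deco d = .inl ⟨i, j⟩ ∧
      G.deco (G.rot.symm d) = .inl ⟨i, finRotate (k i) j⟩
  marked : ∀ (i : Fin n) (j : Fin (k i)) (d : Fin G.size),
    G.deco d = .inl ⟨i, j⟩ → G.AdjWhite d i

end DecoratedMap

open DecoratedMap

/-! ### Generating functions -/

variable {n : ℕ} {M : Type} {N : ℕ}

/-- The set of isomorphism classes of the maps of degree `k` in a given class of maps. -/
def isoClasses (r : ℕ) (𝒢 : Set (DecoratedMap n M N)) (k : ℤ) :
    Set (Quotient (isoSetoid n M N)) :=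
  (fun G => (Quotient.mk _ G : Quotient (isoSetoid n M N))) '' {G | G ∈ 𝒢 ∧ G.deg r = k}

/-- The sum of `w(G) / #Aut(G)` over the maps `G` of degree `k` in `𝒢`, up to isomorphism. -/
def degreeSum (r : ℕ) (v : ℕ → ℂ) (val : M ⊕ Fin N → ℂ) (u : ℂ)
    (𝒢 : Set (DecoratedMap n M N)) (k : ℤ) : ℂ :=
  ∑ᶠ c ∈ isoClasses r 𝒢 k, c.out.weight r v val u / (c.out.autCard : ℂ)

theorem bddBelow_support_degreeSum (r : ℕ) (v : ℕ → ℂ) (val : M ⊕ Fin N → ℂ) (u : ℂ)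
    (𝒢 : Set (DecoratedMap n M N)) (g : ℕ) (h : ∀ G ∈ 𝒢, G.HasGenus g) :
    BddBelow (Function.support (degreeSum r v val u 𝒢)) := by
  refine ⟨((r : ℤ) + 1) * (2 * g - 2), fun k hk => ?_⟩
  have hne : (isoClasses r 𝒢 k).Nonempty := by
    by_contra hcon
    rw [Set.not_nonempty_iff_eq_empty] at hcon
    apply hk
    simp [degreeSum, hcon]
  obtain ⟨_, G, ⟨hG, hk'⟩, -⟩ := hne
  have hg := h G hG
  unfold HasGenus at hg
  rw [← hk', deg]
  apply mul_le_mul_of_nonneg_left _ (by positivity)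
  have : (0 : ℤ) ≤ Fintype.card G.Faces := by positivity
  linarith

/-- The generating function `∑_G (w(G) / #Aut(G)) α^{-deg G}` of a class `𝒢` of maps of genus `g`,
up to isomorphism: a formal Laurent series in `α⁻¹`. -/
def genFun (r : ℕ) (v : ℕ → ℂ) (val : M ⊕ Fin N → ℂ) (u : ℂ)
    (𝒢 : Set (DecoratedMap n M N)) (g : ℕ) (h : ∀ G ∈ 𝒢, G.HasGenus g) : LaurentSeries ℂ :=
  HahnSeries.ofSuppBddBelow (degreeSum r v val u 𝒢)
    (bddBelow_support_degreeSum r v val u 𝒢 g h)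

/-- The parameter `α`, in the ring of formal Laurent series in `α⁻¹`. -/
def alpha : LaurentSeries ℂ := HahnSeries.single (-1) 1

/-- A complex number as a constant formal Laurent series. -/
def const (c : ℂ) : LaurentSeries ℂ := HahnSeries.C c

/-- The generating function `F_{g,n}` of unciliated graphs.  (There is no square vertex, so that
the parameter `u` of the weight plays no role; the same holds for `W` and `S`.) -/
def genF (r : ℕ) (v : ℕ → ℂ) (lam : Fin N → ℂ) (g : ℕ) (z : Fin n → ℂ) : LaurentSeries ℂ :=
  genFun r v (Sum.elim z lam) 0 {G : DecoratedMap n (Fin n) N | G.IsUnciliated r g} g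
    (fun _ h => h.genus)

/-- The generating function `W_{g,n}` of ciliated graphs. -/
def genW (r : ℕ) (v : ℕ → ℂ) (lam : Fin N → ℂ) (g : ℕ) (z : Fin n → ℂ) : LaurentSeries ℂ :=
  genFun r v (Sum.elim z lam) 0 {G : DecoratedMap n (Fin n) N | G.IsCiliated r g} g
    (fun _ h => h.genus)

/-- The generating function `U_{g,n}(u; ·)` of square ciliated graphs. -/
def genU [NeZero n] (r : ℕ) (v : ℕ → ℂ) (lam : Fin N → ℂ) (g : ℕ) (u : ℂ) (z : Fin n → ℂ) :
    LaurentSeries ℂ :=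
  genFun r v (Sum.elim z lam) u {G : DecoratedMap n (Fin n) N | G.IsSquareCiliated r g} g
    (fun _ h => h.genus)

/-- The generating function `S_{g;k}` of multi-ciliated graphs. -/
def genS (r : ℕ) (v : ℕ → ℂ) (lam : Fin N → ℂ) (g : ℕ) (k : Fin n → ℕ)
    (z : (i : Fin n) → Fin (k i) → ℂ) : LaurentSeries ℂ :=
  genFun r v (Sum.elim (fun p : Σ i : Fin n, Fin (k i) => z p.1 p.2) lam) 0
    {G : DecoratedMap n (Σ i : Fin n, Fin (k i)) N | G.IsMultiCiliated k r g} g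
    (fun _ h => h.genus)

/-! ### Notions used in the relations -/

/-- The decorations are such that no propagator has a vanishing denominator. -/
def Admissible (r : ℕ) (v : ℕ → ℂ) (z : M → ℂ) (lam : Fin N → ℂ) : Prop :=
  ∀ p q : M ⊕ Fin N, ddV r v (Sum.elim z lam p) ≠ 0 ∧
    (Sum.elim z lam p ≠ Sum.elim z lam q → dV r v (Sum.elim z lam p) ≠ dV r v (Sum.elim z lam q))

/-- The differential operator `(1 / V''(z_i)) ∂/∂z_i`. -/
def dOp (r : ℕ) (v : ℕ → ℂ) (i : Fin n) (f : (Fin n → ℂ) → ℂ) : (Fin n → ℂ) → ℂ :=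
  fun z => 1 / ddV r v (z i) * deriv (fun t => f (Function.update z i t)) (z i)

/-- The operator `(1 / V''(z_1)) ∂/∂z_1 ⋯ (1 / V''(z_n)) ∂/∂z_n`. -/
def dOpAll (r : ℕ) (v : ℕ → ℂ) (f : (Fin n → ℂ) → ℂ) : (Fin n → ℂ) → ℂ :=
  (List.finRange n).foldr (dOp r v) f

/-- `f` is holomorphic in a punctured neighbourhood of `∞` and the residue of `f(u) du` at
`u = ∞`, i.e. `-(1 / 2πi) ∮_{|u| = R} f(u) du` for large `R`, equals `c`. -/
def HasResidueAtInfinity (f : ℂ → ℂ) (c : ℂ) : Prop :=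
  (∀ᶠ u in Bornology.cobounded ℂ, DifferentiableAt ℂ f u) ∧
  ∀ᶠ R : ℝ in Filter.atTop,
    -((2 * (Real.pi : ℂ) * Complex.I)⁻¹ * circleIntegral f 0 R) = c

end Kontsevich

end

open scoped Topology

noncomputable section

set_option linter.unusedSectionVars false

namespace Kontsevich

open Equiv

/-! ### Orbits of permutations -/

section Orbits

variable {D E : Type}

/-! The weight of a black vertex is, up to sign, the divided difference of `V'` at the decorations
around it (`vw_diff`), and the propagator is minus the inverse of the weight that a bivalent vertex
would have (`propagator_eq`). So a change of one label acts locally. In a vertex weight it adds one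
argument, as a further edge attached at the corner would do. In a propagator it inserts a trivalent
vertex in the edge (`propagator_diff`), as an edge ending on that side would do. The whole theorem
compares such changes of labels with the attachment of an edge in all possible ways.

Automorphisms are handled by labelling the darts: a sum over isomorphism classes with weights `1 /
#Aut` is a sum over graphs on `m` labelled darts divided by `m!` (`degreeSum_eq_total`). Fixing
degree and genus fixes the number `e` of edges minus vertices and the number `f` of faces, and
bounds `m`. Attaching or removing an edge changes `m` by two; choosing its two darts costs a factor
`(m + 2)(m + 1)`, which the factorials absorb (`sum_pointed`, `total_of_step`).

From `F` to `W`: removing a cilium leaves a root vertex of arbitrary degree (`cilTot_eq`). A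
univalent root can be painted white, a bivalent one is erased and marks a side of an edge, and one
of degree at least three marks a corner (`rootTot_eq`). Hence a new cilium in the face of `z` is
`P(z, z) = 1 / V''(z)` times a sum over the corners and sides of that face (`plainTot_addCil`),
which is the derivative with respect to `z` (`hasDerivAt_plainTot`). The only graph missed by the
derivative is a bivalent vertex with a loop on the sphere, since erasing its vertex leaves no graph;
it gives the two correction terms (`propagator_mul_vw`).

From `U` to `W`: the residue at infinity of `V'(u) ∏ 1 / (u - a)` is the weight of a black vertex
with corners `a` (`hasResidueAtInfinity_dV_sqw`). The square vertex therefore becomes a root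
weighted as a black vertex. With the corner `z` of the cilium included, the univalent roots cancel
all the others (`rootTot_self`). With this corner removed by the factor `u - z`, sides and corners
of the face cancel because there are equally many of them (`side_add_corner`). As `u` tends to
infinity, only the univalent roots survive the rescaling by `u ^ 2`.

From `W` to `S`: removing an edge at a white vertex merges two consecutive faces. Conversely, the
far end of this edge can be attached to every corner and every side of the merged face. When the
attaching point moves along the face, one label after the other changes, and the weights telescope
to the difference between giving the whole face one decoration or the other (`mixWt_telescope`).
This yields a divided difference recursion in the variables `V'(z)` (`plainTot_merge`). The sum over
the choices of one corner at each white vertex satisfies the same recursion (`repSum_option`), and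
induction on the number of marked faces concludes (`plainTot_star`). -/

open Classical in
/-- The cycle of an element under a permutation, as a finite set. -/
def orb [Fintype D] (σ : Perm D) (d : D) : Finset D := Finset.univ.filter (σ.SameCycle d)

open Classical in
/-- The set of the cycles (fixed points included) of a permutation. -/
def orbs [Fintype D] (σ : Perm D) : Finset (Finset D) := Finset.univ.image (orb σ)

@[simp] theorem mem_orb [Fintype D] {σ : Perm D} {d e : D} : e ∈ orb σ d ↔ σ.SameCycle d e := by
  simp [orb]

theorem mem_orb_self [Fintype D] (σ : Perm D) (d : D) : d ∈ orb σ d :=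
  mem_orb.2 (Perm.SameCycle.refl _ _)

theorem mem_orbs [Fintype D] {σ : Perm D} {s : Finset D} : s ∈ orbs σ ↔ ∃ d, orb σ d = s := by
  simp [orbs]

theorem orb_mem_orbs [Fintype D] (σ : Perm D) (d : D) : orb σ d ∈ orbs σ := mem_orbs.2 ⟨d, rfl⟩

theorem orb_eq_orb [Fintype D] {σ : Perm D} {d e : D} : orb σ d = orb σ e ↔ σ.SameCycle d e := by
  constructor
  · intro h
    rw [← mem_orb, h]
    exact mem_orb_self σ e
  · intro h
    ext x
    simp only [mem_orb]
    exact ⟨fun h' => h.symm.trans h', fun h' => h.trans h'⟩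

theorem eq_orb_of_mem [Fintype D] {σ : Perm D} {s : Finset D} (hs : s ∈ orbs σ) {d : D}
    (hd : d ∈ s) : s = orb σ d := by
  obtain ⟨e, rfl⟩ := mem_orbs.1 hs
  exact orb_eq_orb.2 (mem_orb.1 hd)

theorem sameCycle_step (σ : Perm D) (d : D) : σ.SameCycle d (σ d) :=
  (Perm.sameCycle_apply_right).2 (Perm.SameCycle.refl _ _)

/-- A function invariant under a permutation is constant on its cycles. -/
theorem SameCycle.invariant {X : Type*} {σ : Perm D} {f : D → X} (hf : ∀ d, f (σ d) = f d)
    {d e : D} (h : σ.SameCycle d e) : f d = f e := by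
  obtain ⟨i, rfl⟩ := h
  have hinv : ∀ d, f (σ⁻¹ d) = f d := fun d => by
    have := hf (σ⁻¹ d)
    rw [show σ (σ⁻¹ d) = d from σ.apply_symm_apply d] at this
    exact this.symm
  induction i with
  | zero => rfl
  | succ i ih => rw [add_comm, zpow_add, zpow_one, Perm.mul_apply, hf, ih]
  | pred i ih => rw [sub_eq_neg_add, zpow_add, zpow_neg_one, Perm.mul_apply, hinv, ih]

theorem SameCycle.invariant_prop {σ : Perm D} {p : D → Prop} (hf : ∀ d, p (σ d) ↔ p d)
    {d e : D} (h : σ.SameCycle d e) : p d ↔ p e :=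
  iff_of_eq (SameCycle.invariant (f := p) (fun d => propext (hf d)) h)

/-- A map between sets with permutations compatible up to cycles maps cycles to cycles. -/
theorem SameCycle.map_of {σ : Perm D} {τ : Perm E} {f : D → E}
    (hf : ∀ d, τ.SameCycle (f d) (f (σ d))) {d e : D} (h : σ.SameCycle d e) :
    τ.SameCycle (f d) (f e) := by
  have := SameCycle.invariant_prop (σ := σ) (p := fun x => τ.SameCycle (f d) (f x))
    (fun x => ⟨fun h' => h'.trans (hf x).symm, fun h' => h'.trans (hf x)⟩) h
  exact this.1 (Perm.SameCycle.refl _ _)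

/-- A permutation extended by a fixed point. -/
def fixOpt (σ : Perm D) : Perm (Option D) := optionCongr σ

open Classical in
/-- A permutation with `none` inserted in a cycle, just after `c`. -/
def insOpt (σ : Perm D) (c : D) : Perm (Option D) where
  toFun
    | none => some (σ c)
    | some a => if a = c then none else some (σ a)
  invFun
    | none => some c
    | some b => if b = σ c then none else some (σ.symm b)
  left_inv := by
    rintro (_ | a)
    · simp
    · by_cases h : a = c <;> simp [h]
  right_inv := by
    rintro (_ | b)
    · simp
    · by_cases h : b = σ c
      · simp [h]
      · have : σ.symm b ≠ c := fun h' => h (by rw [← h']; simp)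
        simp [h, this]

variable (σ : Perm D) (c : D)

@[simp] theorem fixOpt_none : fixOpt σ none = none := rfl
@[simp] theorem fixOpt_some (a : D) : fixOpt σ (some a) = some (σ a) := rfl
@[simp] theorem fixOpt_symm : (fixOpt σ).symm = fixOpt σ.symm := rfl
@[simp] theorem insOpt_none : insOpt σ c none = some (σ c) := rfl
@[simp] theorem insOpt_self : insOpt σ c (some c) = none := by simp [insOpt]
theorem insOpt_of_ne {a : D} (h : a ≠ c) : insOpt σ c (some a) = some (σ a) := by
  simp [insOpt, h]
@[simp] theorem insOpt_symm_none : (insOpt σ c).symm none = some c := rfl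
@[simp] theorem insOpt_symm_apply : (insOpt σ c).symm (some (σ c)) = none := by
  simp [symm_apply_eq]
theorem insOpt_symm_of_ne {b : D} (h : b ≠ σ c) :
    (insOpt σ c).symm (some b) = some (σ.symm b) := by
  rw [symm_apply_eq, insOpt_of_ne _ _ (fun h' => h (by rw [← h']; simp))]
  simp

theorem fixOpt_injective : Function.Injective (fixOpt (D := D)) := fun σ τ h => by
  ext a
  have := congrArg (fun s => s (some a)) h
  simpa using this

theorem exists_fixOpt (τ : Perm (Option D)) (h : τ none = none) : ∃ σ, τ = fixOpt σ :=
  ⟨removeNone τ, by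
    ext1 a
    cases a with
    | none => simp [h]
    | some a =>
      exact (removeNone_some τ (by
        rw [← Option.ne_none_iff_exists']
        exact fun h' => by simpa using τ.injective (h'.trans h.symm))).symm⟩

-- Insertion in a cycle is composition with a transposition, so existence and uniqueness of the
-- permutation before the insertion reduce to the case of a fixed point.
open Classical in
theorem insOpt_eq_mul : insOpt σ c = fixOpt σ * swap none (some c) := by
  ext1 a
  rcases a with _ | a
  · simp
  · by_cases h : a = c
    · subst h; simp
    · rw [insOpt_of_ne _ _ h, Perm.mul_apply, swap_apply_of_ne_of_ne (by simp) (by simpa using h)]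
      simp

open Classical in
theorem exists_insOpt (τ : Perm (Option D)) {c : D} (h : τ (some c) = none) :
    ∃ σ, τ = insOpt σ c := by
  obtain ⟨σ, hσ⟩ := exists_fixOpt (τ * swap none (some c)) (by simp [h])
  refine ⟨σ, ?_⟩
  rw [insOpt_eq_mul, ← hσ, mul_assoc, swap_mul_self, mul_one]

theorem insOpt_injective : Function.Injective (fun σ : Perm D => insOpt σ c) := fun σ τ h => by
  apply fixOpt_injective
  classical
  simpa [insOpt_eq_mul] using h

theorem sameCycle_fixOpt {a b : D} :
    (fixOpt σ).SameCycle (some a) (some b) ↔ σ.SameCycle a b := by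
  constructor
  · intro h
    have := SameCycle.map_of (σ := fixOpt σ) (τ := σ) (f := fun u => u.getD a)
      (by rintro (_ | x)
          · exact Perm.SameCycle.refl _ _
          · exact sameCycle_step σ x) h
    simpa using this
  · exact SameCycle.map_of (fun d => sameCycle_step (fixOpt σ) (some d))

theorem sameCycle_fixOpt_none {u : Option D} : (fixOpt σ).SameCycle none u ↔ u = none := by
  constructor
  · intro h
    have := SameCycle.invariant_prop (σ := fixOpt σ) (p := fun x => x = none)
      (by rintro (_ | x) <;> simp) h
    simpa using this
  · rintro rfl; exact Perm.SameCycle.refl _ _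

theorem sameCycle_fixOpt_some_none {a : D} : ¬ (fixOpt σ).SameCycle (some a) none := fun h => by
  have := (sameCycle_fixOpt_none σ).1 h.symm
  simp at this

/-- The projection `u ↦ u.getD c` respects cycles in both directions, since the new element lies in
the cycle of `c`. -/
theorem sameCycle_insOpt {u w : Option D} :
    (insOpt σ c).SameCycle u w ↔ σ.SameCycle (u.getD c) (w.getD c) := by
  have hn : (insOpt σ c).SameCycle (some c) none := by
    have := sameCycle_step (insOpt σ c) (some c)
    rwa [insOpt_self] at this
  constructor
  · refine SameCycle.map_of (σ := insOpt σ c) (τ := σ) (f := fun u => u.getD c) ?_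
    rintro (_ | x)
    · exact sameCycle_step σ c
    · by_cases h : x = c
      · subst h; simpa using Perm.SameCycle.refl _ _
      · rw [insOpt_of_ne _ _ h]; exact sameCycle_step σ x
  · intro h
    have h1 : ∀ u : Option D, (insOpt σ c).SameCycle u (some (u.getD c)) := by
      rintro (_ | x)
      · exact hn.symm
      · exact Perm.SameCycle.refl _ _
    refine (h1 u).trans (Perm.SameCycle.trans ?_ (h1 w).symm)
    refine SameCycle.map_of (f := some) (fun x => ?_) h
    by_cases h : x = c
    · subst h
      refine hn.trans ?_
      have := sameCycle_step (insOpt σ x) none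
      rwa [insOpt_none] at this
    · rw [← insOpt_of_ne _ _ h]; exact sameCycle_step _ _

theorem sameCycle_permCongr (e : D ≃ E) {a b : D} :
    (e.permCongr σ).SameCycle (e a) (e b) ↔ σ.SameCycle a b := by
  constructor
  · intro h
    have := SameCycle.map_of (τ := σ) (f := e.symm)
      (fun x => by simpa using sameCycle_step σ (e.symm x)) h
    simpa using this
  · exact SameCycle.map_of (fun x => by simpa using sameCycle_step (e.permCongr σ) (e x))

open Classical in
/-- Add `none` to the subset if it contains `c`. -/
def liftIns (c : D) (s : Finset D) : Finset (Option D) :=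
  if c ∈ s then s.insertNone else s.map Function.Embedding.some

theorem some_mem_liftIns {c a : D} {s : Finset D} : some a ∈ liftIns c s ↔ a ∈ s := by
  unfold liftIns; split_ifs <;> simp

theorem none_mem_liftIns {c : D} {s : Finset D} : none ∈ liftIns c s ↔ c ∈ s := by
  unfold liftIns; split_ifs with h <;> simp [h]

theorem mem_liftIns {c : D} {s : Finset D} {u : Option D} : u ∈ liftIns c s ↔ u.getD c ∈ s := by
  cases u with
  | none => exact none_mem_liftIns
  | some a => exact some_mem_liftIns

theorem liftIns_injective (c : D) : Function.Injective (liftIns c) := fun s t h => by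
  ext a
  rw [← some_mem_liftIns (c := c), h, some_mem_liftIns]

variable [Fintype D] [Fintype E]

theorem orb_insOpt (u : Option D) : orb (insOpt σ c) u = liftIns c (orb σ (u.getD c)) := by
  ext w
  rw [mem_orb, sameCycle_insOpt, mem_liftIns, mem_orb]

theorem orb_fixOpt_some (a : D) :
    orb (fixOpt σ) (some a) = (orb σ a).map Function.Embedding.some := by
  ext w
  cases w with
  | none => simpa using sameCycle_fixOpt_some_none σ
  | some b => simp [sameCycle_fixOpt]

theorem orb_fixOpt_none : orb (fixOpt σ) none = {none} := by
  ext w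
  rw [mem_orb, sameCycle_fixOpt_none, Finset.mem_singleton]

open Classical in
theorem orbs_insOpt : orbs (insOpt σ c) = (orbs σ).image (liftIns c) := by
  ext s
  simp only [mem_orbs, Finset.mem_image]
  constructor
  · rintro ⟨u, rfl⟩
    exact ⟨_, ⟨u.getD c, rfl⟩, (orb_insOpt σ c u).symm⟩
  · rintro ⟨_, ⟨a, rfl⟩, rfl⟩
    exact ⟨some a, orb_insOpt σ c (some a)⟩

open Classical in
theorem orbs_fixOpt : orbs (fixOpt σ) =
    insert {none} ((orbs σ).image (Finset.map Function.Embedding.some)) := by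
  ext s
  simp only [mem_orbs, Finset.mem_image, Finset.mem_insert]
  constructor
  · rintro ⟨_ | a, rfl⟩
    · exact Or.inl (orb_fixOpt_none σ)
    · exact Or.inr ⟨_, ⟨a, rfl⟩, (orb_fixOpt_some σ a).symm⟩
  · rintro (rfl | ⟨_, ⟨a, rfl⟩, rfl⟩)
    · exact ⟨none, orb_fixOpt_none σ⟩
    · exact ⟨some a, orb_fixOpt_some σ a⟩

theorem card_orbs_insOpt : (orbs (insOpt σ c)).card = (orbs σ).card := by
  classical
  rw [orbs_insOpt, Finset.card_image_of_injective _ (liftIns_injective c)]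

open Classical in
theorem singleton_none_notMem :
    ({none} : Finset (Option D)) ∉ (orbs σ).image (Finset.map Function.Embedding.some) := by
  intro h
  obtain ⟨s, -, hs⟩ := Finset.mem_image.1 h
  have : (none : Option D) ∈ Finset.map Function.Embedding.some s := by rw [hs]; simp
  simp at this

theorem card_orbs_fixOpt : (orbs (fixOpt σ)).card = (orbs σ).card + 1 := by
  classical
  rw [orbs_fixOpt, Finset.card_insert_of_notMem (singleton_none_notMem σ),
    Finset.card_image_of_injective _ (Finset.map_injective _)]

theorem prod_orbs_insOpt (Φ : Finset (Option D) → ℂ) :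
    ∏ s ∈ orbs (insOpt σ c), Φ s = ∏ s ∈ orbs σ, Φ (liftIns c s) := by
  classical
  rw [orbs_insOpt, Finset.prod_image (fun _ _ _ _ h => liftIns_injective c h)]

theorem prod_orbs_fixOpt (Φ : Finset (Option D) → ℂ) :
    ∏ s ∈ orbs (fixOpt σ), Φ s =
      Φ {none} * ∏ s ∈ orbs σ, Φ (s.map Function.Embedding.some) := by
  classical
  rw [orbs_fixOpt, Finset.prod_insert (singleton_none_notMem σ),
    Finset.prod_image (fun _ _ _ _ h => Finset.map_injective _ h)]

/-! Transport of structure along an equivalence. -/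

theorem orb_permCongr (e : D ≃ E) (a : D) :
    orb (e.permCongr σ) (e a) = (orb σ a).map e.toEmbedding := by
  ext x
  obtain ⟨b, rfl⟩ := e.surjective x
  simp [sameCycle_permCongr]

open Classical in
theorem orbs_permCongr (e : D ≃ E) :
    orbs (e.permCongr σ) = (orbs σ).image (Finset.map e.toEmbedding) := by
  ext s
  simp only [mem_orbs, Finset.mem_image]
  constructor
  · rintro ⟨u, rfl⟩
    obtain ⟨a, rfl⟩ := e.surjective u
    exact ⟨_, ⟨a, rfl⟩, (orb_permCongr σ e a).symm⟩
  · rintro ⟨_, ⟨a, rfl⟩, rfl⟩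
    exact ⟨e a, orb_permCongr σ e a⟩

theorem card_orbs_permCongr (e : D ≃ E) : (orbs (e.permCongr σ)).card = (orbs σ).card := by
  classical
  rw [orbs_permCongr, Finset.card_image_of_injective _ (Finset.map_injective _)]

theorem prod_orbs_permCongr (e : D ≃ E) (Φ : Finset E → ℂ) :
    ∏ s ∈ orbs (e.permCongr σ), Φ s = ∏ s ∈ orbs σ, Φ (s.map e.toEmbedding) := by
  classical
  rw [orbs_permCongr, Finset.prod_image (fun _ _ _ _ h => Finset.map_injective _ h)]

/-- The cycles form a partition. -/
theorem sum_card_orbs : ∑ s ∈ orbs σ, s.card = Fintype.card D := by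
  classical
  have h := Finset.card_eq_sum_card_fiberwise (s := (Finset.univ : Finset D)) (t := orbs σ)
    (f := orb σ) (fun d _ => orb_mem_orbs σ d)
  rw [← Finset.card_univ, h]
  refine Finset.sum_congr rfl fun s hs => congrArg Finset.card ?_
  ext d
  simp only [Finset.mem_filter, Finset.mem_univ, true_and]
  exact ⟨fun hd => (eq_orb_of_mem hs hd).symm, fun hd => hd ▸ mem_orb_self σ d⟩

/-- If `σ` returns to `d` within two steps, the cycle is contained in `{d, σ d}`. The bounds on
degrees can thus be tested by following one dart, which is convenient when darts are added or
removed. -/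
theorem three_le_card_orb_iff (d : D) : 3 ≤ (orb σ d).card ↔ σ d ≠ d ∧ σ (σ d) ≠ d := by
  classical
  constructor
  · intro h
    constructor
    · intro h1
      have : orb σ d ⊆ {d} := fun e he => by
        have := SameCycle.invariant_prop (σ := σ) (p := fun x => x = d)
          (fun x => by rw [← eq_symm_apply, σ.symm_apply_eq.2 h1.symm])
          (mem_orb.1 he)
        simpa using this
      have := Finset.card_le_card this
      simp at this; omega
    · intro h1
      have : orb σ d ⊆ {d, σ d} := fun e he => by
        have := SameCycle.invariant_prop (σ := σ) (p := fun x => x = d ∨ x = σ d)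
          (fun x => by
            rw [← eq_symm_apply, σ.symm_apply_eq.2 h1.symm, σ.apply_eq_iff_eq,
              or_comm]) (mem_orb.1 he)
        simpa using this
      have := Finset.card_le_card this
      have h2 := Finset.card_insert_le d {σ d}
      simp at h2; omega
  · rintro ⟨h1, h2⟩
    have : ({d, σ d, σ (σ d)} : Finset D) ⊆ orb σ d := by
      intro x hx
      simp only [Finset.mem_insert, Finset.mem_singleton] at hx
      rw [mem_orb]
      rcases hx with rfl | rfl | rfl
      · exact Perm.SameCycle.refl _ _
      · exact sameCycle_step _ _
      · exact (sameCycle_step _ _).trans (sameCycle_step _ _)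
    refine le_trans ?_ (Finset.card_le_card this)
    rw [Finset.card_eq_three.2 ⟨d, σ d, σ (σ d), h1.symm, h2.symm, fun h => h1 ?_, rfl⟩]
    exact (σ.injective h).symm

theorem card_orb_eq_one_iff (d : D) : (orb σ d).card = 1 ↔ σ d = d := by
  rw [Finset.card_eq_one]
  constructor
  · rintro ⟨a, ha⟩
    have h1 : d ∈ orb σ d := mem_orb_self σ d
    have h2 : σ d ∈ orb σ d := mem_orb.2 (sameCycle_step σ d)
    rw [ha, Finset.mem_singleton] at h1 h2
    rw [h2, ← h1]
  · intro h1
    refine ⟨d, ?_⟩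
    ext e
    rw [mem_orb, Finset.mem_singleton]
    constructor
    · intro he
      have := SameCycle.invariant_prop (σ := σ) (p := fun x => x = d)
          (fun x => by rw [← eq_symm_apply, σ.symm_apply_eq.2 h1.symm]) he
      simpa using this
    · rintro rfl; exact Perm.SameCycle.refl _ _

theorem card_orb_pos (d : D) : 0 < (orb σ d).card := Finset.card_pos.2 ⟨d, mem_orb_self σ d⟩

theorem card_orb_eq_two_iff (d : D) : (orb σ d).card = 2 ↔ σ d ≠ d ∧ σ (σ d) = d := by
  have h1 := card_orb_eq_one_iff σ d
  have h3 := three_le_card_orb_iff σ d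
  have h0 := card_orb_pos σ d
  constructor
  · intro h
    refine ⟨fun h' => ?_, by_contra fun h' => ?_⟩
    · have := h1.2 h'; omega
    · have := h3.2 ⟨fun h'' => by have := h1.2 h''; omega, h'⟩; omega
  · rintro ⟨ha, hb⟩
    have : ¬ 3 ≤ (orb σ d).card := fun h => (h3.1 h).2 hb
    have : (orb σ d).card ≠ 1 := fun h => ha (h1.1 h)
    omega

end Orbits

/-! ### The vertex weights as functions of multisets -/

section VertexWeights

/-- The complete homogeneous symmetric polynomial of degree `m`, evaluated at a multiset. -/
def hsym (s : Multiset ℂ) (m : ℕ) : ℂ :=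
  PowerSeries.coeff m (s.map (fun a => PowerSeries.mk (fun m => a ^ m))).prod

theorem hsym_zero (s : Multiset ℂ) : hsym s 0 = 1 := by
  induction s using Multiset.induction with
  | empty => simp [hsym]
  | cons a s ih =>
    rw [hsym] at *
    simp only [Multiset.map_cons, Multiset.prod_cons, PowerSeries.coeff_zero_eq_constantCoeff,
      map_mul] at *
    rw [ih]; simp [← PowerSeries.coeff_zero_eq_constantCoeff_apply]

/-- The generating series of `a ::ₘ s` is that of `s` divided by `1 - a X`. -/
theorem hsym_cons_succ (a : ℂ) (s : Multiset ℂ) (m : ℕ) :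
    hsym (a ::ₘ s) (m + 1) = hsym s (m + 1) + a * hsym (a ::ₘ s) m := by
  unfold hsym
  rw [Multiset.map_cons, Multiset.prod_cons]
  set p := (s.map (fun a => PowerSeries.mk (fun m => a ^ m))).prod with hp
  set g := PowerSeries.mk (fun m => a ^ m) with hg
  have h : g * p = p + PowerSeries.C a * (PowerSeries.X * (g * p)) := by
    have := geom_mul a
    rw [← hg] at this
    linear_combination p * this
  conv_lhs => rw [h]
  rw [map_add, PowerSeries.coeff_C_mul, PowerSeries.coeff_succ_X_mul]

theorem hsym_singleton (a : ℂ) (m : ℕ) : hsym {a} m = a ^ m := by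
  simp [hsym]

theorem hsym_pair (a : ℂ) (m : ℕ) : hsym {a, a} m = (m + 1) * a ^ m := by
  induction m with
  | zero => simp [hsym_zero]
  | succ m ih =>
    change hsym (a ::ₘ {a}) (m + 1) = _
    rw [hsym_cons_succ, hsym_singleton]
    change _ + a * hsym {a, a} m = _
    rw [ih]; push_cast; ring

theorem hsym_diff (a b : ℂ) (s : Multiset ℂ) (m : ℕ) :
    (a - b) * hsym (a ::ₘ b ::ₘ s) m = hsym (a ::ₘ s) (m + 1) - hsym (b ::ₘ s) (m + 1) := by
  have h1 := hsym_cons_succ a (b ::ₘ s) m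
  have h2 := hsym_cons_succ b (a ::ₘ s) m
  rw [Multiset.cons_swap b a] at h2
  linear_combination h2 - h1

theorem continuous_hsym (s : Multiset ℂ) (m : ℕ) : Continuous (fun t => hsym (t ::ₘ s) m) := by
  induction m with
  | zero => simp only [hsym_zero]; exact continuous_const
  | succ m ih => simp only [hsym_cons_succ]; exact continuous_const.add (continuous_id.mul ih)

variable (r : ℕ) (v : ℕ → ℂ)

/-- The weight of a black vertex as a function of the multiset of the decorations around it. -/
def vw (s : Multiset ℂ) : ℂ :=
  -∑ j ∈ Finset.Icc (Multiset.card s) (r + 1), v j * hsym s (j - Multiset.card s)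

theorem vertexWeight_eq {ι : Type} [Fintype ι] (a : ι → ℂ) :
    vertexWeight r v a = vw r v (Finset.univ.val.map a) := by
  classical
  unfold vertexWeight vw
  simp only [Multiset.card_map, Finset.card_val, Finset.card_univ, hsym, Multiset.map_map]
  congr 1
  refine Finset.sum_congr rfl fun j _ => ?_
  congr 1
  rw [show (Multiset.map ((fun a : ℂ => PowerSeries.mk fun m => a ^ m) ∘ a)
    (Finset.univ.val : Multiset ι)).prod = ∏ i, PowerSeries.mk (fun m => a i ^ m) from rfl,
    coeff_prod_geom]

/-- The recursion of divided differences, in a form valid also at coinciding arguments: up to sign,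
`vw` is the divided difference of `V'`. The relations between vertex weights and propagators used
below come from it. -/
theorem vw_diff (a b : ℂ) (s : Multiset ℂ) :
    (a - b) * vw r v (a ::ₘ b ::ₘ s) = vw r v (a ::ₘ s) - vw r v (b ::ₘ s) := by
  unfold vw
  simp only [Multiset.card_cons]
  set c := Multiset.card s
  have hsub : Finset.Icc (c + 1 + 1) (r + 1) ⊆ Finset.Icc (c + 1) (r + 1) :=
    Finset.Icc_subset_Icc_left (by omega)
  rw [neg_sub_neg, ← Finset.sum_sub_distrib, mul_neg, Finset.mul_sum, ← Finset.sum_neg_distrib]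
  rw [← Finset.sum_subset hsub]
  · refine Finset.sum_congr rfl fun j hj => ?_
    have hj1 := (Finset.mem_Icc.1 hj).1
    obtain ⟨i, rfl⟩ : ∃ i, j = c + 1 + 1 + i := ⟨j - (c + 1 + 1), by omega⟩
    rw [show c + 1 + 1 + i - (c + 1 + 1) = i by omega,
      show c + 1 + 1 + i - (c + 1) = i + 1 by omega]
    linear_combination (- v (c + 1 + 1 + i)) * hsym_diff a b s i
  · intro j hj hj'
    rw [Finset.mem_Icc] at hj hj'
    -- The sums on the right start one index earlier than the one on the left; their additional
    -- terms are both `v (c + 1)` and cancel.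
    obtain rfl : j = c + 1 := by omega
    simp [hsym_zero]

/-- The sum over `j` is empty. Hence the upper bound `r + 1` on the degrees of black vertices can be
dropped from the combinatorial conditions: the additional graphs have weight zero. -/
theorem vw_eq_zero (s : Multiset ℂ) (h : r + 1 < Multiset.card s) : vw r v s = 0 := by
  rw [vw, Finset.Icc_eq_empty (by omega)]; simp

theorem vw_singleton (a : ℂ) : vw r v {a} = -dV r v a := by
  rw [vw, dV_eq]; simp [hsym_singleton]

theorem ddV_eq (z : ℂ) :
    ddV r v z = ∑ j ∈ Finset.Icc 2 (r + 1), v j * ((j - 1 : ℕ) * z ^ (j - 2)) := by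
  simp only [ddV, potential, Polynomial.derivative_sum, Polynomial.eval_finsetSum]
  rw [← Finset.sum_subset (Finset.Icc_subset_Icc_left (show 1 ≤ 2 by omega))]
  · refine Finset.sum_congr rfl fun j hj => ?_
    have hj0 : (j : ℂ) ≠ 0 := by
      have := (Finset.mem_Icc.mp hj).1
      exact_mod_cast (by omega : j ≠ 0)
    rw [Polynomial.derivative_C_mul_X_pow, Polynomial.derivative_C_mul_X_pow]
    simp only [Polynomial.eval_mul, Polynomial.eval_C, Polynomial.eval_pow, Polynomial.eval_X]
    rw [Nat.sub_sub]
    field_simp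
  · intro j hj hj'
    rw [Finset.mem_Icc] at hj hj'
    obtain rfl : j = 1 := by omega
    simp

theorem vw_pair (a : ℂ) : vw r v {a, a} = -ddV r v a := by
  rw [vw, ddV_eq]
  simp only [Multiset.card_pair, hsym_pair]
  congr 1
  refine Finset.sum_congr rfl fun j hj => ?_
  have := (Finset.mem_Icc.mp hj).1
  congr 2
  rw [← Nat.cast_succ]; congr 1; omega

/-- A propagator is minus the inverse of the weight of a fictitious bivalent vertex, also on the
diagonal. Inserting such a vertex in an edge multiplies the weight by `-1`, as long as `vw` does not
vanish there. -/
theorem propagator_eq (a b : ℂ) : propagator r v a b = -(vw r v {a, b})⁻¹ := by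
  unfold propagator
  split_ifs with h
  · subst h; rw [vw_pair, inv_neg, neg_neg, one_div]
  · have h1 := vw_diff r v a b 0
    simp only [Multiset.cons_zero, vw_singleton] at h1
    change (a - b) * vw r v {a, b} = _ at h1
    have hab : a - b ≠ 0 := sub_ne_zero.2 h
    rw [show dV r v a - dV r v b = (a - b) * (-vw r v {a, b}) by linear_combination h1,
      div_mul_eq_div_div, div_self hab, one_div, inv_neg]

/-- A difference of inverses, evaluated by `vw_diff`. The right-hand side is an edge cut by a
trivalent vertex whose third edge separates the decorations `s` and `t`. -/
theorem propagator_diff {s t b : ℂ} (hs : vw r v {s, b} ≠ 0) (ht : vw r v {t, b} ≠ 0) :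
    propagator r v s b - propagator r v t b =
      (s - t) * (propagator r v s b * propagator r v t b * vw r v {s, t, b}) := by
  have h := vw_diff r v s t {b}
  change (s - t) * vw r v {s, t, b} = vw r v {s, b} - vw r v {t, b} at h
  rw [propagator_eq, propagator_eq]
  field_simp
  linear_combination -h

theorem continuous_vw (s : Multiset ℂ) : Continuous (fun t => vw r v (t ::ₘ s)) := by
  unfold vw
  simp only [Multiset.card_cons]
  exact (continuous_finsetSum _ fun j _ => continuous_const.mul (continuous_hsym _ _)).neg

/-- By `vw_diff`, the slope between `a` and `t` is the weight with arguments `t`, `a` and `s`, which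
is continuous in `t`. -/
theorem hasDerivAt_vw (s : Multiset ℂ) (a : ℂ) :
    HasDerivAt (fun t => vw r v (t ::ₘ s)) (vw r v (a ::ₘ a ::ₘ s)) a := by
  rw [hasDerivAt_iff_tendsto_slope]
  have h := ((continuous_vw r v (a ::ₘ s)).tendsto a).mono_left
    (nhdsWithin_le_nhds (s := {a}ᶜ))
  refine h.congr' ?_
  filter_upwards [self_mem_nhdsWithin] with t ht
  have ht : t - a ≠ 0 := sub_ne_zero.2 ht
  rw [slope_def_field, ← vw_diff]
  field_simp

theorem analyticAt_hsym {D : Type} [Fintype D] (s : Finset D) (m : ℕ) (lab : D → ℂ) :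
    AnalyticAt ℂ (fun lab : D → ℂ => hsym (s.val.map lab) m) lab := by
  classical
  have : (fun lab : D → ℂ => hsym (s.val.map lab) m) =
      fun lab : D → ℂ => ∑ l ∈ s.finsuppAntidiag m, ∏ i ∈ s, lab i ^ l i := by
    funext lab
    rw [hsym, Multiset.map_map, show (Multiset.map ((fun a : ℂ => PowerSeries.mk fun m => a ^ m) ∘
      lab) s.val).prod = ∏ i ∈ s, PowerSeries.mk (fun m => lab i ^ m) from rfl,
      PowerSeries.coeff_prod]
    simp
  rw [this]
  refine Finset.analyticAt_fun_sum _ fun l _ => Finset.analyticAt_fun_prod _ fun i _ => ?_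
  exact ((ContinuousLinearMap.proj (R := ℂ) (φ := fun _ : D => ℂ) i).analyticAt lab).pow _

theorem analyticAt_vw {D : Type} [Fintype D] (s : Finset D) (lab : D → ℂ) :
    AnalyticAt ℂ (fun lab : D → ℂ => vw r v (s.val.map lab)) lab := by
  unfold vw
  simp only [Multiset.card_map]
  exact (Finset.analyticAt_fun_sum _ fun j _ =>
    analyticAt_const.mul (analyticAt_hsym s _ lab)).neg

end VertexWeights

/-! ### Labelled graphs -/

section Labelled

instance (n : ℕ) : Finite (VertexType n) := by
  let f : VertexType n → Option (Option (Fin n)) := fun t => match t with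
    | .black => none
    | .square => some none
    | .white i => some (some i)
  refine Finite.of_injective f ?_
  rintro (_ | i | _) (_ | j | _) <;> simp [f]

/-- Combinatorial data on a set `D` of darts. -/
@[ext]
structure Cfg (n : ℕ) (L D : Type) where
  rot : Perm D
  opp : Perm D
  ty : D → VertexType n
  deco : D → L

variable {n N : ℕ} {K L D E : Type}

instance [Finite L] [Finite D] : Finite (Cfg n L D) := by
  let f : Cfg n L D → Perm D × Perm D × (D → VertexType n) × (D → L) :=
    fun G => (G.rot, G.opp, G.ty, G.deco)
  refine Finite.of_injective f ?_
  intro G H h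
  simp only [f, Prod.mk.injEq] at h
  exact Cfg.ext h.1 h.2.1 h.2.2.1 h.2.2.2

instance [Finite L] [Finite D] : Fintype (Cfg n L D) := Fintype.ofFinite _

@[simp] theorem symm_permCongr (e : D ≃ E) (σ : Perm D) :
    (e.permCongr σ).symm = e.permCongr σ.symm := rfl

namespace Cfg

/-- The face permutation. -/
def face (G : Cfg n L D) : Perm D := G.opp.trans G.rot.symm

theorem face_apply (G : Cfg n L D) (d : D) : G.face d = G.rot.symm (G.opp d) := rfl

/-- Transport along a bijection of the darts. -/
@[simps]
def map (e : D ≃ E) (G : Cfg n L D) : Cfg n L E where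
  rot := e.permCongr G.rot
  opp := e.permCongr G.opp
  ty := G.ty ∘ e.symm
  deco := G.deco ∘ e.symm

@[simp] theorem map_face (e : D ≃ E) (G : Cfg n L D) : (G.map e).face = e.permCongr G.face := by
  ext x; simp [face]

/-- Transport along a bijection, as a bijection. -/
def mapEquiv (e : D ≃ E) : Cfg n L D ≃ Cfg n L E where
  toFun := map e
  invFun := map e.symm
  left_inv G := by ext <;> simp
  right_inv G := by ext <;> simp

end Cfg

/-- The kind of labelled graphs considered: which of the marked faces are ciliated, the permutation
describing the clockwise order around the white vertices, the label of the white vertex adjacent to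
a marked face, the difference of the numbers of edges and vertices, and the number of faces. -/
structure Spec (n : ℕ) (K : Type) where
  cil : K → Prop
  next : K → K
  tp : K → Fin n
  e : ℤ
  f : ℤ

/-- The labelled graphs of a given kind.  The set `S` consists of the darts at which the vertices
are black, of arbitrary degree. -/
structure IsGraph [Fintype D] (X : Spec n K) (S : D → Prop) (G : Cfg n (K ⊕ Fin N) D) : Prop where
  opp_opp : ∀ d, G.opp (G.opp d) = d
  opp_ne : ∀ d, G.opp d ≠ d
  ty_rot : ∀ d, G.ty (G.rot d) = G.ty d
  deco_face : ∀ d, G.deco (G.face d) = G.deco d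
  conn : ∀ p : D → Prop, (∀ d, p (G.rot d) ↔ p d) → (∀ d, p (G.opp d) ↔ p d) → ∀ d d', p d → p d'
  vert : (Fintype.card D : ℤ) = 2 * ((orbs G.rot).card + X.e)
  fac : ((orbs G.face).card : ℤ) = X.f
  white : ∀ d, G.ty d ≠ .black → ∃ k, X.cil k ∧ G.deco d = .inl k ∧
    G.deco (G.rot.symm d) = .inl (X.next k) ∧ G.ty d = .white (X.tp k)
  white_ex : ∀ k, X.cil k → ∃ d, G.ty d ≠ .black ∧ G.deco d = .inl k
  white_unique : ∀ d d', G.ty d ≠ .black → G.ty d' ≠ .black → G.deco d = G.deco d' → d = d'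
  special : ∀ d, S d → G.ty d = .black
  deg : ∀ d, G.ty d = .black → ¬ S d → G.rot d ≠ d ∧ G.rot (G.rot d) ≠ d
  mark_ex : ∀ k, ∃ d, G.deco d = .inl k
  mark_unique : ∀ k d d', G.deco d = .inl k → G.deco d' = .inl k → G.face.SameCycle d d'

/-- A graph with a black root vertex, the vertex of `c`, of arbitrary degree. -/
abbrev IsRooted [Fintype D] (X : Spec n K) (G : Cfg n (K ⊕ Fin N) D) (c : D) : Prop :=
  IsGraph X (G.rot.SameCycle c) G

/-- A graph without special vertices. -/
abbrev IsPlain [Fintype D] (X : Spec n K) (G : Cfg n (K ⊕ Fin N) D) : Prop :=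
  IsGraph X (fun _ => False) G

theorem IsGraph.map [Fintype D] [Fintype E] {X : Spec n K} {S : D → Prop}
    {G : Cfg n (K ⊕ Fin N) D} (h : IsGraph X S G) (e : D ≃ E) :
    IsGraph X (fun x => S (e.symm x)) (G.map e) where
  opp_opp d := by simp [h.opp_opp]
  opp_ne d := fun h' => h.opp_ne (e.symm d) (e.injective (by simpa using h'))
  ty_rot d := by simp [h.ty_rot]
  deco_face d := by simpa using h.deco_face _
  conn p h1 h2 d d' := by
    have := h.conn (fun x => p (e x)) (fun x => by simpa using h1 (e x))
      (fun x => by simpa using h2 (e x)) (e.symm d) (e.symm d')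
    simpa using this
  vert := by
    rw [Cfg.map_rot, card_orbs_permCongr, ← h.vert, Fintype.card_congr e]
  fac := by
    rw [Cfg.map_face, card_orbs_permCongr, h.fac]
  white d hd := by simpa using h.white (e.symm d) (by simpa using hd)
  white_ex k hk := by
    obtain ⟨d, h1, h2⟩ := h.white_ex k hk
    exact ⟨e d, by simpa using h1, by simpa using h2⟩
  white_unique d d' h1 h2 h3 := by
    simpa using h.white_unique (e.symm d) (e.symm d') (by simpa using h1) (by simpa using h2)
      (by simpa using h3)
  special d hd := by simpa using h.special _ hd
  deg d h1 h2 := by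
    have := h.deg (e.symm d) (by simpa using h1) h2
    exact ⟨fun h' => this.1 (e.injective (by simpa using h')),
      fun h' => this.2 (e.injective (by simpa using h'))⟩
  mark_ex k := by
    obtain ⟨d, h1⟩ := h.mark_ex k
    exact ⟨e d, by simpa using h1⟩
  mark_unique k d d' h1 h2 := by
    have := h.mark_unique k (e.symm d) (e.symm d') (by simpa using h1) (by simpa using h2)
    rw [← sameCycle_permCongr _ e] at this
    simpa using this

theorem IsGraph.map_iff [Fintype D] [Fintype E] {X : Spec n K} {S : D → Prop}
    {G : Cfg n (K ⊕ Fin N) D} (e : D ≃ E) {S' : E → Prop} (hS : ∀ d, S' (e d) ↔ S d) :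
    IsGraph X S' (G.map e) ↔ IsGraph X S G := by
  have hS' : S' = fun x => S (e.symm x) := by
    funext x; rw [← propext (hS (e.symm x)), e.apply_symm_apply]
  subst hS'
  refine ⟨fun h => ?_, fun h => h.map e⟩
  have h2 := h.map e.symm
  have : (G.map e).map e.symm = G := (Cfg.mapEquiv e).left_inv G
  rw [this] at h2
  simpa using h2

theorem isPlain_map_iff [Fintype D] [Fintype E] {X : Spec n K} {G : Cfg n (K ⊕ Fin N) D}
    (e : D ≃ E) : IsPlain X (G.map e) ↔ IsPlain X G := IsGraph.map_iff e (fun _ => Iff.rfl)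

theorem isRooted_map_iff [Fintype D] [Fintype E] {X : Spec n K} {G : Cfg n (K ⊕ Fin N) D}
    (e : D ≃ E) (c : D) : IsRooted X (G.map e) (e c) ↔ IsRooted X G c :=
  IsGraph.map_iff e (fun _ => sameCycle_permCongr _ _)

theorem IsGraph.ty_sameCycle [Fintype D] {X : Spec n K} {S : D → Prop}
    {G : Cfg n (K ⊕ Fin N) D} (h : IsGraph X S G) {d d' : D} (hd : G.rot.SameCycle d d') :
    G.ty d = G.ty d' := SameCycle.invariant h.ty_rot hd

theorem IsGraph.deco_sameCycle [Fintype D] {X : Spec n K} {S : D → Prop}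
    {G : Cfg n (K ⊕ Fin N) D} (h : IsGraph X S G) {d d' : D} (hd : G.face.SameCycle d d') :
    G.deco d = G.deco d' := SameCycle.invariant h.deco_face hd

/-- A bound for the number of darts. -/
theorem IsGraph.card_le [Fintype D] [Fintype K] {X : Spec n K} {S : D → Prop}
    {G : Cfg n (K ⊕ Fin N) D} (h : IsGraph X S G)
    (hS : ∀ d d', S d → S d' → G.rot.SameCycle d d') :
    (Fintype.card D : ℤ) ≤ 6 * X.e + 4 * Fintype.card K + 4 := by
  classical
  set A := (orbs G.rot).filter (fun s => ∃ d ∈ s, G.ty d ≠ .black) with hA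
  set B := (orbs G.rot).filter (fun s => ∃ d ∈ s, S d) with hB
  have hBc : B.card ≤ 1 := by
    rw [Finset.card_le_one]
    intro s hs t ht
    obtain ⟨hs1, d, hd, hd'⟩ := Finset.mem_filter.1 hs
    obtain ⟨ht1, e, he, he'⟩ := Finset.mem_filter.1 ht
    rw [eq_orb_of_mem hs1 hd, eq_orb_of_mem ht1 he, orb_eq_orb]
    exact hS _ _ hd' he'
  have hAc : A.card ≤ Fintype.card K := by
    have key : ∀ s : A, ∃ d ∈ s.1, G.ty d ≠ .black ∧ ∃ k, G.deco d = .inl k := fun s => by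
      obtain ⟨_, d, hd, hd'⟩ := Finset.mem_filter.1 s.2
      obtain ⟨k, -, h2, -⟩ := h.white d hd'
      exact ⟨d, hd, hd', k, h2⟩
    choose d hd hd' k hk using key
    rw [← Fintype.card_coe]
    refine Fintype.card_le_of_injective k fun s t hst => Subtype.ext ?_
    have : d s = d t := h.white_unique _ _ (hd' s) (hd' t) (by rw [hk, hk, hst])
    rw [eq_orb_of_mem (Finset.mem_filter.1 s.2).1 (hd s), this,
      eq_orb_of_mem (Finset.mem_filter.1 t.2).1 (hd t)]
  have hsum := sum_card_orbs G.rot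
  -- A vertex outside `A` (white) and `B` (special) is black of degree at least 3, and adding 2
  -- raises the other degrees to at least 3. As the degrees add up to the number of darts, `vert`
  -- turns this into an upper bound.
  have hge : ∑ s ∈ orbs G.rot, (3 : ℤ) ≤ ∑ s ∈ orbs G.rot, ((s.card : ℤ) +
      (if s ∈ A then 2 else 0) + (if s ∈ B then 2 else 0)) := by
    refine Finset.sum_le_sum fun s hs => ?_
    obtain ⟨d, rfl⟩ := mem_orbs.1 hs
    have hpos := card_orb_pos G.rot d
    by_cases h1 : orb G.rot d ∈ A
    · simp only [h1, if_true]; split_ifs <;> omega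
    by_cases h2 : orb G.rot d ∈ B
    · simp only [h2, if_true]; split_ifs; omega
    have hb : G.ty d = .black := by
      by_contra hb
      exact h1 (Finset.mem_filter.2 ⟨hs, d, mem_orb_self _ _, hb⟩)
    have hn : ¬ S d := fun hn => h2 (Finset.mem_filter.2 ⟨hs, d, mem_orb_self _ _, hn⟩)
    have := (three_le_card_orb_iff G.rot d).2 (h.deg d hb hn)
    simp only [h1, h2, if_false]; omega
  rw [Finset.sum_add_distrib, Finset.sum_add_distrib, ← Nat.cast_sum, hsum,
    ← Finset.sum_filter, ← Finset.sum_filter] at hge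
  have e1 : (orbs G.rot).filter (· ∈ A) = A := by
    ext s; simp only [Finset.mem_filter, hA]; tauto
  have e2 : (orbs G.rot).filter (· ∈ B) = B := by
    ext s; simp only [Finset.mem_filter, hB]; tauto
  rw [e1, e2] at hge
  simp only [Finset.sum_const, nsmul_eq_mul] at hge
  have := h.vert
  have : (A.card : ℤ) ≤ Fintype.card K := by exact_mod_cast hAc
  have : (B.card : ℤ) ≤ 1 := by exact_mod_cast hBc
  linarith

/-! ### Sums over labelled graphs with two distinguished darts -/

theorem sum_map [Finite L] [Finite D] [Finite E] (e : D ≃ E) (F : Cfg n L E → ℂ) :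
    ∑ G, F G = ∑ G : Cfg n L D, F (G.map e) :=
  ((Cfg.mapEquiv e).sum_comp F).symm

theorem exists_perm_two (i j : D) (hij : i ≠ j) (a b : D) (hab : a ≠ b) :
    ∃ τ : Perm D, τ i = a ∧ τ j = b := by
  classical
  refine ⟨swap (swap i a j) b * swap i a, ?_, ?_⟩
  · rw [Perm.mul_apply, swap_apply_left, swap_apply_of_ne_of_ne _ hab]
    intro h
    have := (swap i a).injective (h.symm.trans (swap_apply_left i a).symm)
    exact hij this.symm
  · rw [Perm.mul_apply, swap_apply_left]

-- Relabelling is transitive on ordered pairs of distinct darts, so each of the `(m + 2)(m + 1)`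
-- pairs contributes as much as the pair of added darts. This factor is `(m + 2)! / m!` and
-- disappears when the labellings are divided out.
open Classical in
theorem sum_pointed [Finite L] [Fintype D] (h : Cfg n L (Option (Option D)) → Option (Option D) →
      Option (Option D) → ℂ)
    (hh : ∀ (τ : Perm (Option (Option D))) G i j, h (G.map τ) (τ i) (τ j) = h G i j) :
    ∑ G, ∑ i, ∑ j, (if i ≠ j then h G i j else 0) =
      ((Fintype.card D + 2 : ℂ) * (Fintype.card D + 1)) * ∑ G, h G none (some none) := by
  have h1 : ∀ i j, i ≠ j → ∑ G, h G i j = ∑ G, h G none (some none) := by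
    intro i j hij
    obtain ⟨τ, h1, h2⟩ := exists_perm_two none (some none) (by simp) i j hij
    rw [sum_map τ]
    refine Finset.sum_congr rfl fun G _ => ?_
    rw [← h1, ← h2, hh]
  rw [Finset.sum_comm]
  have h2 : ∀ i : Option (Option D), ∑ G : Cfg n L (Option (Option D)), ∑ j,
      (if i ≠ j then h G i j else 0) = (Fintype.card D + 1) * ∑ G, h G none (some none) := by
    intro i
    rw [Finset.sum_comm]
    have : ∀ j ∈ (Finset.univ : Finset (Option (Option D))),
        ∑ G : Cfg n L (Option (Option D)), (if i ≠ j then h G i j else 0) =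
        if i ≠ j then ∑ G, h G none (some none) else 0 := by
      intro j _
      split_ifs with hij
      · exact h1 i j hij
      · simp
    rw [Finset.sum_congr rfl this, ← Finset.sum_filter, Finset.sum_const, Finset.filter_ne,
      Finset.card_erase_of_mem (Finset.mem_univ _), Finset.card_univ, nsmul_eq_mul]
    simp
  rw [Finset.sum_congr rfl fun i _ => h2 i, Finset.sum_const, Finset.card_univ, nsmul_eq_mul]
  simp
  ring

end Labelled

/-! ### Products over vertices and edges -/

section Products

variable (r : ℕ) (v : ℕ → ℂ) {n : ℕ} {D E : Type} [Fintype D] [Fintype E]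

open Classical in
/-- Choice between two values. -/
def pif (p : Prop) (a b : ℂ) : ℂ := if p then a else b

theorem pif_pos {p : Prop} (h : p) (a b : ℂ) : pif p a b = a := if_pos h

theorem pif_neg {p : Prop} (h : ¬ p) (a b : ℂ) : pif p a b = b := if_neg h

/-- The product of the propagators over the cycles of `σ`. -/
def eprod (σ : Perm D) (ls : D → ℂ) : ℂ := ∏ s ∈ orbs σ, -(vw r v (s.val.map ls))⁻¹

/-- The product of the weights of the black vertices. -/
def vprod (σ : Perm D) (ty : D → VertexType n) (lc : D → ℂ) : ℂ :=
  ∏ s ∈ orbs σ, pif (∀ d ∈ s, ty d = .black) (vw r v (s.val.map lc)) 1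

/-- The product of the weights of the vertices, where the vertex of `c` has a weight given by
`φ`. -/
def rprod (σ : Perm D) (ty : D → VertexType n) (lc : D → ℂ) (c : D) (φ : Multiset ℂ → ℂ) : ℂ :=
  ∏ s ∈ orbs σ, pif (c ∈ s) (φ (s.val.map lc))
    (pif (∀ d ∈ s, ty d = .black) (vw r v (s.val.map lc)) 1)

theorem map_update (s : Finset D) [DecidableEq D] {c : D} (hc : c ∉ s) (lc : D → ℂ) (t : ℂ) :
    s.val.map (Function.update lc c t) = s.val.map lc :=
  Multiset.map_congr rfl fun d hd =>
    Function.update_of_ne (fun h => hc (by rw [← h]; exact hd)) _ _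

theorem map_update_self (s : Finset D) [DecidableEq D] {c : D} (hc : c ∈ s) (lc : D → ℂ) (t : ℂ) :
    s.val.map (Function.update lc c t) = t ::ₘ (s.erase c).val.map lc := by
  conv_lhs => rw [← Finset.insert_erase hc, Finset.insert_val_of_notMem (Finset.notMem_erase c s)]
  rw [Multiset.map_cons, Function.update_self, map_update _ (Finset.notMem_erase c s)]

theorem eprod_permCongr (e : D ≃ E) (σ : Perm D) (ls : E → ℂ) :
    eprod r v (e.permCongr σ) ls = eprod r v σ (ls ∘ e) := by
  unfold eprod
  rw [prod_orbs_permCongr]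
  simp [Multiset.map_map]

theorem forall_mem_map_equiv (e : D ≃ E) (s : Finset D) (p : E → Prop) :
    (∀ u ∈ s.map e.toEmbedding, p u) ↔ ∀ a ∈ s, p (e a) := by
  constructor
  · exact fun h a ha => h _ (Finset.mem_map_of_mem e.toEmbedding ha)
  · intro h u hu
    obtain ⟨a, ha, rfl⟩ := Finset.mem_map.1 hu
    exact h a ha

theorem vprod_permCongr (e : D ≃ E) (σ : Perm D) (ty : E → VertexType n) (lc : E → ℂ) :
    vprod r v (e.permCongr σ) ty lc = vprod r v σ (ty ∘ e) (lc ∘ e) := by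
  unfold vprod
  rw [prod_orbs_permCongr]
  simp only [forall_mem_map_equiv]
  simp [Multiset.map_map]

theorem rprod_permCongr (e : D ≃ E) (σ : Perm D) (ty : E → VertexType n) (lc : E → ℂ) (c : D)
    (φ : Multiset ℂ → ℂ) :
    rprod r v (e.permCongr σ) ty lc (e c) φ = rprod r v σ (ty ∘ e) (lc ∘ e) c φ := by
  unfold rprod
  rw [prod_orbs_permCongr]
  simp only [forall_mem_map_equiv]
  simp [Multiset.map_map]

variable {r v}

-- Isolating the factor of the root shows that `rprod` is linear in `φ` and depends on it only
-- through one value.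
open Classical in
theorem rprod_eq (σ : Perm D) (ty : D → VertexType n) (lc : D → ℂ) (c : D)
    (φ : Multiset ℂ → ℂ) : rprod r v σ ty lc c φ = φ ((orb σ c).val.map lc) *
      ∏ s ∈ (orbs σ).erase (orb σ c),
        pif (∀ d ∈ s, ty d = .black) (vw r v (s.val.map lc)) 1 := by
  unfold rprod
  rw [← Finset.mul_prod_erase _ _ (orb_mem_orbs σ c), pif_pos (mem_orb_self σ c)]
  congr 1
  refine Finset.prod_congr rfl fun s hs => pif_neg (fun hc => ?_) _ _
  rw [Finset.mem_erase] at hs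
  exact hs.1 (eq_orb_of_mem hs.2 hc)

theorem rprod_congr (σ : Perm D) (ty : D → VertexType n) (lc : D → ℂ) (c : D)
    {φ ψ : Multiset ℂ → ℂ} (h : φ ((orb σ c).val.map lc) = ψ ((orb σ c).val.map lc)) :
    rprod r v σ ty lc c φ = rprod r v σ ty lc c ψ := by
  rw [rprod_eq, rprod_eq, h]

theorem rprod_add (σ : Perm D) (ty : D → VertexType n) (lc : D → ℂ) (c : D)
    (φ ψ : Multiset ℂ → ℂ) : rprod r v σ ty lc c (fun s => φ s + ψ s) =
      rprod r v σ ty lc c φ + rprod r v σ ty lc c ψ := by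
  rw [rprod_eq, rprod_eq, rprod_eq, add_mul]

theorem rprod_vw (σ : Perm D) (ty : D → VertexType n) (lc : D → ℂ) (c : D)
    (hc : ∀ d, σ.SameCycle c d → ty d = .black) :
    rprod r v σ ty lc c (vw r v) = vprod r v σ ty lc := by
  unfold rprod vprod
  refine Finset.prod_congr rfl fun s hs => ?_
  by_cases h1 : c ∈ s
  · rw [pif_pos h1, pif_pos fun d hd => hc d (mem_orb.1 (eq_orb_of_mem hs h1 ▸ hd))]
  · rw [pif_neg h1]

/-- The weight of the vertices does not depend on the decorations around white vertices. -/
theorem vprod_congr (σ : Perm D) (ty : D → VertexType n) {lc lc' : D → ℂ}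
    (h : ∀ d, ty d = .black → lc d = lc' d) : vprod r v σ ty lc = vprod r v σ ty lc' := by
  unfold vprod
  refine Finset.prod_congr rfl fun s _ => ?_
  by_cases h1 : ∀ d ∈ s, ty d = .black
  · rw [pif_pos h1, pif_pos h1, Multiset.map_congr rfl fun d hd => h d (h1 d hd)]
  · rw [pif_neg h1, pif_neg h1]

/-! Insertion of darts. -/

theorem map_liftIns_of_notMem {c : D} {s : Finset D} (h : c ∉ s) (l : Option D → ℂ) :
    (liftIns c s).val.map l = s.val.map (l ∘ some) := by
  simp [liftIns, h, Multiset.map_map]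

theorem map_liftIns_of_mem {c : D} {s : Finset D} (h : c ∈ s) (l : Option D → ℂ) :
    (liftIns c s).val.map l = l none ::ₘ s.val.map (l ∘ some) := by
  simp [liftIns, h, Finset.insertNone, Multiset.map_map]

theorem forall_mem_liftIns {c : D} {s : Finset D} (p : Option D → Prop) :
    (∀ u ∈ liftIns c s, p u) ↔ (c ∈ s → p none) ∧ ∀ a ∈ s, p (some a) := by
  constructor
  · exact fun h => ⟨fun hc => h _ (none_mem_liftIns.2 hc), fun a ha => h _ (some_mem_liftIns.2 ha)⟩
  · rintro ⟨h1, h2⟩ (_ | a) hu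
    · exact h1 (none_mem_liftIns.1 hu)
    · exact h2 a (some_mem_liftIns.1 hu)

theorem eprod_pair (σ : Perm D) (ls : Option (Option D) → ℂ) :
    eprod r v (insOpt (fixOpt σ) none) ls =
      propagator r v (ls none) (ls (some none)) * eprod r v σ (fun d => ls (some (some d))) := by
  unfold eprod
  rw [prod_orbs_insOpt, prod_orbs_fixOpt, map_liftIns_of_mem (by simp), propagator_eq]
  congr 1
  refine Finset.prod_congr rfl fun s _ => ?_
  rw [map_liftIns_of_notMem (by simp)]
  simp [Multiset.map_map, Function.comp_def]

theorem rprod_pair (σ : Perm D) (ty : Option (Option D) → VertexType n)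
    (lc : Option (Option D) → ℂ) (φ : Multiset ℂ → ℂ) :
    rprod r v (insOpt (fixOpt σ) none) ty lc none φ = φ {lc none, lc (some none)} *
      vprod r v σ (fun d => ty (some (some d))) (fun d => lc (some (some d))) := by
  unfold rprod vprod
  rw [prod_orbs_insOpt, prod_orbs_fixOpt, map_liftIns_of_mem (by simp),
    pif_pos (none_mem_liftIns.2 (by simp))]
  congr 1
  refine Finset.prod_congr rfl fun s _ => ?_
  rw [map_liftIns_of_notMem (by simp), pif_neg (by rw [none_mem_liftIns]; simp)]
  simp only [forall_mem_liftIns]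
  simp [Multiset.map_map, Function.comp_def]

theorem rprod_insOpt (σ : Perm D) (ty : Option D → VertexType n) (lc : Option D → ℂ) (c : D)
    (φ : Multiset ℂ → ℂ) :
    rprod r v (insOpt σ c) ty lc none φ =
      rprod r v σ (fun d => ty (some d)) (fun d => lc (some d)) c (fun s => φ (lc none ::ₘ s)) := by
  unfold rprod
  rw [prod_orbs_insOpt]
  refine Finset.prod_congr rfl fun s _ => ?_
  simp only [none_mem_liftIns, forall_mem_liftIns]
  by_cases h1 : c ∈ s
  · rw [pif_pos h1, pif_pos h1, map_liftIns_of_mem h1]; rfl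
  · rw [pif_neg h1, pif_neg h1, map_liftIns_of_notMem h1]
    simp [h1]

theorem rprod_fixOpt (σ : Perm D) (ty : Option D → VertexType n) (lc : Option D → ℂ) (c : D)
    (φ : Multiset ℂ → ℂ) (hty : ty none ≠ .black) :
    rprod r v (fixOpt σ) ty lc (some c) φ =
      rprod r v σ (fun d => ty (some d)) (fun d => lc (some d)) c φ := by
  unfold rprod
  rw [prod_orbs_fixOpt]
  simp [hty, Multiset.map_map, pif_neg]

/-- The enlarged vertex is neither black nor the root, so its factor is one whatever its degree. -/
theorem rprod_insOpt_white (σ : Perm D) (ty : Option D → VertexType n) (lc : Option D → ℂ) (c e : D)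
    (φ : Multiset ℂ → ℂ) (hce : ¬ σ.SameCycle c e) (hty : ty (some e) ≠ .black) :
    rprod r v (insOpt σ e) ty lc (some c) φ =
      rprod r v σ (fun d => ty (some d)) (fun d => lc (some d)) c φ := by
  unfold rprod
  rw [prod_orbs_insOpt]
  refine Finset.prod_congr rfl fun s hs => ?_
  simp only [some_mem_liftIns, forall_mem_liftIns]
  by_cases h1 : e ∈ s
  · have h2 : c ∉ s := fun h2 => hce (by rw [← mem_orb, ← eq_orb_of_mem hs h2]; exact h1)
    rw [pif_neg h2, pif_neg h2, pif_neg (fun h => hty (h.2 e h1)),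
      pif_neg (fun h => hty (h e h1))]
  · rw [map_liftIns_of_notMem h1]
    simp [h1]

/-! Change of one decoration. -/

open Classical in
theorem rprod_update (σ : Perm D) (ty : D → VertexType n) (lc : D → ℂ) (c : D) (t : ℂ)
    (φ : Multiset ℂ → ℂ) : rprod r v σ ty (Function.update lc c t) c φ =
      φ (t ::ₘ ((orb σ c).erase c).val.map lc) *
      ∏ s ∈ (orbs σ).erase (orb σ c),
        pif (∀ d ∈ s, ty d = .black) (vw r v (s.val.map lc)) 1 := by
  rw [rprod_eq, map_update_self _ (mem_orb_self σ c)]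
  congr 1
  refine Finset.prod_congr rfl fun s hs => ?_
  rw [Finset.mem_erase] at hs
  rw [map_update s (fun hc => hs.1 (eq_orb_of_mem hs.2 hc))]

-- Only the vertex of `c` is affected. There `vw_diff` adds the argument `s` to a weight already
-- containing `t`, as if a further edge were attached at the corner `c`.
open Classical in
theorem vprod_diff (σ : Perm D) (ty : D → VertexType n) (lc : D → ℂ) (c : D)
    (hc : ∀ d, σ.SameCycle c d → ty d = .black) (s t : ℂ) :
    vprod r v σ ty (Function.update lc c s) - vprod r v σ ty (Function.update lc c t) =
      (s - t) * rprod r v σ ty (Function.update lc c t) c (fun m => vw r v (s ::ₘ m)) := by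
  rw [← rprod_vw _ _ _ c hc, ← rprod_vw _ _ _ c hc, rprod_update, rprod_update, rprod_update,
    ← sub_mul, ← vw_diff, mul_assoc]

open Classical in
theorem hasDerivAt_vprod (σ : Perm D) (ty : D → VertexType n) (lc : D → ℂ) (c : D)
    (hc : ∀ d, σ.SameCycle c d → ty d = .black) :
    HasDerivAt (fun t => vprod r v σ ty (Function.update lc c t))
      (rprod r v σ ty lc c (fun m => vw r v (lc c ::ₘ m))) (lc c) := by
  have h := (hasDerivAt_vw r v (((orb σ c).erase c).val.map lc) (lc c)).mul_const
    (∏ s ∈ (orbs σ).erase (orb σ c),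
        pif (∀ d ∈ s, ty d = .black) (vw r v (s.val.map lc)) 1)
  have h1 := rprod_update (r := r) (v := v) σ ty lc c (lc c) (fun m => vw r v (lc c ::ₘ m))
  rw [Function.update_eq_self] at h1
  rw [← h1] at h
  refine h.congr_of_eventuallyEq (Filter.Eventually.of_forall fun t => ?_)
  change vprod r v σ ty (Function.update lc c t) = _
  rw [← rprod_vw _ _ _ c hc, rprod_update]

theorem orb_involution (σ : Perm D) (hσ : ∀ d, σ (σ d) = d) (d : D) [DecidableEq D] :
    orb σ d = {d, σ d} := by
  ext e
  rw [mem_orb, Finset.mem_insert, Finset.mem_singleton]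
  constructor
  · intro h
    have := SameCycle.invariant_prop (σ := σ) (p := fun x => x = d ∨ x = σ d)
      (fun x => by
        rw [σ.apply_eq_iff_eq, or_comm]
        constructor
        · rintro (h | h)
          · exact Or.inl h
          · exact Or.inr (by rw [← h, hσ])
        · rintro (h | h)
          · exact Or.inl h
          · exact Or.inr (by rw [h, hσ])) h
    simpa using this
  · rintro (rfl | rfl)
    · exact Perm.SameCycle.refl _ _
    · exact sameCycle_step _ _

open Classical in
theorem eprod_update (σ : Perm D) (hσ : ∀ d, σ (σ d) = d) (hσ' : ∀ d, σ d ≠ d) (ls : D → ℂ)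
    (d : D) (t : ℂ) : eprod r v σ (Function.update ls d t) =
      propagator r v t (ls (σ d)) *
        ∏ s ∈ (orbs σ).erase (orb σ d), -(vw r v (s.val.map ls))⁻¹ := by
  unfold eprod
  rw [← Finset.mul_prod_erase _ _ (orb_mem_orbs σ d), map_update_self _ (mem_orb_self σ d),
    propagator_eq]
  congr 1
  · rw [orb_involution σ hσ, Finset.erase_insert (by simpa using (hσ' d).symm)]
    simp
  · refine Finset.prod_congr rfl fun s hs => ?_
    rw [Finset.mem_erase] at hs
    rw [map_update s (fun hc => hs.1 (eq_orb_of_mem hs.2 hc))]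

-- Only the edge of `d` is affected. By `propagator_diff` the difference is `s - t` times the weight
-- after inserting in this edge a vertex with corners labelled `s`, `t` and `ls (σ d)`.
open Classical in
theorem eprod_diff (σ : Perm D) (hσ : ∀ d, σ (σ d) = d) (hσ' : ∀ d, σ d ≠ d) (ls : D → ℂ)
    (d : D) (s t : ℂ) (hs : vw r v {s, ls (σ d)} ≠ 0) (ht : vw r v {t, ls (σ d)} ≠ 0) :
    eprod r v σ (Function.update ls d s) - eprod r v σ (Function.update ls d t) =
      (s - t) * (eprod r v σ (Function.update ls d t) *
        (propagator r v s (ls (σ d)) * vw r v {s, t, ls (σ d)})) := by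
  rw [eprod_update σ hσ hσ', eprod_update σ hσ hσ', ← sub_mul, propagator_diff r v hs ht]
  ring

open Classical in
theorem hasDerivAt_eprod (σ : Perm D) (hσ : ∀ d, σ (σ d) = d) (hσ' : ∀ d, σ d ≠ d) (ls : D → ℂ)
    (d : D) (hd : vw r v {ls d, ls (σ d)} ≠ 0) :
    HasDerivAt (fun t => eprod r v σ (Function.update ls d t))
      (eprod r v σ ls * (propagator r v (ls d) (ls (σ d)) * vw r v {ls d, ls d, ls (σ d)}))
      (ls d) := by
  have h1 := (((hasDerivAt_vw r v {ls (σ d)} (ls d)).inv hd).neg).mul_const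
    (∏ s ∈ (orbs σ).erase (orb σ d), -(vw r v (s.val.map ls))⁻¹)
  have h2 := eprod_update (r := r) (v := v) σ hσ hσ' ls d (ls d)
  rw [Function.update_eq_self] at h2
  refine (h1.congr_of_eventuallyEq (Filter.Eventually.of_forall fun t => ?_)).congr_deriv ?_
  · rw [eprod_update σ hσ hσ', propagator_eq]; rfl
  · rw [h2, propagator_eq]
    change - (-vw r v {ls d, ls d, ls (σ d)} / vw r v {ls d, ls (σ d)} ^ 2) * _ = _
    field_simp

theorem analyticAt_vprod (σ : Perm D) (ty : D → VertexType n) (lab : D → ℂ) :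
    AnalyticAt ℂ (fun lab : D → ℂ => vprod r v σ ty lab) lab := by
  unfold vprod
  refine Finset.analyticAt_fun_prod _ fun s _ => ?_
  unfold pif
  split_ifs
  · exact analyticAt_vw r v s lab
  · exact analyticAt_const

theorem analyticAt_eprod (σ : Perm D) (hσ : ∀ d, σ (σ d) = d) (hσ' : ∀ d, σ d ≠ d) (ls : D → ℂ)
    (hd : ∀ d, vw r v {ls d, ls (σ d)} ≠ 0) :
    AnalyticAt ℂ (fun ls : D → ℂ => eprod r v σ ls) ls := by
  classical
  unfold eprod
  refine Finset.analyticAt_fun_prod _ fun s hs => ?_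
  refine ((analyticAt_vw r v s ls).inv ?_).neg
  obtain ⟨d, rfl⟩ := mem_orbs.1 hs
  rw [orb_involution σ hσ, Finset.insert_val_of_notMem (by simpa using (hσ' d).symm)]
  exact hd d

end Products

/-! ### Attaching a univalent white vertex at a corner -/

section Cilium

variable {n N : ℕ} {K L D : Type}

/-- Extension of a function to two new elements. -/
def ext2 {X : Type*} (a b : X) (f : D → X) : Option (Option D) → X
  | none => a
  | some none => b
  | some (some d) => f d

@[simp] theorem ext2_none {X : Type*} (a b : X) (f : D → X) : ext2 a b f none = a := rfl
@[simp] theorem ext2_some_none {X : Type*} (a b : X) (f : D → X) : ext2 a b f (some none) = b := rfl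
@[simp] theorem ext2_some {X : Type*} (a b : X) (f : D → X) (d : D) :
    ext2 a b f (some (some d)) = f d := rfl

/-- The graph obtained by joining a new univalent white vertex, whose dart is `none`, to the corner
of `c`, by an edge whose other dart is `some none`. -/
def Cfg.attach (G : Cfg n L D) (c : D) (i : Fin n) : Cfg n L (Option (Option D)) where
  rot := fixOpt (insOpt G.rot c)
  opp := insOpt (fixOpt G.opp) none
  ty := ext2 (.white i) .black G.ty
  deco := ext2 (G.deco c) (G.deco c) G.deco

/-- In the walk along the face, the two sides of the new edge are passed one after the other just
before `c`: first `some none`, then `none`. No face is created. -/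
theorem Cfg.attach_face (G : Cfg n L D) (c : D) (i : Fin n) :
    (G.attach c i).face = insOpt (insOpt G.face (G.face.symm c)) none := by
  ext1 u
  rw [Cfg.face_apply]
  rcases u with _ | _ | d
  · simp [attach]
  · simp [attach]
  · rw [insOpt_of_ne _ _ (by simp)]
    by_cases h : G.face d = c
    · have h1 : G.opp d = G.rot c := by rw [← h, Cfg.face_apply]; simp
      have h2 : d = G.face.symm c := by rw [← h]; simp
      rw [h2, insOpt_self, ← h2]
      simp [attach, insOpt_of_ne, h1]
    · have h1 : G.opp d ≠ G.rot c := fun h' => h (by rw [Cfg.face_apply, h']; simp)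
      have h2 : d ≠ G.face.symm c := fun h' => h (by rw [h']; simp)
      rw [insOpt_of_ne _ _ h2]
      simp [attach, insOpt_of_ne, insOpt_symm_of_ne _ _ h1, Cfg.face_apply]

theorem Cfg.attach_sameCycle_face (G : Cfg n L D) (c : D) (i : Fin n) (u w : Option (Option D)) :
    (G.attach c i).face.SameCycle u w ↔
      G.face.SameCycle (ext2 c c id u) (ext2 c c id w) := by
  rw [G.attach_face, sameCycle_insOpt, sameCycle_insOpt]
  have h : ∀ a : Option D, G.face.SameCycle (a.getD (G.face.symm c)) (ext2 c c id (some a)) := by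
    rintro (_ | a)
    · have := sameCycle_step G.face (G.face.symm c)
      rwa [apply_symm_apply] at this
    · exact Perm.SameCycle.refl _ _
  have h' : ∀ u : Option (Option D), ext2 c c id u = ext2 c c id (some (u.getD none)) := by
    rintro (_ | _ | d) <;> rfl
  rw [h' u, h' w]
  exact ⟨fun hs => (h _).symm.trans (hs.trans (h _)), fun hs => (h _).trans (hs.trans (h _).symm)⟩

/-- The same kind of graphs, with one more ciliated face. -/
def Spec.addCil (X : Spec n K) (k₀ : K) : Spec n K := { X with cil := fun k => X.cil k ∨ k = k₀ }

variable [Fintype D] {X : Spec n K} {k₀ : K} {G : Cfg n (K ⊕ Fin N) D} {c : D}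

theorem isRooted_of_attach (hX : ¬ X.cil k₀) (hc : G.deco c = .inl k₀)
    (h : IsRooted (X.addCil k₀) (G.attach c (X.tp k₀)) (some none)) : IsRooted X G c := by
  set G' := G.attach c (X.tp k₀) with hG'
  have hopp : ∀ d, G'.opp (some (some d)) = some (some (G.opp d)) := fun d => by
    simp [hG', Cfg.attach, insOpt_of_ne]
  have hrotc : G'.rot (some (some c)) = some none := by simp [hG', Cfg.attach]
  have hrotn : G'.rot (some none) = some (some (G.rot c)) := by simp [hG', Cfg.attach]
  have hrot : ∀ d, d ≠ c → G'.rot (some (some d)) = some (some (G.rot d)) := fun d hd => by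
    simp [hG', Cfg.attach, insOpt_of_ne, hd]
  have hsame : ∀ d, G'.rot.SameCycle (some none) (some (some d)) ↔ G.rot.SameCycle c d :=
    fun d => by simp [hG', Cfg.attach, sameCycle_fixOpt, sameCycle_insOpt]
  have hbl : ∀ d, G.rot.SameCycle c d → G.ty d = .black := fun d hd =>
    h.special (some (some d)) ((hsame d).2 hd)
  have hcb := hbl c (Perm.SameCycle.refl _ _)
  have hrcb := hbl _ (sameCycle_step _ c)
  have hface : ∀ d d', G'.face.SameCycle (some (some d)) (some (some d')) ↔ G.face.SameCycle d d' :=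
    fun d d' => G.attach_sameCycle_face c _ _ _
  refine ⟨?_, ?_, ?_, ?_, ?_, ?_, ?_, ?_, ?_, ?_, hbl, ?_, ?_, ?_⟩
  · intro d
    have := h.opp_opp (some (some d))
    simpa [hopp] using this
  · intro d
    have := h.opp_ne (some (some d))
    simpa [hopp] using this
  · intro d
    by_cases hd : d = c
    · rw [hd, hcb, hrcb]
    · have := h.ty_rot (some (some d))
      rwa [hrot d hd] at this
  · intro d
    exact h.deco_sameCycle ((hface _ _).2 (sameCycle_step _ d).symm)
  · intro p h1 h2 d d' hd
    refine h.conn (ext2 (p c) (p c) p) ?_ ?_ (some (some d)) (some (some d')) hd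
    · rintro (_ | _ | a)
      · rfl
      · rw [hrotn]; exact h1 c
      · by_cases ha : a = c
        · rw [ha, hrotc]; rfl
        · rw [hrot a ha]; exact h1 a
    · rintro (_ | _ | a)
      · simp [hG', Cfg.attach]
      · simp [hG', Cfg.attach]
      · rw [hopp]; exact h2 a
  · have := h.vert
    rw [hG', Cfg.attach, card_orbs_fixOpt, card_orbs_insOpt] at this
    simp only [Fintype.card_option, Spec.addCil] at this
    push_cast at this
    linarith
  · have := h.fac
    rwa [hG', Cfg.attach_face, card_orbs_insOpt, card_orbs_insOpt] at this
  · intro d hd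
    obtain ⟨k, hk1, hk2, hk3, hk4⟩ := h.white (some (some d)) hd
    have hdr : d ≠ G.rot c := fun h' => hd (by rw [h', hrcb])
    rcases hk1 with hk1 | rfl
    · refine ⟨k, hk1, hk2, ?_, hk4⟩
      simpa [hG', Cfg.attach, insOpt_symm_of_ne _ _ hdr, Spec.addCil] using hk3
    · have := h.white_unique (some (some d)) none hd (by simp [hG', Cfg.attach])
        (by rw [hk2]; exact hc.symm)
      simp at this
  · intro k hk
    obtain ⟨u, hu1, hu2⟩ := h.white_ex k (Or.inl hk)
    rcases u with _ | _ | d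
    · have : k₀ = k := Sum.inl_injective (hc.symm.trans hu2)
      exact absurd (this ▸ hk) hX
    · exact absurd rfl hu1
    · exact ⟨d, hu1, hu2⟩
  · intro d d' h1 h2 h3
    simpa using h.white_unique (some (some d)) (some (some d')) h1 h2 h3
  · intro d hd hd'
    have hd'' : ∀ a, G.rot.SameCycle a d → a ≠ c := fun a ha h' => hd' (h' ▸ ha)
    have := h.deg (some (some d)) hd (fun h' => hd' ((hsame d).1 h'))
    rw [hrot d (hd'' d (Perm.SameCycle.refl _ _)),
      hrot _ (hd'' _ (sameCycle_step _ d).symm)] at this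
    simpa using this
  · intro k
    obtain ⟨u, hu⟩ := h.mark_ex k
    rcases u with _ | _ | d
    · exact ⟨c, hu⟩
    · exact ⟨c, hu⟩
    · exact ⟨d, hu⟩
  · intro k d d' h1 h2
    exact (hface _ _).1 (h.mark_unique k (some (some d)) (some (some d')) h1 h2)

/-- One edge and one vertex are added and no face, so `e` and `f` persist. The new white vertex is
the only one in its face because the face was not ciliated. -/
theorem IsGraph.attach (hX : ¬ X.cil k₀) (hX' : X.next k₀ = k₀) (hc : G.deco c = .inl k₀)
    (h : IsRooted X G c) : IsRooted (X.addCil k₀) (G.attach c (X.tp k₀)) (some none) := by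
  set G' := G.attach c (X.tp k₀) with hG'
  have hopp : ∀ d, G'.opp (some (some d)) = some (some (G.opp d)) := fun d => by
    simp [hG', Cfg.attach, insOpt_of_ne]
  have hoppn : G'.opp none = some none := by simp [hG', Cfg.attach]
  have hoppn' : G'.opp (some none) = none := by simp [hG', Cfg.attach]
  have hrotnn : G'.rot none = none := by simp [hG', Cfg.attach]
  have hrotc : G'.rot (some (some c)) = some none := by simp [hG', Cfg.attach]
  have hrotn : G'.rot (some none) = some (some (G.rot c)) := by simp [hG', Cfg.attach]
  have hrot : ∀ d, d ≠ c → G'.rot (some (some d)) = some (some (G.rot d)) := fun d hd => by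
    simp [hG', Cfg.attach, insOpt_of_ne, hd]
  have hsame : ∀ d, G'.rot.SameCycle (some none) (some (some d)) ↔ G.rot.SameCycle c d :=
    fun d => by simp [hG', Cfg.attach, sameCycle_fixOpt, sameCycle_insOpt]
  have hcb := h.special c (Perm.SameCycle.refl _ _)
  have hrcb := h.special _ (sameCycle_step _ c)
  have hface : ∀ d d', G'.face.SameCycle d d' ↔ G.face.SameCycle (ext2 c c id d) (ext2 c c id d') :=
    fun d d' => G.attach_sameCycle_face c _ _ _
  have hdeco : ∀ u, G'.deco u = G.deco (ext2 c c id u) := by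
    rintro (_ | _ | d) <;> rfl
  have hcil : ∀ d, G.ty d ≠ .black → G.deco d ≠ .inl k₀ := fun d hd hd' => by
    obtain ⟨k, h1, h2, -⟩ := h.white d hd
    have : k₀ = k := Sum.inl_injective (hd'.symm.trans h2)
    exact hX (this ▸ h1)
  refine ⟨?_, ?_, ?_, ?_, ?_, ?_, ?_, ?_, ?_, ?_, ?_, ?_, ?_, ?_⟩
  · rintro (_ | _ | d)
    · rw [hoppn, hoppn']
    · rw [hoppn', hoppn]
    · rw [hopp, hopp, h.opp_opp]
  · rintro (_ | _ | d)
    · rw [hoppn]; simp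
    · rw [hoppn']; simp
    · rw [hopp]; simpa using h.opp_ne d
  · rintro (_ | _ | d)
    · rw [hrotnn]
    · rw [hrotn]; exact hrcb
    · by_cases hd : d = c
      · rw [hd, hrotc]; exact hcb.symm
      · rw [hrot d hd]; exact h.ty_rot d
  · intro u
    rw [hdeco, hdeco]
    exact (h.deco_sameCycle ((hface _ _).1 (sameCycle_step G'.face u))).symm
  · intro p h1 h2
    have hcn : p (some (some c)) ↔ p (some none) := by rw [← h1 (some (some c)), hrotc]
    have key := h.conn (fun d => p (some (some d))) (fun d => by
      by_cases hd : d = c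
      · rw [hd, hcn, ← h1 (some none), hrotn]
      · rw [← h1 (some (some d)), hrot d hd]) (fun d => by rw [← h2 (some (some d)), hopp])
    have hn : p none ↔ p (some none) := by rw [← h2 none, hoppn]
    have hred : ∀ u, p u ↔ p (some (some (ext2 c c id u))) := by
      rintro (_ | _ | d)
      · exact hn.trans hcn.symm
      · exact hcn.symm
      · rfl
    intro u u' hu
    rw [hred] at hu ⊢
    exact key _ _ hu
  · have := h.vert
    rw [hG', Cfg.attach, card_orbs_fixOpt, card_orbs_insOpt]
    simp only [Fintype.card_option, Spec.addCil]
    push_cast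
    linarith
  · rw [hG', Cfg.attach_face, card_orbs_insOpt, card_orbs_insOpt]
    exact h.fac
  · rintro (_ | _ | d) hd
    · exact ⟨k₀, Or.inr rfl, hc, by simpa [hG', Cfg.attach, Spec.addCil, hX'] using hc, rfl⟩
    · exact absurd rfl hd
    · obtain ⟨k, hk1, hk2, hk3, hk4⟩ := h.white d hd
      have hdr : d ≠ G.rot c := fun h' => hd (by rw [h']; exact hrcb)
      refine ⟨k, Or.inl hk1, hk2, ?_, hk4⟩
      simpa [hG', Cfg.attach, insOpt_symm_of_ne _ _ hdr, Spec.addCil] using hk3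
  · rintro k (hk | rfl)
    · obtain ⟨d, hd⟩ := h.white_ex k hk
      exact ⟨some (some d), hd⟩
    · exact ⟨none, by simp [hG', Cfg.attach], hc⟩
  · rintro (_ | _ | d) (_ | _ | d') h1 h2 h3
    · rfl
    · exact absurd rfl h2
    · exact absurd (h3.symm.trans hc) (hcil d' h2)
    · exact absurd rfl h1
    · rfl
    · exact absurd rfl h1
    · exact absurd (h3.trans hc) (hcil d h1)
    · exact absurd rfl h2
    · rw [h.white_unique d d' h1 h2 h3]
  · rintro (_ | _ | d) hd
    · exact absurd hd (sameCycle_fixOpt_some_none _)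
    · rfl
    · exact h.special d ((hsame d).1 hd)
  · rintro (_ | _ | d) h1 h2
    · simp [hG', Cfg.attach] at h1
    · exact absurd (Perm.SameCycle.refl _ _) h2
    · rw [hsame] at h2
      have hd'' : ∀ a, G.rot.SameCycle a d → a ≠ c := fun a ha h' => h2 (h' ▸ ha)
      rw [hrot d (hd'' d (Perm.SameCycle.refl _ _)), hrot _ (hd'' _ (sameCycle_step _ d).symm)]
      simpa using h.deg d h1 h2
  · intro k
    obtain ⟨d, hd⟩ := h.mark_ex k
    exact ⟨some (some d), hd⟩
  · intro k u u' h1 h2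
    rw [hdeco] at h1 h2
    exact (hface _ _).2 (h.mark_unique k _ _ h1 h2)

/-- Every graph with a univalent white vertex which is not joined to a univalent vertex is obtained
by attaching it. -/
theorem exists_attach {G' : Cfg n (K ⊕ Fin N) (Option (Option D))}
    (h : IsRooted (X.addCil k₀) G' (some none)) (hX' : X.next k₀ = k₀)
    (h1 : G'.ty none ≠ .black) (h2 : G'.deco none = .inl k₀) (h3 : G'.opp none = some none)
    (h4 : G'.rot (some none) ≠ some none) :
    ∃ (G : Cfg n (K ⊕ Fin N) D) (c : D), G.deco c = .inl k₀ ∧ G' = G.attach c (X.tp k₀) := by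
  obtain ⟨k, -, hk2, hk3, hk4⟩ := h.white none h1
  obtain rfl : k₀ = k := Sum.inl_injective (h2.symm.trans hk2)
  have hrn : G'.rot none = none := by
    have hs : G'.rot.symm none = none := by
      refine h.white_unique _ _ ?_ h1 ?_
      · rw [← h.ty_rot]; simpa using h1
      · rw [hk3, h2]; simp [Spec.addCil, hX']
    rw [← hs, apply_symm_apply, hs]
  obtain ⟨ρ, hρ⟩ := exists_fixOpt G'.rot hrn
  -- Since the root is not univalent, the dart of the cilium comes after some other dart `c`; this
  -- is the corner of attachment.
  obtain ⟨c, hc⟩ : ∃ c, ρ (some c) = none := by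
    rcases hn : ρ.symm none with _ | c
    · exact absurd (by rw [hρ, fixOpt_some, ← hn, apply_symm_apply, hn]) h4
    · exact ⟨c, by rw [← hn, apply_symm_apply]⟩
  obtain ⟨rot, hrot⟩ := exists_insOpt ρ hc
  obtain ⟨ω, hω⟩ := exists_insOpt G'.opp (c := none) (by rw [← h3, h.opp_opp])
  obtain ⟨opp, hopp⟩ := exists_fixOpt ω (by
    have := h3; rw [hω, insOpt_none] at this; simpa using this)
  have hd1 : G'.deco (some none) = .inl k₀ := by
    rw [← h2, ← h.deco_face (some none), Cfg.face_apply, ← h3, h.opp_opp, (symm_apply_eq _).2 hrn.symm]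
  have hd2 : G'.deco (some (some c)) = .inl k₀ := by
    have h5 := h.deco_face none
    rw [Cfg.face_apply, h3, h2, hρ, hrot] at h5
    simpa using h5
  refine ⟨⟨rot, opp, fun d => G'.ty (some (some d)), fun d => G'.deco (some (some d))⟩, c, hd2, ?_⟩
  apply Cfg.ext
  · rw [hρ, hrot]; rfl
  · rw [hω, hopp]; rfl
  · funext u
    rcases u with _ | _ | d
    · exact hk4
    · exact h.special _ (Perm.SameCycle.refl _ _)
    · rfl
  · funext u
    rcases u with _ | _ | d
    · exact h2.trans hd2.symm
    · exact hd1.trans hd2.symm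
    · rfl

theorem attach_injective {G₁ G₂ : Cfg n L D} {c₁ c₂ : D} {i : Fin n}
    (h : G₁.attach c₁ i = G₂.attach c₂ i) : G₁ = G₂ ∧ c₁ = c₂ := by
  have hr : insOpt G₁.rot c₁ = insOpt G₂.rot c₂ := fixOpt_injective (congrArg Cfg.rot h)
  have hc : c₁ = c₂ := by
    have := congrArg (fun σ : Perm (Option D) => σ.symm none) hr
    simpa using this
  subst hc
  have ho : insOpt (fixOpt G₁.opp) none = insOpt (fixOpt G₂.opp) none := congrArg Cfg.opp h
  refine ⟨Cfg.ext (insOpt_injective _ hr) (fixOpt_injective (insOpt_injective _ ho)) ?_ ?_, rfl⟩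
  · funext d
    exact congrFun (congrArg Cfg.ty h) (some (some d))
  · funext d
    exact congrFun (congrArg Cfg.deco h) (some (some d))

end Cilium

/-! ### Inserting a bivalent vertex in an edge -/

section Bisect

variable {n N : ℕ} {K L D : Type}

/-- The graph obtained by inserting a bivalent vertex, with darts `none` and `some none`, in the
edge of `d`; the dart `none` lies in the face of `d`. -/
def Cfg.bisect (G : Cfg n L D) (d : D) : Cfg n L (Option (Option D)) where
  rot := insOpt (fixOpt G.rot) none
  -- The involution is recovered as `rot ∘ face` from the face permutation wanted: `none` inserted
  -- after `d`, and `some none` after `G.opp d`.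
  opp := (insOpt (insOpt G.face (G.opp d)) (some d)).trans (insOpt (fixOpt G.rot) none)
  ty := ext2 .black .black G.ty
  deco := ext2 (G.deco d) (G.deco (G.opp d)) G.deco

theorem Cfg.bisect_face (G : Cfg n L D) (d : D) :
    (G.bisect d).face = insOpt (insOpt G.face (G.opp d)) (some d) := by
  ext1 u
  simp [Cfg.face_apply, bisect]

theorem Cfg.bisect_sameCycle_face (G : Cfg n L D) (d : D) (u w : Option (Option D)) :
    (G.bisect d).face.SameCycle u w ↔
      G.face.SameCycle (ext2 d (G.opp d) id u) (ext2 d (G.opp d) id w) := by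
  rw [G.bisect_face, sameCycle_insOpt, sameCycle_insOpt]
  rcases u with _ | _ | a <;> rcases w with _ | _ | b <;> rfl

theorem Cfg.rot_face (G : Cfg n L D) (d : D) : G.rot (G.face d) = G.opp d := by
  simp [Cfg.face_apply]

section

variable {G : Cfg n L D} (hN : ∀ a, G.opp a ≠ a) (d : D)
include hN

theorem bisect_opp_none : (G.bisect d).opp none = some (some (G.opp d)) := by
  simp [Cfg.bisect, insOpt_of_ne _ _ (hN d).symm, Cfg.rot_face, insOpt_of_ne]

theorem bisect_opp_self : (G.bisect d).opp (some (some d)) = some none := by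
  simp [Cfg.bisect]

theorem bisect_opp_opp : (G.bisect d).opp (some (some (G.opp d))) = none := by
  rw [Cfg.bisect, trans_apply, insOpt_of_ne _ _ (by simpa using hN d)]
  simp

theorem bisect_opp_of_ne {a : D} (h1 : a ≠ d) (h2 : a ≠ G.opp d) :
    (G.bisect d).opp (some (some a)) = some (some (G.opp a)) := by
  simp [Cfg.bisect, insOpt_of_ne, h1, h2, Cfg.rot_face]

theorem bisect_opp_some_none (hO : ∀ a, G.opp (G.opp a) = a) :
    (G.bisect d).opp (some none) = some (some d) := by
  simp [Cfg.bisect, insOpt_of_ne, Cfg.rot_face, hO]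

end

@[simp] theorem bisect_rot_none (G : Cfg n L D) (d : D) : (G.bisect d).rot none = some none := by
  simp [Cfg.bisect]

@[simp] theorem bisect_rot_some_none (G : Cfg n L D) (d : D) :
    (G.bisect d).rot (some none) = none := by
  simp [Cfg.bisect]

@[simp] theorem bisect_rot_some (G : Cfg n L D) (d a : D) :
    (G.bisect d).rot (some (some a)) = some (some (G.rot a)) := by
  simp [Cfg.bisect, insOpt_of_ne]

@[simp] theorem bisect_rot_symm_some (G : Cfg n L D) (d a : D) :
    (G.bisect d).rot.symm (some (some a)) = some (some (G.rot.symm a)) := by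
  rw [symm_apply_eq]; simp

theorem bisect_sameCycle_rot (G : Cfg n L D) (d : D) (u : Option (Option D)) :
    (G.bisect d).rot.SameCycle none u ↔ ∀ a, u ≠ some (some a) := by
  rw [Cfg.bisect, sameCycle_insOpt]
  change (fixOpt G.rot).SameCycle none _ ↔ _
  rw [sameCycle_fixOpt_none]
  rcases u with _ | _ | a <;> simp

variable [Fintype D] {X : Spec n K} {G : Cfg n (K ⊕ Fin N) D} {d : D}

/-- One edge and one vertex are added, and both new darts are inserted in existing cycles of the
face permutation, so `e` and `f` persist. -/
theorem IsGraph.bisect (h : IsPlain X G) (d : D) : IsRooted X (G.bisect d) none := by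
  have hN := h.opp_ne
  have hO := h.opp_opp
  have hface := G.bisect_sameCycle_face d
  have hdeco : ∀ u, (G.bisect d).deco u = G.deco (ext2 d (G.opp d) id u) := by
    rintro (_ | _ | d) <;> rfl
  refine ⟨?_, ?_, ?_, ?_, ?_, ?_, ?_, ?_, ?_, ?_, ?_, ?_, ?_, ?_⟩
  · rintro (_ | _ | a)
    · rw [bisect_opp_none hN, bisect_opp_opp hN]
    · rw [bisect_opp_some_none hN _ hO, bisect_opp_self hN]
    · by_cases h1 : a = d
      · rw [h1, bisect_opp_self hN, bisect_opp_some_none hN _ hO]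
      by_cases h2 : a = G.opp d
      · rw [h2, bisect_opp_opp hN, bisect_opp_none hN]
      rw [bisect_opp_of_ne hN _ h1 h2, bisect_opp_of_ne hN, hO]
      · exact fun h' => h2 (by rw [← h', hO])
      · exact fun h' => h1 (G.opp.injective h')
  · rintro (_ | _ | a)
    · rw [bisect_opp_none hN]; simp
    · rw [bisect_opp_some_none hN _ hO]; simp
    · by_cases h1 : a = d
      · rw [h1, bisect_opp_self hN]; simp
      by_cases h2 : a = G.opp d
      · rw [h2, bisect_opp_opp hN]; simp
      rw [bisect_opp_of_ne hN _ h1 h2]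
      simpa using hN a
  · rintro (_ | _ | a)
    · rw [bisect_rot_none]; rfl
    · rw [bisect_rot_some_none]; rfl
    · rw [bisect_rot_some]; exact h.ty_rot a
  · intro u
    rw [hdeco, hdeco]
    exact (h.deco_sameCycle ((hface _ _).1 (sameCycle_step _ u))).symm
  · intro p h1 h2
    have e1 : p none ↔ p (some none) := by rw [← h1 none, bisect_rot_none]
    have e2 : p (some (some (G.opp d))) ↔ p none := by rw [← h2 none, bisect_opp_none hN]
    have e3 : p (some (some d)) ↔ p (some none) := by
      rw [← h2 (some none), bisect_opp_some_none hN _ hO]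
    have key := h.conn (fun d => p (some (some d)))
      (fun a => by rw [← h1 (some (some a)), bisect_rot_some]) (fun a => by
        by_cases ha : a = d
        · rw [ha, e2, e1, e3]
        by_cases ha' : a = G.opp d
        · rw [ha', hO, e2, e1, e3]
        rw [← h2 (some (some a)), bisect_opp_of_ne hN _ ha ha'])
    have hred : ∀ u, p u ↔ p (some (some (ext2 d (G.opp d) id u))) := by
      rintro (_ | _ | d)
      · exact e1.trans e3.symm
      · exact e1.symm.trans e2.symm
      · rfl
    intro u u' hu
    rw [hred] at hu ⊢
    exact key _ _ hu
  · have := h.vert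
    rw [Cfg.bisect, card_orbs_insOpt, card_orbs_fixOpt]
    simp only [Fintype.card_option]
    push_cast
    linarith
  · rw [Cfg.bisect_face, card_orbs_insOpt, card_orbs_insOpt]
    exact h.fac
  · rintro (_ | _ | a) ha
    · exact absurd rfl ha
    · exact absurd rfl ha
    · rw [bisect_rot_symm_some]; exact h.white a ha
  · intro k hk
    obtain ⟨a, ha⟩ := h.white_ex k hk
    exact ⟨some (some a), ha⟩
  · rintro (_ | _ | a) (_ | _ | b) h1 h2 h3
    all_goals first
      | exact absurd rfl h1
      | exact absurd rfl h2
      | rw [h.white_unique a b h1 h2 h3]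
  · rintro (_ | _ | a) hu
    · rfl
    · rfl
    · exact absurd rfl ((bisect_sameCycle_rot G d _).1 hu a)
  · rintro (_ | _ | a) h1 h2
    · exact absurd (Perm.SameCycle.refl _ _) h2
    · exact absurd ((bisect_sameCycle_rot G d _).2 (by simp)) h2
    · rw [bisect_rot_some, bisect_rot_some]
      simpa using h.deg a h1 id
  · intro k
    obtain ⟨a, ha⟩ := h.mark_ex k
    exact ⟨some (some a), ha⟩
  · intro k u w h1 h2
    rw [hdeco] at h1 h2
    exact (hface _ _).2 (h.mark_unique k _ _ h1 h2)

theorem isPlain_of_bisect (h : IsRooted X (G.bisect d) none) (hO : ∀ a, G.opp (G.opp a) = a)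
    (hN : ∀ a, G.opp a ≠ a) : IsPlain X G := by
  have hface : ∀ a b, (G.bisect d).face.SameCycle (some (some a)) (some (some b)) ↔
      G.face.SameCycle a b := fun a b => G.bisect_sameCycle_face d _ _
  refine ⟨hO, hN, ?_, ?_, ?_, ?_, ?_, ?_, ?_, ?_, fun _ h => h.elim, ?_, ?_, ?_⟩
  · intro a
    have := h.ty_rot (some (some a))
    rwa [bisect_rot_some] at this
  · intro a
    exact h.deco_sameCycle ((hface _ _).2 (sameCycle_step _ a).symm)
  · intro p h1 h2 a b hab
    refine h.conn (ext2 (p d) (p d) p) ?_ ?_ (some (some a)) (some (some b)) hab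
    · rintro (_ | _ | a)
      · rw [bisect_rot_none]; rfl
      · rw [bisect_rot_some_none]; rfl
      · rw [bisect_rot_some]; exact h1 a
    · rintro (_ | _ | a)
      · rw [bisect_opp_none hN]; exact h2 d
      · rw [bisect_opp_some_none hN _ hO]; rfl
      · by_cases e1 : a = d
        · rw [e1, bisect_opp_self hN]; rfl
        by_cases e2 : a = G.opp d
        · rw [e2, bisect_opp_opp hN]; exact (h2 d).symm
        rw [bisect_opp_of_ne hN _ e1 e2]; exact h2 a
  · have := h.vert
    rw [Cfg.bisect, card_orbs_insOpt, card_orbs_fixOpt] at this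
    simp only [Fintype.card_option] at this
    push_cast at this
    linarith
  · have := h.fac
    rwa [Cfg.bisect_face, card_orbs_insOpt, card_orbs_insOpt] at this
  · intro a ha
    have := h.white (some (some a)) ha
    rwa [bisect_rot_symm_some] at this
  · intro k hk
    obtain ⟨u, hu1, hu2⟩ := h.white_ex k hk
    rcases u with _ | _ | a
    · exact absurd rfl hu1
    · exact absurd rfl hu1
    · exact ⟨a, hu1, hu2⟩
  · intro a b h1 h2 h3
    simpa using h.white_unique (some (some a)) (some (some b)) h1 h2 h3
  · intro a ha _
    have := h.deg (some (some a)) ha (by rw [bisect_sameCycle_rot]; simp)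
    rw [bisect_rot_some, bisect_rot_some] at this
    simpa using this
  · intro k
    obtain ⟨u, hu⟩ := h.mark_ex k
    rcases u with _ | _ | a
    · exact ⟨d, hu⟩
    · exact ⟨G.opp d, hu⟩
    · exact ⟨a, hu⟩
  · intro k a b h1 h2
    exact (hface _ _).1 (h.mark_unique k (some (some a)) (some (some b)) h1 h2)

/-- Every graph with a bivalent root vertex which is not the only one is obtained by inserting this
vertex in an edge. -/
theorem exists_bisect {G' : Cfg n (K ⊕ Fin N) (Option (Option D))} (h : IsRooted X G' none)
    (h1 : G'.rot none = some none) (h2 : G'.rot (some none) = none)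
    (h3 : G'.opp none ≠ some none) :
    ∃ (G : Cfg n (K ⊕ Fin N) D) (d : D), (∀ a, G.opp (G.opp a) = a) ∧ (∀ a, G.opp a ≠ a) ∧
      G' = G.bisect d := by
  obtain ⟨ρ, hρ⟩ := exists_insOpt G'.rot (c := none) h2
  obtain ⟨rot, hrot⟩ := exists_fixOpt ρ (by rw [hρ, insOpt_none] at h1; simpa using h1)
  subst hrot
  obtain ⟨d', hd'⟩ : ∃ d', G'.opp none = some (some d') := by
    rcases hh : G'.opp none with _ | _ | d'
    · exact absurd hh (h.opp_ne _)
    · exact absurd hh h3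
    · exact ⟨d', rfl⟩
  obtain ⟨d, hd⟩ : ∃ d, G'.opp (some none) = some (some d) := by
    rcases hh : G'.opp (some none) with _ | _ | d
    · exact absurd (by rw [← hh, h.opp_opp]) h3
    · exact absurd hh (h.opp_ne _)
    · exact ⟨d, rfl⟩
  have hdd : d' ≠ d := fun hh => by
    have := G'.opp.injective (hd'.trans ((congrArg (some ∘ some) hh).trans hd.symm))
    simp at this
  have hod : G'.opp (some (some d)) = some none := by rw [← hd, h.opp_opp]
  have hod' : G'.opp (some (some d')) = none := by rw [← hd', h.opp_opp]
  -- The two darts are removed from the face permutation rather than from the involution; the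
  -- involution of the smaller graph is then `rot ∘ face`.
  obtain ⟨φ, hφ⟩ := exists_insOpt G'.face (c := some d) (by
    rw [Cfg.face_apply, hod, hρ, symm_apply_eq]; simp)
  obtain ⟨face, hface⟩ := exists_insOpt φ (c := d') (by
    have : G'.face (some (some d')) = some none := by
      rw [Cfg.face_apply, hod', hρ]; simp
    rw [hφ, insOpt_of_ne _ _ (by simpa using hdd)] at this
    simpa using this)
  subst hface
  set G : Cfg n (K ⊕ Fin N) D := ⟨rot, face.trans rot, fun d => G'.ty (some (some d)),
    fun d => G'.deco (some (some d))⟩ with hG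
  have hGf : G.face = face := by ext a; simp [Cfg.face_apply, hG]
  have hopp : ∀ u, G'.opp u = G'.rot (G'.face u) := fun u => (G'.rot_face u).symm
  have hGd : G.opp d = d' := by
    have := hopp none
    rw [hd', hφ, hρ, insOpt_none, insOpt_of_ne _ _ hdd.symm, insOpt_of_ne _ _ (by simp)] at this
    simpa [hG] using this.symm
  have hGd' : G.opp d' = d := by
    have := hopp (some none)
    rw [hd, hφ, hρ, insOpt_of_ne _ _ (by simp), insOpt_none, insOpt_of_ne _ _ (by simp)] at this
    simpa [hG] using this.symm
  have hGa : ∀ a, a ≠ d → a ≠ d' → G'.opp (some (some a)) = some (some (G.opp a)) := by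
    intro a ha ha'
    rw [hopp, hφ, hρ, insOpt_of_ne _ _ (by simpa using ha), insOpt_of_ne _ _ ha',
      insOpt_of_ne _ _ (by simp)]
    rfl
  have hGO : ∀ a, G.opp (G.opp a) = a := by
    intro a
    by_cases ha : a = d
    · rw [ha, hGd, hGd']
    by_cases ha' : a = d'
    · rw [ha', hGd', hGd]
    have h5 := h.opp_opp (some (some a))
    rw [hGa a ha ha', hGa] at h5
    · simpa using h5
    · exact fun hh => ha' (G.opp.injective (hh.trans hGd'.symm))
    · exact fun hh => ha (G.opp.injective (hh.trans hGd.symm))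
  have hGN : ∀ a, G.opp a ≠ a := by
    intro a
    by_cases ha : a = d
    · rw [ha, hGd]; exact hdd
    by_cases ha' : a = d'
    · rw [ha', hGd']; exact hdd.symm
    intro hh
    exact h.opp_ne (some (some a)) (by rw [hGa a ha ha', hh])
  refine ⟨G, d, hGO, hGN, ?_⟩
  apply Cfg.ext
  · rw [hρ]; rfl
  · ext1 u
    rw [hopp, Cfg.bisect, hφ, hρ, hGd, hGf]
    rfl
  · funext u
    rcases u with _ | _ | a
    · exact h.special _ (Perm.SameCycle.refl _ _)
    · exact h.special _ (h1 ▸ sameCycle_step G'.rot none)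
    · rfl
  · funext u
    rcases u with _ | _ | a
    · have e := h.deco_face (some (some d))
      rw [hφ, insOpt_self] at e
      exact e
    · have e := h.deco_face (some (some d'))
      rw [hφ, insOpt_of_ne _ _ (by simpa using hdd), insOpt_self, ← hGd] at e
      exact e
    · rfl

theorem bisect_injective {G₁ G₂ : Cfg n L D} {d₁ d₂ : D}
    (hN₁ : ∀ a, G₁.opp a ≠ a) (hN₂ : ∀ a, G₂.opp a ≠ a)
    (h : G₁.bisect d₁ = G₂.bisect d₂) : G₁ = G₂ ∧ d₁ = d₂ := by
  have hr : G₁.rot = G₂.rot := fixOpt_injective (insOpt_injective _ (congrArg Cfg.rot h))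
  have hf := congrArg Cfg.face h
  rw [Cfg.bisect_face, Cfg.bisect_face] at hf
  have hd : d₁ = d₂ := by
    have := congrArg (fun σ : Perm (Option (Option D)) => σ.symm none) hf
    simpa using this
  subst hd
  have hd' : G₁.opp d₁ = G₂.opp d₁ := by
    have := congrArg (fun G => G.opp none) h
    simp only [bisect_opp_none hN₁, bisect_opp_none hN₂] at this
    simpa using this
  have hf' := insOpt_injective _ hf
  simp only [hd'] at hf'
  have hf'' := insOpt_injective _ hf'
  refine ⟨Cfg.ext hr ?_ ?_ ?_, rfl⟩
  · ext a
    rw [← Cfg.rot_face, ← Cfg.rot_face, hr, hf'']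
  · funext a
    exact congrFun (congrArg Cfg.ty h) (some (some a))
  · funext a
    exact congrFun (congrArg Cfg.deco h) (some (some a))

end Bisect

/-! ### Weighted sums over labelled graphs -/

section Sums

theorem sum_pif_bij {α β : Type*} [Fintype α] [Fintype β] {P : α → Prop} {Q : β → Prop}
    {f : α → ℂ} {g : β → ℂ} (i : β → α) (hi : ∀ b, Q b → P (i b))
    (hinj : ∀ b b', Q b → Q b' → i b = i b' → b = b') (hsurj : ∀ a, P a → ∃ b, Q b ∧ i b = a)
    (hfg : ∀ b, Q b → f (i b) = g b) :
    ∑ a, pif (P a) (f a) 0 = ∑ b, pif (Q b) (g b) 0 := by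
  classical
  unfold pif
  rw [← Finset.sum_filter, ← Finset.sum_filter]
  symm
  refine Finset.sum_bij (fun b _ => i b) ?_ ?_ ?_ ?_
  · intro b hb; simpa using hi b (by simpa using hb)
  · intro b hb b' hb' h; exact hinj b b' (by simpa using hb) (by simpa using hb') h
  · intro a ha
    obtain ⟨b, hb, rfl⟩ := hsurj a (by simpa using ha)
    exact ⟨b, by simpa using hb, rfl⟩
  · intro b hb; exact (hfg b (by simpa using hb)).symm

theorem sum_pif_unique {α : Type*} [Fintype α] {P : α → Prop} (f : α → ℂ) (a : α)
    (h : ∀ b, P b ↔ b = a) : ∑ b, pif (P b) (f b) 0 = f a := by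
  classical
  unfold pif
  simp [h]

theorem pif_congr {p q : Prop} (h : p ↔ q) {a a' : ℂ} (h' : p → a = a') :
    pif p a 0 = pif q a' 0 := by
  by_cases hp : p
  · rw [pif_pos hp, pif_pos (h.1 hp), h' hp]
  · rw [pif_neg hp, pif_neg (fun hq => hp (h.2 hq))]

variable (r : ℕ) (v : ℕ → ℂ) {n N : ℕ} {K D E : Type} [Fintype K] [Fintype D] [Fintype E]

/-- The weight of a graph with given values of the decorations. -/
def wt {L : Type} (val : L → ℂ) (G : Cfg n L D) : ℂ :=
  eprod r v G.opp (val ∘ G.deco) * vprod r v G.rot G.ty (val ∘ G.deco)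

/-- The weight of a rooted graph with given values of the decorations, where the root vertex has
the weight given by `φ`. -/
def rwt {L : Type} (val : L → ℂ) (φ : Multiset ℂ → ℂ) (G : Cfg n L D) (c : D) : ℂ :=
  eprod r v G.opp (val ∘ G.deco) * rprod r v G.rot G.ty (val ∘ G.deco) c φ

variable (D) in
/-- The weighted sum over graphs labelled by `D`. -/
def plainSum (X : Spec n K) (val : K ⊕ Fin N → ℂ) : ℂ :=
  ∑ G : Cfg n (K ⊕ Fin N) D, pif (IsPlain X G) (wt r v val G) 0

variable (D) in
/-- The weighted sum over graphs labelled by `D` with a root in the face marked by `k₀`. -/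
def rootSum (X : Spec n K) (val : K ⊕ Fin N → ℂ) (k₀ : K) (φ : Multiset ℂ → ℂ) : ℂ :=
  ∑ p : Cfg n (K ⊕ Fin N) D × D, pif (IsRooted X p.1 p.2 ∧ p.1.deco p.2 = .inl k₀)
    (rwt r v val φ p.1 p.2) 0

/-- The dart `i` is the dart of the white vertex of the ciliated face `k₀`, and `j` is the opposite
dart, at a root vertex. -/
def IsCilRooted (X : Spec n K) (k₀ : K) (G : Cfg n (K ⊕ Fin N) D) (i j : D) : Prop :=
  IsRooted (X.addCil k₀) G j ∧ G.ty i ≠ .black ∧ G.deco i = .inl k₀ ∧ G.opp i = j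

variable (D) in
/-- The weighted sum over graphs labelled by `D`, the root being joined to the univalent vertex
of the ciliated face `k₀`. -/
def cilSum (X : Spec n K) (val : K ⊕ Fin N → ℂ) (k₀ : K) (φ : Multiset ℂ → ℂ) : ℂ :=
  ∑ G : Cfg n (K ⊕ Fin N) D, ∑ i, ∑ j, pif (IsCilRooted X k₀ G i j) (rwt r v val φ G j) 0

variable {r v}

theorem map_ty_comp {L : Type} (e : D ≃ E) (G : Cfg n L D) : (G.map e).ty ∘ e = G.ty := by
  funext d; simp

theorem map_deco_comp {L : Type} (e : D ≃ E) (G : Cfg n L D) : (G.map e).deco ∘ e = G.deco := by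
  funext d; simp

theorem wt_map {L : Type} (e : D ≃ E) (val : L → ℂ) (G : Cfg n L D) :
    wt r v val (G.map e) = wt r v val G := by
  unfold wt
  rw [Cfg.map_opp, Cfg.map_rot, eprod_permCongr, vprod_permCongr, Function.comp_assoc, map_ty_comp,
    map_deco_comp]

theorem rwt_map {L : Type} (e : D ≃ E) (val : L → ℂ) (φ : Multiset ℂ → ℂ) (G : Cfg n L D) (c : D) :
    rwt r v val φ (G.map e) (e c) = rwt r v val φ G c := by
  unfold rwt
  rw [Cfg.map_opp, Cfg.map_rot, eprod_permCongr, rprod_permCongr, Function.comp_assoc, map_ty_comp,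
    map_deco_comp]

theorem plainSum_congr (e : D ≃ E) (X : Spec n K) (val : K ⊕ Fin N → ℂ) :
    plainSum r v D X val = plainSum r v E X val := by
  unfold plainSum
  rw [sum_map e]
  exact Finset.sum_congr rfl fun G _ => pif_congr (isPlain_map_iff e).symm
    fun _ => (wt_map e val G).symm

theorem isCilRooted_map_iff {X : Spec n K} {k₀ : K} {G : Cfg n (K ⊕ Fin N) D} (e : D ≃ E) (i j : D) :
    IsCilRooted X k₀ (G.map e) (e i) (e j) ↔ IsCilRooted X k₀ G i j := by
  unfold IsCilRooted
  rw [isRooted_map_iff]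
  simp

theorem cilSum_congr (e : D ≃ E) (X : Spec n K) (val : K ⊕ Fin N → ℂ) (k₀ : K)
    (φ : Multiset ℂ → ℂ) : cilSum r v D X val k₀ φ = cilSum r v E X val k₀ φ := by
  unfold cilSum
  rw [sum_map e]
  refine Finset.sum_congr rfl fun G _ => ?_
  rw [← e.sum_comp]
  refine Finset.sum_congr rfl fun i _ => ?_
  rw [← e.sum_comp]
  exact Finset.sum_congr rfl fun j _ => pif_congr (isCilRooted_map_iff e i j).symm
    fun _ => (rwt_map e val φ G j).symm

theorem rootSum_congr (e : D ≃ E) (X : Spec n K) (val : K ⊕ Fin N → ℂ) (k₀ : K)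
    (φ : Multiset ℂ → ℂ) : rootSum r v D X val k₀ φ = rootSum r v E X val k₀ φ := by
  unfold rootSum
  rw [Fintype.sum_prod_type, Fintype.sum_prod_type, sum_map e]
  refine Finset.sum_congr rfl fun G _ => ?_
  rw [← e.sum_comp]
  refine Finset.sum_congr rfl fun c _ => pif_congr ?_ fun _ => (rwt_map e val φ G c).symm
  dsimp only
  rw [isRooted_map_iff]
  simp

theorem rootSum_add (X : Spec n K) (val : K ⊕ Fin N → ℂ) (k₀ : K) (φ ψ : Multiset ℂ → ℂ) :
    rootSum r v D X val k₀ (fun s => φ s + ψ s) =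
      rootSum r v D X val k₀ φ + rootSum r v D X val k₀ ψ := by
  unfold rootSum rwt pif
  rw [← Finset.sum_add_distrib]
  refine Finset.sum_congr rfl fun p _ => ?_
  rw [rprod_add]
  split_ifs <;> ring

theorem rootSum_congr_fun (X : Spec n K) (val : K ⊕ Fin N → ℂ) (k₀ : K) {φ ψ : Multiset ℂ → ℂ}
    (h : ∀ s, s ≠ 0 → φ s = ψ s) :
    rootSum r v D X val k₀ φ = rootSum r v D X val k₀ ψ := by
  unfold rootSum rwt
  refine Finset.sum_congr rfl fun p _ => ?_
  rw [rprod_congr]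
  refine h _ fun h0 => ?_
  have := card_orb_pos p.1.rot p.2
  have h0' := congrArg Multiset.card h0
  rw [Multiset.card_map, Finset.card_val, Multiset.card_zero] at h0'
  omega

/-- All that distinguishes a root from another black vertex is the missing lower bound on its
degree. -/
theorem isPlain_iff {X : Spec n K} {G : Cfg n (K ⊕ Fin N) D} {c : D} :
    IsRooted X G c ∧ 3 ≤ (orb G.rot c).card ↔ IsPlain X G ∧ G.ty c = .black := by
  rw [three_le_card_orb_iff]
  constructor
  · rintro ⟨h, h3⟩
    have hc : G.ty c = .black := h.special c (Perm.SameCycle.refl _ _)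
    refine ⟨{ h with special := fun _ h => h.elim, deg := fun d hd _ => ?_ }, hc⟩
    by_cases hs : G.rot.SameCycle c d
    · rw [← three_le_card_orb_iff, ← orb_eq_orb.2 hs, three_le_card_orb_iff]
      exact h3
    · exact h.deg d hd hs
  · rintro ⟨h, hc⟩
    refine ⟨{ h with special := fun d hd => ?_, deg := fun d hd _ => h.deg d hd id }, h.deg c hc id⟩
    rw [← h.ty_sameCycle hd, hc]

/-- The next corner clockwise at this white vertex has the label `next k₀ = k₀`, and distinct
corners of white vertices have distinct labels; so the vertex is univalent. -/
theorem rot_eq_of_cil {X : Spec n K} {S : D → Prop} {k₀ : K} (hX' : X.next k₀ = k₀)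
    {G : Cfg n (K ⊕ Fin N) D} (h : IsGraph X S G) {i : D}
    (h1 : G.ty i ≠ .black) (h2 : G.deco i = .inl k₀) : G.rot i = i := by
  obtain ⟨k, -, hk2, hk3, hk4⟩ := h.white i h1
  obtain rfl : k₀ = k := Sum.inl_injective (h2.symm.trans hk2)
  have hs : G.rot.symm i = i := by
    refine h.white_unique _ _ ?_ h1 ?_
    · rw [← h.ty_rot]; simpa using h1
    · rw [hk3, h2, hX']
  exact ((symm_apply_eq _).1 hs).symm

/-- A plain graph with a ciliated face, as a graph with two distinguished darts. -/
theorem plainSum_eq_cilSum (X : Spec n K) (val : K ⊕ Fin N → ℂ) (k₀ : K) (hX' : X.next k₀ = k₀) :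
    plainSum r v D (X.addCil k₀) val =
      cilSum r v D X val k₀ (fun s => pif (3 ≤ Multiset.card s) (vw r v s) 0) := by
  unfold plainSum cilSum
  refine Finset.sum_congr rfl fun G _ => ?_
  by_cases h : IsPlain (X.addCil k₀) G
  · obtain ⟨i, hi1, hi2⟩ := h.white_ex k₀ (Or.inr rfl)
    have hri := rot_eq_of_cil (X := X.addCil k₀) hX' h hi1 hi2
    -- Both sides of the edge of a univalent vertex lie in the same face, so a white dart at its
    -- other end would have the same label as `i`.
    have hj : G.ty (G.opp i) = .black := by
      by_contra hj
      have := h.white_unique _ _ hj hi1 (by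
        rw [← h.deco_face (G.opp i), Cfg.face_apply, h.opp_opp, (symm_apply_eq _).2 hri.symm])
      exact h.opp_ne i this
    obtain ⟨h1, h2⟩ := isPlain_iff.2 ⟨h, hj⟩
    rw [pif_pos h, Finset.sum_eq_single i, Finset.sum_eq_single (G.opp i), pif_pos
      ⟨h1, hi1, hi2, rfl⟩]
    · unfold wt rwt
      rw [← rprod_vw _ _ _ _ h1.special]
      congr 1
      refine rprod_congr _ _ _ _ ?_
      rw [pif_pos (by simpa using h2)]
    · exact fun j _ hj' => pif_neg (fun h' => hj' h'.2.2.2.symm) _ _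
    · simp
    · intro i' _ hi'
      refine Finset.sum_eq_zero fun j _ => pif_neg (fun h' => hi' ?_) _ _
      exact h.white_unique _ _ h'.2.1 hi1 (h'.2.2.1.trans hi2.symm)
    · simp
  · rw [pif_neg h]
    symm
    refine Finset.sum_eq_zero fun i _ => Finset.sum_eq_zero fun j _ => ?_
    by_cases h1 : IsCilRooted X k₀ G i j
    · rw [pif_pos h1, rwt, rprod_eq, pif_neg, zero_mul, mul_zero]
      intro h3
      exact h (isPlain_iff.1 ⟨h1.1, by simpa using h3⟩).1
    · rw [pif_neg h1]

theorem rwt_attach {L : Type} (val : L → ℂ) (φ : Multiset ℂ → ℂ) (G : Cfg n L D) (c : D)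
    (i : Fin n) : rwt r v val φ (G.attach c i) (some none) =
      propagator r v (val (G.deco c)) (val (G.deco c)) *
        rwt r v val (fun s => φ (val (G.deco c) ::ₘ s)) G c := by
  unfold rwt
  rw [Cfg.attach, eprod_pair, rprod_fixOpt _ _ _ _ _ (by simp), rprod_insOpt, mul_assoc]
  rfl

theorem cilSum_pointed (X : Spec n K) (val : K ⊕ Fin N → ℂ) (k₀ : K) (φ : Multiset ℂ → ℂ) :
    cilSum r v (Option (Option D)) X val k₀ φ =
      ((Fintype.card D + 2 : ℂ) * (Fintype.card D + 1)) *
        ∑ G : Cfg n (K ⊕ Fin N) (Option (Option D)), pif (IsCilRooted X k₀ G none (some none))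
          (rwt r v val φ G (some none)) 0 := by
  rw [← sum_pointed (fun G i j => pif (IsCilRooted X k₀ G i j) (rwt r v val φ G j) 0)]
  · unfold cilSum
    refine Finset.sum_congr rfl fun G _ => Finset.sum_congr rfl fun i _ =>
      Finset.sum_congr rfl fun j _ => ?_
    split_ifs with h
    · rfl
    · refine pif_neg (fun h' => h fun hij => ?_) _ _
      exact h'.1.opp_ne i (h'.2.2.2.trans hij.symm)
  · intro τ G i j
    exact pif_congr (isCilRooted_map_iff τ i j) fun _ => rwt_map τ val φ G j

/-- By connectedness the two added darts do not form a component by themselves when there are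
others. Graphs with two darts escape this argument and are treated separately. -/
theorem IsGraph.not_closed {X : Spec n K} {S : Option (Option D) → Prop}
    {G : Cfg n (K ⊕ Fin N) (Option (Option D))} (h : IsGraph X S G) [Nonempty D]
    (h1 : ∀ u, (∀ a, G.rot u ≠ some (some a)) ↔ ∀ a, u ≠ some (some a))
    (h2 : ∀ u, (∀ a, G.opp u ≠ some (some a)) ↔ ∀ a, u ≠ some (some a)) : False := by
  obtain ⟨a⟩ := ‹Nonempty D›
  exact h.conn (fun u => ∀ a, u ≠ some (some a)) h1 h2 none (some (some a)) (by simp) a rfl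

theorem perm_closed {σ : Perm (Option (Option D))} (h1 : ∀ a, σ none ≠ some (some a))
    (h2 : ∀ a, σ (some none) ≠ some (some a)) (u : Option (Option D)) :
    (∀ a, σ u ≠ some (some a)) ↔ ∀ a, u ≠ some (some a) := by
  rcases u with _ | _ | d
  · simpa using h1
  · simpa using h2
  · refine ⟨fun h => ?_, fun h => absurd rfl (h d)⟩
    -- Otherwise three distinct darts would be mapped into a set of two.
    exfalso
    have key : ∀ w : Option (Option D), (∀ a, w ≠ some (some a)) → w = none ∨ w = some none := by
      rintro (_ | _ | a) hw
      · simp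
      · simp
      · exact absurd rfl (hw a)
    have n1 : σ none ≠ σ (some none) := fun e => by simpa using σ.injective e
    have n2 : σ none ≠ σ (some (some d)) := fun e => by simpa using σ.injective e
    have n3 : σ (some none) ≠ σ (some (some d)) := fun e => by simpa using σ.injective e
    rcases key _ h1 with e1 | e1 <;> rcases key _ h2 with e2 | e2 <;> rcases key _ h with e3 | e3 <;>
      rw [e1, e2] at n1 <;> rw [e1, e3] at n2 <;> rw [e2, e3] at n3 <;>
      first | exact n1 rfl | exact n2 rfl | exact n3 rfl

/-- The two darts of the cilium are moved to the standard position and removed. The removed edge had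
the propagator `P(z, z)`, and the root loses a corner decorated by `z`. -/
theorem cilSum_eq_rootSum (X : Spec n K) (val : K ⊕ Fin N → ℂ) (k₀ : K) (φ : Multiset ℂ → ℂ)
    (hX : ¬ X.cil k₀) (hX' : X.next k₀ = k₀) [Nonempty D] :
    cilSum r v (Option (Option D)) X val k₀ φ =
      ((Fintype.card D + 2 : ℂ) * (Fintype.card D + 1)) *
        (propagator r v (val (.inl k₀)) (val (.inl k₀)) *
          rootSum r v D X val k₀ (fun s => φ (val (.inl k₀) ::ₘ s))) := by
  rw [cilSum_pointed, rootSum]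
  congr 1
  rw [Finset.mul_sum]
  rw [sum_pif_bij (β := Cfg n (K ⊕ Fin N) D × D)
    (Q := fun p => IsRooted X p.1 p.2 ∧ p.1.deco p.2 = .inl k₀)
    (g := fun p => propagator r v (val (.inl k₀)) (val (.inl k₀)) *
      rwt r v val (fun s => φ (val (.inl k₀) ::ₘ s)) p.1 p.2)
    (fun p => p.1.attach p.2 (X.tp k₀))]
  · refine Finset.sum_congr rfl fun p _ => ?_
    unfold pif; split_ifs <;> simp
  · rintro ⟨G, c⟩ ⟨h1, h2⟩
    exact ⟨h1.attach hX hX' h2, by simp [Cfg.attach], by simpa [Cfg.attach] using h2,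
      by simp [Cfg.attach]⟩
  · rintro ⟨G, c⟩ ⟨G₂, c₂⟩ - - h
    obtain ⟨rfl, rfl⟩ := attach_injective h
    rfl
  · rintro G' ⟨h1, h2, h3, h4⟩
    obtain ⟨G, c, hc, rfl⟩ := exists_attach h1 hX' h2 h3 h4 (fun h5 => by
      refine h1.not_closed (perm_closed ?_ ?_) (perm_closed ?_ ?_)
      · rw [rot_eq_of_cil (X := X.addCil k₀) hX' h1 h2 h3]; simp
      · rw [h5]; simp
      · rw [h4]; simp
      · rw [← h4, h1.opp_opp]; simp)
    exact ⟨(G, c), ⟨isRooted_of_attach hX hc h1, hc⟩, rfl⟩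
  · rintro ⟨G, c⟩ ⟨-, h2⟩
    rw [rwt_attach]
    simp only at h2
    rw [h2]

end Sums

section RootedSums

variable {r : ℕ} {v : ℕ → ℂ} {n N : ℕ} {K D E : Type} [Fintype K] [Fintype D] [Fintype E]

/-! Exceptional graphs with a single edge. -/

theorem perm_unique_of_swap {σ τ : Perm (Option (Option D))} [IsEmpty D]
    (h : σ none = τ none) : σ = τ := by
  have hcov : ∀ u : Option (Option D), u = none ∨ u = some none := by
    rintro (_ | _ | a)
    · simp
    · simp
    · exact isEmptyElim a
  ext1 u
  rcases hcov u with rfl | rfl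
  · exact h
  · have h1 : σ (some none) ≠ σ none := fun e => by simpa using σ.injective e
    have h2 : τ (some none) ≠ τ none := fun e => by simpa using τ.injective e
    rcases hcov (σ (some none)) with e1 | e1 <;> rcases hcov (τ (some none)) with e2 | e2 <;>
      rcases hcov (τ none) with e3 | e3 <;> simp_all

/-- The graph with a single edge joining a univalent white vertex to a univalent vertex. -/
def segment {L : Type} (i : Fin n) (ℓ : L) : Cfg n L (Option (Option (Fin 0))) where
  rot := fixOpt (fixOpt 1)
  opp := insOpt (fixOpt 1) none
  ty := ext2 (.white i) .black (fun a => a.elim0)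
  deco := ext2 ℓ ℓ (fun a => a.elim0)

theorem segment_face {L : Type} (i : Fin n) (ℓ : L) :
    (segment i ℓ).face = insOpt (fixOpt 1) none := by
  apply perm_unique_of_swap
  simp [Cfg.face_apply, segment]

/-- With two darts only, the cilium uses up the root: the graph is a segment on the sphere, with two
vertices, one edge and one face, which carries the only mark. -/
theorem isCilRooted_segment (X : Spec n K) (k₀ : K) (hX' : X.next k₀ = k₀)
    (G : Cfg n (K ⊕ Fin N) (Option (Option (Fin 0)))) :
    IsCilRooted X k₀ G none (some none) ↔
      G = segment (X.tp k₀) (.inl k₀) ∧ X.e = -1 ∧ X.f = 1 ∧ ∀ k, k = k₀ := by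
  constructor
  · rintro ⟨h, h1, h2, h3⟩
    have hr := rot_eq_of_cil (X := X.addCil k₀) hX' h h1 h2
    have e1 : G.rot = fixOpt (fixOpt 1) := perm_unique_of_swap (by rw [hr]; simp)
    have e2 : G.opp = insOpt (fixOpt 1) none := perm_unique_of_swap (by rw [h3]; simp)
    have hG : G = segment (X.tp k₀) (.inl k₀) := by
      apply Cfg.ext
      · rw [e1]; rfl
      · rw [e2]; rfl
      · funext u
        rcases u with _ | _ | a
        · obtain ⟨k, -, hk2, -, hk4⟩ := h.white none h1
          obtain rfl : k₀ = k := Sum.inl_injective (h2.symm.trans hk2)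
          exact hk4
        · exact h.special _ (Perm.SameCycle.refl _ _)
        · exact a.elim0
      · funext u
        rcases u with _ | _ | a
        · exact h2
        · have := h.deco_face (some none)
          rw [Cfg.face_apply, ← h3, h.opp_opp, h3, (symm_apply_eq _).2 hr.symm] at this
          rw [← this, h2]; rfl
        · exact a.elim0
    refine ⟨hG, ?_, ?_, ?_⟩
    · have := h.vert
      rw [e1, card_orbs_fixOpt, card_orbs_fixOpt] at this
      have h0 : (orbs (1 : Perm (Fin 0))).card = 0 := rfl
      rw [h0] at this
      simp [Spec.addCil] at this
      linarith
    · have := h.fac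
      rw [hG, segment_face, card_orbs_insOpt, card_orbs_fixOpt] at this
      have h0 : (orbs (1 : Perm (Fin 0))).card = 0 := rfl
      rw [h0] at this
      simp [Spec.addCil] at this
      exact this.symm
    · intro k
      obtain ⟨u, hu⟩ := h.mark_ex k
      rw [hG] at hu
      rcases u with _ | _ | a
      · exact (Sum.inl_injective hu).symm
      · exact (Sum.inl_injective hu).symm
      · exact a.elim0
  · rintro ⟨rfl, he, hf, hK⟩
    have hdeco : ∀ u, (segment (X.tp k₀) (.inl k₀) :
        Cfg n (K ⊕ Fin N) (Option (Option (Fin 0)))).deco u = .inl k₀ := by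
      rintro (_ | _ | a)
      · rfl
      · rfl
      · exact a.elim0
    refine ⟨⟨?_, ?_, ?_, ?_, ?_, ?_, ?_, ?_, ?_, ?_, ?_, ?_, ?_, ?_⟩, by simp [segment], rfl,
      by simp [segment]⟩
    · rintro (_ | _ | a)
      · simp [segment]
      · simp [segment]
      · exact a.elim0
    · rintro (_ | _ | a)
      · simp [segment]
      · simp [segment]
      · exact a.elim0
    · rintro (_ | _ | a)
      · simp [segment]
      · simp [segment]
      · exact a.elim0
    · intro u; rw [hdeco, hdeco]
    · intro p _ h2
      have : p none ↔ p (some none) := by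
        rw [← h2 none]; simp [segment]
      rintro (_ | _ | a) (_ | _ | b)
      all_goals first
        | exact a.elim0
        | exact b.elim0
        | tauto
    · change ((Fintype.card (Option (Option (Fin 0))) : ℕ) : ℤ) =
        2 * (((orbs (fixOpt (fixOpt (1 : Perm (Fin 0))))).card : ℕ) + X.e)
      rw [card_orbs_fixOpt, card_orbs_fixOpt, he]; simp
      rfl
    · rw [segment_face, card_orbs_insOpt, card_orbs_fixOpt]
      change _ = X.f
      rw [hf]; rfl
    · rintro (_ | _ | a) ha
      · exact ⟨k₀, Or.inr rfl, rfl, by rw [hdeco]; simp [Spec.addCil, hX'], rfl⟩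
      · exact absurd rfl ha
      · exact a.elim0
    · intro k _
      exact ⟨none, by simp [segment], by rw [hdeco, hK k]⟩
    · rintro (_ | _ | a) (_ | _ | b) h1 h2 -
      all_goals first
        | rfl
        | exact a.elim0
        | exact b.elim0
        | exact absurd rfl h1
        | exact absurd rfl h2
    · rintro (_ | _ | a) ha
      · exact absurd ha (sameCycle_fixOpt_some_none _)
      · rfl
      · exact a.elim0
    · rintro (_ | _ | a) h1 h2
      · simp [segment] at h1
      · exact absurd (Perm.SameCycle.refl _ _) h2
      · exact a.elim0
    · intro k
      exact ⟨none, by rw [hdeco, hK k]⟩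
    · intro k u w _ _
      rw [segment_face, sameCycle_insOpt]
      rcases u with _ | _ | a <;> rcases w with _ | _ | b
      all_goals first
        | exact a.elim0
        | exact b.elim0
        | exact Perm.SameCycle.refl _ _

theorem cilSum_segment (X : Spec n K) (val : K ⊕ Fin N → ℂ) (k₀ : K) (φ : Multiset ℂ → ℂ)
    (hX' : X.next k₀ = k₀) :
    cilSum r v (Option (Option (Fin 0))) X val k₀ φ =
      2 * pif (X.e = -1 ∧ X.f = 1 ∧ ∀ k, k = k₀)
        (propagator r v (val (.inl k₀)) (val (.inl k₀)) * φ {val (.inl k₀)}) 0 := by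
  rw [cilSum_pointed]
  congr 1
  · simp
  simp only [isCilRooted_segment X k₀ hX']
  by_cases h : X.e = -1 ∧ X.f = 1 ∧ ∀ k, k = k₀
  · rw [pif_pos h]
    simp only [h]
    rw [sum_pif_unique _ (segment (X.tp k₀) (.inl k₀))]
    · unfold rwt
      rw [segment, eprod_pair]
      have h0 : eprod r v (1 : Perm (Fin 0)) = fun _ => 1 := by
        funext l; rfl
      rw [h0, mul_one]
      congr 1
      unfold rprod
      rw [prod_orbs_fixOpt, prod_orbs_fixOpt]
      have h1 : orbs (1 : Perm (Fin 0)) = ∅ := rfl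
      rw [h1, Finset.prod_empty]
      simp [pif]
    · simp
  · rw [pif_neg h]
    exact Finset.sum_eq_zero fun G _ => pif_neg (fun h' => h h'.2) _ _

/-- The graph with a single vertex, which is bivalent, and a single edge. -/
def loop {L : Type} (ℓ ℓ' : L) : Cfg n L (Option (Option (Fin 0))) where
  rot := insOpt (fixOpt 1) none
  opp := insOpt (fixOpt 1) none
  ty := ext2 .black .black (fun a => a.elim0)
  deco := ext2 ℓ ℓ' (fun a => a.elim0)

theorem loop_face {L : Type} (ℓ ℓ' : L) :
    (loop ℓ ℓ' : Cfg n L (Option (Option (Fin 0)))).face = fixOpt (fixOpt 1) := by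
  apply perm_unique_of_swap
  rw [Cfg.face_apply, symm_apply_eq]
  simp [loop]

/-- With two darts only, a bivalent root carries a loop, which cuts the sphere in two faces; every
mark is the label of one of them. Erasing the vertex leaves no graph, so this case is not an
instance of `exists_bisect`. -/
theorem isRooted_loop (X : Spec n K) (k₀ : K)
    (G : Cfg n (K ⊕ Fin N) (Option (Option (Fin 0)))) :
    (IsRooted X G none ∧ G.rot none = some none ∧ G.rot (some none) = none ∧
      G.deco none = .inl k₀) ↔
      ∃ ℓ, G = loop (.inl k₀) ℓ ∧ X.e = 0 ∧ X.f = 2 ∧ (∀ k, ¬ X.cil k) ∧ ℓ ≠ .inl k₀ ∧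
        ∀ k, k = k₀ ∨ ℓ = .inl k := by
  constructor
  · rintro ⟨h, h1, h2, h3⟩
    have hb : ∀ u, G.ty u = .black := by
      rintro (_ | _ | a)
      · exact h.special _ (Perm.SameCycle.refl _ _)
      · exact h.special _ (h1 ▸ sameCycle_step _ _)
      · exact a.elim0
    have h4 : G.opp none = some none := by
      rcases hh : G.opp none with _ | _ | a
      · exact absurd hh (h.opp_ne _)
      · rfl
      · exact a.elim0
    have e1 : G.rot = insOpt (fixOpt 1) none := perm_unique_of_swap (by rw [h1]; simp)
    have e2 : G.opp = insOpt (fixOpt 1) none := perm_unique_of_swap (by rw [h4]; simp)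
    have hG : G = loop (.inl k₀) (G.deco (some none)) := by
      apply Cfg.ext
      · rw [e1]; rfl
      · rw [e2]; rfl
      · funext u
        rw [hb]
        rcases u with _ | _ | a
        · rfl
        · rfl
        · exact a.elim0
      · funext u
        rcases u with _ | _ | a
        · exact h3
        · rfl
        · exact a.elim0
    have h0 : (orbs (1 : Perm (Fin 0))).card = 0 := rfl
    have hf := loop_face (n := n) (.inl k₀) (G.deco (some none))
    rw [← hG] at hf
    refine ⟨G.deco (some none), hG, ?_, ?_, ?_, ?_, ?_⟩
    · have := h.vert
      rw [e1, card_orbs_insOpt, card_orbs_fixOpt, h0] at this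
      simp at this
      linarith
    · have := h.fac
      rw [hf, card_orbs_fixOpt, card_orbs_fixOpt, h0] at this
      simp at this
      exact this.symm
    · intro k hk
      obtain ⟨u, hu, -⟩ := h.white_ex k hk
      exact hu (hb u)
    · intro hk
      have := h.mark_unique k₀ none (some none) h3 hk
      rw [hf, sameCycle_fixOpt_none] at this
      simp at this
    · intro k
      obtain ⟨u, hu⟩ := h.mark_ex k
      rcases u with _ | _ | a
      · exact Or.inl (Sum.inl_injective (hu.symm.trans h3))
      · exact Or.inr hu
      · exact a.elim0
  · rintro ⟨ℓ, rfl, he, hf, hcil, hne, hK⟩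
    have hb : ∀ u, (loop (.inl k₀) ℓ : Cfg n (K ⊕ Fin N) (Option (Option (Fin 0)))).ty u =
        .black := by
      rintro (_ | _ | a)
      · rfl
      · rfl
      · exact a.elim0
    have hface : ∀ u, (loop (.inl k₀) ℓ : Cfg n (K ⊕ Fin N) (Option (Option (Fin 0)))).face u
        = u := by
      rintro (_ | _ | a)
      · rw [loop_face]; rfl
      · rw [loop_face]; rfl
      · exact a.elim0
    refine ⟨⟨?_, ?_, ?_, ?_, ?_, ?_, ?_, ?_, ?_, ?_, ?_, ?_, ?_, ?_⟩, by simp [loop],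
      by simp [loop], rfl⟩
    · rintro (_ | _ | a)
      · simp [loop]
      · simp [loop]
      · exact a.elim0
    · rintro (_ | _ | a)
      · simp [loop]
      · simp [loop]
      · exact a.elim0
    · intro u; rw [hb, hb]
    · intro u; rw [hface]
    · intro p _ h2
      have : p none ↔ p (some none) := by
        rw [← h2 none]; simp [loop]
      rintro (_ | _ | a) (_ | _ | b)
      all_goals first
        | exact a.elim0
        | exact b.elim0
        | tauto
    · change ((Fintype.card (Option (Option (Fin 0))) : ℕ) : ℤ) =
        2 * (((orbs (insOpt (fixOpt (1 : Perm (Fin 0))) none)).card : ℕ) + X.e)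
      rw [card_orbs_insOpt, card_orbs_fixOpt, he]; simp
      rfl
    · rw [loop_face, card_orbs_fixOpt, card_orbs_fixOpt, hf]; rfl
    · intro u hu; exact absurd (hb u) hu
    · intro k hk; exact absurd hk (hcil k)
    · intro u w hu; exact absurd (hb u) hu
    · intro u _; exact hb u
    · rintro (_ | _ | a) h1 h2
      · exact absurd (Perm.SameCycle.refl _ _) h2
      · exact absurd (by rw [loop, sameCycle_insOpt]; exact Perm.SameCycle.refl _ _) h2
      · exact a.elim0
    · intro k
      rcases hK k with rfl | h
      · exact ⟨none, rfl⟩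
      · exact ⟨some none, h⟩
    · intro k u w h1 h2
      rcases u with _ | _ | a <;> rcases w with _ | _ | b
      all_goals first
        | exact a.elim0
        | exact b.elim0
        | exact Perm.SameCycle.refl _ _
        | skip
      · exact absurd ((show ℓ = .inl k from h2).trans
          (show (.inl k₀ : K ⊕ Fin N) = .inl k from h1).symm) hne
      · exact absurd ((show ℓ = .inl k from h1).trans
          (show (.inl k₀ : K ⊕ Fin N) = .inl k from h2).symm) hne

theorem rwt_loop {L : Type} (val : L → ℂ) (φ : Multiset ℂ → ℂ) (ℓ ℓ' : L) :
    rwt r v val φ (loop ℓ ℓ' : Cfg n L (Option (Option (Fin 0)))) none =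
      propagator r v (val ℓ) (val ℓ') * φ {val ℓ, val ℓ'} := by
  unfold rwt
  rw [loop, eprod_pair, rprod_pair]
  have h0 : eprod r v (1 : Perm (Fin 0)) = fun _ => 1 := by
    funext l; rfl
  have h1 : ∀ (ty : Fin 0 → VertexType n) l, vprod r v (1 : Perm (Fin 0)) ty l = 1 := by
    intro ty l; rfl
  rw [h0, h1, mul_one, mul_one]
  rfl

end RootedSums

section SmallRoots

variable {r : ℕ} {v : ℕ → ℂ} {n N : ℕ} {K D E : Type} [Fintype K] [Fintype D] [Fintype E]

/-! Roots at a univalent vertex. -/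

open Classical in
/-- Change the type at one dart. -/
def Cfg.setTy {L : Type} (G : Cfg n L D) (c : D) (t : VertexType n) : Cfg n L D :=
  { G with ty := Function.update G.ty c t }

theorem Cfg.setTy_ty_self {L : Type} (G : Cfg n L D) (c : D) (t : VertexType n) :
    (G.setTy c t).ty c = t := by simp [setTy]

theorem Cfg.setTy_ty_of_ne {L : Type} (G : Cfg n L D) {c d : D} (t : VertexType n) (h : d ≠ c) :
    (G.setTy c t).ty d = G.ty d := by simp [setTy, h]

theorem sameCycle_of_fixed {σ : Perm D} {c d : D} (hc : σ c = c) : σ.SameCycle c d ↔ d = c := by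
  have h1 := (card_orb_eq_one_iff σ c).2 hc
  rw [Finset.card_eq_one] at h1
  obtain ⟨a, ha⟩ := h1
  have h2 : c ∈ orb σ c := mem_orb_self σ c
  rw [ha, Finset.mem_singleton] at h2
  rw [← mem_orb, ha, Finset.mem_singleton, h2]

theorem IsGraph.setTy_white {X : Spec n K} {k₀ : K} (hX : ¬ X.cil k₀) (hX' : X.next k₀ = k₀)
    {G : Cfg n (K ⊕ Fin N) D} {c : D} (h : IsRooted X G c) (hc : G.deco c = .inl k₀)
    (hr : G.rot c = c) : IsPlain (X.addCil k₀) (G.setTy c (.white (X.tp k₀))) := by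
  have hty : ∀ d, d ≠ c → (G.setTy c (.white (X.tp k₀))).ty d = G.ty d :=
    fun d hd => G.setTy_ty_of_ne _ hd
  have htc : (G.setTy c (.white (X.tp k₀))).ty c = .white (X.tp k₀) := G.setTy_ty_self _ _
  have hcil : ∀ d, G.ty d ≠ .black → G.deco d ≠ .inl k₀ := fun d hd hd' => by
    obtain ⟨k, h1, h2, -⟩ := h.white d hd
    have : k₀ = k := Sum.inl_injective (hd'.symm.trans h2)
    exact hX (this ▸ h1)
  refine ⟨h.opp_opp, h.opp_ne, ?_, h.deco_face, h.conn, h.vert, h.fac, ?_, ?_, ?_,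
    fun _ h => h.elim, ?_, h.mark_ex, h.mark_unique⟩
  · intro d
    by_cases hd : d = c
    · rw [hd]; change (G.setTy c _).ty (G.rot c) = _; rw [hr]
    · rw [hty d hd]
      change (G.setTy c _).ty (G.rot d) = _
      rw [hty, h.ty_rot]
      exact fun h' => hd (G.rot.injective (h'.trans hr.symm))
  · intro d hd
    by_cases hdc : d = c
    · rw [hdc]
      exact ⟨k₀, Or.inr rfl, hc, by
        change G.deco (G.rot.symm c) = _
        rw [(symm_apply_eq _).2 hr.symm, hc]; simp [Spec.addCil, hX'], htc⟩
    · rw [hty d hdc] at hd ⊢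
      obtain ⟨k, h1, h2, h3, h4⟩ := h.white d hd
      exact ⟨k, Or.inl h1, h2, h3, h4⟩
  · rintro k (hk | rfl)
    · obtain ⟨d, hd1, hd2⟩ := h.white_ex k hk
      refine ⟨d, ?_, hd2⟩
      rwa [hty]
      rintro rfl
      exact hd1 (h.special _ (Perm.SameCycle.refl _ _))
    · exact ⟨c, by rw [htc]; simp, hc⟩
  · intro d d' h1 h2 h3
    by_cases hd : d = c <;> by_cases hd' : d' = c
    · rw [hd, hd']
    · rw [hty _ hd'] at h2
      exact absurd (h3.symm.trans (hd ▸ hc)) (hcil d' h2)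
    · rw [hty _ hd] at h1
      exact absurd (h3.trans (hd' ▸ hc)) (hcil d h1)
    · rw [hty _ hd] at h1
      rw [hty _ hd'] at h2
      exact h.white_unique d d' h1 h2 h3
  · intro d hd _
    by_cases hdc : d = c
    · rw [hdc, htc] at hd
      simp at hd
    · rw [hty d hdc] at hd
      exact h.deg d hd (by rwa [sameCycle_of_fixed hr])

theorem IsGraph.setTy_black {X : Spec n K} {k₀ : K} (hX : ¬ X.cil k₀)
    {G : Cfg n (K ⊕ Fin N) D} {c : D} (h : IsPlain (X.addCil k₀) G) (hc : G.deco c = .inl k₀)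
    (hc' : G.ty c ≠ .black) (hr : G.rot c = c) : IsRooted X (G.setTy c .black) c := by
  have hty : ∀ d, d ≠ c → (G.setTy c .black).ty d = G.ty d :=
    fun d hd => G.setTy_ty_of_ne _ hd
  have htc : (G.setTy c .black).ty c = .black := G.setTy_ty_self _ _
  have hne : ∀ d, (G.setTy c .black).ty d ≠ .black → d ≠ c := by
    rintro d hd rfl; exact hd htc
  refine ⟨h.opp_opp, h.opp_ne, ?_, h.deco_face, h.conn, h.vert, h.fac, ?_, ?_, ?_,
    ?_, ?_, h.mark_ex, h.mark_unique⟩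
  · intro d
    by_cases hd : d = c
    · rw [hd]; change (G.setTy c _).ty (G.rot c) = _; rw [hr]
    · rw [hty d hd]
      change (G.setTy c _).ty (G.rot d) = _
      rw [hty, h.ty_rot]
      exact fun h' => hd (G.rot.injective (h'.trans hr.symm))
  · intro d hd
    have hdc := hne d hd
    rw [hty d hdc] at hd ⊢
    obtain ⟨k, h1 | rfl, h2, h3, h4⟩ := h.white d hd
    · exact ⟨k, h1, h2, h3, h4⟩
    · exact absurd (h.white_unique _ _ hd hc' (h2.trans hc.symm)) hdc
  · intro k hk
    obtain ⟨d, hd1, hd2⟩ := h.white_ex k (Or.inl hk)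
    refine ⟨d, ?_, hd2⟩
    rwa [hty]
    rintro rfl
    exact hX (by rwa [Sum.inl_injective (hc.symm.trans hd2)])
  · intro d d' h1 h2 h3
    have e1 := hne d h1
    have e2 := hne d' h2
    rw [hty _ e1] at h1
    rw [hty _ e2] at h2
    exact h.white_unique d d' h1 h2 h3
  · intro d hd
    have : d = c := (sameCycle_of_fixed hr).1 hd
    rw [this, htc]
  · intro d hd hdc
    have hdc : d ≠ c := fun h' => hdc ((sameCycle_of_fixed hr).2 h')
    rw [hty d hdc] at hd
    exact h.deg d hd id

/-- A univalent root in the face `k₀` and a white vertex ciliating this face differ by their colour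
only; repainting is a bijection, and replaces the weight `ψ {z}` by one. -/
theorem rootSum_univalent (X : Spec n K) (val : K ⊕ Fin N → ℂ) (k₀ : K) (ψ : Multiset ℂ → ℂ)
    (hX : ¬ X.cil k₀) (hX' : X.next k₀ = k₀) :
    rootSum r v D X val k₀ (fun s => pif (Multiset.card s = 1) (ψ s) 0) =
      ψ {val (.inl k₀)} * plainSum r v D (X.addCil k₀) val := by
  have h1 : rootSum r v D X val k₀ (fun s => pif (Multiset.card s = 1) (ψ s) 0) =
      ∑ p : Cfg n (K ⊕ Fin N) D × D, pif ((IsRooted X p.1 p.2 ∧ p.1.deco p.2 = .inl k₀) ∧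
        p.1.rot p.2 = p.2) (rwt r v val ψ p.1 p.2) 0 := by
    unfold rootSum
    refine Finset.sum_congr rfl fun p _ => ?_
    have hcard : Multiset.card ((orb p.1.rot p.2).val.map (val ∘ p.1.deco)) = 1 ↔
        p.1.rot p.2 = p.2 := by
      rw [Multiset.card_map, Finset.card_val, card_orb_eq_one_iff]
    by_cases h : p.1.rot p.2 = p.2
    · refine pif_congr (by simp [h]) fun _ => ?_
      unfold rwt
      rw [rprod_congr]
      rw [pif_pos (hcard.2 h)]
    · rw [pif_neg (p := (_ ∧ _) ∧ p.1.rot p.2 = p.2) (fun h' => h h'.2), rwt, rprod_eq,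
        pif_neg (fun h' => h (hcard.1 h')), zero_mul, mul_zero]
      unfold pif; simp
  rw [h1, plainSum, Finset.mul_sum]
  have h2 : ∀ G : Cfg n (K ⊕ Fin N) D, ψ {val (.inl k₀)} * pif (IsPlain (X.addCil k₀) G)
      (wt r v val G) 0 = pif (IsPlain (X.addCil k₀) G) (ψ {val (.inl k₀)} * wt r v val G) 0 := by
    intro G; unfold pif; split_ifs <;> simp
  simp only [h2]
  symm
  refine sum_pif_bij (fun p => p.1.setTy p.2 (.white (X.tp k₀))) ?_ ?_ ?_ ?_
  · rintro ⟨G, c⟩ ⟨⟨h, hc⟩, hr⟩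
    exact h.setTy_white hX hX' hc hr
  · rintro ⟨G, c⟩ ⟨G₂, c₂⟩ ⟨⟨h, hc⟩, hr⟩ ⟨⟨h', hc'⟩, hr'⟩ he
    simp only at h hc hr h' hc' hr' he
    have hp := h.setTy_white hX hX' hc hr
    obtain rfl : c = c₂ := by
      refine hp.white_unique _ _ ?_ ?_ ?_
      · rw [G.setTy_ty_self]; simp
      · rw [he, G₂.setTy_ty_self]; simp
      · have := congrFun (congrArg Cfg.deco he) c₂
        change G.deco c₂ = G₂.deco c₂ at this
        change G.deco c = G.deco c₂
        rw [this, hc, hc']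
    have : G = G₂ := by
      have e1 := congrArg Cfg.rot he
      have e2 := congrArg Cfg.opp he
      have e3 := congrArg Cfg.deco he
      refine Cfg.ext e1 e2 ?_ e3
      funext d
      by_cases hd : d = c
      · rw [hd, h.special _ (Perm.SameCycle.refl _ _), h'.special _ (Perm.SameCycle.refl _ _)]
      · have := congrFun (congrArg Cfg.ty he) d
        rwa [G.setTy_ty_of_ne _ hd, G₂.setTy_ty_of_ne _ hd] at this
    rw [this]
  · intro G hG
    obtain ⟨c, hc1, hc2⟩ := hG.white_ex k₀ (Or.inr rfl)
    have hr := rot_eq_of_cil (X := X.addCil k₀) hX' hG hc1 hc2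
    refine ⟨(G.setTy c .black, c), ⟨⟨hG.setTy_black hX hc2 hc1 hr, hc2⟩, hr⟩, ?_⟩
    refine Cfg.ext rfl rfl ?_ rfl
    funext d
    by_cases hd : d = c
    · rw [hd]
      simp only [Cfg.setTy_ty_self]
      obtain ⟨k, -, hk2, -, hk4⟩ := hG.white c hc1
      obtain rfl : k₀ = k := Sum.inl_injective (hc2.symm.trans hk2)
      exact hk4.symm
    · simp only [Cfg.setTy_ty_of_ne _ _ hd]
  · rintro ⟨G, c⟩ ⟨⟨h, hc⟩, hr⟩
    simp only at h hc hr ⊢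
    unfold wt rwt
    have ho : orb G.rot c = {c} := by
      ext d; rw [mem_orb, sameCycle_of_fixed hr, Finset.mem_singleton]
    change ψ _ * (eprod r v G.opp (val ∘ G.deco) * vprod r v G.rot _ (val ∘ G.deco)) = _
    rw [rprod_eq, ho]
    have : ψ (({c} : Finset D).val.map (val ∘ G.deco)) = ψ {val (.inl k₀)} := by
      simp [hc]
    rw [this]
    rw [mul_left_comm]
    congr 2
    unfold vprod
    have hm := orb_mem_orbs G.rot c
    rw [ho] at hm
    classical
    rw [← Finset.mul_prod_erase _ _ hm, pif_neg, one_mul]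
    · refine Finset.prod_congr (by congr!) fun s hs => ?_
      have hcs : c ∉ s := by
        intro hcs
        rw [Finset.mem_erase] at hs
        exact hs.1 (by rw [eq_orb_of_mem hs.2 hcs, ho])
      congr 1
      refine propext (forall_congr' fun d => forall_congr' fun hd => ?_)
      rw [G.setTy_ty_of_ne]
      rintro rfl; exact hcs hd
    · intro hh
      have := hh c (Finset.mem_singleton_self c)
      rw [G.setTy_ty_self] at this
      simp at this

/-! Roots at vertices of degree at least three. -/

theorem rootSum_ge_three (X : Spec n K) (val : K ⊕ Fin N → ℂ) (k₀ : K) (φ : Multiset ℂ → ℂ) :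
    rootSum r v D X val k₀ (fun s => pif (3 ≤ Multiset.card s) (φ s) 0) =
      ∑ p : Cfg n (K ⊕ Fin N) D × D, pif (IsPlain X p.1 ∧ p.1.ty p.2 = .black ∧
        p.1.deco p.2 = .inl k₀) (rwt r v val φ p.1 p.2) 0 := by
  unfold rootSum
  refine Finset.sum_congr rfl fun p _ => ?_
  have hcard : 3 ≤ Multiset.card ((orb p.1.rot p.2).val.map (val ∘ p.1.deco)) ↔
      3 ≤ (orb p.1.rot p.2).card := by
    rw [Multiset.card_map, Finset.card_val]
  rw [← and_assoc, ← isPlain_iff]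
  by_cases h : 3 ≤ (orb p.1.rot p.2).card
  · refine pif_congr (by simp [h]) fun _ => ?_
    unfold rwt
    rw [rprod_congr]
    rw [pif_pos (hcard.2 h)]
  · rw [pif_neg (p := (_ ∧ _) ∧ _) (fun h' => h h'.1.2), rwt, rprod_eq,
      pif_neg (fun h' => h (hcard.1 h')), zero_mul, mul_zero]
    unfold pif; simp

/-! Roots at bivalent vertices. -/

/-- The edge `{d, opp d}` is replaced by `{none, opp d}` and `{d, some none}`. Exchanging the names
`opp d` and `some none` turns these into the old edge and a disjoint new one, whose product of
propagators is known from `eprod_pair`. -/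
theorem bisect_opp_eq {L : Type} {G : Cfg n L D} (hO : ∀ a, G.opp (G.opp a) = a)
    (hN : ∀ a, G.opp a ≠ a) (d : D) [DecidableEq (Option (Option D))] :
    (G.bisect d).opp = (swap (some (some (G.opp d))) (some none)).permCongr
      (insOpt (fixOpt G.opp) none) := by
  have sw : ∀ x : Option (Option D), x ≠ some (some (G.opp d)) → x ≠ some none →
      swap (some (some (G.opp d))) (some none) x = x :=
    fun x h h' => swap_apply_of_ne_of_ne h h'
  ext1 u
  rw [permCongr_apply, symm_swap]
  rcases u with _ | _ | a
  · rw [bisect_opp_none hN, sw none (by simp) (by simp), insOpt_none, fixOpt_none,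
      swap_apply_right]
  · rw [bisect_opp_some_none hN _ hO, swap_apply_right, insOpt_of_ne _ _ (by simp),
      fixOpt_some, hO, sw _ _ (by simp)]
    simpa using (hN d).symm
  · by_cases h1 : a = d
    · rw [h1, bisect_opp_self hN, sw (some (some d)) _ (by simp), insOpt_of_ne _ _ (by simp),
        fixOpt_some, swap_apply_left]
      simpa using (hN d).symm
    by_cases h2 : a = G.opp d
    · rw [h2, bisect_opp_opp hN, swap_apply_left, insOpt_self, sw none (by simp) (by simp)]
    · rw [bisect_opp_of_ne hN _ h1 h2, sw (some (some a)) (by simpa using h2) (by simp),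
        insOpt_of_ne _ _ (by simp), fixOpt_some, sw _ _ (by simp)]
      simpa using fun h => h1 h

/-- The two darts exchanged in `bisect_opp_eq` carry equal labels by `hls`, so the conjugation does
not affect the product. -/
theorem eprod_bisect {L : Type} {G : Cfg n L D} (hO : ∀ a, G.opp (G.opp a) = a)
    (hN : ∀ a, G.opp a ≠ a) (d : D) (ls : Option (Option D) → ℂ)
    (hls : ls (some none) = ls (some (some (G.opp d)))) :
    eprod r v (G.bisect d).opp ls = propagator r v (ls none) (ls (some none)) *
      eprod r v G.opp (fun a => ls (some (some a))) := by
  classical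
  rw [bisect_opp_eq hO hN, eprod_permCongr]
  have : ls ∘ swap (some (some (G.opp d))) (some none) = ls := by
    funext u
    rw [Function.comp_apply, swap_apply_def]
    split_ifs with h1 h2
    · rw [h1, hls]
    · rw [h2, hls]
    · rfl
  rw [this, eprod_pair]

theorem rwt_bisect {L : Type} {G : Cfg n L D} (hO : ∀ a, G.opp (G.opp a) = a)
    (hN : ∀ a, G.opp a ≠ a) (d : D) (val : L → ℂ) (φ : Multiset ℂ → ℂ) :
    rwt r v val φ (G.bisect d) none = wt r v val G *
      (propagator r v (val (G.deco d)) (val (G.deco (G.opp d))) *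
        φ {val (G.deco d), val (G.deco (G.opp d))}) := by
  unfold rwt wt
  rw [eprod_bisect hO hN _ _ (by simp [Cfg.bisect])]
  have := rprod_pair (r := r) (v := v) G.rot (G.bisect d).ty (val ∘ (G.bisect d).deco) φ
  change rprod r v (G.bisect d).rot _ _ _ _ = _ at this
  rw [this]
  change propagator r v (val (G.deco d)) (val (G.deco (G.opp d))) *
    eprod r v G.opp (val ∘ G.deco) * (φ {val (G.deco d), val (G.deco (G.opp d))} *
      vprod r v G.rot G.ty (val ∘ G.deco)) = _
  ring

/-- Sums over graphs with a bivalent root vertex, as sums over graphs with a distinguished side of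
an edge. -/
theorem sum_bivalent (X : Spec n K) (k₀ : K) [Nonempty D]
    (Ψ : Cfg n (K ⊕ Fin N) (Option (Option D)) → Option (Option D) → ℂ)
    (hΨ : ∀ (τ : Perm (Option (Option D))) G c, Ψ (G.map τ) (τ c) = Ψ G c) :
    ∑ p : Cfg n (K ⊕ Fin N) (Option (Option D)) × Option (Option D),
        pif ((IsRooted X p.1 p.2 ∧ p.1.deco p.2 = .inl k₀) ∧ (orb p.1.rot p.2).card = 2)
          (Ψ p.1 p.2) 0 =
      ((Fintype.card D + 2 : ℂ) * (Fintype.card D + 1)) *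
        ∑ p : Cfg n (K ⊕ Fin N) D × D, pif (IsPlain X p.1 ∧ p.1.deco p.2 = .inl k₀)
          (Ψ (p.1.bisect p.2) none) 0 := by
  have h1 := sum_pointed (D := D) (n := n) (L := K ⊕ Fin N) (fun G i j =>
    pif ((IsRooted X G i ∧ G.deco i = .inl k₀) ∧ G.rot i = j ∧ G.rot j = i) (Ψ G i) 0)
    (fun τ G i j => pif_congr (by rw [isRooted_map_iff]; simp) (fun _ => hΨ τ G i))
  have h2 : ∑ p : Cfg n (K ⊕ Fin N) (Option (Option D)) × Option (Option D),
        pif ((IsRooted X p.1 p.2 ∧ p.1.deco p.2 = .inl k₀) ∧ (orb p.1.rot p.2).card = 2)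
          (Ψ p.1 p.2) 0 = ((Fintype.card D + 2 : ℂ) * (Fintype.card D + 1)) *
        ∑ G : Cfg n (K ⊕ Fin N) (Option (Option D)), pif ((IsRooted X G none ∧
          G.deco none = .inl k₀) ∧ G.rot none = some none ∧ G.rot (some none) = none)
          (Ψ G none) 0 := by
    rw [← h1, Fintype.sum_prod_type]
    refine Finset.sum_congr rfl fun G _ => Finset.sum_congr rfl fun i _ => ?_
    simp only [card_orb_eq_two_iff]
    by_cases hi : G.rot i ≠ i ∧ G.rot (G.rot i) = i
    · rw [Finset.sum_eq_single (G.rot i), if_pos hi.1.symm]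
      · exact pif_congr (by simp [hi]) fun _ => rfl
      · intro j _ hj
        split_ifs
        · exact pif_neg (fun h => hj h.2.1.symm) _ _
        · rfl
      · simp
    · rw [pif_neg (fun h => hi h.2)]
      symm
      refine Finset.sum_eq_zero fun j _ => ?_
      split_ifs with hij
      · refine pif_neg (fun h => hi ?_) _ _
        rw [h.2.1]; exact ⟨fun h => hij h.symm, h.2.2⟩
      · rfl
  rw [h2]
  congr 1
  refine sum_pif_bij (fun p => p.1.bisect p.2) ?_ ?_ ?_ ?_
  · rintro ⟨G, d⟩ ⟨h, hd⟩
    exact ⟨⟨h.bisect d, hd⟩, by simp, by simp⟩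
  · rintro ⟨G, d⟩ ⟨G₂, d₂⟩ ⟨h, -⟩ ⟨h', -⟩ he
    obtain ⟨rfl, rfl⟩ := bisect_injective h.opp_ne h'.opp_ne he
    rfl
  · rintro G' ⟨⟨h, hk⟩, hr1, hr2⟩
    obtain ⟨G, d, hO, hN, rfl⟩ := exists_bisect h hr1 hr2 (fun h5 => by
      refine h.not_closed (perm_closed ?_ ?_) (perm_closed ?_ ?_)
      · rw [hr1]; simp
      · rw [hr2]; simp
      · rw [h5]; simp
      · rw [← h5, h.opp_opp]; simp)
    exact ⟨(G, d), ⟨isPlain_of_bisect h hO hN, hk⟩, rfl⟩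
  · intros; rfl

theorem rootSum_bivalent_eq (X : Spec n K) (val : K ⊕ Fin N → ℂ) (k₀ : K) (φ : Multiset ℂ → ℂ) :
    rootSum r v D X val k₀ (fun s => pif (Multiset.card s = 2) (φ s) 0) =
      ∑ p : Cfg n (K ⊕ Fin N) D × D, pif ((IsRooted X p.1 p.2 ∧ p.1.deco p.2 = .inl k₀) ∧
        (orb p.1.rot p.2).card = 2) (rwt r v val φ p.1 p.2) 0 := by
  unfold rootSum
  refine Finset.sum_congr rfl fun p _ => ?_
  have hcard : Multiset.card ((orb p.1.rot p.2).val.map (val ∘ p.1.deco)) = 2 ↔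
      (orb p.1.rot p.2).card = 2 := by
    rw [Multiset.card_map, Finset.card_val]
  by_cases h : (orb p.1.rot p.2).card = 2
  · refine pif_congr (by simp [h]) fun _ => ?_
    unfold rwt
    rw [rprod_congr]
    rw [pif_pos (hcard.2 h)]
  · rw [pif_neg (p := _ ∧ _ = 2) (fun h' => h h'.2), rwt, rprod_eq,
      pif_neg (fun h' => h (hcard.1 h')), zero_mul, mul_zero]
    unfold pif; simp

theorem rootSum_bivalent (X : Spec n K) (val : K ⊕ Fin N → ℂ) (k₀ : K) (φ : Multiset ℂ → ℂ)
    [Nonempty D] :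
    rootSum r v (Option (Option D)) X val k₀ (fun s => pif (Multiset.card s = 2) (φ s) 0) =
      ((Fintype.card D + 2 : ℂ) * (Fintype.card D + 1)) *
        ∑ p : Cfg n (K ⊕ Fin N) D × D, pif (IsPlain X p.1 ∧ p.1.deco p.2 = .inl k₀)
          (wt r v val p.1 * (propagator r v (val (p.1.deco p.2)) (val (p.1.deco (p.1.opp p.2))) *
            φ {val (p.1.deco p.2), val (p.1.deco (p.1.opp p.2))})) 0 := by
  rw [rootSum_bivalent_eq, sum_bivalent X k₀ (rwt r v val φ) (fun τ G c => rwt_map τ val φ G c)]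
  congr 1
  exact Finset.sum_congr rfl fun p _ => pif_congr Iff.rfl fun h =>
    rwt_bisect h.1.opp_opp h.1.opp_ne _ _ _

/-- The contribution of the graph with a single vertex and a single edge. -/
def loopSum (r : ℕ) (v : ℕ → ℂ) (X : Spec n K) (val : K ⊕ Fin N → ℂ) (k₀ : K)
    (φ : Multiset ℂ → ℂ) : ℂ :=
  ∑ ℓ : K ⊕ Fin N, pif (X.e = 0 ∧ X.f = 2 ∧ (∀ k, ¬ X.cil k) ∧ ℓ ≠ .inl k₀ ∧
    ∀ k, k = k₀ ∨ ℓ = .inl k)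
    (propagator r v (val (.inl k₀)) (val ℓ) * φ {val (.inl k₀), val ℓ}) 0

theorem rootSum_loop (X : Spec n K) (val : K ⊕ Fin N → ℂ) (k₀ : K) (φ : Multiset ℂ → ℂ) :
    rootSum r v (Option (Option (Fin 0))) X val k₀
      (fun s => pif (Multiset.card s = 2) (φ s) 0) = 2 * loopSum r v X val k₀ φ := by
  have h1 := sum_pointed (D := Fin 0) (n := n) (L := K ⊕ Fin N) (fun G i j =>
    pif (IsRooted X G i ∧ G.rot i = j ∧ G.rot j = i ∧ G.deco i = .inl k₀) (rwt r v val φ G i) 0)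
    (fun τ G i j => pif_congr (by rw [isRooted_map_iff]; simp) (fun _ => rwt_map τ val φ G i))
  rw [rootSum_bivalent_eq]
  have h2 : ∑ p : Cfg n (K ⊕ Fin N) (Option (Option (Fin 0))) × Option (Option (Fin 0)),
        pif ((IsRooted X p.1 p.2 ∧ p.1.deco p.2 = .inl k₀) ∧ (orb p.1.rot p.2).card = 2)
          (rwt r v val φ p.1 p.2) 0 = 2 *
        ∑ G : Cfg n (K ⊕ Fin N) (Option (Option (Fin 0))), pif (IsRooted X G none ∧
          G.rot none = some none ∧ G.rot (some none) = none ∧ G.deco none = .inl k₀)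
          (rwt r v val φ G none) 0 := by
    rw [show (2 : ℂ) = ((Fintype.card (Fin 0) : ℂ) + 2) * ((Fintype.card (Fin 0) : ℂ) + 1) by simp]
    rw [← h1, Fintype.sum_prod_type]
    refine Finset.sum_congr rfl fun G _ => Finset.sum_congr rfl fun i _ => ?_
    simp only [card_orb_eq_two_iff]
    by_cases hi : G.rot i ≠ i ∧ G.rot (G.rot i) = i
    · rw [Finset.sum_eq_single (G.rot i), if_pos hi.1.symm]
      · exact pif_congr (by simp [hi]) fun _ => rfl
      · intro j _ hj
        split_ifs
        · exact pif_neg (fun h => hj h.2.1.symm) _ _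
        · rfl
      · simp
    · rw [pif_neg (fun h => hi h.2)]
      symm
      refine Finset.sum_eq_zero fun j _ => ?_
      split_ifs with hij
      · refine pif_neg (fun h => hi ?_) _ _
        rw [h.2.1]; exact ⟨fun h => hij h.symm, h.2.2.1⟩
      · rfl
  rw [h2]
  congr 1
  simp only [isRooted_loop]
  unfold loopSum
  refine sum_pif_bij (fun ℓ => loop (.inl k₀) ℓ) ?_ ?_ ?_ ?_
  · exact fun ℓ h => ⟨ℓ, rfl, h⟩
  · intro ℓ ℓ' _ _ h
    exact congrFun (congrArg Cfg.deco h) (some none)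
  · rintro G ⟨ℓ, rfl, h⟩
    exact ⟨ℓ, h, rfl⟩
  · intro ℓ _
    exact rwt_loop val φ _ _

theorem rootSum_split (X : Spec n K) (val : K ⊕ Fin N → ℂ) (k₀ : K) (φ : Multiset ℂ → ℂ) :
    rootSum r v D X val k₀ φ =
      rootSum r v D X val k₀ (fun s => pif (Multiset.card s = 1) (φ s) 0) +
      rootSum r v D X val k₀ (fun s => pif (Multiset.card s = 2) (φ s) 0) +
      rootSum r v D X val k₀ (fun s => pif (3 ≤ Multiset.card s) (φ s) 0) := by
  rw [← rootSum_add, ← rootSum_add]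
  refine rootSum_congr_fun _ _ _ fun s hs => ?_
  have : 0 < Multiset.card s := Multiset.card_pos.2 hs
  unfold pif
  split_ifs <;> first | omega | simp

end SmallRoots

/-! ### Sums over all sizes -/

section Totals

/-- The sum over all numbers of darts, where the labellings of the darts are divided out. -/
def total (f : ℕ → ℂ) : ℂ := ∑' m, (m.factorial : ℂ)⁻¹ * f m

theorem total_eq_sum {f : ℕ → ℂ} {B : ℕ} (hf : ∀ m, B ≤ m → f m = 0) :
    total f = ∑ m ∈ Finset.range B, (m.factorial : ℂ)⁻¹ * f m :=
  tsum_eq_sum fun m hm => by rw [hf m (by simpa using hm), mul_zero]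

theorem total_const_mul (a : ℂ) (f : ℕ → ℂ) : total (fun m => a * f m) = a * total f := by
  unfold total
  rw [← tsum_mul_left]
  exact tsum_congr fun m => by ring

theorem total_add {f g : ℕ → ℂ} {B : ℕ} (hf : ∀ m, B ≤ m → f m = 0) (hg : ∀ m, B ≤ m → g m = 0) :
    total (fun m => f m + g m) = total f + total g := by
  rw [total_eq_sum hf, total_eq_sum hg,
    total_eq_sum (B := B) (fun m hm => by rw [hf m hm, hg m hm, add_zero]),
    ← Finset.sum_add_distrib]
  exact Finset.sum_congr rfl fun m _ => by ring

/-- For comparing sums over graphs that differ by two darts. The factor `(m + 2)(m + 1)` is absorbed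
by the factorials, and `x` accounts for the graphs with exactly two darts, which come from no
smaller graph. -/
theorem total_of_step {f g : ℕ → ℂ} {B : ℕ} (hf : ∀ m, B ≤ m → f m = 0)
    (hg : ∀ m, B ≤ m → g m = 0) (x : ℂ) (h0 : f 0 = 0) (h1 : f 1 = 0)
    (h2 : f 2 = 2 * (x + g 0))
    (h3 : ∀ m : ℕ, 1 ≤ m → f (m + 2) = ((m : ℂ) + 2) * (m + 1) * g m) :
    total f = x + total g := by
  rw [total_eq_sum (B := B + 1 + 1 + 1) (fun m hm => hf m (by omega)),
    total_eq_sum (B := B + 1) (fun m hm => hg m (by omega)), Finset.sum_range_succ',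
    Finset.sum_range_succ', Finset.sum_range_succ', Finset.sum_range_succ']
  have : ∀ m : ℕ, ((m + 1 + 1 + 1).factorial : ℂ)⁻¹ * f (m + 1 + 1 + 1) =
      ((m + 1).factorial : ℂ)⁻¹ * g (m + 1) := fun m => by
    rw [show m + 1 + 1 + 1 = (m + 1) + 2 from rfl, h3 (m + 1) (by omega), Nat.factorial_succ,
      Nat.factorial_succ]
    have e1 : ((m : ℂ) + 1 + 1) ≠ 0 := by exact_mod_cast Nat.succ_ne_zero (m + 1)
    have e2 : ((m : ℂ) + 1 + 2) ≠ 0 := by exact_mod_cast Nat.succ_ne_zero (m + 2)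
    have e3 : ((m + 1).factorial : ℂ) ≠ 0 := by exact_mod_cast Nat.factorial_ne_zero _
    push_cast
    rw [show (m : ℂ) + 2 + 1 = m + 1 + 2 by ring]
    field_simp
  simp only [this, zero_add, h0, h1]
  rw [show 0 + 1 + 1 = 2 from rfl, h2]
  simp
  ring

variable (r : ℕ) (v : ℕ → ℂ) {n N : ℕ} {K D : Type} [Fintype K] [Fintype D]

variable (D) in
/-- The weighted sum over graphs with a distinguished corner of a black vertex in the face `k₀`. -/
def cornerSum (X : Spec n K) (val : K ⊕ Fin N → ℂ) (k₀ : K) (φ : Multiset ℂ → ℂ) : ℂ :=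
  ∑ p : Cfg n (K ⊕ Fin N) D × D, pif (IsPlain X p.1 ∧ p.1.ty p.2 = .black ∧
    p.1.deco p.2 = .inl k₀) (rwt r v val φ p.1 p.2) 0

variable (D) in
/-- The weighted sum over graphs with a distinguished side of an edge in the face `k₀`. -/
def sideSum (X : Spec n K) (val : K ⊕ Fin N → ℂ) (k₀ : K) (φ : Multiset ℂ → ℂ) : ℂ :=
  ∑ p : Cfg n (K ⊕ Fin N) D × D, pif (IsPlain X p.1 ∧ p.1.deco p.2 = .inl k₀)
    (wt r v val p.1 * (propagator r v (val (p.1.deco p.2)) (val (p.1.deco (p.1.opp p.2))) *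
      φ {val (p.1.deco p.2), val (p.1.deco (p.1.opp p.2))})) 0

/-- A number larger than all sizes of graphs of a given kind. -/
def Spec.bound (X : Spec n K) : ℕ := (6 * X.e + 4 * Fintype.card K + 5).toNat

/-- Since `X` fixes edges minus vertices and the number of faces, this is one coefficient of a
generating function. Only sizes below `X.bound` contribute. -/
def plainTot (X : Spec n K) (val : K ⊕ Fin N → ℂ) : ℂ :=
  total fun m => plainSum r v (Fin m) X val

def rootTot (X : Spec n K) (val : K ⊕ Fin N → ℂ) (k₀ : K) (φ : Multiset ℂ → ℂ) : ℂ :=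
  total fun m => rootSum r v (Fin m) X val k₀ φ

def cilTot (X : Spec n K) (val : K ⊕ Fin N → ℂ) (k₀ : K) (φ : Multiset ℂ → ℂ) : ℂ :=
  total fun m => cilSum r v (Fin m) X val k₀ φ

def cornerTot (X : Spec n K) (val : K ⊕ Fin N → ℂ) (k₀ : K) (φ : Multiset ℂ → ℂ) : ℂ :=
  total fun m => cornerSum r v (Fin m) X val k₀ φ

def sideTot (X : Spec n K) (val : K ⊕ Fin N → ℂ) (k₀ : K) (φ : Multiset ℂ → ℂ) : ℂ :=
  total fun m => sideSum r v (Fin m) X val k₀ φ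

variable {r v}

theorem IsGraph.card_lt_bound {X : Spec n K} {S : D → Prop}
    {G : Cfg n (K ⊕ Fin N) D} (h : IsGraph X S G)
    (hS : ∀ d d', S d → S d' → G.rot.SameCycle d d') : Fintype.card D < X.bound := by
  have := h.card_le hS
  unfold Spec.bound
  omega

theorem not_isRooted_of_bound {X : Spec n K} {m : ℕ} (hm : X.bound ≤ m)
    (G : Cfg n (K ⊕ Fin N) (Fin m)) (c : Fin m) : ¬ IsRooted X G c := fun h => by
  have := h.card_lt_bound fun d d' h h' => h.symm.trans h'
  rw [Fintype.card_fin] at this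
  omega

theorem not_isPlain_of_bound {X : Spec n K} {m : ℕ} (hm : X.bound ≤ m)
    (G : Cfg n (K ⊕ Fin N) (Fin m)) : ¬ IsPlain X G := fun h => by
  have := h.card_lt_bound fun d d' h => h.elim
  rw [Fintype.card_fin] at this
  omega

theorem plainSum_eq_zero {X : Spec n K} {m : ℕ} (hm : X.bound ≤ m) (val : K ⊕ Fin N → ℂ) :
    plainSum r v (Fin m) X val = 0 :=
  Finset.sum_eq_zero fun G _ => pif_neg (not_isPlain_of_bound hm G) _ _

theorem rootSum_eq_zero {X : Spec n K} {m : ℕ} (hm : X.bound ≤ m) (val : K ⊕ Fin N → ℂ) (k₀ : K)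
    (φ : Multiset ℂ → ℂ) : rootSum r v (Fin m) X val k₀ φ = 0 :=
  Finset.sum_eq_zero fun p _ => pif_neg (fun h => not_isRooted_of_bound hm p.1 p.2 h.1) _ _

theorem cornerSum_eq_zero {X : Spec n K} {m : ℕ} (hm : X.bound ≤ m) (val : K ⊕ Fin N → ℂ) (k₀ : K)
    (φ : Multiset ℂ → ℂ) : cornerSum r v (Fin m) X val k₀ φ = 0 :=
  Finset.sum_eq_zero fun p _ => pif_neg (fun h => not_isPlain_of_bound hm p.1 h.1) _ _

theorem sideSum_eq_zero {X : Spec n K} {m : ℕ} (hm : X.bound ≤ m) (val : K ⊕ Fin N → ℂ) (k₀ : K)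
    (φ : Multiset ℂ → ℂ) : sideSum r v (Fin m) X val k₀ φ = 0 :=
  Finset.sum_eq_zero fun p _ => pif_neg (fun h => not_isPlain_of_bound hm p.1 h.1) _ _

theorem cilSum_eq_zero {X : Spec n K} {m : ℕ} (hm : X.bound ≤ m) (val : K ⊕ Fin N → ℂ) (k₀ : K)
    (φ : Multiset ℂ → ℂ) : cilSum r v (Fin m) X val k₀ φ = 0 :=
  Finset.sum_eq_zero fun G _ => Finset.sum_eq_zero fun _ _ => Finset.sum_eq_zero fun j _ =>
    pif_neg (fun h => not_isRooted_of_bound (X := X.addCil k₀) hm G j h.1) _ _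

theorem ne_of_subsingleton [Subsingleton D] {X : Spec n K} {S : D → Prop}
    {G : Cfg n (K ⊕ Fin N) D} (c : D) : ¬ IsGraph X S G := fun h =>
  h.opp_ne c (Subsingleton.elim _ _)

/-- The bijection removing two elements. -/
def finOptOpt (m : ℕ) : Fin (m + 2) ≃ Option (Option (Fin m)) :=
  (finSuccEquiv (m + 1)).trans (optionCongr (finSuccEquiv m))

/-- Removal of the cilium in all sizes at once. The first term is the segment, whose root has no
corner left to attach the cilium to. -/
theorem cilTot_eq (X : Spec n K) (val : K ⊕ Fin N → ℂ) (k₀ : K) (φ : Multiset ℂ → ℂ)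
    (hX : ¬ X.cil k₀) (hX' : X.next k₀ = k₀) :
    cilTot r v X val k₀ φ =
      pif (X.e = -1 ∧ X.f = 1 ∧ ∀ k, k = k₀)
        (propagator r v (val (.inl k₀)) (val (.inl k₀)) * φ {val (.inl k₀)}) 0 +
      propagator r v (val (.inl k₀)) (val (.inl k₀)) *
        rootTot r v X val k₀ (fun s => φ (val (.inl k₀) ::ₘ s)) := by
  unfold rootTot
  rw [← total_const_mul]
  refine total_of_step (B := X.bound) (fun m hm => cilSum_eq_zero hm _ _ _)
    (fun m hm => by rw [rootSum_eq_zero hm, mul_zero]) _ ?_ ?_ ?_ ?_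
  · exact Finset.sum_eq_zero fun G _ => by simp
  · exact Finset.sum_eq_zero fun G _ => Finset.sum_eq_zero fun _ _ => Finset.sum_eq_zero fun j _ =>
      pif_neg (fun h => ne_of_subsingleton j h.1) _ _
  · rw [cilSum_congr (finOptOpt 0), cilSum_segment X val k₀ φ hX']
    have : rootSum r v (Fin 0) X val k₀ (fun s => φ (val (.inl k₀) ::ₘ s)) = 0 :=
      Fintype.sum_empty _
    rw [this, mul_zero, add_zero]
  · intro m hm
    have : Nonempty (Fin m) := ⟨⟨0, hm⟩⟩
    rw [cilSum_congr (finOptOpt m), cilSum_eq_rootSum X val k₀ φ hX hX', Fintype.card_fin]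

theorem rootTot_bivalent (X : Spec n K) (val : K ⊕ Fin N → ℂ) (k₀ : K) (φ : Multiset ℂ → ℂ) :
    rootTot r v X val k₀ (fun s => pif (Multiset.card s = 2) (φ s) 0) =
      loopSum r v X val k₀ φ + sideTot r v X val k₀ φ := by
  refine total_of_step (B := X.bound) (fun m hm => rootSum_eq_zero hm _ _ _)
    (fun m hm => sideSum_eq_zero hm _ _ _) _ ?_ ?_ ?_ ?_
  · exact Fintype.sum_empty _
  · exact Finset.sum_eq_zero fun p _ => pif_neg (fun h => ne_of_subsingleton p.2 h.1) _ _
  · rw [rootSum_congr (finOptOpt 0), rootSum_loop]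
    have : sideSum r v (Fin 0) X val k₀ φ = 0 := Fintype.sum_empty _
    rw [this, add_zero]
  · intro m hm
    have : Nonempty (Fin m) := ⟨⟨0, hm⟩⟩
    rw [rootSum_congr (finOptOpt m), rootSum_bivalent, Fintype.card_fin]
    rfl

/-- Sorting by the degree of the root: a univalent root is painted white; a bivalent one is erased
and marks a side of its edge, apart from the loop; one of degree at least three is an ordinary black
vertex with a marked corner. -/
theorem rootTot_eq (X : Spec n K) (val : K ⊕ Fin N → ℂ) (k₀ : K) (φ : Multiset ℂ → ℂ)
    (hX : ¬ X.cil k₀) (hX' : X.next k₀ = k₀) :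
    rootTot r v X val k₀ φ = φ {val (.inl k₀)} * plainTot r v (X.addCil k₀) val +
      (loopSum r v X val k₀ φ + sideTot r v X val k₀ φ) + cornerTot r v X val k₀ φ := by
  rw [← rootTot_bivalent, plainTot, ← total_const_mul, rootTot, rootTot, cornerTot]
  rw [← total_add (B := X.bound) (fun m hm => by rw [plainSum_eq_zero (X := X.addCil k₀) hm, mul_zero])
    (fun m hm => rootSum_eq_zero hm _ _ _),
    ← total_add (B := X.bound) (fun m hm => by
      rw [plainSum_eq_zero (X := X.addCil k₀) hm, rootSum_eq_zero hm]; simp)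
    (fun m hm => cornerSum_eq_zero hm _ _ _)]
  congr 1
  funext m
  rw [rootSum_split, rootSum_ge_three, ← rootSum_univalent X val k₀ φ hX hX']
  rfl

/-- Adding a cilium. -/
theorem plainTot_addCil (X : Spec n K) (val : K ⊕ Fin N → ℂ) (k₀ : K)
    (hX : ¬ X.cil k₀) (hX' : X.next k₀ = k₀) :
    plainTot r v (X.addCil k₀) val = propagator r v (val (.inl k₀)) (val (.inl k₀)) *
      (loopSum r v X val k₀ (fun s => vw r v (val (.inl k₀) ::ₘ s)) +
        sideTot r v X val k₀ (fun s => vw r v (val (.inl k₀) ::ₘ s)) +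
        cornerTot r v X val k₀ (fun s => vw r v (val (.inl k₀) ::ₘ s))) := by
  -- The black vertex carrying the cilium is the root. Without the cilium its degree is still at
  -- least two, so the univalent term of `rootTot_eq` vanishes, and so does the segment.
  have h1 : plainTot r v (X.addCil k₀) val =
      cilTot r v X val k₀ (fun s => pif (3 ≤ Multiset.card s) (vw r v s) 0) := by
    unfold plainTot cilTot
    congr 1
    funext m
    exact plainSum_eq_cilSum X val k₀ hX'
  have h2 := rootTot_eq (r := r) (v := v) X val k₀
    (fun s => pif (2 ≤ Multiset.card s) (vw r v (val (.inl k₀) ::ₘ s)) 0) hX hX'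
  rw [h1, cilTot_eq X val k₀ _ hX hX', pif_neg (p := 3 ≤ _) (by simp), mul_zero]
  have h3 : ∀ s : Multiset ℂ, pif (3 ≤ Multiset.card (val (.inl k₀) ::ₘ s))
      (vw r v (val (.inl k₀) ::ₘ s)) 0 =
      pif (2 ≤ Multiset.card s) (vw r v (val (.inl k₀) ::ₘ s)) 0 := fun s =>
    pif_congr (by rw [Multiset.card_cons]; omega) fun _ => rfl
  simp only [h3]
  rw [h2, pif_neg (p := 2 ≤ _) (by simp), zero_mul, zero_add]
  have h4 : loopSum r v X val k₀
      (fun s => pif (2 ≤ Multiset.card s) (vw r v (val (.inl k₀) ::ₘ s)) 0) =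
      loopSum r v X val k₀ (fun s => vw r v (val (.inl k₀) ::ₘ s)) := by
    refine Finset.sum_congr rfl fun ℓ _ => pif_congr Iff.rfl fun _ => ?_
    beta_reduce
    rw [pif_pos (by simp)]
  have h5 : sideTot r v X val k₀
      (fun s => pif (2 ≤ Multiset.card s) (vw r v (val (.inl k₀) ::ₘ s)) 0) =
      sideTot r v X val k₀ (fun s => vw r v (val (.inl k₀) ::ₘ s)) := by
    unfold sideTot sideSum
    congr 1
    funext m
    refine Finset.sum_congr rfl fun p _ => pif_congr Iff.rfl fun _ => ?_
    beta_reduce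
    rw [pif_pos (by simp)]
  have h6 : cornerTot r v X val k₀
      (fun s => pif (2 ≤ Multiset.card s) (vw r v (val (.inl k₀) ::ₘ s)) 0) =
      cornerTot r v X val k₀ (fun s => vw r v (val (.inl k₀) ::ₘ s)) := by
    unfold cornerTot cornerSum rwt
    congr 1
    funext m
    refine Finset.sum_congr rfl fun p _ => pif_congr Iff.rfl fun h => ?_
    rw [rprod_congr]
    have := (isPlain_iff.2 ⟨h.1, h.2.1⟩).2
    rw [pif_pos]
    rw [Multiset.card_map, Finset.card_val]
    omega
  rw [h4, h5, h6]
  unfold pif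
  split_ifs <;> ring

/-! The operators used for the square vertex. -/

/-- A univalent root has the weight `vw {z, z} = -V''(z)`, so these roots give `-V''(z)` times the
ciliated sum. By `plainTot_addCil` all the other roots give `V''(z)` times the same sum. -/
theorem rootTot_self (X : Spec n K) (val : K ⊕ Fin N → ℂ) (k₀ : K)
    (hX : ¬ X.cil k₀) (hX' : X.next k₀ = k₀)
    (hz : propagator r v (val (.inl k₀)) (val (.inl k₀)) * ddV r v (val (.inl k₀)) = 1) :
    rootTot r v X val k₀ (fun s => vw r v (val (.inl k₀) ::ₘ s)) = 0 := by
  rw [rootTot_eq X val k₀ _ hX hX', show (val (.inl k₀) ::ₘ {val (.inl k₀)} : Multiset ℂ) =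
    {val (.inl k₀), val (.inl k₀)} from rfl, vw_pair]
  have := plainTot_addCil (r := r) (v := v) X val k₀ hX hX'
  rw [this]
  linear_combination (-1 : ℂ) * (loopSum r v X val k₀ (fun s => vw r v (val (.inl k₀) ::ₘ s)) +
        sideTot r v X val k₀ (fun s => vw r v (val (.inl k₀) ::ₘ s)) +
        cornerTot r v X val k₀ (fun s => vw r v (val (.inl k₀) ::ₘ s))) * hz

/-- A face has as many sides as corners. A bivalent black vertex on a side multiplies the weight by
`-1`, and marking a corner does not change it; the face not being ciliated, all its corners are
black. -/
theorem side_add_corner (X : Spec n K) (val : K ⊕ Fin N → ℂ) (k₀ : K)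
    (hX : ¬ X.cil k₀)
    (hv : ∀ p q : K ⊕ Fin N, vw r v {val p, val q} ≠ 0) :
    sideTot r v X val k₀ (vw r v) + cornerTot r v X val k₀ (vw r v) = 0 := by
  unfold sideTot cornerTot
  rw [← total_add (B := X.bound) (fun m hm => sideSum_eq_zero hm _ _ _)
    (fun m hm => cornerSum_eq_zero hm _ _ _)]
  have : ∀ m, sideSum r v (Fin m) X val k₀ (vw r v) + cornerSum r v (Fin m) X val k₀ (vw r v) =
      0 := fun m => by
    unfold sideSum cornerSum
    rw [← Finset.sum_add_distrib]
    refine Finset.sum_eq_zero fun p _ => ?_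
    by_cases h : IsPlain X p.1 ∧ p.1.deco p.2 = .inl k₀
    · have hb : p.1.ty p.2 = .black := by
        by_contra hb
        obtain ⟨k, h1, h2, -⟩ := h.1.white _ hb
        have : k₀ = k := Sum.inl_injective (h.2.symm.trans h2)
        exact hX (this ▸ h1)
      rw [pif_pos h, pif_pos ⟨h.1, hb, h.2⟩, propagator_eq, neg_mul,
        inv_mul_cancel₀ (hv _ _), rwt, rprod_vw, wt]
      · ring
      · exact fun d hd => (h.1.ty_sameCycle hd).symm.trans hb
    · rw [pif_neg h, pif_neg (fun h' => h ⟨h'.1, h'.2.2⟩), add_zero]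
  simp only [this]
  simp [total]

theorem rootTot_vw (X : Spec n K) (val : K ⊕ Fin N → ℂ) (k₀ : K)
    (hX : ¬ X.cil k₀) (hX' : X.next k₀ = k₀)
    (hv : ∀ p q : K ⊕ Fin N, vw r v {val p, val q} ≠ 0) :
    rootTot r v X val k₀ (vw r v) =
      -dV r v (val (.inl k₀)) * plainTot r v (X.addCil k₀) val + loopSum r v X val k₀ (vw r v) := by
  rw [rootTot_eq X val k₀ _ hX hX', vw_singleton]
  linear_combination side_add_corner X val k₀ hX hv

theorem rootTot_univalent (X : Spec n K) (val : K ⊕ Fin N → ℂ) (k₀ : K)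
    (hX : ¬ X.cil k₀) (hX' : X.next k₀ = k₀) :
    rootTot r v X val k₀ (fun s => pif (Multiset.card s = 1) 1 0) =
      plainTot r v (X.addCil k₀) val := by
  unfold rootTot plainTot
  congr 1
  funext m
  rw [rootSum_univalent X val k₀ (fun _ => 1) hX hX', one_mul]

/-- Only the weight of the root involves `φ`. When `φ` depends on a parameter, residues and limits
can therefore be taken inside the sum, on one multiset at a time. -/
theorem rootTot_eq_sum (X : Spec n K) (val : K ⊕ Fin N → ℂ) (k₀ : K) :
    ∃ (ι : Type) (_ : Fintype ι) (a : ι → ℂ) (s : ι → Multiset ℂ), (∀ i, s i ≠ 0) ∧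
      ∀ φ, rootTot r v X val k₀ φ = ∑ i, a i * φ (s i) := by
  classical
  refine ⟨(m : Fin X.bound) × (Cfg n (K ⊕ Fin N) (Fin m) × Fin m), inferInstance,
    fun q => ((q.1 : ℕ).factorial : ℂ)⁻¹ *
      pif (IsRooted X q.2.1 q.2.2 ∧ q.2.1.deco q.2.2 = .inl k₀)
        (eprod r v q.2.1.opp (val ∘ q.2.1.deco) *
          ∏ s ∈ (orbs q.2.1.rot).erase (orb q.2.1.rot q.2.2),
        pif (∀ d ∈ s, q.2.1.ty d = .black) (vw r v (s.val.map (val ∘ q.2.1.deco))) 1) 0,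
    fun q => (orb q.2.1.rot q.2.2).val.map (val ∘ q.2.1.deco), ?_, ?_⟩
  · intro q h0
    have := card_orb_pos q.2.1.rot q.2.2
    have h0' := congrArg Multiset.card h0
    rw [Multiset.card_map, Finset.card_val, Multiset.card_zero] at h0'
    omega
  · intro φ
    rw [rootTot, total_eq_sum (fun m hm => rootSum_eq_zero hm _ _ _), Finset.sum_range,
      Fintype.sum_sigma]
    refine Finset.sum_congr rfl fun m _ => ?_
    rw [rootSum, Finset.mul_sum]
    refine Finset.sum_congr rfl fun p _ => ?_
    unfold pif rwt
    dsimp only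
    split_ifs with h
    · rw [rprod_eq]
      simp only [mul_assoc]
      rw [mul_comm (φ _)]
      congr!
    · simp

end Totals

/-! ### Derivatives with respect to the decoration of a marked face -/

section Derivatives

-- The chain rule along a path on which the labels in `S` move together at unit speed and the others
-- are stationary.
open Classical in
theorem hasDerivAt_sum_partials {D : Type} [Fintype D] {f : (D → ℂ) → ℂ} {x : D → ℂ}
    (hf : DifferentiableAt ℂ f x) (S : D → Prop) (p : D → ℂ)
    (hp : ∀ d, S d → HasDerivAt (fun t => f (Function.update x d t)) (p d) (x d))
    {γ : ℂ → D → ℂ} {t₀ : ℂ} (hγ : γ t₀ = x)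
    (hγ' : ∀ d, HasDerivAt (fun t => γ t d) (pif (S d) 1 0) t₀) :
    HasDerivAt (fun t => f (γ t)) (∑ d, pif (S d) (p d) 0) t₀ := by
  have h1 : HasDerivAt γ (fun d => pif (S d) 1 0) t₀ := hasDerivAt_pi.2 hγ'
  have h2 := (hγ ▸ hf.hasFDerivAt : HasFDerivAt f (fderiv ℂ f x) (γ t₀)).comp_hasDerivAt t₀ h1
  refine h2.congr_deriv (Eq.symm ?_)
  have h3 := LinearMap.pi_apply_eq_sum_univ (fderiv ℂ f x).toLinearMap (fun d => pif (S d) 1 0)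
  refine Eq.trans ?_ h3.symm
  refine Finset.sum_congr rfl fun d _ => ?_
  by_cases hd : S d
  · rw [pif_pos hd, pif_pos hd, one_smul]
    have h4 : HasFDerivAt f (fderiv ℂ f x) (Function.update x d (x d)) := by
      rw [Function.update_eq_self]; exact hf.hasFDerivAt
    have h5 := h4.comp_hasDerivAt (x d) (hasDerivAt_update x d (x d))
    refine (hp d hd).unique (h5.congr_deriv ?_)
    change fderiv ℂ f x _ = fderiv ℂ f x _
    congr 1
    funext j
    simp [Pi.single_apply, eq_comm]
  · rw [pif_neg hd, pif_neg hd, zero_smul]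

variable {r : ℕ} {v : ℕ → ℂ} {n N : ℕ} {K D : Type} [Fintype K] [Fintype D]

theorem hasDerivAt_update_comp {L : Type} [DecidableEq L] (val : L → ℂ) (ℓ : L) (deco : D → L)
    (d : D) : HasDerivAt (fun t => (Function.update val ℓ t ∘ deco) d) (pif (deco d = ℓ) 1 0)
      (val ℓ) := by
  by_cases h : deco d = ℓ
  · rw [pif_pos h]
    simpa [h] using hasDerivAt_id' (val ℓ)
  · rw [pif_neg h]
    simpa [h] using hasDerivAt_const (val ℓ) (val (deco d))

/-- The product rule over all darts of the face. Differentiating a propagator inserts a vertex on a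
side, differentiating a vertex weight marks a corner, and in both cases `vw` acquires the additional
argument `z` that a cilium would bring. -/
theorem hasDerivAt_wt [DecidableEq K] {X : Spec n K} {G : Cfg n (K ⊕ Fin N) D} (hG : IsPlain X G)
    (val : K ⊕ Fin N → ℂ) (k₀ : K) (hX : ¬ X.cil k₀)
    (hv : ∀ p q : K ⊕ Fin N, vw r v {val p, val q} ≠ 0) :
    HasDerivAt (fun t => wt r v (Function.update val (.inl k₀) t) G)
      (∑ d, pif (G.deco d = .inl k₀) (wt r v val G *
        (propagator r v (val (G.deco d)) (val (G.deco (G.opp d))) *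
          vw r v (val (.inl k₀) ::ₘ {val (G.deco d), val (G.deco (G.opp d))}))) 0 +
      ∑ d, pif (G.deco d = .inl k₀)
        (rwt r v val (fun s => vw r v (val (.inl k₀) ::ₘ s)) G d) 0) (val (.inl k₀)) := by
  have hγ : Function.update val (.inl k₀) (val (.inl k₀)) ∘ G.deco = val ∘ G.deco := by
    rw [Function.update_eq_self]
  have h1 := hasDerivAt_sum_partials
    (analyticAt_eprod (r := r) (v := v) G.opp hG.opp_opp hG.opp_ne (val ∘ G.deco)
      (fun d => hv _ _)).differentiableAt (fun d => G.deco d = .inl k₀)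
    (fun d => eprod r v G.opp (val ∘ G.deco) * (propagator r v (val (G.deco d))
      (val (G.deco (G.opp d))) * vw r v {val (G.deco d), val (G.deco d), val (G.deco (G.opp d))}))
    (fun d _ => hasDerivAt_eprod (r := r) (v := v) G.opp hG.opp_opp hG.opp_ne (val ∘ G.deco) d
      (hv _ _)) hγ
    (fun d => hasDerivAt_update_comp val (.inl k₀) G.deco d)
  have h2 := hasDerivAt_sum_partials
    (analyticAt_vprod (r := r) (v := v) G.rot G.ty (val ∘ G.deco)).differentiableAt
    (fun d => G.deco d = .inl k₀)
    (fun d => rprod r v G.rot G.ty (val ∘ G.deco) d (fun m => vw r v (val (G.deco d) ::ₘ m)))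
    (fun d hd => by
      have hb : G.ty d = .black := by
        by_contra hb
        obtain ⟨k, h1, h2, -⟩ := hG.white _ hb
        have : k₀ = k := Sum.inl_injective (hd.symm.trans h2)
        exact hX (this ▸ h1)
      exact hasDerivAt_vprod (r := r) (v := v) G.rot G.ty (val ∘ G.deco) d
        (fun d' hd' => (hG.ty_sameCycle hd').symm.trans hb)) hγ
    (fun d => hasDerivAt_update_comp val (.inl k₀) G.deco d)
  refine (h1.mul h2).congr_deriv ?_
  simp only [hγ]
  rw [Finset.sum_mul, Finset.mul_sum]
  congr 1
  · refine Finset.sum_congr rfl fun d _ => ?_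
    by_cases h : G.deco d = .inl k₀
    · rw [pif_pos h, pif_pos h, h, wt]
      simp only [Multiset.insert_eq_cons]
      ring
    · rw [pif_neg h, pif_neg h, zero_mul]
  · refine Finset.sum_congr rfl fun d _ => ?_
    by_cases h : G.deco d = .inl k₀
    · rw [pif_pos h, pif_pos h, h, rwt]
    · rw [pif_neg h, pif_neg h, mul_zero]

theorem hasDerivAt_plainSum [DecidableEq K] (X : Spec n K) (val : K ⊕ Fin N → ℂ) (k₀ : K)
    (hX : ¬ X.cil k₀) (hv : ∀ p q : K ⊕ Fin N, vw r v {val p, val q} ≠ 0) :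
    HasDerivAt (fun t => plainSum r v D X (Function.update val (.inl k₀) t))
      (sideSum r v D X val k₀ (fun s => vw r v (val (.inl k₀) ::ₘ s)) +
        cornerSum r v D X val k₀ (fun s => vw r v (val (.inl k₀) ::ₘ s))) (val (.inl k₀)) := by
  unfold plainSum
  have h1 : ∀ G : Cfg n (K ⊕ Fin N) D, HasDerivAt (fun t => pif (IsPlain X G)
      (wt r v (Function.update val (.inl k₀) t) G) 0) (pif (IsPlain X G)
      (∑ d, pif (G.deco d = .inl k₀) (wt r v val G *
        (propagator r v (val (G.deco d)) (val (G.deco (G.opp d))) *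
          vw r v (val (.inl k₀) ::ₘ {val (G.deco d), val (G.deco (G.opp d))}))) 0 +
      ∑ d, pif (G.deco d = .inl k₀)
        (rwt r v val (fun s => vw r v (val (.inl k₀) ::ₘ s)) G d) 0) 0) (val (.inl k₀)) := by
    intro G
    by_cases h : IsPlain X G
    · simp only [pif_pos h]
      exact hasDerivAt_wt h val k₀ hX hv
    · simp only [pif_neg h]
      exact hasDerivAt_const _ _
  refine (HasDerivAt.fun_sum fun G _ => h1 G).congr_deriv ?_
  unfold sideSum cornerSum
  rw [Fintype.sum_prod_type, Fintype.sum_prod_type, ← Finset.sum_add_distrib]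
  refine Finset.sum_congr rfl fun G _ => ?_
  by_cases h : IsPlain X G
  · rw [pif_pos h]
    congr 1
    · exact Finset.sum_congr rfl fun d _ => pif_congr (by simp [h]) fun _ => rfl
    · refine Finset.sum_congr rfl fun d _ => pif_congr ?_ fun _ => rfl
      refine ⟨fun hd => ⟨h, ?_, hd⟩, fun hd => hd.2.2⟩
      by_contra hb
      obtain ⟨k, h1, h2, -⟩ := h.white _ hb
      have : k₀ = k := Sum.inl_injective (hd.symm.trans h2)
      exact hX (this ▸ h1)
  · rw [pif_neg h, Finset.sum_eq_zero, Finset.sum_eq_zero, add_zero]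
    · exact fun d _ => pif_neg (fun h' => h h'.1) _ _
    · exact fun d _ => pif_neg (fun h' => h h'.1) _ _

/-- Up to the loop, the derivative is the expression that `plainTot_addCil` multiplies by `P(z, z) =
1 / V''(z)`: differentiation adds a cilium. -/
theorem hasDerivAt_plainTot [DecidableEq K] (X : Spec n K) (val : K ⊕ Fin N → ℂ) (k₀ : K)
    (hX : ¬ X.cil k₀) (hv : ∀ p q : K ⊕ Fin N, vw r v {val p, val q} ≠ 0) :
    HasDerivAt (fun t => plainTot r v X (Function.update val (.inl k₀) t))
      (sideTot r v X val k₀ (fun s => vw r v (val (.inl k₀) ::ₘ s)) +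
        cornerTot r v X val k₀ (fun s => vw r v (val (.inl k₀) ::ₘ s))) (val (.inl k₀)) := by
  have h1 : (fun t => plainTot r v X (Function.update val (.inl k₀) t)) = fun t =>
      ∑ m ∈ Finset.range X.bound, (m.factorial : ℂ)⁻¹ *
        plainSum r v (Fin m) X (Function.update val (.inl k₀) t) := by
    funext t
    exact total_eq_sum fun m hm => plainSum_eq_zero hm _
  rw [h1, sideTot, cornerTot, ← total_add (B := X.bound) (fun m hm => sideSum_eq_zero hm _ _ _)
    (fun m hm => cornerSum_eq_zero hm _ _ _), total_eq_sum (B := X.bound) (fun m hm => by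
      rw [sideSum_eq_zero hm, cornerSum_eq_zero hm, add_zero])]
  exact HasDerivAt.fun_sum fun m _ => (hasDerivAt_plainSum X val k₀ hX hv).const_mul _

theorem analyticAt_plainTot (X : Spec n K) (lam : Fin N → ℂ) (z : K → ℂ)
    (hv : ∀ p q : K ⊕ Fin N, vw r v {Sum.elim z lam p, Sum.elim z lam q} ≠ 0) :
    AnalyticAt ℂ (fun y : K → ℂ => plainTot r v X (Sum.elim y lam)) z := by
  have h1 : (fun y : K → ℂ => plainTot r v X (Sum.elim y lam)) = fun y =>
      ∑ m ∈ Finset.range X.bound, (m.factorial : ℂ)⁻¹ *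
        plainSum r v (Fin m) X (Sum.elim y lam) := by
    funext t
    exact total_eq_sum fun m hm => plainSum_eq_zero hm _
  rw [h1]
  refine Finset.analyticAt_fun_sum _ fun m _ => analyticAt_const.mul ?_
  unfold plainSum
  refine Finset.analyticAt_fun_sum _ fun G _ => ?_
  by_cases h : IsPlain X G
  · simp only [pif_pos h]
    unfold wt
    have hl : AnalyticAt ℂ (fun y : K → ℂ => Sum.elim y lam ∘ G.deco) z := by
      rw [analyticAt_pi_iff]
      intro d
      simp only [Function.comp_apply]
      rcases G.deco d with k | j
      · exact (ContinuousLinearMap.proj (R := ℂ) (φ := fun _ : K => ℂ) k).analyticAt z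
      · exact analyticAt_const
    have a1 := analyticAt_eprod (r := r) (v := v) G.opp h.opp_opp h.opp_ne
      (Sum.elim z lam ∘ G.deco) (fun d => hv _ _)
    have a2 := analyticAt_vprod (r := r) (v := v) G.rot G.ty (Sum.elim z lam ∘ G.deco)
    have b1 := AnalyticAt.comp (f := fun y : K → ℂ => Sum.elim y lam ∘ G.deco) (x := z) a1 hl
    have b2 := AnalyticAt.comp (f := fun y : K → ℂ => Sum.elim y lam ∘ G.deco) (x := z) a2 hl
    exact b1.fun_mul b2
  · simp only [pif_neg h]
    exact analyticAt_const

/-- Decorations for which no propagator has a vanishing denominator. -/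
def Regular (r : ℕ) (v : ℕ → ℂ) (lam : Fin N → ℂ) (z : K → ℂ) : Prop :=
  ∀ p q : K ⊕ Fin N, vw r v {Sum.elim z lam p, Sum.elim z lam q} ≠ 0

/-- Expresses admissibility by one condition, which does not distinguish equal from different
decorations and is visibly open. -/
theorem vw_pair_ne_zero_iff (a b : ℂ) : vw r v {a, b} ≠ 0 ↔
    (a = b → ddV r v a ≠ 0) ∧ (a ≠ b → dV r v a ≠ dV r v b) := by
  have h := vw_diff r v a b 0
  rw [show (a ::ₘ 0 : Multiset ℂ) = {a} from rfl, show (b ::ₘ 0 : Multiset ℂ) = {b} from rfl,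
    vw_singleton, vw_singleton] at h
  by_cases hab : a = b
  · subst hab; rw [vw_pair]; simp
  · have hab' : a - b ≠ 0 := sub_ne_zero.2 hab
    simp only [hab, false_implies, true_and, ne_eq, not_false_eq_true, true_implies]
    rw [not_iff_not]
    rw [← mul_right_inj' hab', mul_zero]
    change (a - b) * vw r v (a ::ₘ {b}) = 0 ↔ _
    rw [h]
    constructor <;> intro h' <;> linear_combination -h'

theorem regular_iff (lam : Fin N → ℂ) (z : K → ℂ) :
    Regular r v lam z ↔ Admissible r v z lam := by
  unfold Regular Admissible
  simp only [vw_pair_ne_zero_iff]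
  constructor
  · exact fun h p q => ⟨(h p p).1 rfl, (h p q).2⟩
  · exact fun h p q => ⟨fun _ => (h p q).1, (h p q).2⟩

/-- Each operator is applied to a formula that holds for admissible decorations only, so it must
hold in a whole neighbourhood. -/
theorem isOpen_regular (lam : Fin N → ℂ) : IsOpen {z : K → ℂ | Regular r v lam z} := by
  have : {z : K → ℂ | Regular r v lam z} = ⋂ p : K ⊕ Fin N, ⋂ q : K ⊕ Fin N,
      {z | vw r v {Sum.elim z lam p, Sum.elim z lam q} ≠ 0} := by
    ext z; simp [Regular]
  rw [this]
  refine isOpen_iInter_of_finite fun p => isOpen_iInter_of_finite fun q => ?_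
  have h1 : Continuous fun w : Fin 2 → ℂ => vw r v (Finset.univ.val.map w) :=
    continuous_iff_continuousAt.2 fun w => (analyticAt_vw r v Finset.univ w).continuousAt
  have h2 : ∀ p : K ⊕ Fin N, Continuous fun z : K → ℂ => Sum.elim z lam p := by
    rintro (k | j)
    · exact continuous_apply k
    · exact continuous_const
  have h3 : Continuous fun z : K → ℂ => vw r v {Sum.elim z lam p, Sum.elim z lam q} := by
    have h4 : Continuous fun z : K → ℂ => (![Sum.elim z lam p, Sum.elim z lam q] : Fin 2 → ℂ) := by
      refine continuous_pi fun i => ?_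
      fin_cases i
      · exact h2 p
      · exact h2 q
    refine (h1.comp h4).congr fun z => ?_
    rfl
  exact isOpen_ne_fun h3 continuous_const

end Derivatives

/-! ### The differential operators -/

section Operators

variable {r : ℕ} {v : ℕ → ℂ} {n N : ℕ}

theorem dOp_congr (i : Fin n) {f g : (Fin n → ℂ) → ℂ} {U : Set (Fin n → ℂ)} (hU : IsOpen U)
    (h : ∀ y ∈ U, f y = g y) {y : Fin n → ℂ} (hy : y ∈ U) : dOp r v i f y = dOp r v i g y := by
  unfold dOp
  congr 1
  refine Filter.EventuallyEq.deriv_eq ?_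
  have h1 : Continuous (fun t => Function.update y i t) := continuous_const.update i continuous_id
  have h2 : (fun t => Function.update y i t) ⁻¹' U ∈ 𝓝 (y i) :=
    (hU.preimage h1).mem_nhds (by simpa using hy)
  filter_upwards [h2] with t ht using h _ ht

/-- The graphs with marked faces labelled by `Fin n`, the face `i` being ciliated if `j ≤ i`. -/
def stdSpec (n : ℕ) (e f : ℤ) (j : ℕ) : Spec n (Fin n) := ⟨fun i => j ≤ i, id, id, e, f⟩

theorem stdSpec_addCil (e f : ℤ) (i : Fin n) :
    (stdSpec n e f (i + 1)).addCil i = stdSpec n e f i := by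
  unfold Spec.addCil stdSpec
  congr 1
  funext k
  refine propext ?_
  rw [Fin.ext_iff]
  omega

/-- `hasDerivAt_plainTot` and `plainTot_addCil` involve the same sides and corners; only the loop is
present in one and absent from the other. -/
theorem plainTot_stdSpec (e f : ℤ) (i : Fin n) (lam : Fin N → ℂ) {y : Fin n → ℂ}
    (hy : Regular r v lam y) :
    DifferentiableAt ℂ (fun t => plainTot r v (stdSpec n e f (i + 1))
      (Sum.elim (Function.update y i t) lam)) (y i) ∧
    dOp r v i (fun y => plainTot r v (stdSpec n e f (i + 1)) (Sum.elim y lam)) y =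
      plainTot r v (stdSpec n e f i) (Sum.elim y lam) - (1 / ddV r v (y i)) *
        loopSum r v (stdSpec n e f (i + 1)) (Sum.elim y lam) i (fun s => vw r v (y i ::ₘ s)) := by
  have hX : ¬ (stdSpec n e f (i + 1)).cil i := by simp [stdSpec]
  have h1 := hasDerivAt_plainTot (r := r) (v := v) (stdSpec n e f (i + 1)) (Sum.elim y lam) i hX hy
  simp only [Sum.update_elim_inl, Sum.elim_inl] at h1
  refine ⟨h1.differentiableAt, ?_⟩
  rw [dOp, h1.deriv, ← stdSpec_addCil, plainTot_addCil _ _ _ hX rfl]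
  simp only [Sum.elim_inl]
  rw [propagator, if_pos rfl]
  ring

/-- The loop has two faces, hence at most two marks, and no ciliated face. So it can intervene only
in the operator applied first, that of the last index. -/
theorem loopSum_stdSpec_eq_zero {e f : ℤ} {i : Fin n} {val : Fin n ⊕ Fin N → ℂ}
    {φ : Multiset ℂ → ℂ} (h : ¬ (e = 0 ∧ f = 2 ∧ n ≤ 2 ∧ (i : ℕ) + 1 = n)) :
    loopSum r v (stdSpec n e f (i + 1)) val i φ = 0 := by
  refine Finset.sum_eq_zero fun ℓ _ => pif_neg ?_ _ _
  rintro ⟨h1, h2, h3, h4, h5⟩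
  refine h ⟨h1, h2, ?_, ?_⟩
  · by_contra hn
    have key : ∀ k k' : Fin n, k ≠ i → k' ≠ i → k = k' := fun k k' hk hk' => by
      have e1 := (h5 k).resolve_left hk
      have e2 := (h5 k').resolve_left hk'
      exact Sum.inl_injective (e1.symm.trans e2)
    have h6 : ∃ k k' : Fin n, k ≠ i ∧ k' ≠ i ∧ k ≠ k' := by
      rcases i with ⟨i, hi⟩
      by_cases h0 : i = 0
      · exact ⟨⟨1, by omega⟩, ⟨2, by omega⟩, by simp; omega, by simp; omega, by simp⟩
      · by_cases h1 : i = 1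
        · exact ⟨⟨0, by omega⟩, ⟨2, by omega⟩, by simp; omega, by simp; omega, by simp⟩
        · exact ⟨⟨0, by omega⟩, ⟨1, by omega⟩, by simp; omega, by simp; omega, by simp⟩
    obtain ⟨k, k', hk, hk', hkk⟩ := h6
    exact hkk (key k k' hk hk')
  · by_contra hi
    have := h3 ⟨i + 1, by omega⟩
    exact this le_rfl

/-- The iterated operators for the last indices. -/
def dOpFrom (r : ℕ) (v : ℕ → ℂ) (f : (Fin n → ℂ) → ℂ) (j : ℕ) : (Fin n → ℂ) → ℂ :=
  ((List.finRange n).drop j).foldr (dOp r v) f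

theorem dOpFrom_zero (f : (Fin n → ℂ) → ℂ) : dOpFrom r v f 0 = dOpAll r v f := rfl

theorem dOpFrom_self (f : (Fin n → ℂ) → ℂ) : dOpFrom r v f n = f := by
  unfold dOpFrom
  rw [List.drop_eq_nil_of_le (by simp)]
  rfl

theorem dOpFrom_step (f : (Fin n → ℂ) → ℂ) (i : Fin n) :
    dOpFrom r v f i = dOp r v i (dOpFrom r v f (i + 1)) := by
  unfold dOpFrom
  rw [List.drop_eq_getElem_cons (by simp), List.foldr_cons]
  simp

/-- Descending induction on `j`; each operator ciliates one more face, without correction as `h`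
excludes the loop. -/
theorem dOpFrom_eq (e f : ℤ) (lam : Fin N → ℂ) (h : ¬ (e = 0 ∧ f = 2 ∧ n ≤ 2)) {j : ℕ} (hj : j ≤ n)
    {y : Fin n → ℂ} (hy : Regular r v lam y) :
    dOpFrom r v (fun y => plainTot r v (stdSpec n e f n) (Sum.elim y lam)) j y =
      plainTot r v (stdSpec n e f j) (Sum.elim y lam) := by
  induction hj using Nat.decreasingInduction generalizing y with
  | self => rw [dOpFrom_self]
  | of_succ j hj ih =>
    rw [show j = ((⟨j, hj⟩ : Fin n) : ℕ) from rfl, dOpFrom_step,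
      dOp_congr _ (isOpen_regular lam) (fun y hy => ih hy) hy, (plainTot_stdSpec e f _ lam hy).2,
      loopSum_stdSpec_eq_zero (fun h' => h ⟨h'.1, h'.2.1, h'.2.2.1⟩), mul_zero, sub_zero]

/-- The contribution of a loop. -/
theorem propagator_mul_vw {a b : ℂ} (hab : a ≠ b) (ha : ddV r v a ≠ 0)
    (hd : dV r v a ≠ dV r v b) :
    1 / ddV r v a * (propagator r v a b * vw r v (a ::ₘ {a, b})) =
      1 / (ddV r v a * (a - b)) - 1 / (dV r v a - dV r v b) := by
  have h1 := vw_diff r v a b {a}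
  have h2 := vw_diff r v a b 0
  rw [show (a ::ₘ b ::ₘ {a} : Multiset ℂ) = a ::ₘ {a, b} by
    rw [Multiset.insert_eq_cons, ← Multiset.cons_zero, ← Multiset.cons_zero, Multiset.cons_swap b a],
    show (a ::ₘ {a} : Multiset ℂ) = {a, a} from rfl, vw_pair,
    show (b ::ₘ {a} : Multiset ℂ) = {a, b} from Multiset.pair_comm _ _] at h1
  rw [show (a ::ₘ 0 : Multiset ℂ) = {a} from rfl, show (b ::ₘ 0 : Multiset ℂ) = {b} from rfl,
    vw_singleton, vw_singleton, show (a ::ₘ {b} : Multiset ℂ) = {a, b} from rfl] at h2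
  have h3 : a - b ≠ 0 := sub_ne_zero.2 hab
  have h4 : dV r v a - dV r v b ≠ 0 := sub_ne_zero.2 hd
  rw [propagator, if_neg hab]
  field_simp
  linear_combination (a - b) * h1 - h2

/-- The second face of the loop is unmarked and may have any of the decorations `lam j`; each choice
gives the term computed in `propagator_mul_vw`. -/
theorem dOpAll_one (e f : ℤ) (hn : n = 1) (hef : e = 0 ∧ f = 2) (lam : Fin N → ℂ) (i : Fin n)
    {y : Fin n → ℂ} (hy : Regular r v lam y) (hl : ∀ j, y i ≠ lam j) :
    plainTot r v (stdSpec n e f 0) (Sum.elim y lam) =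
      dOpAll r v (fun y => plainTot r v (stdSpec n e f n) (Sum.elim y lam)) y +
        ∑ j : Fin N, (1 / (ddV r v (y i) * (y i - lam j)) - 1 / (dV r v (y i) - dV r v (lam j))) := by
  subst hn
  obtain rfl : i = 0 := Subsingleton.elim _ _
  have h0 : dOpAll r v (fun y => plainTot r v (stdSpec 1 e f 1) (Sum.elim y lam)) y =
      dOp r v 0 (fun y => plainTot r v (stdSpec 1 e f 1) (Sum.elim y lam)) y := rfl
  have h1 := (plainTot_stdSpec e f (0 : Fin 1) lam hy).2
  have h2 : (1 / ddV r v (y 0)) * loopSum r v (stdSpec 1 e f 1) (Sum.elim y lam) 0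
      (fun s => vw r v (y 0 ::ₘ s)) =
      ∑ j : Fin N, (1 / (ddV r v (y 0) * (y 0 - lam j)) - 1 / (dV r v (y 0) - dV r v (lam j))) := by
    rw [loopSum, Fintype.sum_sum_type, Finset.sum_eq_zero, zero_add, Finset.mul_sum]
    · refine Finset.sum_congr rfl fun j _ => ?_
      rw [pif_pos]
      · have hA := (regular_iff lam y).1 hy (.inl 0) (.inr j)
        exact propagator_mul_vw (hl j) hA.1 (hA.2 (hl j))
      · exact ⟨hef.1, hef.2, fun k => by simp [stdSpec], by simp,
          fun k => Or.inl (Subsingleton.elim _ _)⟩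
    · intro k _
      refine pif_neg (fun h => h.2.2.2.1 ?_) _ _
      rw [Subsingleton.elim k 0]
  rw [h0]
  change dOp r v 0 (fun y => plainTot r v (stdSpec 1 e f 1) (Sum.elim y lam)) y =
    plainTot r v (stdSpec 1 e f 0) (Sum.elim y lam) - (1 / ddV r v (y 0)) *
        loopSum r v (stdSpec 1 e f 1) (Sum.elim y lam) 0 (fun s => vw r v (y 0 ::ₘ s)) at h1
  rw [h1, h2]
  ring

theorem hasDerivAt_dV (z : ℂ) : HasDerivAt (dV r v) (ddV r v z) z :=
  Polynomial.hasDerivAt _ z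

/-- The loop separates the two marked faces. It intervenes when the operator of the index `1` is
applied, and the correction is the image of its contribution under the operator of the index `0`. -/
theorem dOpAll_two (e f : ℤ) (hn : n = 2) (hef : e = 0 ∧ f = 2) (lam : Fin N → ℂ) (i j : Fin n)
    (hi : (i : ℕ) = 0) (hj : (j : ℕ) = 1)
    {y : Fin n → ℂ} (hy : Regular r v lam y) (hl : y i ≠ y j) :
    plainTot r v (stdSpec n e f 0) (Sum.elim y lam) =
      dOpAll r v (fun y => plainTot r v (stdSpec n e f n) (Sum.elim y lam)) y +
        (1 / (ddV r v (y i) * ddV r v (y j) * (y i - y j) ^ 2) -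
          1 / (dV r v (y i) - dV r v (y j)) ^ 2) := by
  subst hn
  obtain rfl : i = 0 := Fin.ext hi
  obtain rfl : j = 1 := Fin.ext hj
  have h0 : dOpAll r v (fun y => plainTot r v (stdSpec 2 e f 2) (Sum.elim y lam)) y =
      dOp r v 0 (dOp r v 1 (fun y => plainTot r v (stdSpec 2 e f 2) (Sum.elim y lam))) y := rfl
  set U : Set (Fin 2 → ℂ) := {y | Regular r v lam y} ∩ {y | y 0 ≠ y 1} with hU
  have hUo : IsOpen U := (isOpen_regular lam).inter
    (isOpen_ne_fun (continuous_apply 0) (continuous_apply 1))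
  -- The contribution of the loop, from `propagator_mul_vw` at `a = y 1` and `b = y 0`.
  set h : (Fin 2 → ℂ) → ℂ := fun y =>
    1 / (ddV r v (y 1) * (y 1 - y 0)) - 1 / (dV r v (y 1) - dV r v (y 0)) with hh
  have h1 : ∀ y ∈ U, dOp r v 1 (fun y => plainTot r v (stdSpec 2 e f 2) (Sum.elim y lam)) y =
      plainTot r v (stdSpec 2 e f 1) (Sum.elim y lam) - h y := by
    rintro y ⟨hy, hy'⟩
    have h1 := (plainTot_stdSpec e f (1 : Fin 2) lam hy).2
    change dOp r v 1 (fun y => plainTot r v (stdSpec 2 e f 2) (Sum.elim y lam)) y =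
      plainTot r v (stdSpec 2 e f 1) (Sum.elim y lam) - (1 / ddV r v (y 1)) *
        loopSum r v (stdSpec 2 e f 2) (Sum.elim y lam) 1 (fun s => vw r v (y 1 ::ₘ s)) at h1
    rw [h1]
    congr 1
    rw [loopSum, Finset.sum_eq_single (.inl 0), pif_pos]
    · have hA := (regular_iff lam y).1 hy (.inl 1) (.inl 0)
      exact propagator_mul_vw (Ne.symm hy') hA.1 (hA.2 (Ne.symm hy'))
    · refine ⟨hef.1, hef.2, fun k => by simp [stdSpec]; omega, by simp, fun k => ?_⟩
      fin_cases k
      · right; rfl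
      · left; rfl
    · intro ℓ _ hℓ
      refine pif_neg (fun h => hℓ ?_) _ _
      have := h.2.2.2.2 0
      simpa using this
    · simp
  rw [h0, dOp_congr 0 hUo h1 ⟨hy, hl⟩]
  obtain ⟨h2, h3⟩ := plainTot_stdSpec (r := r) (v := v) e f (0 : Fin 2) lam hy
  rw [loopSum_stdSpec_eq_zero (by simp), mul_zero, sub_zero] at h3
  change DifferentiableAt ℂ (fun t => plainTot r v (stdSpec 2 e f 1)
      (Sum.elim (Function.update y 0 t) lam)) (y 0) at h2
  change dOp r v 0 (fun y => plainTot r v (stdSpec 2 e f 1) (Sum.elim y lam)) y =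
      plainTot r v (stdSpec 2 e f 0) (Sum.elim y lam) at h3
  have hA := (regular_iff lam y).1 hy (.inl 1) (.inl 0)
  have hB := (regular_iff lam y).1 hy (.inl 0) (.inl 1)
  have a1 : ddV r v (y 1) ≠ 0 := hA.1
  have a0 : ddV r v (y 0) ≠ 0 := hB.1
  have a2 : dV r v (y 1) - dV r v (y 0) ≠ 0 := sub_ne_zero.2 (hA.2 (Ne.symm hl))
  have a3 : y 1 - y 0 ≠ 0 := sub_ne_zero.2 (Ne.symm hl)
  have h4 : HasDerivAt (fun t => h (Function.update y 0 t))
      (1 / (ddV r v (y 1) * (y 1 - y 0) ^ 2) - ddV r v (y 0) / (dV r v (y 1) - dV r v (y 0)) ^ 2)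
      (y 0) := by
    have h5 : (fun t => h (Function.update y 0 t)) = fun t =>
        1 / (ddV r v (y 1) * (y 1 - t)) - 1 / (dV r v (y 1) - dV r v t) := by
      funext t
      simp [hh]
    rw [h5]
    have h6 : HasDerivAt (fun t => ddV r v (y 1) * (y 1 - t)) (ddV r v (y 1) * (0 - 1)) (y 0) :=
      ((hasDerivAt_const _ _).sub (hasDerivAt_id' _)).const_mul _
    have h7 : HasDerivAt (fun t => dV r v (y 1) - dV r v t) (0 - ddV r v (y 0)) (y 0) :=
      (hasDerivAt_const _ _).sub (hasDerivAt_dV _)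
    have h8 := (h6.fun_inv (mul_ne_zero a1 a3)).fun_sub (h7.fun_inv a2)
    simp only [one_div]
    refine h8.congr_deriv ?_
    field_simp
    ring
  have h5 : dOp r v 0 (fun y => plainTot r v (stdSpec 2 e f 1) (Sum.elim y lam) - h y) y =
      plainTot r v (stdSpec 2 e f 0) (Sum.elim y lam) - 1 / ddV r v (y 0) *
      (1 / (ddV r v (y 1) * (y 1 - y 0) ^ 2) -
        ddV r v (y 0) / (dV r v (y 1) - dV r v (y 0)) ^ 2) := by
    rw [← h3]
    unfold dOp
    rw [(h2.hasDerivAt.fun_sub h4).deriv]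
    ring
  rw [h5]
  rw [← neg_sub (y 1) (y 0), ← neg_sub (dV r v (y 1)) (dV r v (y 0))]
  field_simp
  ring

end Operators

/-! ### Residues at infinity -/

section Residues

open Filter Bornology

theorem eventually_sphere {p : ℂ → Prop} (h : ∀ᶠ u in cobounded ℂ, p u) :
    ∀ᶠ R : ℝ in atTop, 0 < R ∧ ∀ u ∈ Metric.sphere (0 : ℂ) R, p u := by
  obtain ⟨R₀, -, h0⟩ := (hasBasis_cobounded_norm (E := ℂ)).eventually_iff.1 h
  filter_upwards [eventually_ge_atTop R₀, eventually_gt_atTop 0] with R hR hR'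
  exact ⟨hR', fun u hu => h0 (by simpa using (by simpa using hu : ‖u‖ = R).symm ▸ hR)⟩

theorem HasResidueAtInfinity.congr {f g : ℂ → ℂ} {c : ℂ} (hf : HasResidueAtInfinity f c)
    (h : ∀ᶠ u in cobounded ℂ, g u = f u) : HasResidueAtInfinity g c := by
  constructor
  · have h1 : ∀ᶠ u in cobounded ℂ, ∀ᶠ w in 𝓝 u, g w = f w := by
      obtain ⟨R₀, -, h0⟩ := (hasBasis_cobounded_norm (E := ℂ)).eventually_iff.1 h
      filter_upwards [eventually_cobounded_le_norm (R₀ + 1)] with u hu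
      have h2 : IsOpen {w : ℂ | R₀ < ‖w‖} := isOpen_lt continuous_const continuous_norm
      filter_upwards [h2.mem_nhds (show R₀ < ‖u‖ by linarith)] with w hw
      exact h0 (show R₀ ≤ ‖w‖ from le_of_lt hw)
    filter_upwards [hf.1, h1] with u h2 h3
    exact h2.congr_of_eventuallyEq h3
  · filter_upwards [hf.2, eventually_sphere h] with R h2 h3
    rw [circleIntegral.integral_congr h3.1.le h3.2]
    exact h2

theorem HasResidueAtInfinity.congr_value {f : ℂ → ℂ} {c d : ℂ} (hf : HasResidueAtInfinity f c)
    (h : c = d) : HasResidueAtInfinity f d := h ▸ hf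

theorem HasResidueAtInfinity.circleIntegrable {f : ℂ → ℂ} {c : ℂ} (hf : HasResidueAtInfinity f c) :
    ∀ᶠ R : ℝ in atTop, CircleIntegrable f 0 R := by
  filter_upwards [eventually_sphere hf.1] with R h
  exact ContinuousOn.circleIntegrable h.1.le
    fun u hu => (h.2 u hu).continuousAt.continuousWithinAt

theorem HasResidueAtInfinity.add {f g : ℂ → ℂ} {c d : ℂ} (hf : HasResidueAtInfinity f c)
    (hg : HasResidueAtInfinity g d) : HasResidueAtInfinity (fun u => f u + g u) (c + d) := by
  refine ⟨by filter_upwards [hf.1, hg.1] with u h1 h2 using h1.add h2, ?_⟩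
  filter_upwards [hf.2, hg.2, hf.circleIntegrable, hg.circleIntegrable] with R h1 h2 h3 h4
  rw [circleIntegral.integral_add h3 h4, ← h1, ← h2]
  ring

theorem HasResidueAtInfinity.const_mul {f : ℂ → ℂ} {c : ℂ} (hf : HasResidueAtInfinity f c)
    (a : ℂ) : HasResidueAtInfinity (fun u => a * f u) (a * c) := by
  refine ⟨by filter_upwards [hf.1] with u h1 using h1.const_mul a, ?_⟩
  filter_upwards [hf.2] with R h1
  rw [circleIntegral.integral_const_mul, ← h1]
  ring

theorem hasResidueAtInfinity_zero : HasResidueAtInfinity (fun _ => 0) 0 :=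
  ⟨by simp, by simp [circleIntegral]⟩

theorem HasResidueAtInfinity.sum {ι : Type*} (s : Finset ι) {f : ι → ℂ → ℂ} {c : ι → ℂ}
    (h : ∀ i ∈ s, HasResidueAtInfinity (f i) (c i)) :
    HasResidueAtInfinity (fun u => ∑ i ∈ s, f i u) (∑ i ∈ s, c i) := by
  classical
  induction s using Finset.induction_on with
  | empty => simpa using hasResidueAtInfinity_zero
  | insert i s hi ih =>
    simp only [Finset.sum_insert hi]
    exact (h i (Finset.mem_insert_self i s)).add
      (ih fun j hj => h j (Finset.mem_insert_of_mem hj))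

/-- The weight of a square vertex decorated by `u`. -/
def sqw (u : ℂ) (s : Multiset ℂ) : ℂ := (s.map fun a => 1 / (u - a)).prod

theorem sqw_zero (u : ℂ) : sqw u 0 = 1 := by simp [sqw]

theorem sqw_cons (u a : ℂ) (s : Multiset ℂ) : sqw u (a ::ₘ s) = 1 / (u - a) * sqw u s := by
  simp [sqw]

theorem eventually_ne_cobounded (a : ℂ) : ∀ᶠ u in cobounded ℂ, u - a ≠ 0 := by
  filter_upwards [eventually_cobounded_le_norm (‖a‖ + 1)] with u hu h
  rw [sub_eq_zero] at h
  rw [h] at hu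
  linarith

theorem differentiable_sqw (s : Multiset ℂ) :
    ∀ᶠ u in cobounded ℂ, DifferentiableAt ℂ (fun u => sqw u s) u := by
  induction s using Multiset.induction with
  | empty => simp [sqw_zero]
  | cons a s ih =>
    filter_upwards [ih, eventually_ne_cobounded a] with u h1 h2
    simp only [sqw_cons]
    exact ((differentiableAt_const 1).div (differentiableAt_id.sub_const a) h2).mul h1

theorem hasResidueAtInfinity_pow (j : ℕ) : HasResidueAtInfinity (fun u => u ^ j) 0 := by
  refine ⟨.of_forall fun u => differentiableAt_pow j, .of_forall fun R => ?_⟩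
  have := circleIntegral.integral_sub_zpow_of_ne (n := j) (by omega) 0 0 R
  simp only [sub_zero, zpow_natCast] at this
  rw [this]
  simp

/-- With two distinct poles, partial fractions give a difference of two products with one factor
less and the same residue. If all poles coincide, the function is a power of `u - a`, of exponent
`-1` only for a single factor. -/
theorem hasResidueAtInfinity_sqw (m : ℕ) (s : Multiset ℂ) (hs : Multiset.card s = m + 1) :
    HasResidueAtInfinity (fun u => sqw u s) (if m = 0 then -1 else 0) := by
  induction m generalizing s with
  | zero =>
    obtain ⟨a, rfl⟩ := Multiset.card_eq_one.1 hs
    refine ⟨differentiable_sqw _, ?_⟩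
    filter_upwards [eventually_gt_atTop ‖a‖] with R hR
    have h1 := circleIntegral.integral_sub_inv_of_mem_ball (c := (0 : ℂ)) (w := a) (R := R)
      (by simpa using hR)
    simp only [sqw, Multiset.map_singleton, Multiset.prod_singleton, one_div, if_true]
    rw [h1, inv_mul_cancel₀]
    simp [Real.pi_ne_zero]
  | succ m ih =>
    rw [if_neg (by omega)]
    by_cases hall : ∃ a b t, s = a ::ₘ b ::ₘ t ∧ a ≠ b
    · obtain ⟨a, b, t, rfl, hab⟩ := hall
      simp only [Multiset.card_cons] at hs
      have h1 := ih (a ::ₘ t) (by rw [Multiset.card_cons]; omega)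
      have h2 := ih (b ::ₘ t) (by rw [Multiset.card_cons]; omega)
      have h3 := (h1.add (h2.const_mul (-1))).const_mul ((a - b)⁻¹)
      rw [neg_one_mul, add_neg_cancel, mul_zero] at h3
      refine h3.congr ?_
      filter_upwards [eventually_ne_cobounded a, eventually_ne_cobounded b] with u ha hb
      have hab' : a - b ≠ 0 := sub_ne_zero.2 hab
      simp only [sqw_cons]
      field_simp
      ring
    · have hpos : 0 < Multiset.card s := by omega
      obtain ⟨a, ha⟩ := Multiset.card_pos_iff_exists_mem.1 hpos
      obtain ⟨t, rfl⟩ := Multiset.exists_cons_of_mem ha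
      have hrep : t = Multiset.replicate (m + 1) a := by
        rw [Multiset.eq_replicate]
        refine ⟨by simpa using hs, fun b hb => ?_⟩
        obtain ⟨t', rfl⟩ := Multiset.exists_cons_of_mem hb
        by_contra hba
        exact hall ⟨a, b, t', rfl, Ne.symm hba⟩
      refine ⟨differentiable_sqw _, .of_forall fun R => ?_⟩
      have h1 := circleIntegral.integral_sub_zpow_of_ne (n := -((m + 2 : ℕ) : ℤ)) (by omega) 0 a R
      have h2 : (fun u => sqw u (a ::ₘ t)) = fun u => (u - a) ^ (-((m + 2 : ℕ) : ℤ)) := by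
        funext u
        rw [sqw_cons, hrep, sqw, Multiset.map_replicate, Multiset.prod_replicate, ← pow_succ',
          zpow_neg, zpow_natCast, one_div, inv_pow]
      rw [h2, h1]
      simp

/-- The residue of `u ^ j ∏ 1 / (u - a)`. -/
theorem hasResidueAtInfinity_pow_sqw (j : ℕ) (s : Multiset ℂ) (hs : s ≠ 0) :
    HasResidueAtInfinity (fun u => u ^ j * sqw u s)
      (-(if Multiset.card s ≤ j + 1 then hsym s (j + 1 - Multiset.card s) else 0)) := by
  induction j generalizing s with
  | zero =>
    obtain ⟨m, hm⟩ := Nat.exists_eq_succ_of_ne_zero (fun h => hs (Multiset.card_eq_zero.1 h))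
    have h1 := hasResidueAtInfinity_sqw m s hm
    simp only [pow_zero, one_mul]
    convert h1 using 1
    rw [hm]
    by_cases h : m = 0
    · subst h; simp [hsym_zero]
    · simp [h]
  | succ j ih =>
    obtain ⟨a, ha⟩ := Multiset.exists_mem_of_ne_zero hs
    obtain ⟨t, rfl⟩ := Multiset.exists_cons_of_mem ha
    -- From `u ^ (j + 1) = a * u ^ j + u ^ j * (u - a)`, where `u - a` removes the pole at `a`; this
    -- matches the recursion `hsym_cons_succ`. If no other pole is left, the second term is a
    -- polynomial.
    have h1 := (ih (a ::ₘ t) hs).const_mul a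
    by_cases ht : t = 0
    · subst ht
      refine ((h1.add (hasResidueAtInfinity_pow j)).congr ?_).congr_value ?_
      · filter_upwards [eventually_ne_cobounded a] with u hu
        simp only [sqw_cons, sqw_zero]
        field_simp
        ring
      · simp only [Multiset.cons_zero, Multiset.card_singleton, hsym_singleton]
        simp
        ring
    · have h2 := ih t ht
      refine ((h1.add h2).congr ?_).congr_value ?_
      · filter_upwards [eventually_ne_cobounded a] with u hu
        simp only [sqw_cons]
        field_simp
        ring
      · rw [Multiset.card_cons]
        by_cases h3 : Multiset.card t ≤ j + 1
        · rw [if_pos h3, if_pos (show Multiset.card t + 1 ≤ j + 1 + 1 by omega)]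
          by_cases h4 : Multiset.card t + 1 ≤ j + 1
          · obtain ⟨k, hk⟩ := Nat.exists_eq_add_of_le h4
            rw [if_pos h4, show j + 1 - (Multiset.card t + 1) = k by omega,
              show j + 1 - Multiset.card t = k + 1 by omega,
              show j + 1 + 1 - (Multiset.card t + 1) = k + 1 by omega, hsym_cons_succ]
            ring
          · rw [if_neg h4, show j + 1 - Multiset.card t = 0 by omega,
              show j + 1 + 1 - (Multiset.card t + 1) = 0 by omega, hsym_zero, hsym_zero]
            ring
        · rw [if_neg h3, if_neg (by omega), if_neg (by omega)]
          ring

variable (r : ℕ) (v : ℕ → ℂ)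

/-- The link between square and black vertices: pairing the weight of a square vertex with `V'`
gives that of a black vertex with the same corners, since both are divided differences of `V'`, up
to sign. -/
theorem hasResidueAtInfinity_dV_sqw (s : Multiset ℂ) (hs : s ≠ 0) :
    HasResidueAtInfinity (fun u => dV r v u * sqw u s) (vw r v s) := by
  have h1 := HasResidueAtInfinity.sum (Finset.Icc 1 (r + 1))
    (fun j _ => (hasResidueAtInfinity_pow_sqw (j - 1) s hs).const_mul (v j))
  convert h1 using 1
  · funext u
    rw [dV_eq, Finset.sum_mul]
    exact Finset.sum_congr rfl fun j _ => by ring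
  · have hpos : 0 < Multiset.card s := Multiset.card_pos.2 hs
    rw [vw, ← Finset.sum_neg_distrib]
    refine (Finset.sum_subset (Finset.Icc_subset_Icc_left hpos) ?_).symm.trans ?_ |>.symm
    · intro j hj hj'
      rw [Finset.mem_Icc] at hj hj'
      rw [if_neg (by omega)]
      ring
    · refine Finset.sum_congr rfl fun j hj => ?_
      rw [Finset.mem_Icc] at hj
      rw [if_pos (by omega), show j - 1 + 1 = j by omega]
      ring

theorem hasResidueAtInfinity_dV : HasResidueAtInfinity (fun u => dV r v u) 0 := by
  have h1 := HasResidueAtInfinity.sum (Finset.Icc 1 (r + 1))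
    (fun j _ => (hasResidueAtInfinity_pow (j - 1)).const_mul (v j))
  simp only [mul_zero, Finset.sum_const_zero] at h1
  refine h1.congr (.of_forall fun u => ?_)
  rw [dV_eq]

theorem tendsto_sqw (s : Multiset ℂ) :
    Tendsto (fun u => sqw u s) (cobounded ℂ) (𝓝 (if s = 0 then 1 else 0)) := by
  have h0 : ∀ a : ℂ, Tendsto (fun u : ℂ => 1 / (u - a)) (cobounded ℂ) (𝓝 0) := fun a => by
    simp only [one_div]
    exact tendsto_inv₀_cobounded.comp (tendsto_sub_const_cobounded a)
  induction s using Multiset.induction with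
  | empty => simp [sqw_zero]
  | cons a s ih =>
    simp only [sqw_cons]
    rw [if_neg (Multiset.cons_ne_zero)]
    simpa using (h0 a).mul ih

/-- One factor `u / (u - a)` tends to `1` and every other factor to `0`. -/
theorem tendsto_mul_sqw (s : Multiset ℂ) (hs : s ≠ 0) :
    Tendsto (fun u => u * sqw u s) (cobounded ℂ) (𝓝 (if Multiset.card s = 1 then 1 else 0)) := by
  obtain ⟨a, ha⟩ := Multiset.exists_mem_of_ne_zero hs
  obtain ⟨t, rfl⟩ := Multiset.exists_cons_of_mem ha
  have h0 : Tendsto (fun u : ℂ => 1 + a * sqw u {a}) (cobounded ℂ) (𝓝 (1 + a * 0)) := by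
    have := tendsto_sqw {a}
    rw [if_neg (Multiset.singleton_ne_zero a)] at this
    exact (this.const_mul a).const_add 1
  have h1 := h0.mul (tendsto_sqw t)
  rw [mul_zero, add_zero, one_mul] at h1
  have h2 : (if Multiset.card (a ::ₘ t) = 1 then (1 : ℂ) else 0) = if t = 0 then 1 else 0 := by
    rw [Multiset.card_cons]
    simp
  rw [h2]
  refine h1.congr' ?_
  filter_upwards [eventually_ne_cobounded a] with u hu
  rw [sqw_cons, show ({a} : Multiset ℂ) = a ::ₘ 0 from rfl, sqw_cons, sqw_zero]
  field_simp
  ring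

end Residues

/-! ### Residues and limits of sums over rooted graphs -/

section Square

open Filter Bornology

variable {r : ℕ} {v : ℕ → ℂ} {n N : ℕ} {K : Type} [Fintype K]

theorem rootTot_residue (X : Spec n K) (val : K ⊕ Fin N → ℂ) (k₀ : K) {h : ℂ → ℂ}
    {φ : ℂ → Multiset ℂ → ℂ} {χ : Multiset ℂ → ℂ}
    (hφ : ∀ s, s ≠ 0 → HasResidueAtInfinity (fun u => h u * φ u s) (χ s)) :
    HasResidueAtInfinity (fun u => h u * rootTot r v X val k₀ (φ u)) (rootTot r v X val k₀ χ) := by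
  obtain ⟨ι, _, a, s, hs, hsum⟩ := rootTot_eq_sum (r := r) (v := v) X val k₀
  simp only [hsum]
  refine (HasResidueAtInfinity.sum Finset.univ fun i _ => (hφ (s i) (hs i)).const_mul (a i)).congr
    (.of_forall fun u => ?_)
  rw [Finset.mul_sum]
  exact Finset.sum_congr rfl fun i _ => by ring

theorem rootTot_tendsto (X : Spec n K) (val : K ⊕ Fin N → ℂ) (k₀ : K) {h : ℂ → ℂ}
    {φ : ℂ → Multiset ℂ → ℂ} {χ : Multiset ℂ → ℂ} {l : Filter ℂ}
    (hφ : ∀ s, s ≠ 0 → Tendsto (fun u => h u * φ u s) l (𝓝 (χ s))) :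
    Tendsto (fun u => h u * rootTot r v X val k₀ (φ u)) l (𝓝 (rootTot r v X val k₀ χ)) := by
  obtain ⟨ι, _, a, s, hs, hsum⟩ := rootTot_eq_sum (r := r) (v := v) X val k₀
  simp only [hsum]
  refine (tendsto_finsetSum Finset.univ fun i _ => (hφ (s i) (hs i)).const_mul (a i)).congr
    fun u => ?_
  rw [Finset.mul_sum]
  exact Finset.sum_congr rfl fun i _ => by ring

/-- The residue turns the square vertex into a black one with the corner `z` of the cilium included,
and these sum to zero by `rootTot_self`. Only the segment is left. -/
theorem cilTot_residue (X : Spec n K) (val : K ⊕ Fin N → ℂ) (k₀ : K) (hX : ¬ X.cil k₀) (hX' : X.next k₀ = k₀)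
    (hv : ∀ p q : K ⊕ Fin N, vw r v {val p, val q} ≠ 0) :
    HasResidueAtInfinity (fun u => dV r v u * cilTot r v X val k₀ (sqw u))
    (pif (X.e = -1 ∧ X.f = 1 ∧ ∀ k, k = k₀)
      (-(dV r v (val (.inl k₀)) / ddV r v (val (.inl k₀)))) 0) := by
  set z := val (.inl k₀) with hz
  set P := propagator r v z z with hP
  have hdd : ddV r v z ≠ 0 := by
    have := hv (.inl k₀) (.inl k₀)
    rw [vw_pair] at this
    exact neg_ne_zero.1 this
  have hPd : P = 1 / ddV r v z := by rw [hP, propagator, if_pos rfl]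
  have h1 := (rootTot_residue (r := r) (v := v) X val k₀ (h := dV r v)
    (φ := fun u s => sqw u (z ::ₘ s)) (χ := fun s => vw r v (z ::ₘ s))
    (fun s _ => hasResidueAtInfinity_dV_sqw r v _ (Multiset.cons_ne_zero))).const_mul P
  rw [rootTot_self X val k₀ hX hX' (by rw [← hz, ← hP, hPd]; field_simp), mul_zero] at h1
  have h2 := (hasResidueAtInfinity_dV_sqw r v {z} (Multiset.singleton_ne_zero z)).const_mul P
  rw [vw_singleton] at h2
  by_cases hs : X.e = -1 ∧ X.f = 1 ∧ ∀ k, k = k₀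
  · rw [pif_pos hs]
    have h3 := h2.add h1
    rw [show P * -dV r v z + 0 = -(dV r v z / ddV r v z) by rw [hPd]; ring] at h3
    refine h3.congr (.of_forall fun u => ?_)
    rw [cilTot_eq X val k₀ _ hX hX', pif_pos hs, ← hz, ← hP]
    ring
  · rw [pif_neg hs]
    refine h1.congr (.of_forall fun u => ?_)
    rw [cilTot_eq X val k₀ _ hX hX', pif_neg hs, ← hz, ← hP]
    ring

/-- The factor `u - z` cancels the corner due to the cilium, so the root is weighted by `vw` of the
other corners, as in `rootTot_vw`. For the segment only the polynomial `V'` remains, which has no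
residue. -/
theorem cilTot_residue_mul (X : Spec n K) (val : K ⊕ Fin N → ℂ) (k₀ : K) (hX : ¬ X.cil k₀) (hX' : X.next k₀ = k₀)
    (hv : ∀ p q : K ⊕ Fin N, vw r v {val p, val q} ≠ 0) :
    HasResidueAtInfinity (fun u => dV r v u * (u - val (.inl k₀)) * cilTot r v X val k₀ (sqw u))
      (propagator r v (val (.inl k₀)) (val (.inl k₀)) *
        (-dV r v (val (.inl k₀)) * plainTot r v (X.addCil k₀) val +
          loopSum r v X val k₀ (vw r v))) := by
  rw [← rootTot_vw X val k₀ hX hX' hv]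
  set z := val (.inl k₀) with hz
  set P := propagator r v z z with hP
  have h1 := (rootTot_residue (r := r) (v := v) X val k₀ (h := fun u => dV r v u * (u - z))
    (φ := fun u s => sqw u (z ::ₘ s)) (χ := vw r v)
    (fun s hs => (hasResidueAtInfinity_dV_sqw r v s hs).congr (by
      filter_upwards [eventually_ne_cobounded z] with u hu
      rw [sqw_cons]
      field_simp))).const_mul P
  have h2 := (hasResidueAtInfinity_dV r v).const_mul P
  rw [mul_zero] at h2
  by_cases hs : X.e = -1 ∧ X.f = 1 ∧ ∀ k, k = k₀
  · have h3 := h2.add h1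
    rw [zero_add] at h3
    refine h3.congr ?_
    filter_upwards [eventually_ne_cobounded z] with u hu
    rw [cilTot_eq X val k₀ _ hX hX', pif_pos hs, ← hz, ← hP,
      show ({z} : Multiset ℂ) = z ::ₘ 0 from rfl, sqw_cons, sqw_zero]
    field_simp
  · refine h1.congr (.of_forall fun u => ?_)
    rw [cilTot_eq X val k₀ _ hX hX', pif_neg hs, ← hz, ← hP]
    ring

/-- The cilium accounts for one factor `1 / (u - z)`; after multiplication by `u ^ 2` only the roots
with exactly one further corner survive. The segment decays like `1 / u` and has to be subtracted.
-/
theorem cilTot_tendsto (X : Spec n K) (val : K ⊕ Fin N → ℂ) (k₀ : K) (hX : ¬ X.cil k₀) (hX' : X.next k₀ = k₀) :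
    Tendsto (fun u => u ^ 2 * (cilTot r v X val k₀ (sqw u) -
      pif (X.e = -1 ∧ X.f = 1 ∧ ∀ k, k = k₀)
        (1 / (ddV r v (val (.inl k₀)) * (u - val (.inl k₀)))) 0)) (cobounded ℂ)
      (𝓝 (plainTot r v (X.addCil k₀) val / ddV r v (val (.inl k₀)))) := by
  rw [← rootTot_univalent X val k₀ hX hX']
  set z := val (.inl k₀) with hz
  set P := propagator r v z z with hP
  have hPd : P = 1 / ddV r v z := by rw [hP, propagator, if_pos rfl]
  have h1 := (rootTot_tendsto (r := r) (v := v) X val k₀ (h := fun u => u ^ 2)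
    (φ := fun u s => sqw u (z ::ₘ s)) (χ := fun s => pif (Multiset.card s = 1) 1 0)
    (l := cobounded ℂ) (fun s hs => by
      have h2 := tendsto_mul_sqw s hs
      have h3 := tendsto_mul_sqw {z} (Multiset.singleton_ne_zero z)
      rw [if_pos (Multiset.card_singleton z)] at h3
      have h4 := h3.mul h2
      rw [one_mul] at h4
      have h5 : pif (Multiset.card s = 1) 1 0 = if Multiset.card s = 1 then 1 else 0 := by
        unfold pif; congr
      rw [h5]
      refine h4.congr fun u => ?_
      rw [sqw_cons, show ({z} : Multiset ℂ) = z ::ₘ 0 from rfl, sqw_cons, sqw_zero]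
      ring)).const_mul P
  rw [show ∀ x : ℂ, P * x = x / ddV r v z from fun x => by rw [hPd]; ring] at h1
  refine h1.congr fun u => ?_
  rw [cilTot_eq X val k₀ _ hX hX', ← hz, ← hP]
  by_cases hs : X.e = -1 ∧ X.f = 1 ∧ ∀ k, k = k₀
  · rw [pif_pos hs, pif_pos hs, show ({z} : Multiset ℂ) = z ::ₘ 0 from rfl, sqw_cons, sqw_zero, hPd]
    simp only [one_div, mul_inv]
    ring
  · rw [pif_neg hs, pif_neg hs]
    ring

end Square

/-! ### Splitting a cycle of a permutation -/

section SplitCycle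

variable {D : Type} [DecidableEq D] {σ τ : Perm D} {x y : D}

theorem mul_swap_of_ne (hτ : τ = σ * swap x y) {d : D} (h1 : d ≠ x) (h2 : d ≠ y) : τ d = σ d := by
  rw [hτ, Perm.mul_apply, swap_apply_of_ne_of_ne h1 h2]

theorem mul_swap_left (hτ : τ = σ * swap x y) : τ x = σ y := by
  rw [hτ, Perm.mul_apply, swap_apply_left]

theorem mul_swap_right (hτ : τ = σ * swap x y) : τ y = σ x := by
  rw [hτ, Perm.mul_apply, swap_apply_right]

theorem sameCycle_of_split (hτ : τ = σ * swap x y) (hxy : σ.SameCycle x y) {d d' : D}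
    (h : τ.SameCycle d d') : σ.SameCycle d d' := by
  have key : ∀ u, σ.SameCycle d (τ u) ↔ σ.SameCycle d u := fun u => by
    by_cases h1 : u = x
    · rw [h1, mul_swap_left hτ]
      exact ⟨fun h => (h.trans (sameCycle_step σ y).symm).trans hxy.symm,
        fun h => (h.trans hxy).trans (sameCycle_step σ y)⟩
    by_cases h2 : u = y
    · rw [h2, mul_swap_right hτ]
      exact ⟨fun h => (h.trans (sameCycle_step σ x).symm).trans hxy,
        fun h => (h.trans hxy.symm).trans (sameCycle_step σ x)⟩
    rw [mul_swap_of_ne hτ h1 h2]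
    exact ⟨fun h => h.trans (sameCycle_step σ u).symm, fun h => h.trans (sameCycle_step σ u)⟩
  exact (SameCycle.invariant_prop key h).1 (Perm.SameCycle.refl _ _)

theorem split_of_sameCycle (hτ : τ = σ * swap x y) (hxy : σ.SameCycle x y) {d d' : D}
    (h : σ.SameCycle d d') (hd : ¬ σ.SameCycle x d) : τ.SameCycle d d' := by
  have hx : ∀ u, u = x ∨ u = y → ¬ τ.SameCycle d u := by
    rintro u (rfl | rfl) h'
    · exact hd (sameCycle_of_split hτ hxy h').symm
    · exact hd (hxy.trans (sameCycle_of_split hτ hxy h').symm)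
  have key : ∀ u, τ.SameCycle d (σ u) ↔ τ.SameCycle d u := fun u => by
    by_cases h1 : u = x
    · rw [h1, ← mul_swap_right hτ]
      exact ⟨fun h => absurd (h.trans (sameCycle_step τ y).symm) (hx y (Or.inr rfl)),
        fun h => absurd h (hx x (Or.inl rfl))⟩
    by_cases h2 : u = y
    · rw [h2, ← mul_swap_left hτ]
      exact ⟨fun h => absurd (h.trans (sameCycle_step τ x).symm) (hx x (Or.inl rfl)),
        fun h => absurd h (hx y (Or.inr rfl))⟩
    rw [← mul_swap_of_ne hτ h1 h2]
    exact ⟨fun h => h.trans (sameCycle_step τ u).symm, fun h => h.trans (sameCycle_step τ u)⟩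
  exact (SameCycle.invariant_prop key h).1 (Perm.SameCycle.refl _ _)

theorem split_or (hτ : τ = σ * swap x y) {d : D} (h : σ.SameCycle x d) :
    τ.SameCycle x d ∨ τ.SameCycle y d := by
  have key : ∀ u, (τ.SameCycle x (σ u) ∨ τ.SameCycle y (σ u)) ↔
      (τ.SameCycle x u ∨ τ.SameCycle y u) := fun u => by
    by_cases h1 : u = x
    · rw [h1, ← mul_swap_right hτ]
      exact ⟨fun _ => Or.inl (Perm.SameCycle.refl _ _), fun _ => Or.inr (sameCycle_step τ y)⟩
    by_cases h2 : u = y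
    · rw [h2, ← mul_swap_left hτ]
      exact ⟨fun _ => Or.inr (Perm.SameCycle.refl _ _), fun _ => Or.inl (sameCycle_step τ x)⟩
    rw [← mul_swap_of_ne hτ h1 h2]
    exact ⟨fun h => h.imp (fun h => h.trans (sameCycle_step τ u).symm)
      (fun h => h.trans (sameCycle_step τ u).symm), fun h => h.imp
      (fun h => h.trans (sameCycle_step τ u)) (fun h => h.trans (sameCycle_step τ u))⟩
  exact (SameCycle.invariant_prop (p := fun u => τ.SameCycle x u ∨ τ.SameCycle y u) key h).1
    (Or.inl (Perm.SameCycle.refl _ _))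

theorem exists_iterate_of_sameCycle [Finite D] {d d' : D} (h : σ.SameCycle d d') :
    ∃ i : ℕ, (σ^[i]) d = d' := by
  obtain ⟨i, -, hi⟩ := h.exists_pow_eq' 
  exact ⟨i, by rw [← hi]; exact (congrFun (Perm.iterate_eq_pow σ i) d)⟩

theorem sameCycle_iterate (d : D) (i : ℕ) : σ.SameCycle d ((σ^[i]) d) := by
  induction i with
  | zero => exact Perm.SameCycle.refl _ _
  | succ i ih =>
    rw [Function.iterate_succ_apply']
    exact ih.trans (sameCycle_step σ _)

/-- The elements met by `σ` after `y`, up to the first arrival at `x`, form a set containing `x` but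
not `y`; it is stable under `τ`, which sends `x` back to `σ y`. -/
theorem not_sameCycle_of_split [Finite D] (hτ : τ = σ * swap x y) (hxy : σ.SameCycle x y)
    (hne : x ≠ y) : ¬ τ.SameCycle x y := by
  classical
  have hex : ∃ j : ℕ, (σ^[j]) y = x := exists_iterate_of_sameCycle hxy.symm
  set j := Nat.find hex with hj
  have hjx : (σ^[j]) y = x := Nat.find_spec hex
  have hmin : ∀ i < j, (σ^[i]) y ≠ x := fun i hi => Nat.find_min hex hi
  have hny : ∀ i, 0 < i → i ≤ j → (σ^[i]) y ≠ y := fun i h0 h1 h2 => by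
    have h3 : (σ^[j - i]) ((σ^[i]) y) = x := by
      rw [← Function.iterate_add_apply, Nat.sub_add_cancel h1, hjx]
    rw [h2] at h3
    exact hmin (j - i) (by omega) h3
  have hstep : ∀ u, (∃ i, 0 < i ∧ i ≤ j ∧ (σ^[i]) y = u) → ∃ i, 0 < i ∧ i ≤ j ∧ (σ^[i]) y = τ u := by
    rintro u ⟨i, h0, h1, rfl⟩
    by_cases hij : i = j
    · rw [hij, hjx, mul_swap_left hτ]
      exact ⟨1, by omega, by omega, rfl⟩
    · refine ⟨i + 1, by omega, by omega, ?_⟩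
      rw [mul_swap_of_ne hτ (hmin i (by omega)) (hny i h0 h1), Function.iterate_succ_apply']
  intro h
  obtain ⟨m, hm⟩ := exists_iterate_of_sameCycle h
  have hj0 : 0 < j := by
    rcases Nat.eq_zero_or_pos j with h0 | h0
    · rw [h0] at hjx; exact absurd hjx.symm hne
    · exact h0
  have hall : ∀ m, ∃ i, 0 < i ∧ i ≤ j ∧ (σ^[i]) y = (τ^[m]) x := fun m => by
    induction m with
    | zero => exact ⟨j, hj0, le_rfl, hjx⟩
    | succ m ih =>
      rw [Function.iterate_succ_apply']
      exact hstep _ ih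
  obtain ⟨i, h0, h1, h2⟩ := hall m
  exact hny i h0 h1 (h2.trans hm)

/-- `σ` sends `x` to `τ y` and then follows the `τ`-cycle of `y`, on which `x` does not lie, until
it reaches `y`. -/
theorem sameCycle_of_merge [Finite D] (hτ : τ = σ * swap x y) (h : ¬ τ.SameCycle x y) :
    σ.SameCycle x y := by
  have hσ : σ = τ * swap x y := by rw [hτ, mul_assoc, swap_mul_self, mul_one]
  have key : ∀ i : ℕ, σ.SameCycle x y ∨ σ.SameCycle x ((τ^[i + 1]) y) := fun i => by
    induction i with
    | zero =>
      right
      rw [zero_add, Function.iterate_one, ← mul_swap_left hσ]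
      exact sameCycle_step σ x
    | succ i ih =>
      rcases ih with ih | ih
      · exact Or.inl ih
      · by_cases h1 : (τ^[i + 1]) y = y
        · rw [h1] at ih; exact Or.inl ih
        · right
          rw [Function.iterate_succ_apply', ← mul_swap_of_ne hσ _ h1]
          · exact ih.trans (sameCycle_step σ _)
          · intro h2
            exact h (h2 ▸ (sameCycle_iterate (σ := τ) y (i + 1))).symm
  obtain ⟨m, hm⟩ := exists_iterate_of_sameCycle (sameCycle_step τ y).symm
  rw [← Function.iterate_succ_apply] at hm
  rcases key m with h1 | h1
  · exact h1
  · rwa [hm] at h1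

/-- A transposition of two points of one cycle cuts it in two and leaves the other cycles alone.
This is why an edge drawn inside a face creates exactly one face. -/
theorem card_orbs_split [Fintype D] (hτ : τ = σ * swap x y) (hxy : σ.SameCycle x y) (hne : x ≠ y) :
    (orbs τ).card = (orbs σ).card + 1 := by
  classical
  have h1 : ∀ d, ¬ σ.SameCycle x d → orb τ d = orb σ d := fun d hd => by
    ext d'
    rw [mem_orb, mem_orb]
    exact ⟨sameCycle_of_split hτ hxy, fun h => split_of_sameCycle hτ hxy h hd⟩
  have hx : orb τ x ∉ (orbs σ).erase (orb σ x) := fun h => by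
    rw [Finset.mem_erase] at h
    exact h.1 (eq_orb_of_mem h.2 (mem_orb_self τ x))
  have hy : orb τ y ∉ (orbs σ).erase (orb σ x) := fun h => by
    rw [Finset.mem_erase] at h
    exact h.1 ((eq_orb_of_mem h.2 (mem_orb_self τ y)).trans (orb_eq_orb.2 hxy.symm))
  have h2 : orbs τ = insert (orb τ x) (insert (orb τ y) ((orbs σ).erase (orb σ x))) := by
    ext s
    rw [Finset.mem_insert, Finset.mem_insert, Finset.mem_erase]
    constructor
    · intro hs
      obtain ⟨d, rfl⟩ := mem_orbs.1 hs
      by_cases hd : σ.SameCycle x d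
      · rcases split_or hτ hd with h | h
        · exact Or.inl (orb_eq_orb.2 h.symm)
        · exact Or.inr (Or.inl (orb_eq_orb.2 h.symm))
      · right; right
        rw [h1 d hd]
        exact ⟨fun h => hd (orb_eq_orb.1 h).symm, orb_mem_orbs σ d⟩
    · rintro (rfl | rfl | ⟨h, hs⟩)
      · exact orb_mem_orbs τ x
      · exact orb_mem_orbs τ y
      · obtain ⟨d, rfl⟩ := mem_orbs.1 hs
        rw [← h1 d (fun h' => h (orb_eq_orb.2 h'.symm))]
        exact orb_mem_orbs τ d
  rw [h2, Finset.card_insert_of_notMem, Finset.card_insert_of_notMem hy,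
    Finset.card_erase_of_mem (orb_mem_orbs σ x)]
  · have := Finset.card_pos.2 ⟨_, orb_mem_orbs σ x⟩
    omega
  · rw [Finset.mem_insert]
    rintro (h | h)
    · exact not_sameCycle_of_split hτ hxy hne (orb_eq_orb.1 h)
    · exact hx h

end SplitCycle

/-! ### Positions along a cycle -/

section Positions

variable {D : Type} [Finite D] {f : Perm D} {e c : D}

/-- Walking along the cycle of `e` one meets `d` before `c`. -/
def Before (f : Perm D) (e c d : D) : Prop := ∃ s : ℕ, (f^[s]) e = d ∧ ∀ t ≤ s, (f^[t]) e ≠ c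

theorem before_self (h : e ≠ c) : Before f e c e :=
  ⟨0, rfl, fun t ht => by rw [Nat.le_zero.1 ht]; exact h⟩

theorem not_before : ¬ Before f e c c := fun ⟨s, h1, h2⟩ => h2 s le_rfl h1

theorem before_step {d : D} (h1 : f d ≠ c) (h2 : f d ≠ e) : Before f e c (f d) ↔ Before f e c d := by
  constructor
  · rintro ⟨s, h3, h4⟩
    rcases s with _ | s
    · exact absurd h3.symm h2
    · rw [Function.iterate_succ_apply'] at h3
      exact ⟨s, f.injective h3, fun t ht => h4 t (by omega)⟩
  · rintro ⟨s, h3, h4⟩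
    refine ⟨s + 1, by rw [Function.iterate_succ_apply', h3], fun t ht => ?_⟩
    rcases Nat.lt_or_ge t (s + 1) with h5 | h5
    · exact h4 t (by omega)
    · rw [show t = s + 1 by omega, Function.iterate_succ_apply', h3]; exact h1

theorem before_pred (hec : f.SameCycle e c) (hne : e ≠ c) {d : D} (h : f d = c) :
    Before f e c d := by
  classical
  have hex : ∃ j : ℕ, (f^[j]) e = c := exists_iterate_of_sameCycle hec
  obtain ⟨j, hj⟩ : ∃ j, Nat.find hex = j + 1 := by
    refine Nat.exists_eq_succ_of_ne_zero fun h0 => hne ?_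
    have := Nat.find_spec hex
    rwa [h0] at this
  have h1 := Nat.find_spec hex
  rw [hj, Function.iterate_succ_apply'] at h1
  exact ⟨j, f.injective (h1.trans h.symm), fun t ht => Nat.find_min hex (by omega)⟩

theorem not_before_of_last (hec : f.SameCycle e c) {d : D} (h : f d = e) :
    ¬ Before f e c d := by
  classical
  rintro ⟨s, h1, h2⟩
  obtain ⟨j, hj⟩ := exists_iterate_of_sameCycle hec
  have hper : Function.IsPeriodicPt f (s + 1) e := by
    unfold Function.IsPeriodicPt Function.IsFixedPt
    rw [Function.iterate_succ_apply', h1, h]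
  have h3 : (f^[j % (s + 1)]) e = c := by
    rw [hper.iterate_mod_apply j, hj]
  exact h2 _ (by have := Nat.mod_lt j (show 0 < s + 1 by omega); omega) h3

/-- Along the cycle, `p` can change only on arriving at `e`, where it holds, or at `c`, where it
fails. This identifies the labels of a split face with positions along the face. -/
theorem before_unique {p : D → Prop} (h1 : p e) (h2 : ¬ p c)
    (h3 : ∀ d, f d ≠ c → f d ≠ e → (p (f d) ↔ p d)) {d : D} (hd : f.SameCycle e d) :
    p d ↔ Before f e c d := by
  classical
  constructor
  · intro hp
    by_contra hb
    have hex : ∃ j : ℕ, (f^[j]) e = d := exists_iterate_of_sameCycle hd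
    set s := Nat.find hex with hs
    have hsd : (f^[s]) e = d := Nat.find_spec hex
    have h4 : ∃ t ≤ s, (f^[t]) e = c := by
      by_contra hcon
      push Not at hcon
      exact hb ⟨s, hsd, hcon⟩
    obtain ⟨t, ht, htc⟩ := h4
    have key : ∀ i, t + i ≤ s → ¬ p ((f^[t + i]) e) := fun i => by
      induction i with
      | zero => intro _; rw [add_zero, htc]; exact h2
      | succ i ih =>
        intro hi
        rw [← add_assoc, Function.iterate_succ_apply']
        by_cases h5 : f ((f^[t + i]) e) = c
        · rw [h5]; exact h2
        · rw [h3 _ h5]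
          · exact ih (by omega)
          · intro h6
            rw [← Function.iterate_succ_apply' f (t + i) e] at h6
            refine Nat.find_min hex (m := s - (t + i + 1)) (by omega) ?_
            have h7 : (f^[s - (t + i + 1)]) ((f^[t + i + 1]) e) = d := by
              rw [← Function.iterate_add_apply, Nat.sub_add_cancel (by omega), hsd]
            rwa [h6] at h7
    have := key (s - t) (by omega)
    rw [Nat.add_sub_of_le ht, hsd] at this
    exact this hp
  · rintro ⟨s, rfl, h4⟩
    have key : ∀ i ≤ s, p ((f^[i]) e) := fun i => by
      induction i with
      | zero => intro _; exact h1
      | succ i ih =>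
        intro hi
        rw [Function.iterate_succ_apply']
        by_cases h5 : f ((f^[i]) e) = e
        · rw [h5]; exact h1
        · rw [h3 _ _ h5]
          · exact ih (by omega)
          · rw [← Function.iterate_succ_apply' f i e]; exact h4 _ hi
    exact key s le_rfl

/-- Sums over a cycle. -/
theorem sum_cycle [Fintype D] (e : D) (g : D → ℂ) :
    ∑ d, pif (f.SameCycle e d) (g d) 0 =
      ∑ i ∈ Finset.range (Function.minimalPeriod f e), g ((f^[i]) e) := by
  classical
  have h0 : ∀ d, pif (f.SameCycle e d) (g d) 0 = if f.SameCycle e d then g d else 0 := fun d => by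
    unfold pif; congr
  simp only [h0]
  rw [← Finset.sum_filter]
  symm
  refine Finset.sum_bij (fun i _ => (f^[i]) e) ?_ ?_ ?_ ?_
  · intro i _
    simpa using sameCycle_iterate e i
  · intro i hi j hj h
    exact Function.iterate_injOn_Iio_minimalPeriod (by simpa using hi) (by simpa using hj) h
  · intro d hd
    obtain ⟨i, hi⟩ := exists_iterate_of_sameCycle (Finset.mem_filter.1 hd).2
    have hpos : 0 < Function.minimalPeriod f e :=
      Function.minimalPeriod_pos_of_mem_periodicPts
        (f.injective.mem_periodicPts e)
    refine ⟨i % Function.minimalPeriod f e, by simpa using Nat.mod_lt _ hpos, ?_⟩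
    rw [Function.iterate_mod_minimalPeriod_eq, hi]
  · intros; rfl

end Positions

/-! ### Splitting a face by a new edge from a white vertex to a corner -/

section SplitFace

variable {n N : ℕ} {K D : Type}

open Classical in
/-- The labels after the splitting of the face `a`, at the dart `e` and the corner `c`. -/
def Cfg.splitLab (G : Cfg n (K ⊕ Fin N) D) (a : K) (e c d : D) : Option K ⊕ Fin N :=
  if G.deco d = .inl a ∧ ¬ Before G.face e c d then .inl none else Sum.map some id (G.deco d)

/-- The graph obtained by joining the white vertex of `e` to the corner of `c` by a new edge. -/
def Cfg.split (G : Cfg n (K ⊕ Fin N) D) (a : K) (e c : D) :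
    Cfg n (Option K ⊕ Fin N) (Option (Option D)) where
  rot := insOpt (insOpt G.rot c) (some e)
  opp := insOpt (fixOpt G.opp) none
  ty := ext2 (G.ty e) .black G.ty
  deco := ext2 (.inl none) (.inl (some a)) (G.splitLab a e c)

section Tables

variable (G : Cfg n (K ⊕ Fin N) D) (a : K) {e c : D}

theorem split_rot_none (h : e ≠ c) : (G.split a e c).rot none = some (some (G.rot e)) := by
  simp [Cfg.split, insOpt_of_ne _ _ h]

theorem split_rot_some_none : (G.split a e c).rot (some none) = some (some (G.rot c)) := by
  simp [Cfg.split, insOpt_of_ne]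

theorem split_rot_left : (G.split a e c).rot (some (some e)) = none := by
  simp [Cfg.split]

theorem split_rot_right (h : e ≠ c) : (G.split a e c).rot (some (some c)) = some none := by
  simp [Cfg.split, insOpt_of_ne _ _ (show (some c : Option D) ≠ some e by simpa using h.symm)]

theorem split_rot_of_ne {d : D} (h1 : d ≠ e) (h2 : d ≠ c) :
    (G.split a e c).rot (some (some d)) = some (some (G.rot d)) := by
  simp [Cfg.split, insOpt_of_ne _ _ (show (some d : Option D) ≠ some e by simpa using h1),
    insOpt_of_ne _ _ h2]

theorem split_symm_of_ne {b : D} (h1 : b ≠ G.rot e) (h2 : b ≠ G.rot c) :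
    (G.split a e c).rot.symm (some (some b)) = some (some (G.rot.symm b)) := by
  rw [symm_apply_eq, split_rot_of_ne, apply_symm_apply]
  · exact fun h' => h1 (by rw [← h', apply_symm_apply])
  · exact fun h' => h2 (by rw [← h', apply_symm_apply])

theorem split_opp_none : (G.split a e c).opp none = some none := by simp [Cfg.split]

theorem split_opp_some_none : (G.split a e c).opp (some none) = none := by simp [Cfg.split]

theorem split_opp (d : D) : (G.split a e c).opp (some (some d)) = some (some (G.opp d)) := by
  simp [Cfg.split, insOpt_of_ne]

theorem split_face_none (h : e ≠ c) : (G.split a e c).face none = some (some c) := by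
  rw [Cfg.face_apply, split_opp_none, symm_apply_eq, split_rot_right _ _ h]

theorem split_face_some_none : (G.split a e c).face (some none) = some (some e) := by
  rw [Cfg.face_apply, split_opp_some_none, symm_apply_eq, split_rot_left]

theorem split_face_left (h : e ≠ c) {d : D} (hd : G.face d = e) :
    (G.split a e c).face (some (some d)) = none := by
  rw [Cfg.face_apply, split_opp, symm_apply_eq, split_rot_none _ _ h]
  rw [Cfg.face_apply, symm_apply_eq] at hd
  rw [hd]

theorem split_face_right {d : D} (hd : G.face d = c) :
    (G.split a e c).face (some (some d)) = some none := by
  rw [Cfg.face_apply, split_opp, symm_apply_eq, split_rot_some_none]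
  rw [Cfg.face_apply, symm_apply_eq] at hd
  rw [hd]

theorem split_face_of_ne (h : e ≠ c) {d : D} (h1 : G.face d ≠ e) (h2 : G.face d ≠ c) :
    (G.split a e c).face (some (some d)) = some (some (G.face d)) := by
  rw [Cfg.face_apply, split_opp, split_symm_of_ne _ _, Cfg.face_apply]
  · exact fun h' => h1 (by rw [Cfg.face_apply, h', symm_apply_apply])
  · exact fun h' => h2 (by rw [Cfg.face_apply, h', symm_apply_apply])

/-- The new darts are first inserted in the face cycle, `none` before `e` and `some none` before
`c`, and then their successors are exchanged. This presents the new faces as a cycle cut by a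
transposition. -/
theorem split_face_eq [DecidableEq (Option (Option D))] (h : e ≠ c) :
    (G.split a e c).face = insOpt (insOpt G.face (G.face.symm c)) (some (G.face.symm e)) *
      swap none (some none) := by
  have hne : G.face.symm e ≠ G.face.symm c := fun h' => h (G.face.symm.injective h')
  ext1 u
  rw [Perm.mul_apply]
  rcases u with _ | _ | d
  · rw [swap_apply_left, split_face_none _ _ h, insOpt_of_ne _ _ (by simp), insOpt_none,
      apply_symm_apply]
  · rw [swap_apply_right, split_face_some_none, insOpt_none, insOpt_of_ne _ _ hne,
      apply_symm_apply]
  · rw [swap_apply_of_ne_of_ne (by simp) (by simp)]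
    by_cases h1 : G.face d = e
    · rw [split_face_left _ _ h h1, ← h1, symm_apply_apply, insOpt_self]
    have h1' : d ≠ G.face.symm e := fun h' => h1 (by rw [h', apply_symm_apply])
    rw [insOpt_of_ne _ _ (by simpa using h1')]
    by_cases h2 : G.face d = c
    · rw [split_face_right _ _ h2, ← h2, symm_apply_apply, insOpt_self]
    have h2' : d ≠ G.face.symm c := fun h' => h2 (by rw [h', apply_symm_apply])
    rw [split_face_of_ne _ _ h h1 h2, insOpt_of_ne _ _ h2']

theorem split_sigma_sameCycle (u w : Option (Option D)) :
    (insOpt (insOpt G.face (G.face.symm c)) (some (G.face.symm e))).SameCycle u w ↔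
      G.face.SameCycle (ext2 e c id u) (ext2 e c id w) := by
  rw [sameCycle_insOpt, sameCycle_insOpt]
  have h : ∀ u : Option (Option D), G.face.SameCycle
      ((u.getD (some (G.face.symm e))).getD (G.face.symm c)) (ext2 e c id u) := by
    have h1 : ∀ x, G.face.SameCycle (G.face.symm x) x := fun x => by
      have := sameCycle_step G.face (G.face.symm x)
      rwa [apply_symm_apply] at this
    rintro (_ | _ | d)
    · exact h1 e
    · exact h1 c
    · exact Perm.SameCycle.refl _ _
  exact ⟨fun hs => (h _).symm.trans (hs.trans (h _)), fun hs => (h _).trans (hs.trans (h _).symm)⟩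

theorem split_rot_sameCycle (u w : Option (Option D)) :
    (G.split a e c).rot.SameCycle u w ↔
      G.rot.SameCycle (ext2 e c id u) (ext2 e c id w) := by
  change (insOpt (insOpt G.rot c) (some e)).SameCycle u w ↔ _
  rw [sameCycle_insOpt, sameCycle_insOpt]
  have h : ∀ u : Option (Option D), ((u.getD (some e)).getD c) = (ext2 e c id u) := by
    rintro (_ | _ | d) <;> rfl
  rw [h, h]

variable {G a}

theorem splitLab_left [Finite D] (hec : e ≠ c) (he : G.deco e = .inl a) :
    G.splitLab a e c e = .inl (some a) := by
  unfold Cfg.splitLab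
  rw [if_neg (fun h => h.2 (before_self hec)), he]
  rfl

theorem splitLab_right [Finite D] (hc : G.deco c = .inl a) : G.splitLab a e c c = .inl none := by
  unfold Cfg.splitLab
  rw [if_pos ⟨hc, not_before⟩]

theorem splitLab_of_ne {d : D} (hd : G.deco d ≠ .inl a) :
    G.splitLab a e c d = Sum.map some id (G.deco d) := by
  unfold Cfg.splitLab
  rw [if_neg (fun h => hd h.1)]

theorem splitLab_eq_none {d : D} : G.splitLab a e c d = .inl none ↔
    G.deco d = .inl a ∧ ¬ Before G.face e c d := by
  unfold Cfg.splitLab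
  split_ifs with h
  · simp [h]
  · simp only [h, iff_false]
    rcases G.deco d <;> simp

theorem splitLab_eq_some {d : D} : G.splitLab a e c d = .inl (some a) ↔
    G.deco d = .inl a ∧ Before G.face e c d := by
  unfold Cfg.splitLab
  split_ifs with h
  · simp [h]
  · rcases hd : G.deco d with k | j
    · rw [hd] at h
      simp only [Sum.map_inl, Sum.inl.injEq, Option.some.injEq] at h ⊢
      tauto
    · simp

theorem splitLab_eq_some_of_ne {d : D} {k : K} (hk : k ≠ a) :
    G.splitLab a e c d = .inl (some k) ↔ G.deco d = .inl k := by
  unfold Cfg.splitLab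
  split_ifs with h
  · simp [h, hk.symm]
  · rcases hd : G.deco d with k | j <;> simp

theorem splitLab_merge (d : D) :
    Sum.map (fun k : Option K => k.getD a) id (G.splitLab a e c d) = G.deco d := by
  unfold Cfg.splitLab
  split_ifs with h
  · rw [h.1]; rfl
  · rcases G.deco d <;> rfl

theorem splitLab_face [Finite D] (hf : ∀ d, G.deco (G.face d) = G.deco d) {d : D}
    (h1 : G.face d ≠ c) (h2 : G.face d ≠ e) : G.splitLab a e c (G.face d) = G.splitLab a e c d := by
  unfold Cfg.splitLab
  rw [hf, before_step h1 h2]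

end Tables

/-- The specification of a graph with two consecutive faces around a white vertex. -/
structure Spec.Mergeable (X : Spec n (Option K)) (a : K) : Prop where
  cil : ∀ k, X.cil k
  next_none : X.next none = some a
  inj : Function.Injective X.next
  tp_none : X.tp none = X.tp (some a)

/-- The specification where the face `none` is merged with the face `a`. -/
def Spec.merge (X : Spec n (Option K)) (a : K) : Spec n K :=
  ⟨fun _ => True, fun k => (X.next (some k)).getD a, fun k => X.tp (some k), X.e - 1, X.f - 1⟩

theorem Spec.Mergeable.next_eq {X : Spec n (Option K)} {a : K} (hX : X.Mergeable a) (k : K) :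
    (X.next (some k) = none ∧ (X.merge a).next k = a) ∨
      (X.next (some k) = some ((X.merge a).next k) ∧ (X.merge a).next k ≠ a) := by
  rcases h : X.next (some k) with _ | k'
  · exact Or.inl ⟨rfl, by simp [merge, h]⟩
  · right
    have h1 : (X.merge a).next k = k' := by simp [merge, h]
    rw [h1]
    refine ⟨rfl, ?_⟩
    rintro rfl
    have := hX.inj (h.trans hX.next_none.symm)
    simp at this

variable [Fintype D] {X : Spec n (Option K)} {a : K} {G : Cfg n (K ⊕ Fin N) D} {e c : D}

/-- The new edge joins two corners of one face and cuts it in two, so `e` and `f` of the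
specification both increase by one and the genus is unchanged. The part met from `e` before `c`
keeps the label `a`; it contains the corner `e`, next clockwise after the new corner `none`. -/
theorem IsGraph.split (hX : X.Mergeable a) (hc : G.deco c = .inl a) (he : G.deco e = .inl a)
    (hew : G.ty e ≠ .black) (h : IsRooted (X.merge a) G c) :
    IsRooted X (G.split a e c) (some none) := by
  classical
  have hcb := h.special c (Perm.SameCycle.refl _ _)
  have hrcb := h.special _ (sameCycle_step _ c)
  have hec : e ≠ c := fun h' => hew (h' ▸ hcb)
  have hcyc : G.face.SameCycle e c := h.mark_unique a e c he hc
  have hF := split_face_eq G a hec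
  have hxy : (insOpt (insOpt G.face (G.face.symm c)) (some (G.face.symm e))).SameCycle none
      (some none) := (split_sigma_sameCycle G none (some none)).2 hcyc
  obtain ⟨ka, -, hka, hka', hka''⟩ := h.white e hew
  obtain rfl : a = ka := Sum.inl_injective (he.symm.trans hka)
  have hsame : ∀ d, (G.split a e c).rot.SameCycle (some none) (some (some d)) ↔
      G.rot.SameCycle c d := fun d => split_rot_sameCycle G a _ _
  have hdF : ∀ u, (G.split a e c).deco ((G.split a e c).face u) = (G.split a e c).deco u := by
    rintro (_ | _ | d)
    · rw [split_face_none _ _ hec]; exact splitLab_right hc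
    · rw [split_face_some_none]; exact splitLab_left hec he
    · by_cases h1 : G.face d = e
      · rw [split_face_left _ _ hec h1]
        refine (splitLab_eq_none.2 ⟨?_, not_before_of_last hcyc h1⟩).symm
        rw [← h.deco_face, h1, he]
      by_cases h2 : G.face d = c
      · rw [split_face_right _ _ h2]
        refine (splitLab_eq_some.2 ⟨?_, before_pred hcyc hec h2⟩).symm
        rw [← h.deco_face, h2, hc]
      · rw [split_face_of_ne _ _ hec h1 h2]
        exact splitLab_face h.deco_face h2 h1
  have hwhite : ∀ d, G.ty d ≠ .black → ∃ k, G.deco d = .inl k ∧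
      G.splitLab a e c d = .inl (some k) := fun d hd => by
    obtain ⟨k, -, hk, -⟩ := h.white d hd
    refine ⟨k, hk, ?_⟩
    by_cases hk' : k = a
    · rw [hk'] at hk
      rw [h.white_unique d e hd hew (hk.trans he.symm), hk']
      exact splitLab_left hec he
    · exact (splitLab_eq_some_of_ne hk').2 hk
  refine ⟨?_, ?_, ?_, hdF, ?_, ?_, ?_, ?_, ?_, ?_, ?_, ?_, ?_, ?_⟩
  · rintro (_ | _ | d)
    · rw [split_opp_none, split_opp_some_none]
    · rw [split_opp_some_none, split_opp_none]
    · rw [split_opp, split_opp, h.opp_opp]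
  · rintro (_ | _ | d)
    · rw [split_opp_none]; simp
    · rw [split_opp_some_none]; simp
    · rw [split_opp]; simpa using h.opp_ne d
  · rintro (_ | _ | d)
    · rw [split_rot_none _ _ hec]; exact h.ty_rot e
    · rw [split_rot_some_none]; exact hrcb
    · by_cases h1 : d = e
      · rw [h1, split_rot_left]; rfl
      by_cases h2 : d = c
      · rw [h2, split_rot_right _ _ hec]; exact hcb.symm
      · rw [split_rot_of_ne _ _ h1 h2]; exact h.ty_rot d
  · intro p h1 h2
    have hcn : p (some (some c)) ↔ p (some none) := by
      rw [← h1 (some (some c)), split_rot_right _ _ hec]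
    have hen : p (some (some e)) ↔ p none := by rw [← h1 (some (some e)), split_rot_left]
    have key := h.conn (fun d => p (some (some d))) (fun d => by
      by_cases hd : d = c
      · rw [hd, hcn, ← h1 (some none), split_rot_some_none]
      by_cases hd' : d = e
      · rw [hd', hen, ← h1 none, split_rot_none _ _ hec]
      · rw [← h1 (some (some d)), split_rot_of_ne _ _ hd' hd])
      (fun d => by rw [← h2 (some (some d)), split_opp])
    have hred : ∀ u, p u ↔ p (some (some (ext2 e c id u))) := by
      rintro (_ | _ | d)
      · exact hen.symm
      · exact hcn.symm
      · rfl
    intro u u' hu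
    rw [hred] at hu ⊢
    exact key _ _ hu
  · have := h.vert
    change ((Fintype.card (Option (Option D)) : ℕ) : ℤ) =
      2 * ((orbs (insOpt (insOpt G.rot c) (some e))).card + X.e)
    rw [card_orbs_insOpt, card_orbs_insOpt]
    simp only [Fintype.card_option, Spec.merge] at this ⊢
    push_cast
    linarith
  · have := h.fac
    rw [card_orbs_split hF hxy (by simp), card_orbs_insOpt, card_orbs_insOpt]
    simp only [Spec.merge] at this
    push_cast
    linarith
  · rintro (_ | _ | d) hd
    · refine ⟨none, hX.cil _, rfl, ?_, ?_⟩
      · rw [show (G.split a e c).rot.symm none = some (some e) by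
          rw [symm_apply_eq, split_rot_left], hX.next_none]
        exact splitLab_left hec he
      · rw [hX.tp_none]; exact hka''
    · exact absurd rfl hd
    · obtain ⟨k, -, hk, hk', hk''⟩ := h.white d hd
      obtain ⟨k₁, hk1, hk2⟩ := hwhite d hd
      obtain rfl : k = k₁ := Sum.inl_injective (hk.symm.trans hk1)
      refine ⟨some k, hX.cil _, hk2, ?_, hk''⟩
      have hdc : d ≠ G.rot c := fun h' => hd (by rw [h']; exact hrcb)
      by_cases hde : d = G.rot e
      · rw [hde, show (G.split a e c).rot.symm (some (some (G.rot e))) = none by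
          rw [symm_apply_eq, split_rot_none _ _ hec]]
        rw [hde, symm_apply_apply, he] at hk'
        rcases hX.next_eq k with h1 | h1
        · rw [h1.1]; rfl
        · exact absurd (Sum.inl_injective hk').symm h1.2
      · rw [split_symm_of_ne _ _ hde hdc]
        rcases hX.next_eq k with h1 | h1
        · rw [h1.2] at hk'
          have := h.white_unique (G.rot.symm d) e (by
            rw [← h.ty_rot, apply_symm_apply]; exact hd) hew (hk'.trans he.symm)
          exact absurd (by rw [← this, apply_symm_apply]) hde
        · rw [h1.1]
          exact (splitLab_eq_some_of_ne h1.2).2 hk'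
  · rintro (_ | k) -
    · exact ⟨none, hew, rfl⟩
    · obtain ⟨d, hd1, hd2⟩ := h.white_ex k trivial
      obtain ⟨k₁, hk1, hk2⟩ := hwhite d hd1
      obtain rfl : k = k₁ := Sum.inl_injective (hd2.symm.trans hk1)
      exact ⟨some (some d), hd1, hk2⟩
  · rintro (_ | _ | d) (_ | _ | d') h1 h2 h3
    · rfl
    · exact absurd rfl h2
    · obtain ⟨k, -, hk⟩ := hwhite d' h2
      have := h3.trans hk
      simp [Cfg.split] at this
    · exact absurd rfl h1
    · rfl
    · exact absurd rfl h1
    · obtain ⟨k, -, hk⟩ := hwhite d h1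
      have := hk.symm.trans h3
      simp [Cfg.split] at this
    · exact absurd rfl h2
    · obtain ⟨k, hk, hk'⟩ := hwhite d h1
      obtain ⟨l, hl, hl'⟩ := hwhite d' h2
      have h4 : k = l := by
        have := (hk'.symm.trans h3).trans hl'
        simpa using this
      rw [h.white_unique d d' h1 h2 (by rw [hk, hl, h4])]
  · rintro (_ | _ | d) hd
    · refine absurd ?_ hew
      exact h.special e ((split_rot_sameCycle G a _ _).1 hd)
    · rfl
    · exact h.special d ((hsame d).1 hd)
  · rintro (_ | _ | d) h1 h2
    · exact absurd h1 hew
    · exact absurd (Perm.SameCycle.refl _ _) h2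
    · rw [hsame] at h2
      have hd'' : ∀ b, G.rot.SameCycle b d → b ≠ c := fun b hb h' => h2 (h' ▸ hb)
      have hd3 : ∀ b, G.rot.SameCycle b d → b ≠ e := fun b hb h' => hew (by
        rw [← h', h.ty_sameCycle hb]; exact h1)
      have e1 := Perm.SameCycle.refl G.rot d
      have e2 := (sameCycle_step G.rot d).symm
      rw [split_rot_of_ne _ _ (hd3 d e1) (hd'' d e1), split_rot_of_ne _ _ (hd3 _ e2) (hd'' _ e2)]
      simpa using h.deg d h1 h2
  · rintro (_ | k)
    · exact ⟨none, rfl⟩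
    · by_cases hk : k = a
      · exact ⟨some none, by rw [hk]; rfl⟩
      · obtain ⟨d, hd⟩ := h.mark_ex k
        exact ⟨some (some d), (splitLab_eq_some_of_ne hk).2 hd⟩
  · have hinv : ∀ {u w}, (G.split a e c).face.SameCycle u w →
        (G.split a e c).deco u = (G.split a e c).deco w := fun h' => SameCycle.invariant hdF h'
    have hcy : ∀ u, (G.split a e c).deco u = .inl none ∨ (G.split a e c).deco u = .inl (some a) →
        G.face.SameCycle e (ext2 e c id u) := by
      rintro (_ | _ | d) hu
      · exact Perm.SameCycle.refl _ _
      · exact hcyc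
      · refine h.mark_unique a e d he ?_
        rcases hu with hu | hu
        · exact (splitLab_eq_none.1 hu).1
        · exact (splitLab_eq_some.1 hu).1
    have hno : ∀ u, (G.split a e c).deco u = .inl none → (G.split a e c).face.SameCycle none u := by
      intro u hu
      rcases split_or hF ((split_sigma_sameCycle G none u).2 (hcy u (Or.inl hu))) with h1 | h1
      · exact h1
      · have := (hinv h1).trans hu
        simp [Cfg.split] at this
    have hso : ∀ u, (G.split a e c).deco u = .inl (some a) →
        (G.split a e c).face.SameCycle (some none) u := by
      intro u hu
      rcases split_or hF ((split_sigma_sameCycle G none u).2 (hcy u (Or.inr hu))) with h1 | h1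
      · have := (hinv h1).trans hu
        simp [Cfg.split] at this
      · exact h1
    rintro (_ | k) u w hu hw
    · exact (hno u hu).symm.trans (hno w hw)
    · by_cases hk : k = a
      · rw [hk] at hu hw
        exact (hso u hu).symm.trans (hso w hw)
      · have hk' : (some k : Option K) ≠ some a := by simpa using hk
        rcases u with _ | _ | d
        · simp [Cfg.split] at hu
        · exact absurd (Sum.inl_injective hu).symm hk'
        rcases w with _ | _ | d'
        · simp [Cfg.split] at hw
        · exact absurd (Sum.inl_injective hw).symm hk'
        have hu' := (splitLab_eq_some_of_ne hk).1 hu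
        have hw' := (splitLab_eq_some_of_ne hk).1 hw
        refine split_of_sameCycle hF hxy ((split_sigma_sameCycle G _ _).2
          (h.mark_unique k d d' hu' hw')) fun h' => ?_
        have h1 := h.deco_sameCycle ((split_sigma_sameCycle G _ _).1 h')
        have h2 := (he.symm.trans h1).trans hu'
        exact hk (Sum.inl_injective h2).symm

end SplitFace

/-! ### Merging two consecutive faces around a white vertex -/

section MergeFace

variable {n N : ℕ} {K D : Type} [Fintype D] {X : Spec n (Option K)} {a : K}
  {G : Cfg n (K ⊕ Fin N) D} {e c : D}

/-- The sides of the edge have different labels, hence lie in different faces, and its removal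
merges them. The graph stays connected since `e` and `c` are then corners of a common face. -/
theorem isRooted_of_split (hX : X.Mergeable a) (hc : G.deco c = .inl a) (he : G.deco e = .inl a)
    (hew : G.ty e ≠ .black) (hec : e ≠ c) (h : IsRooted X (G.split a e c) (some none)) :
    IsRooted (X.merge a) G c := by
  classical
  have hF := split_face_eq G a hec
  have hinv : ∀ {u w}, (G.split a e c).face.SameCycle u w →
        (G.split a e c).deco u = (G.split a e c).deco w := fun h' => h.deco_sameCycle h'
  have hxy := sameCycle_of_merge hF (fun h' => by
    have := hinv h'
    simp [Cfg.split] at this)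
  have hcyc : G.face.SameCycle e c := (split_sigma_sameCycle G none (some none)).1 hxy
  have hmem : ∀ {u w}, (G.split a e c).face.SameCycle u w →
      G.face.SameCycle (ext2 e c id u) (ext2 e c id w) := fun h' =>
    (split_sigma_sameCycle G _ _).1 (sameCycle_of_split hF hxy h')
  have hmerge : ∀ {d : D} {k : Option K}, (G.split a e c).deco (some (some d)) = .inl k →
      G.deco d = .inl (k.getD a) := fun {d k} hd => by
    rw [← splitLab_merge (a := a) (e := e) (c := c) d]
    change Sum.map _ id ((G.split a e c).deco (some (some d))) = _
    rw [hd]; rfl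
  have hsame : ∀ d, (G.split a e c).rot.SameCycle (some none) (some (some d)) ↔
      G.rot.SameCycle c d := fun d => split_rot_sameCycle G a _ _
  have hbl : ∀ d, G.rot.SameCycle c d → G.ty d = .black := fun d hd =>
    h.special (some (some d)) ((hsame d).2 hd)
  have hcb := hbl c (Perm.SameCycle.refl _ _)
  have hrcb := hbl _ (sameCycle_step _ c)
  have hwhite : ∀ d, G.ty d ≠ .black → ∃ k, (G.split a e c).deco (some (some d)) = .inl (some k) ∧
      (G.split a e c).deco ((G.split a e c).rot.symm (some (some d))) = .inl (X.next (some k)) ∧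
      G.ty d = .white (X.tp (some k)) := fun d hd => by
    obtain ⟨k, -, h1, h2, h3⟩ := h.white (some (some d)) hd
    rcases k with _ | k
    · have := h.white_unique (some (some d)) none hd hew h1
      simp at this
    · exact ⟨k, h1, h2, h3⟩
  have hface : ∀ d, G.deco (G.face d) = G.deco d := fun d => by
    have h0 : ∀ d, Sum.map (fun k : Option K => k.getD a) id
        ((G.split a e c).deco (some (some d))) = G.deco d := fun d => splitLab_merge d
    by_cases h1 : G.face d = e
    · have := h.deco_face (some (some d))
      rw [split_face_left _ _ hec h1] at this
      rw [h1, he, ← h0 d, ← this]; rfl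
    by_cases h2 : G.face d = c
    · have := h.deco_face (some (some d))
      rw [split_face_right _ _ h2] at this
      rw [h2, hc, ← h0 d, ← this]; rfl
    · have := h.deco_face (some (some d))
      rw [split_face_of_ne _ _ hec h1 h2] at this
      rw [← h0, this, h0]
  refine ⟨?_, ?_, ?_, hface, ?_, ?_, ?_, ?_, ?_, ?_, hbl, ?_, ?_, ?_⟩
  · intro d
    have := h.opp_opp (some (some d))
    rw [split_opp, split_opp] at this
    simpa using this
  · intro d
    have := h.opp_ne (some (some d))
    rw [split_opp] at this
    simpa using this
  · intro d
    by_cases h1 : d = e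
    · have := h.ty_rot none
      rw [split_rot_none _ _ hec] at this
      rw [h1]; exact this
    by_cases h2 : d = c
    · rw [h2, hcb, hrcb]
    · have := h.ty_rot (some (some d))
      rwa [split_rot_of_ne _ _ h1 h2] at this
  · intro p h1 h2 d d' hd
    refine h.conn (ext2 (p e) (p c) p) ?_ ?_ (some (some d)) (some (some d')) hd
    · rintro (_ | _ | b)
      · rw [split_rot_none _ _ hec]; exact h1 e
      · rw [split_rot_some_none]; exact h1 c
      · by_cases hb : b = e
        · rw [hb, split_rot_left]; rfl
        by_cases hb' : b = c
        · rw [hb', split_rot_right _ _ hec]; rfl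
        · rw [split_rot_of_ne _ _ hb hb']; exact h1 b
    · have hpc : p c ↔ p e := (SameCycle.invariant_prop (fun d => by
        rw [Cfg.face_apply, ← h2 d, ← h1 (G.rot.symm _), apply_symm_apply]) hcyc).symm
      rintro (_ | _ | b)
      · rw [split_opp_none]; exact hpc
      · rw [split_opp_some_none]; exact hpc.symm
      · rw [split_opp]; exact h2 b
  · have := h.vert
    change ((Fintype.card (Option (Option D)) : ℕ) : ℤ) =
      2 * ((orbs (insOpt (insOpt G.rot c) (some e))).card + X.e) at this
    rw [card_orbs_insOpt, card_orbs_insOpt] at this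
    simp only [Fintype.card_option, Spec.merge] at this ⊢
    push_cast at this
    linarith
  · have := h.fac
    rw [card_orbs_split hF hxy (by simp), card_orbs_insOpt, card_orbs_insOpt] at this
    simp only [Spec.merge]
    push_cast at this
    linarith
  · intro d hd
    obtain ⟨k, hk1, hk2, hk3⟩ := hwhite d hd
    refine ⟨k, trivial, hmerge hk1, ?_, hk3⟩
    have hdc : d ≠ G.rot c := fun h' => hd (by rw [h']; exact hrcb)
    by_cases hde : d = G.rot e
    · rw [hde, show (G.split a e c).rot.symm (some (some (G.rot e))) = none by
          rw [symm_apply_eq, split_rot_none _ _ hec]] at hk2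
      have hk2' : X.next (some k) = none := (Sum.inl_injective hk2).symm
      rw [hde, symm_apply_apply, he, Spec.merge]
      simp [hk2']
    · rw [split_symm_of_ne _ _ hde hdc] at hk2
      exact hmerge hk2
  · intro k _
    obtain ⟨u, hu1, hu2⟩ := h.white_ex (some k) (hX.cil _)
    rcases u with _ | _ | d
    · simp [Cfg.split] at hu2
    · exact absurd rfl hu1
    · exact ⟨d, hu1, hmerge hu2⟩
  · intro d d' h1 h2 h3
    obtain ⟨k, hk, -⟩ := hwhite d h1
    obtain ⟨l, hl, -⟩ := hwhite d' h2
    have h4 : k = l := by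
      have := ((hmerge hk).symm.trans h3).trans (hmerge hl)
      simpa using this
    simpa using h.white_unique (some (some d)) (some (some d')) h1 h2 (by rw [hk, hl, h4])
  · intro d h1 h2
    have hd'' : ∀ b, G.rot.SameCycle b d → b ≠ c := fun b hb h' => h2 (h' ▸ hb)
    have hty : ∀ u, (G.split a e c).rot.SameCycle u (some (some d)) →
        (G.split a e c).ty u = .black := fun u hu => by rw [h.ty_sameCycle hu]; exact h1
    have hd3 : ∀ b, G.rot.SameCycle b d → b ≠ e := fun b hb h' => hew
      (hty (some (some e)) ((split_rot_sameCycle G a _ _).2 (h' ▸ hb)))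
    have e1 := Perm.SameCycle.refl G.rot d
    have e2 := (sameCycle_step G.rot d).symm
    have := h.deg (some (some d)) h1 (fun h' => h2 ((hsame d).1 h'))
    rw [split_rot_of_ne _ _ (hd3 d e1) (hd'' d e1), split_rot_of_ne _ _ (hd3 _ e2) (hd'' _ e2)]
      at this
    simpa using this
  · intro k
    obtain ⟨u, hu⟩ := h.mark_ex (some k)
    rcases u with _ | _ | d
    · simp [Cfg.split] at hu
    · refine ⟨e, ?_⟩
      rw [he]
      simpa [Cfg.split] using hu
    · exact ⟨d, hmerge hu⟩
  · intro k d d' hd hd'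
    by_cases hk : k = a
    · have key : ∀ d, G.deco d = .inl a → G.face.SameCycle e d := fun d hd => by
        by_cases hb : Before G.face e c d
        · exact hcyc.trans (hmem (h.mark_unique (some a) (some none) (some (some d)) rfl
            (splitLab_eq_some.2 ⟨hd, hb⟩)))
        · exact hmem (h.mark_unique none none (some (some d)) rfl (splitLab_eq_none.2 ⟨hd, hb⟩))
      rw [hk] at hd hd'
      exact (key d hd).symm.trans (key d' hd')
    · exact hmem (h.mark_unique (some k) (some (some d)) (some (some d'))
        ((splitLab_eq_some_of_ne hk).2 hd) ((splitLab_eq_some_of_ne hk).2 hd'))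

/-- The dart `e` precedes `none` at the white vertex and `c` precedes `some none` at the root. As
labels are constant along the faces of `G'`, `before_unique` shows that they are those of
`splitLab`. -/
theorem exists_split (hX : X.Mergeable a) {G' : Cfg n (Option K ⊕ Fin N) (Option (Option D))}
    (h : IsRooted X G' (some none)) (h1 : G'.ty none ≠ .black) (h2 : G'.deco none = .inl none)
    (h3 : G'.opp none = some none) (h4 : G'.rot (some none) ≠ some none) :
    ∃ (G : Cfg n (K ⊕ Fin N) D) (e c : D), G.deco c = .inl a ∧ G.deco e = .inl a ∧
      G.ty e ≠ .black ∧ e ≠ c ∧ G' = G.split a e c := by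
  classical
  have hyb : G'.ty (some none) = .black := h.special _ (Perm.SameCycle.refl _ _)
  obtain ⟨k, -, hk2, hk3, hk4⟩ := h.white none h1
  obtain rfl : none = k := Sum.inl_injective (h2.symm.trans hk2)
  rw [hX.next_none] at hk3
  have hwt : G'.ty (G'.rot.symm none) ≠ .black := by
    rw [← h.ty_rot, apply_symm_apply]; exact h1
  obtain ⟨e, he⟩ : ∃ e, G'.rot.symm none = some (some e) := by
    rcases hu : G'.rot.symm none with _ | _ | e
    · rw [hu, h2] at hk3; simp at hk3
    · rw [hu] at hwt; exact absurd hyb hwt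
    · exact ⟨e, rfl⟩
  rw [he] at hk3 hwt
  obtain ⟨ρ, hρ⟩ := exists_insOpt G'.rot (c := some e) (by rw [← he, apply_symm_apply])
  obtain ⟨c, hc⟩ : ∃ c, ρ (some c) = none := by
    rcases hn : ρ.symm none with _ | c
    · have h5 : ρ none = none := by rw [← hn, apply_symm_apply, hn]
      exact absurd (by rw [hρ, insOpt_of_ne _ _ (by simp), h5]) h4
    · exact ⟨c, by rw [← hn, apply_symm_apply]⟩
  obtain ⟨rot, hrot⟩ := exists_insOpt ρ hc
  have hec : e ≠ c := by
    rintro rfl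
    have h5 := h.ty_rot none
    rw [hρ, insOpt_none, hc, hyb] at h5
    exact h1 h5.symm
  obtain ⟨ω, hω⟩ := exists_insOpt G'.opp (c := none) (by rw [← h3, h.opp_opp])
  obtain ⟨opp, hopp⟩ := exists_fixOpt ω (by
    have := h3; rw [hω, insOpt_none] at this; simpa using this)
  set G : Cfg n (K ⊕ Fin N) D := ⟨rot, opp, fun d => G'.ty (some (some d)),
    fun d => Sum.map (fun k : Option K => k.getD a) id (G'.deco (some (some d)))⟩ with hG
  have hr : G'.rot = (G.split a e c).rot := by rw [hρ, hrot]; rfl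
  have ho : G'.opp = (G.split a e c).opp := by rw [hω, hopp]; rfl
  have hf : G'.face = (G.split a e c).face := by unfold Cfg.face; rw [hr, ho]
  have hF := hf.trans (split_face_eq G a hec)
  have hd1 : G'.deco (some (some c)) = .inl none := by
    rw [← h2, ← h.deco_face none, hf, split_face_none _ _ hec]
  have hd2 : G'.deco (some none) = .inl (some a) := by
    rw [← hk3, ← h.deco_face (some none), hf, split_face_some_none]
  have hxy := sameCycle_of_merge hF (fun h' => by
    have := h.deco_sameCycle h'
    rw [h2, hd2] at this
    simp at this)
  have hmem : ∀ {u w}, G'.face.SameCycle u w →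
      G.face.SameCycle (ext2 e c id u) (ext2 e c id w) := fun h' =>
    (split_sigma_sameCycle G _ _).1 (sameCycle_of_split hF hxy h')
  have hcyc : G.face.SameCycle e c := (split_sigma_sameCycle G none (some none)).1 hxy
  have hce : G.deco e = .inl a := by
    change Sum.map _ id (G'.deco (some (some e))) = _
    rw [hk3]; rfl
  have hcc : G.deco c = .inl a := by
    change Sum.map _ id (G'.deco (some (some c))) = _
    rw [hd1]; rfl
  have hbef : ∀ d, G.face.SameCycle e d → (G'.deco (some (some d)) = .inl (some a) ↔
      Before G.face e c d) := fun d hd => by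
    refine before_unique (p := fun d => G'.deco (some (some d)) = .inl (some a)) hk3 ?_ ?_ hd
    · rw [hd1]; simp
    · intro d h5 h6
      rw [← h.deco_face (some (some d)), hf, split_face_of_ne _ _ hec h6 h5]
  refine ⟨G, e, c, hcc, hce, hwt, hec, Cfg.ext hr ho ?_ ?_⟩
  · funext u
    rcases u with _ | _ | d
    · rw [← h.ty_rot, hr, split_rot_none _ _ hec]
      have h5 := h.ty_rot none
      rw [hr, split_rot_none _ _ hec] at h5
      rw [h5]
      change G'.ty none = G'.ty (some (some e))
      rw [← h.ty_rot (some (some e)), ← he, apply_symm_apply]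
    · exact hyb
    · rfl
  · funext u
    rcases u with _ | _ | d
    · exact h2
    · exact hd2
    · change _ = G.splitLab a e c d
      have hGd : G.deco d = Sum.map (fun k : Option K => k.getD a) id (G'.deco (some (some d))) :=
        rfl
      rcases hu : G'.deco (some (some d)) with k | j
      · rw [hu] at hGd
        rcases k with _ | k
        · symm
          refine splitLab_eq_none.2 ⟨hGd, fun hb => ?_⟩
          have h5 : G.face.SameCycle e d := hmem (h.mark_unique none none _ h2 hu)
          have := (hbef d h5).2 hb
          rw [hu] at this
          simp at this
        · by_cases hk : k = a
          · rw [hk] at hu hGd ⊢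
            symm
            refine splitLab_eq_some.2 ⟨hGd, ?_⟩
            have h5 : G.face.SameCycle e d :=
              hcyc.trans (hmem (h.mark_unique (some a) (some none) _ hd2 hu))
            exact (hbef d h5).1 hu
          · exact ((splitLab_eq_some_of_ne hk).2 hGd).symm
      · rw [hu] at hGd
        rw [splitLab_of_ne (by rw [hGd]; simp), hGd]
        rfl

theorem split_injective {G₁ G₂ : Cfg n (K ⊕ Fin N) D} {e₁ c₁ e₂ c₂ : D}
    (h : G₁.split a e₁ c₁ = G₂.split a e₂ c₂) : G₁ = G₂ ∧ e₁ = e₂ ∧ c₁ = c₂ := by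
  have hr : insOpt (insOpt G₁.rot c₁) (some e₁) = insOpt (insOpt G₂.rot c₂) (some e₂) :=
    congrArg Cfg.rot h
  have he : e₁ = e₂ := by
    have := congrArg (fun σ : Perm (Option (Option D)) => σ.symm none) hr
    simpa using this
  subst he
  have hr' := insOpt_injective _ hr
  have hc : c₁ = c₂ := by
    have := congrArg (fun σ : Perm (Option D) => σ.symm none) hr'
    simpa using this
  subst hc
  have ho : insOpt (fixOpt G₁.opp) none = insOpt (fixOpt G₂.opp) none := congrArg Cfg.opp h
  refine ⟨Cfg.ext (insOpt_injective _ hr') (fixOpt_injective (insOpt_injective _ ho)) ?_ ?_,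
    rfl, rfl⟩
  · funext d
    exact congrFun (congrArg Cfg.ty h) (some (some d))
  · funext d
    have := congrFun (congrArg Cfg.deco h) (some (some d))
    change G₁.splitLab a e₁ c₁ d = G₂.splitLab a e₁ c₁ d at this
    rw [← splitLab_merge (G := G₁) (a := a) (e := e₁) (c := c₁) d, this, splitLab_merge]

end MergeFace

/-! ### The weights of split graphs -/

section MixedSums

variable (r : ℕ) (v : ℕ → ℂ) {n N : ℕ} {K D E : Type} [Fintype K] [Fintype D] [Fintype E]

/-- The weight of a split graph, without the propagator of the new edge. -/
def mixWt (val : Option K ⊕ Fin N → ℂ) (a : K) (G : Cfg n (K ⊕ Fin N) D) (e c : D) : ℂ :=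
  eprod r v G.opp (val ∘ G.splitLab a e c) *
    rprod r v G.rot G.ty (val ∘ G.splitLab a e c) c (fun s => vw r v (val (.inl (some a)) ::ₘ s))

/-- The sum of the weights of the graphs split at a given corner. -/
def mixSum (val : Option K ⊕ Fin N → ℂ) (a : K) (G : Cfg n (K ⊕ Fin N) D) (c : D) : ℂ :=
  ∑ e, pif (G.ty e ≠ .black ∧ G.deco e = .inl a) (mixWt r v val a G e c) 0

variable {r v}

theorem before_permCongr (τ : D ≃ E) (f : Perm D) (e c d : D) :
    Before (τ.permCongr f) (τ e) (τ c) (τ d) ↔ Before f e c d := by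
  have h : ∀ s : ℕ, ((τ.permCongr f)^[s]) (τ e) = τ ((f^[s]) e) := fun s => by
    induction s with
    | zero => rfl
    | succ s ih => rw [Function.iterate_succ_apply', ih, Function.iterate_succ_apply']; simp
  unfold Before
  simp only [h, τ.apply_eq_iff_eq, ne_eq]

theorem splitLab_map (τ : D ≃ E) (a : K) (G : Cfg n (K ⊕ Fin N) D) (e c : D) :
    (G.map τ).splitLab a (τ e) (τ c) ∘ τ = G.splitLab a e c := by
  funext d
  unfold Cfg.splitLab
  rw [Function.comp_apply, Cfg.map_face, before_permCongr, ← Function.comp_apply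
    (f := (G.map τ).deco), map_deco_comp]

theorem mixWt_map (τ : D ≃ E) (val : Option K ⊕ Fin N → ℂ) (a : K) (G : Cfg n (K ⊕ Fin N) D)
    (e c : D) : mixWt r v val a (G.map τ) (τ e) (τ c) = mixWt r v val a G e c := by
  unfold mixWt
  rw [Cfg.map_opp, Cfg.map_rot, eprod_permCongr, rprod_permCongr, Function.comp_assoc, map_ty_comp,
    splitLab_map]

theorem mixSum_map (τ : D ≃ E) (val : Option K ⊕ Fin N → ℂ) (a : K) (G : Cfg n (K ⊕ Fin N) D)
    (c : D) : mixSum r v val a (G.map τ) (τ c) = mixSum r v val a G c := by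
  unfold mixSum
  rw [← τ.sum_comp]
  exact Finset.sum_congr rfl fun e _ => pif_congr (by simp) fun _ => mixWt_map τ val a G e c

theorem wt_split (val : Option K ⊕ Fin N → ℂ) (a : K) {X : Spec n (Option K)}
    {G : Cfg n (K ⊕ Fin N) D} {e c : D} (he : G.ty e ≠ .black)
    (h : IsRooted X (G.split a e c) (some none)) :
    wt r v val (G.split a e c) = propagator r v (val (.inl none)) (val (.inl (some a))) *
      mixWt r v val a G e c := by
  unfold wt mixWt
  rw [← rprod_vw _ _ _ _ h.special]
  have hc : ¬ G.rot.SameCycle c e := fun h' => he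
    (h.special (some (some e)) ((split_rot_sameCycle G a _ _).2 h'))
  change eprod r v (insOpt (fixOpt G.opp) none) _ *
    rprod r v (insOpt (insOpt G.rot c) (some e)) _ _ (some none) _ = _
  rw [eprod_pair, rprod_insOpt_white _ _ _ _ _ _ ?_ he, rprod_insOpt, mul_assoc]
  · rfl
  · rw [sameCycle_insOpt]; exact hc

/-- If the far end were white, uniqueness of the labels would make it the neighbouring dart of the
same vertex, on both sides; the graph would be a loop at a bivalent white vertex on the sphere. The
relation `e + 2 = f` expresses genus zero, and there `hX2` supplies another white vertex. -/
theorem IsGraph.opp_black {X : Spec n (Option K)} {a : K} (hX : X.Mergeable a)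
    (hX2 : X.e + 2 = X.f → ∃ k, X.tp k ≠ X.tp none) {G : Cfg n (Option K ⊕ Fin N) D}
    (h : IsPlain X G) {i : D} (h1 : G.ty i ≠ .black) (h2 : G.deco i = .inl none) :
    G.ty (G.opp i) = .black := by
  classical
  by_contra hb
  obtain ⟨k, -, hk2, hk3, -⟩ := h.white i h1
  obtain rfl : none = k := Sum.inl_injective (h2.symm.trans hk2)
  rw [hX.next_none] at hk3
  have hw : ∀ d, G.ty (G.rot.symm d) = G.ty d := fun d => by rw [← h.ty_rot, apply_symm_apply]
  have hj : G.opp i = G.rot.symm i := by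
    refine h.white_unique _ _ hb (by rwa [hw]) ?_
    rw [hk3, ← h.deco_face (G.opp i), Cfg.face_apply, h.opp_opp, hk3]
  have hfi : G.face i = i := by
    refine h.white_unique _ _ ?_ h1 (h.deco_face i)
    rwa [Cfg.face_apply, hw]
  have hri : G.rot i = G.opp i := by
    rw [Cfg.face_apply, symm_apply_eq] at hfi; exact hfi.symm
  have hrj : G.rot (G.opp i) = i := by rw [hj, apply_symm_apply]
  have hcl : ∀ σ : Perm D, σ i = G.opp i → σ (G.opp i) = i → ∀ d,
      (σ d = i ∨ σ d = G.opp i) ↔ (d = i ∨ d = G.opp i) := fun σ h1 h2 d => by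
    constructor
    · rintro (h3 | h3)
      · exact Or.inr (σ.injective (h3.trans h2.symm))
      · exact Or.inl (σ.injective (h3.trans h1.symm))
    · rintro (rfl | rfl)
      · exact Or.inr h1
      · exact Or.inl h2
  have hall : ∀ d, d = i ∨ d = G.opp i := fun d =>
    h.conn (fun d => d = i ∨ d = G.opp i) (hcl _ hri hrj) (hcl _ rfl (h.opp_opp i)) i d
      (Or.inl rfl)
  have huniv : (Finset.univ : Finset D) = {i, G.opp i} := by
    ext d; simpa using hall d
  have hcard : Fintype.card D = 2 := by
    rw [← Finset.card_univ, huniv, Finset.card_pair (h.opp_ne i).symm]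
  have hrot : (orbs G.rot).card = 1 := by
    rw [Finset.card_eq_one]
    refine ⟨orb G.rot i, ?_⟩
    ext s
    rw [mem_orbs, Finset.mem_singleton]
    constructor
    · rintro ⟨d, rfl⟩
      rcases hall d with rfl | rfl
      · rfl
      · rw [orb_eq_orb, ← hri]; exact (sameCycle_step _ _).symm
    · rintro rfl; exact ⟨i, rfl⟩
  have hface : (orbs G.face).card = 2 := by
    have hfj : G.face (G.opp i) = G.opp i := by
      rw [Cfg.face_apply, h.opp_opp, symm_apply_eq, hrj]
    have hid : G.face = 1 := by
      ext1 d
      rcases hall d with rfl | rfl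
      · exact hfi
      · exact hfj
    have := sum_card_orbs G.face
    rw [Finset.sum_congr rfl (g := fun _ => 1) ?_] at this
    · simpa [hcard] using this
    · intro s hs
      obtain ⟨d, rfl⟩ := mem_orbs.1 hs
      rw [card_orb_eq_one_iff, hid]; rfl
  have h5 := h.vert
  have h6 := h.fac
  rw [hcard, hrot] at h5
  rw [hface] at h6
  obtain ⟨k, hk⟩ := hX2 (by push_cast at h5 h6; linarith)
  apply hk
  have htp : ∀ k, ∃ d, G.ty d = .white (X.tp k) := fun k => by
    obtain ⟨d, hd1, hd2⟩ := h.white_ex k (hX.cil k)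
    obtain ⟨k', -, hk', -, hk''⟩ := h.white d hd1
    obtain rfl : k = k' := Sum.inl_injective (hd2.symm.trans hk')
    exact ⟨d, hk''⟩
  have hty : ∀ d, G.ty d = G.ty i := fun d => by
    rcases hall d with rfl | rfl
    · rfl
    · rw [← hri, h.ty_rot]
  obtain ⟨d, hd⟩ := htp k
  obtain ⟨d', hd'⟩ := htp none
  have := hd.symm.trans ((hty d).trans ((hty d').symm.trans hd'))
  exact VertexType.white.inj this

/-- A graph with two consecutive faces at a white vertex, as a split graph. -/
theorem plainSum_split {X : Spec n (Option K)} {a : K} (hX : X.Mergeable a)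
    (hX2 : X.e + 2 = X.f → ∃ k, X.tp k ≠ X.tp none) (val : Option K ⊕ Fin N → ℂ) :
    plainSum r v (Option (Option D)) X val =
      ((Fintype.card D + 2 : ℂ) * (Fintype.card D + 1)) *
        (propagator r v (val (.inl none)) (val (.inl (some a))) *
        ∑ p : Cfg n (K ⊕ Fin N) D × D,
          pif ((IsRooted (X.merge a) p.1 p.2 ∧ p.1.deco p.2 = .inl a) ∧ 2 ≤ (orb p.1.rot p.2).card)
            (mixSum r v val a p.1 p.2) 0) := by
  have h1 := sum_pointed (D := D) (n := n) (L := Option K ⊕ Fin N) (fun G i j =>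
    pif (IsPlain X G ∧ G.ty i ≠ .black ∧ G.deco i = .inl none ∧ G.opp i = j) (wt r v val G) 0)
    (fun τ G i j => pif_congr (by rw [isPlain_map_iff]; simp) (fun _ => wt_map τ val G))
  -- In each graph exactly one pair of darts contributes: the white dart labelled `none` and its
  -- opposite.
  have h2 : plainSum r v (Option (Option D)) X val =
      ((Fintype.card D + 2 : ℂ) * (Fintype.card D + 1)) *
        ∑ G : Cfg n (Option K ⊕ Fin N) (Option (Option D)), pif (IsPlain X G ∧ G.ty none ≠ .black ∧
          G.deco none = .inl none ∧ G.opp none = some none) (wt r v val G) 0 := by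
    rw [← h1]
    unfold plainSum
    refine Finset.sum_congr rfl fun G _ => ?_
    by_cases h : IsPlain X G
    · obtain ⟨i, hi1, hi2⟩ := h.white_ex none (hX.cil none)
      rw [pif_pos h, Finset.sum_eq_single i, Finset.sum_eq_single (G.opp i),
        if_pos (h.opp_ne i).symm, pif_pos ⟨h, hi1, hi2, rfl⟩]
      · intro j _ hj
        split_ifs
        · exact pif_neg (fun h' => hj h'.2.2.2.symm) _ _
        · rfl
      · simp
      · intro i' _ hi'
        refine Finset.sum_eq_zero fun j _ => ?_
        split_ifs
        · exact pif_neg (fun h' => hi' (h.white_unique _ _ h'.2.1 hi1 (h'.2.2.1.trans hi2.symm))) _ _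
        · rfl
      · simp
    · rw [pif_neg h]
      symm
      refine Finset.sum_eq_zero fun i _ => Finset.sum_eq_zero fun j _ => ?_
      split_ifs
      · exact pif_neg (fun h' => h h'.1) _ _
      · rfl
  rw [h2]
  congr 1
  have h3 : ∑ p : Cfg n (K ⊕ Fin N) D × D,
      pif ((IsRooted (X.merge a) p.1 p.2 ∧ p.1.deco p.2 = .inl a) ∧ 2 ≤ (orb p.1.rot p.2).card)
        (mixSum r v val a p.1 p.2) 0 = ∑ q : (Cfg n (K ⊕ Fin N) D × D) × D,
      pif (((IsRooted (X.merge a) q.1.1 q.1.2 ∧ q.1.1.deco q.1.2 = .inl a) ∧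
        2 ≤ (orb q.1.1.rot q.1.2).card) ∧ q.1.1.ty q.2 ≠ .black ∧ q.1.1.deco q.2 = .inl a)
        (mixWt r v val a q.1.1 q.2 q.1.2) 0 := by
    rw [Fintype.sum_prod_type (α₁ := Cfg n (K ⊕ Fin N) D × D)]
    refine Finset.sum_congr rfl fun p _ => ?_
    unfold mixSum
    dsimp only
    by_cases hp : (IsRooted (X.merge a) p.1 p.2 ∧ p.1.deco p.2 = .inl a) ∧
        2 ≤ (orb p.1.rot p.2).card
    · rw [pif_pos hp]
      exact Finset.sum_congr rfl fun e _ => pif_congr (by simp [hp]) fun _ => rfl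
    · rw [pif_neg hp]
      symm
      exact Finset.sum_eq_zero fun e _ => pif_neg (fun h => hp h.1) _ _
  rw [h3, Finset.mul_sum, sum_pif_bij (β := (Cfg n (K ⊕ Fin N) D × D) × D)
    (Q := fun q => ((IsRooted (X.merge a) q.1.1 q.1.2 ∧ q.1.1.deco q.1.2 = .inl a) ∧
        2 ≤ (orb q.1.1.rot q.1.2).card) ∧ q.1.1.ty q.2 ≠ .black ∧ q.1.1.deco q.2 = .inl a)
    (g := fun q => propagator r v (val (.inl none)) (val (.inl (some a))) *
      mixWt r v val a q.1.1 q.2 q.1.2)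
    (fun q => q.1.1.split a q.2 q.1.2)]
  · refine Finset.sum_congr rfl fun p _ => ?_
    unfold pif; split_ifs <;> simp
  · rintro ⟨⟨G, c⟩, e⟩ ⟨⟨⟨hr, hc⟩, hcard⟩, hew, he⟩
    have hs := hr.split hX hc he hew
    refine ⟨(isPlain_iff (c := some none)).1 ⟨hs, ?_⟩ |>.1, hew, rfl, split_opp_none _ _⟩
    dsimp only at hcard
    have hne : G.rot c ≠ c := fun h => by
      rw [(card_orb_eq_one_iff G.rot c).2 h] at hcard; omega
    have hce : e ≠ c := fun h => hew (h ▸ hr.special c (Perm.SameCycle.refl _ _))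
    have hce' : G.rot c ≠ e := fun h => hew (h ▸ hr.special _ (sameCycle_step _ c))
    rw [three_le_card_orb_iff, split_rot_some_none, split_rot_of_ne _ _ hce' hne]
    simp
  · rintro ⟨⟨G, c⟩, e⟩ ⟨⟨G₂, c₂⟩, e₂⟩ - - h
    obtain ⟨rfl, rfl, rfl⟩ := split_injective h
    rfl
  · rintro G' ⟨h, h4, h5, h6⟩
    have hb : G'.ty (some none) = .black := by rw [← h6]; exact h.opp_black hX hX2 h4 h5
    obtain ⟨hr, hcard⟩ := isPlain_iff.2 ⟨h, hb⟩
    have hcard' := (three_le_card_orb_iff _ _).1 hcard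
    obtain ⟨G, e, c, hc, he, hew, hec, rfl⟩ := exists_split hX hr h4 h5 h6 hcard'.1
    refine ⟨((G, c), e), ⟨⟨⟨isRooted_of_split hX hc he hew hec hr, hc⟩, ?_⟩, hew, he⟩, rfl⟩
    dsimp only
    have hpos := card_orb_pos G.rot c
    have hne : (orb G.rot c).card ≠ 1 := fun h1 => hcard'.2 (by
      rw [card_orb_eq_one_iff] at h1
      rw [split_rot_some_none, h1, split_rot_right _ _ hec])
    omega
  · rintro ⟨⟨G, c⟩, e⟩ ⟨⟨⟨hr, hc⟩, hcard⟩, hew, he⟩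
    exact wt_split val a hew (hr.split hX hc he hew)

variable (r v) in
variable (D) in
/-- Sums over the corners of a face. -/
def mixCorner (X : Spec n K) (val : Option K ⊕ Fin N → ℂ) (a : K) : ℂ :=
  ∑ p : Cfg n (K ⊕ Fin N) D × D, pif (IsPlain X p.1 ∧ p.1.ty p.2 = .black ∧
    p.1.deco p.2 = .inl a) (mixSum r v val a p.1 p.2) 0

variable (r v) in
variable (D) in
/-- Sums over the sides of a face. -/
def mixSide (X : Spec n K) (val : Option K ⊕ Fin N → ℂ) (a : K) : ℂ :=
  ∑ p : Cfg n (K ⊕ Fin N) D × D, pif (IsPlain X p.1 ∧ p.1.deco p.2 = .inl a)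
    (mixSum r v val a (p.1.bisect p.2) none) 0

variable (r v) in
/-- Sums over the bivalent corners of a face. -/
def mixBivalent (D : Type) [Fintype D] (X : Spec n K) (val : Option K ⊕ Fin N → ℂ) (a : K) : ℂ :=
  ∑ p : Cfg n (K ⊕ Fin N) D × D, pif ((IsRooted X p.1 p.2 ∧ p.1.deco p.2 = .inl a) ∧
    (orb p.1.rot p.2).card = 2) (mixSum r v val a p.1 p.2) 0

theorem mixBivalent_congr (τ : D ≃ E) (X : Spec n K) (val : Option K ⊕ Fin N → ℂ) (a : K) :
    mixBivalent r v D X val a = mixBivalent r v E X val a := by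
  unfold mixBivalent
  rw [Fintype.sum_prod_type, Fintype.sum_prod_type, sum_map τ]
  refine Finset.sum_congr rfl fun G _ => ?_
  rw [← τ.sum_comp]
  refine Finset.sum_congr rfl fun c _ => pif_congr ?_ fun _ => (mixSum_map τ val a G c).symm
  dsimp only
  rw [isRooted_map_iff, card_orb_eq_two_iff, card_orb_eq_two_iff]
  simp

/-- As for `rootTot_bivalent`, but without a loop term: in the loop all darts belong to the root, so
there is no white dart to split the face from. -/
theorem total_mixBivalent (X : Spec n K) (val : Option K ⊕ Fin N → ℂ) (a : K) :
    total (fun m => mixBivalent r v (Fin m) X val a) =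
      total (fun m => mixSide r v (Fin m) X val a) := by
  rw [← zero_add (total (fun m => mixSide r v (Fin m) X val a))]
  refine total_of_step (B := X.bound) ?_ ?_ _ ?_ ?_ ?_ ?_
  · exact fun m hm => Finset.sum_eq_zero fun p _ =>
      pif_neg (fun h => not_isRooted_of_bound hm p.1 p.2 h.1.1) _ _
  · exact fun m hm => Finset.sum_eq_zero fun p _ =>
      pif_neg (fun h => not_isPlain_of_bound hm p.1 h.1) _ _
  · exact Fintype.sum_empty _
  · exact Finset.sum_eq_zero fun p _ => pif_neg (fun h => ne_of_subsingleton p.2 h.1.1) _ _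
  · have h0 : mixSide r v (Fin 0) X val a = 0 := Fintype.sum_empty _
    rw [h0, add_zero, mul_zero]
    refine Finset.sum_eq_zero fun p _ => ?_
    by_cases h : (IsRooted X p.1 p.2 ∧ p.1.deco p.2 = .inl a) ∧ (orb p.1.rot p.2).card = 2
    · rw [pif_pos h]
      refine Finset.sum_eq_zero fun e _ => pif_neg (fun h' => h'.1 ?_) _ _
      have huniv : orb p.1.rot p.2 = Finset.univ :=
        Finset.eq_univ_of_card _ (by rw [h.2, Fintype.card_fin])
      exact h.1.1.special e (mem_orb.1 (by rw [huniv]; exact Finset.mem_univ _))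
    · rw [pif_neg h]
  · intro m hm
    have : Nonempty (Fin m) := ⟨⟨0, hm⟩⟩
    rw [mixBivalent_congr (finOptOpt m), mixBivalent,
      sum_bivalent X a (mixSum r v val a) (fun τ G c => mixSum_map τ val a G c), Fintype.card_fin]
    rfl

/-- The edge of the white dart labelled `none` is removed. Its black end keeps degree at least two;
it is either an ordinary black vertex, or bivalent and then erased from its edge. -/
theorem plainTot_split {X : Spec n (Option K)} {a : K} (hX : X.Mergeable a)
    (hX2 : X.e + 2 = X.f → ∃ k, X.tp k ≠ X.tp none) (val : Option K ⊕ Fin N → ℂ) :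
    plainTot r v X val = propagator r v (val (.inl none)) (val (.inl (some a))) *
      total (fun m => mixCorner r v (Fin m) (X.merge a) val a +
        mixSide r v (Fin m) (X.merge a) val a) := by
  have hc : ∀ m, (X.merge a).bound ≤ m → mixCorner r v (Fin m) (X.merge a) val a = 0 :=
    fun m hm => Finset.sum_eq_zero fun p _ =>
      pif_neg (fun h => not_isPlain_of_bound hm p.1 h.1) _ _
  have hs : ∀ m, (X.merge a).bound ≤ m → mixSide r v (Fin m) (X.merge a) val a = 0 :=
    fun m hm => Finset.sum_eq_zero fun p _ =>
      pif_neg (fun h => not_isPlain_of_bound hm p.1 h.1) _ _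
  have hb : ∀ m, (X.merge a).bound ≤ m → mixBivalent r v (Fin m) (X.merge a) val a = 0 :=
    fun m hm => Finset.sum_eq_zero fun p _ =>
      pif_neg (fun h => not_isRooted_of_bound hm p.1 p.2 h.1.1) _ _
  rw [total_add hc hs, ← total_mixBivalent, ← total_add hc hb, ← total_const_mul]
  rw [← zero_add (total (fun m => propagator r v (val (.inl none)) (val (.inl (some a))) * _))]
  have key : ∀ m, mixCorner r v (Fin m) (X.merge a) val a +
      mixBivalent r v (Fin m) (X.merge a) val a = ∑ p : Cfg n (K ⊕ Fin N) (Fin m) × Fin m,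
          pif ((IsRooted (X.merge a) p.1 p.2 ∧ p.1.deco p.2 = .inl a) ∧ 2 ≤ (orb p.1.rot p.2).card)
            (mixSum r v val a p.1 p.2) 0 := fun m => by
    unfold mixCorner mixBivalent
    rw [← Finset.sum_add_distrib]
    refine Finset.sum_congr rfl fun p _ => ?_
    have h3 := isPlain_iff (X := X.merge a) (G := p.1) (c := p.2)
    have hpos := card_orb_pos p.1.rot p.2
    by_cases h4 : 3 ≤ (orb p.1.rot p.2).card
    · rw [pif_neg (p := _ ∧ _ = 2) (fun h => by omega), add_zero]
      refine pif_congr ?_ fun _ => rfl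
      constructor
      · exact fun h => ⟨⟨(h3.2 ⟨h.1, h.2.1⟩).1, h.2.2⟩, by omega⟩
      · exact fun h => ⟨(h3.1 ⟨h.1.1, h4⟩).1, (h3.1 ⟨h.1.1, h4⟩).2, h.1.2⟩
    · rw [pif_neg (p := IsPlain _ _ ∧ _) (fun h => h4 (h3.2 ⟨h.1, h.2.1⟩).2), zero_add]
      refine pif_congr (and_congr_right fun _ => ?_) fun _ => rfl
      omega
  refine total_of_step (B := (X.merge a).bound + X.bound) ?_ ?_ _ ?_ ?_ ?_ ?_
  · exact fun m hm => plainSum_eq_zero (by omega) _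
  · intro m hm
    rw [hc m (by omega), hb m (by omega), add_zero, mul_zero]
  · refine Finset.sum_eq_zero fun G _ => pif_neg (fun h => ?_) _ _
    obtain ⟨d, -⟩ := h.mark_ex none
    exact d.elim0
  · refine Finset.sum_eq_zero fun G _ => pif_neg (fun h => ?_) _ _
    exact ne_of_subsingleton 0 h
  · rw [plainSum_congr (finOptOpt 0), plainSum_split hX hX2, key]
    simp
  · intro m hm
    rw [plainSum_congr (finOptOpt m), plainSum_split hX hX2, key, Fintype.card_fin]

end MixedSums

/-! ### Moving along a face -/

section Telescope

variable {r : ℕ} {v : ℕ → ℂ} {n N : ℕ} {K D : Type} [Fintype K] [Fintype D]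

open Classical in
/-- The labels where the face `a` is split after the first `i` darts following `e`. -/
def Cfg.stepLab (G : Cfg n (K ⊕ Fin N) D) (a : K) (e : D) (i : ℕ) (d : D) : Option K ⊕ Fin N :=
  if G.deco d = .inl a ∧ ¬ ∃ j < i, (G.face^[j]) e = d then .inl none
  else Sum.map some id (G.deco d)

theorem iterate_ne {f : Perm D} {e : D} {i j : ℕ} (hi : i < Function.minimalPeriod f e)
    (hj : j < i) : (f^[j]) e ≠ (f^[i]) e := fun h => by
  have := Function.iterate_injOn_Iio_minimalPeriod (f := f) (x := e)
    (show j ∈ Set.Iio _ from hj.trans hi) hi h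
  omega

theorem before_iterate {f : Perm D} {e : D} {i : ℕ} (hi : i < Function.minimalPeriod f e) (d : D) :
    Before f e ((f^[i]) e) d ↔ ∃ j < i, (f^[j]) e = d := by
  constructor
  · rintro ⟨s, h1, h2⟩
    refine ⟨s, ?_, h1⟩
    by_contra h
    exact h2 i (by omega) rfl
  · rintro ⟨j, hj, rfl⟩
    exact ⟨j, rfl, fun t ht => iterate_ne hi (by omega)⟩

theorem splitLab_iterate (G : Cfg n (K ⊕ Fin N) D) (a : K) (e : D) {i : ℕ}
    (hi : i < Function.minimalPeriod G.face e) :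
    G.splitLab a e ((G.face^[i]) e) = G.stepLab a e i := by
  funext d
  unfold Cfg.splitLab Cfg.stepLab
  classical
  exact if_congr (and_congr_right fun _ => not_congr (before_iterate hi d)) rfl rfl

/-- The dart `none` comes right after `(face ^ i) e`, so it is preceded by the first `i + 1` darts
of the face; `some none` comes right after the opposite of that dart and lies on the same side of
the cut. -/
theorem before_bisect {X : Spec n K} {G : Cfg n (K ⊕ Fin N) D} (h : IsPlain X G) {e : D} {i : ℕ}
    (hi : i < Function.minimalPeriod G.face e) (u : Option (Option D))
    (hu : (G.bisect ((G.face^[i]) e)).face.SameCycle (some (some e)) u) :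
    Before (G.bisect ((G.face^[i]) e)).face (some (some e)) none u ↔
      ext2 False (∃ j < i + 1, (G.face^[j]) e = G.opp ((G.face^[i]) e))
        (fun d => ∃ j < i + 1, (G.face^[j]) e = d) u := by
  classical
  set d := (G.face^[i]) e with hd
  have hne : G.opp d ≠ d := h.opp_ne d
  have hf1 : (G.bisect d).face (some (some d)) = none := by
    rw [Cfg.bisect_face, insOpt_self]
  have hf2 : (G.bisect d).face (some (some (G.opp d))) = some none := by
    rw [Cfg.bisect_face, insOpt_of_ne _ _ (by simpa using hne), insOpt_self]
  have hf3 : ∀ b, b ≠ d → b ≠ G.opp d →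
      (G.bisect d).face (some (some b)) = some (some (G.face b)) := fun b h1 h2 => by
    rw [Cfg.bisect_face, insOpt_of_ne _ _ (by simpa using h1), insOpt_of_ne _ _ h2]
  have hf4 : (G.bisect d).face none = some (some (G.face d)) := by
    rw [Cfg.bisect_face, insOpt_none, insOpt_of_ne _ _ hne.symm]
  have hf5 : (G.bisect d).face (some none) = some (some (G.face (G.opp d))) := by
    rw [Cfg.bisect_face, insOpt_of_ne _ _ (by simp), insOpt_none]
  have key : ∀ b, b ≠ d → G.face b ≠ e →
      ((∃ j < i + 1, (G.face^[j]) e = G.face b) ↔ ∃ j < i + 1, (G.face^[j]) e = b) := by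
    intro b hb1 hb2
    constructor
    · rintro ⟨j, hj, hj'⟩
      rcases j with _ | j
      · exact absurd hj'.symm hb2
      · rw [Function.iterate_succ_apply'] at hj'
        exact ⟨j, by omega, G.face.injective hj'⟩
    · rintro ⟨j, hj, rfl⟩
      refine ⟨j + 1, ?_, Function.iterate_succ_apply' _ _ _⟩
      have : j ≠ i := fun h => hb1 (by rw [h])
      omega
  refine (before_unique (p := fun u => ext2 False (∃ j < i + 1, (G.face^[j]) e = G.opp d)
        (fun d => ∃ j < i + 1, (G.face^[j]) e = d) u) ?_ ?_ ?_ hu).symm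
  · exact ⟨0, by omega, rfl⟩
  · exact id
  · rintro (_ | _ | b) h1 h2
    · rw [hf4] at h2 ⊢
      simp only [ext2_some, ext2_none, iff_false]
      rintro ⟨j, hj, hj'⟩
      rcases j with _ | j
      · exact h2 (by rw [← hj']; rfl)
      · rw [Function.iterate_succ_apply'] at hj'
        exact iterate_ne hi (by omega) (G.face.injective hj')
    · rw [hf5] at h2 ⊢
      simp only [ext2_some, ext2_some_none]
      exact key _ hne (by simpa using h2)
    · by_cases hb : b = d
      · rw [hb] at h1
        exact absurd hf1 h1
      by_cases hb' : b = G.opp d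
      · rw [hb', hf2]; rfl
      · rw [hf3 b hb hb'] at h2 ⊢
        simp only [ext2_some]
        exact key b hb (by simpa using h2)

theorem splitLab_bisect {X : Spec n K} {G : Cfg n (K ⊕ Fin N) D} (h : IsPlain X G) {a : K} {e : D}
    (he : G.deco e = .inl a) {i : ℕ} (hi : i < Function.minimalPeriod G.face e) :
    (G.bisect ((G.face^[i]) e)).splitLab a (some (some e)) none =
      ext2 (.inl none) (G.stepLab a e (i + 1) (G.opp ((G.face^[i]) e))) (G.stepLab a e (i + 1)) := by
  classical
  set d := (G.face^[i]) e with hd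
  have hcyc : ∀ u, (G.bisect d).deco u = .inl a →
      (G.bisect d).face.SameCycle (some (some e)) u := fun u hu => by
    rw [Cfg.bisect_sameCycle_face]
    refine h.mark_unique a _ _ he ?_
    rcases u with _ | _ | b <;> exact hu
  have hda : G.deco d = .inl a := by
    rw [← he]; exact (h.deco_sameCycle (sameCycle_iterate e i)).symm
  have hB := fun u hu => before_bisect h hi u (hcyc u hu)
  funext u
  unfold Cfg.splitLab
  rcases u with _ | _ | b
  · rw [if_pos ⟨hda, not_before⟩]; rfl
  · by_cases hu : G.deco (G.opp d) = .inl a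
    · have := hB (some none) hu
      simp only [ext2_some_none] at this
      rw [← hd] at this
      simp only [this, ext2_some_none, Cfg.stepLab]
      rfl
    · rw [if_neg (fun h' => hu h'.1)]
      simp only [ext2_some_none, Cfg.stepLab]
      rw [if_neg (fun h' => hu h'.1)]
      rfl
  · by_cases hu : G.deco b = .inl a
    · have := hB (some (some b)) hu
      simp only [ext2_some] at this
      rw [← hd] at this
      simp only [this, ext2_some, Cfg.stepLab]
      rfl
    · rw [if_neg (fun h' => hu h'.1)]
      simp only [ext2_some, Cfg.stepLab]
      rw [if_neg (fun h' => hu h'.1)]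
      rfl

theorem stepLab_zero (G : Cfg n (K ⊕ Fin N) D) (a : K) (e : D) [DecidableEq (K ⊕ Fin N)]
    (val : Option K ⊕ Fin N → ℂ) :
    val ∘ G.stepLab a e 0 = Function.update (val ∘ Sum.map some id) (.inl a) (val (.inl none)) ∘
      G.deco := by
  funext d
  unfold Cfg.stepLab
  by_cases h : G.deco d = .inl a <;> simp [h]

theorem stepLab_last {X : Spec n K} {G : Cfg n (K ⊕ Fin N) D} (h : IsPlain X G) {a : K} {e : D}
    (he : G.deco e = .inl a) (val : Option K ⊕ Fin N → ℂ) :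
    val ∘ G.stepLab a e (Function.minimalPeriod G.face e) =
      (val ∘ Sum.map some id) ∘ G.deco := by
  classical
  funext d
  unfold Cfg.stepLab
  rw [Function.comp_apply, if_neg]
  · rfl
  rintro ⟨h1, h2⟩
  obtain ⟨i, hi⟩ := exists_iterate_of_sameCycle (h.mark_unique a _ _ he h1)
  have hpos : 0 < Function.minimalPeriod G.face e :=
    Function.minimalPeriod_pos_of_mem_periodicPts (G.face.injective.mem_periodicPts e)
  exact h2 ⟨i % Function.minimalPeriod G.face e, Nat.mod_lt _ hpos, by
    rw [Function.iterate_mod_minimalPeriod_eq, hi]⟩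

theorem stepLab_succ [DecidableEq D] {X : Spec n K} {G : Cfg n (K ⊕ Fin N) D} (h : IsPlain X G)
    {a : K} {e : D} (he : G.deco e = .inl a) {i : ℕ} (hi : i < Function.minimalPeriod G.face e)
    (val : Option K ⊕ Fin N → ℂ) :
    val ∘ G.stepLab a e (i + 1) = Function.update (val ∘ G.stepLab a e (i + 1)) ((G.face^[i]) e)
        (val (.inl (some a))) ∧
      val ∘ G.stepLab a e i = Function.update (val ∘ G.stepLab a e (i + 1)) ((G.face^[i]) e)
        (val (.inl none)) := by
  have hda : G.deco ((G.face^[i]) e) = .inl a := by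
    rw [← he]; exact (h.deco_sameCycle (sameCycle_iterate e i)).symm
  constructor
  · symm
    rw [Function.update_eq_self_iff]
    unfold Cfg.stepLab
    rw [Function.comp_apply, if_neg (fun h' => h'.2 ⟨i, by omega, rfl⟩)]
    exact congrArg val (congrArg (Sum.map some id) hda.symm)
  · rw [Function.eq_update_iff]
    constructor
    · unfold Cfg.stepLab
      rw [Function.comp_apply, if_pos ⟨hda, fun ⟨j, hj, hj'⟩ => iterate_ne hi hj hj'⟩]
    · intro d hd
      rw [Function.comp_apply, Function.comp_apply]
      congr 1
      unfold Cfg.stepLab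
      have : (∃ j < i, (G.face^[j]) e = d) ↔ ∃ j < i + 1, (G.face^[j]) e = d := by
        constructor
        · rintro ⟨j, hj, hj'⟩; exact ⟨j, by omega, hj'⟩
        · rintro ⟨j, hj, hj'⟩
          have : j ≠ i := fun h => hd (by rw [← hj', h])
          exact ⟨j, by omega, hj'⟩
      by_cases h1 : G.deco d = .inl a ∧ ¬ ∃ j < i, (G.face^[j]) e = d
      · rw [if_pos h1, if_pos ⟨h1.1, fun h2 => h1.2 (this.2 h2)⟩]
      · rw [if_neg h1, if_neg fun h2 => h1 ⟨h2.1, fun h3 => h2.2 (this.1 h3)⟩]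

/-- Passing one dart `d` changes its label, both as a corner and as a side. The change at the corner
gives the graph split at the vertex of `d` (`vprod_diff`), or nothing if this vertex is white; the
change at the side gives the graph split at a new vertex on the edge (`eprod_diff`). -/
theorem mixWt_step {X : Spec n K} {G : Cfg n (K ⊕ Fin N) D} (h : IsPlain X G) {a : K} {e : D}
    (he : G.deco e = .inl a) {i : ℕ} (hi : i < Function.minimalPeriod G.face e)
    (val : Option K ⊕ Fin N → ℂ) (hv : ∀ p q, vw r v {val p, val q} ≠ 0) :
    (val (.inl none) - val (.inl (some a))) *
      (pif (G.ty ((G.face^[i]) e) = .black) (mixWt r v val a G e ((G.face^[i]) e)) 0 +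
        mixWt r v val a (G.bisect ((G.face^[i]) e)) (some (some e)) none) =
      eprod r v G.opp (val ∘ G.stepLab a e i) * vprod r v G.rot G.ty (val ∘ G.stepLab a e i) -
      eprod r v G.opp (val ∘ G.stepLab a e (i + 1)) *
        vprod r v G.rot G.ty (val ∘ G.stepLab a e (i + 1)) := by
  classical
  obtain ⟨h1, h2⟩ := stepLab_succ h he hi val
  set d := (G.face^[i]) e with hd
  set ls := val ∘ G.stepLab a e (i + 1) with hls
  set zn := val (.inl none)
  set za := val (.inl (some a))
  have hside : mixWt r v val a (G.bisect d) (some (some e)) none =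
      propagator r v zn (ls (G.opp d)) * eprod r v G.opp ls *
        (vw r v (za ::ₘ {zn, ls (G.opp d)}) * vprod r v G.rot G.ty ls) := by
    unfold mixWt
    rw [splitLab_bisect h he hi, eprod_bisect h.opp_opp h.opp_ne _ _ rfl]
    congr 1
    exact rprod_pair (r := r) (v := v) G.rot (G.bisect d).ty _ _
  have hcorner : (zn - za) * pif (G.ty d = .black) (mixWt r v val a G e d) 0 =
      eprod r v G.opp (val ∘ G.stepLab a e i) *
        (vprod r v G.rot G.ty (val ∘ G.stepLab a e i) - vprod r v G.rot G.ty ls) := by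
    by_cases hb : G.ty d = .black
    · rw [pif_pos hb]
      unfold mixWt
      rw [splitLab_iterate G a e hi]
      have hc : ∀ d', G.rot.SameCycle d d' → G.ty d' = .black :=
        fun d' hd' => (h.ty_sameCycle hd').symm.trans hb
      have := vprod_diff (r := r) (v := v) G.rot G.ty ls d hc za zn
      rw [← h1, ← h2] at this
      linear_combination (eprod r v G.opp (val ∘ G.stepLab a e i)) * this
    · rw [pif_neg hb, mul_zero]
      have : vprod r v G.rot G.ty (val ∘ G.stepLab a e i) = vprod r v G.rot G.ty ls := by
        refine vprod_congr _ _ fun d' hd' => ?_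
        rw [h2, Function.update_of_ne]
        rintro rfl
        exact hb hd'
      rw [this, sub_self, mul_zero]
  have hE := eprod_diff (r := r) (v := v) G.opp h.opp_opp h.opp_ne ls d zn za (hv _ _) (hv _ _)
  rw [← h1, ← h2] at hE
  have hm : (za ::ₘ {zn, ls (G.opp d)} : Multiset ℂ) = {zn, za, ls (G.opp d)} :=
    Multiset.cons_swap _ _ _
  rw [mul_add, hcorner, hside, hm]
  linear_combination (-vprod r v G.rot G.ty ls) * hE

/-- The face is walked once around from its white dart `e`. The steps telescope between the
labelling of the whole face by `none` and that by `a`. -/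
theorem mixWt_telescope [DecidableEq K] {Y : Spec n K} {G : Cfg n (K ⊕ Fin N) D} (h : IsPlain Y G)
    {a : K} (ha : Y.cil a) (val : Option K ⊕ Fin N → ℂ) (hv : ∀ p q, vw r v {val p, val q} ≠ 0) :
    (val (.inl none) - val (.inl (some a))) *
      (∑ c, pif (G.ty c = .black ∧ G.deco c = .inl a) (mixSum r v val a G c) 0 +
        ∑ d, pif (G.deco d = .inl a) (mixSum r v val a (G.bisect d) none) 0) =
      wt r v (Function.update (val ∘ Sum.map some id) (.inl a) (val (.inl none))) G -
        wt r v (val ∘ Sum.map some id) G := by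
  obtain ⟨e, hew, he⟩ := h.white_ex a ha
  have hm1 : ∀ c, mixSum r v val a G c = mixWt r v val a G e c := fun c =>
    sum_pif_unique _ e fun b => ⟨fun hb => h.white_unique _ _ hb.1 hew (hb.2.trans he.symm),
      fun hb => hb ▸ ⟨hew, he⟩⟩
  have hm2 : ∀ d, mixSum r v val a (G.bisect d) none =
      mixWt r v val a (G.bisect d) (some (some e)) none := fun d => by
    refine sum_pif_unique _ (some (some e)) ?_
    rintro (_ | _ | b)
    · simp [Cfg.bisect]
    · simp [Cfg.bisect]
    · constructor
      · rintro ⟨h1, h2⟩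
        rw [h.white_unique b e h1 hew (h2.trans he.symm)]
      · intro hb
        obtain rfl : b = e := by simpa using hb
        exact ⟨hew, he⟩
  have hcyc : ∀ d, G.deco d = .inl a ↔ G.face.SameCycle e d := fun d =>
    ⟨fun hd => h.mark_unique a e d he hd, fun hd => (h.deco_sameCycle hd).symm.trans he⟩
  have hsum : ∑ c, pif (G.ty c = .black ∧ G.deco c = .inl a) (mixSum r v val a G c) 0 +
        ∑ d, pif (G.deco d = .inl a) (mixSum r v val a (G.bisect d) none) 0 =
      ∑ d, pif (G.face.SameCycle e d) (pif (G.ty d = .black) (mixWt r v val a G e d) 0 +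
        mixWt r v val a (G.bisect d) (some (some e)) none) 0 := by
    rw [← Finset.sum_add_distrib]
    refine Finset.sum_congr rfl fun d _ => ?_
    rw [hm1, hm2, hcyc]
    unfold pif
    by_cases h1 : G.ty d = .black <;> by_cases h2 : G.face.SameCycle e d <;> simp [h1, h2]
  rw [hsum, sum_cycle, Finset.mul_sum, Finset.sum_congr rfl fun i hi =>
    mixWt_step h he (Finset.mem_range.1 hi) val hv, Finset.sum_range_sub', stepLab_zero,
    stepLab_last h he]
  rfl

/-- The relation between graphs with two consecutive faces at a white vertex and graphs where these
faces are merged. -/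
theorem plainTot_merge [DecidableEq K] {X : Spec n (Option K)} {a : K} (hX : X.Mergeable a)
    (hX2 : X.e + 2 = X.f → ∃ k, X.tp k ≠ X.tp none) (val : Option K ⊕ Fin N → ℂ)
    (hv : ∀ p q, vw r v {val p, val q} ≠ 0) (hne : val (.inl none) ≠ val (.inl (some a))) :
    plainTot r v X val = (dV r v (val (.inl none)) - dV r v (val (.inl (some a))))⁻¹ *
      (plainTot r v (X.merge a)
        (Function.update (val ∘ Sum.map some id) (.inl a) (val (.inl none))) -
      plainTot r v (X.merge a) (val ∘ Sum.map some id)) := by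
  -- The numerator of the propagator of the removed edge is exactly the factor required by
  -- `mixWt_telescope`.
  rw [plainTot_split hX hX2, propagator, if_neg hne, div_eq_mul_inv, mul_comm (_ - _), mul_assoc]
  congr 1
  unfold plainTot
  rw [← total_const_mul, sub_eq_add_neg (total _), ← neg_one_mul (total _), ← total_const_mul,
    ← total_add (B := (X.merge a).bound) (fun m hm => plainSum_eq_zero hm _)
      (fun m hm => by rw [plainSum_eq_zero hm, mul_zero])]
  congr 1
  funext m
  unfold mixCorner mixSide plainSum
  rw [Fintype.sum_prod_type, Fintype.sum_prod_type, ← Finset.sum_add_distrib, Finset.mul_sum,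
    Finset.mul_sum, ← Finset.sum_add_distrib]
  refine Finset.sum_congr rfl fun G _ => ?_
  by_cases h : IsPlain (X.merge a) G
  · rw [pif_pos h, pif_pos h, neg_one_mul, ← sub_eq_add_neg,
      ← mixWt_telescope h (show (X.merge a).cil a from trivial) val hv]
    congr 2
    · exact Finset.sum_congr rfl fun c _ => pif_congr (by simp [h]) fun _ => rfl
    · exact Finset.sum_congr rfl fun c _ => pif_congr (by simp [h]) fun _ => rfl
  · rw [pif_neg h, pif_neg h, Finset.sum_eq_zero, Finset.sum_eq_zero]
    · simp
    · exact fun d _ => pif_neg (fun h' => h h'.1) _ _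
    · exact fun d _ => pif_neg (fun h' => h h'.1) _ _

end Telescope

/-! ### Renaming the marked faces -/

section Relabel

variable {r : ℕ} {v : ℕ → ℂ} {n N : ℕ} {K K₂ D : Type} [Fintype K] [Fintype K₂] [Fintype D]

def Cfg.relabel {L L₂ : Type} (e : L ≃ L₂) (G : Cfg n L D) : Cfg n L₂ D :=
  ⟨G.rot, G.opp, G.ty, e ∘ G.deco⟩

def Cfg.relabelEquiv {L L₂ : Type} (e : L ≃ L₂) : Cfg n L D ≃ Cfg n L₂ D where
  toFun := Cfg.relabel e
  invFun := Cfg.relabel e.symm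
  left_inv G := by ext <;> simp [Cfg.relabel]
  right_inv G := by ext <;> simp [Cfg.relabel]

def Spec.relabel (e : K ≃ K₂) (X : Spec n K) : Spec n K₂ :=
  ⟨X.cil ∘ e.symm, e ∘ X.next ∘ e.symm, X.tp ∘ e.symm, X.e, X.f⟩

theorem IsGraph.relabel (e : K ≃ K₂) {X : Spec n K} {S : D → Prop} {G : Cfg n (K ⊕ Fin N) D}
    (h : IsGraph X S G) : IsGraph (X.relabel e) S (G.relabel (e.sumCongr (Equiv.refl _))) := by
  have hd : ∀ d k, (G.relabel (e.sumCongr (Equiv.refl _))).deco d = .inl k ↔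
      G.deco d = .inl (e.symm k) := fun d k => by
    unfold Cfg.relabel
    rcases h : G.deco d with k' | j
    · simp [h, Equiv.eq_symm_apply]
    · simp [h]
  refine ⟨h.opp_opp, h.opp_ne, h.ty_rot, ?_, h.conn, h.vert, h.fac, ?_, ?_, ?_, h.special, h.deg,
    ?_, ?_⟩
  · exact fun d => congrArg (e.sumCongr (Equiv.refl (Fin N))) (h.deco_face d)
  · intro d hw
    obtain ⟨k, h1, h2, h3, h4⟩ := h.white d hw
    refine ⟨e k, ?_, ?_, ?_, ?_⟩
    · simpa [Spec.relabel] using h1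
    · rw [hd, h2, symm_apply_apply]
    · rw [hd]
      refine h3.trans ?_
      simp [Spec.relabel]
    · refine h4.trans ?_
      simp [Spec.relabel]
  · intro k hk
    obtain ⟨d, h1, h2⟩ := h.white_ex (e.symm k) hk
    exact ⟨d, h1, (hd _ _).2 h2⟩
  · exact fun d d' h1 h2 h3 => h.white_unique d d' h1 h2
      ((e.sumCongr (Equiv.refl _)).injective h3)
  · intro k
    obtain ⟨d, h1⟩ := h.mark_ex (e.symm k)
    exact ⟨d, (hd _ _).2 h1⟩
  · exact fun k d d' h1 h2 => h.mark_unique _ d d' ((hd _ _).1 h1) ((hd _ _).1 h2)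

theorem isGraph_relabel_iff (e : K ≃ K₂) {X : Spec n K} {S : D → Prop} {G : Cfg n (K ⊕ Fin N) D} :
    IsGraph (X.relabel e) S (G.relabel (e.sumCongr (Equiv.refl _))) ↔ IsGraph X S G := by
  refine ⟨fun h => ?_, fun h => h.relabel e⟩
  have h1 := h.relabel e.symm
  have h2 : (X.relabel e).relabel e.symm = X := by
    cases X
    simp [Spec.relabel, Function.comp_def]
  have h3 : (G.relabel (e.sumCongr (Equiv.refl _))).relabel (e.symm.sumCongr (Equiv.refl _)) = G :=
    (Cfg.relabelEquiv (e.sumCongr (Equiv.refl _))).left_inv G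
  rwa [h2, h3] at h1

theorem plainTot_relabel (e : K ≃ K₂) (X : Spec n K) (z : K → ℂ) (lam : Fin N → ℂ) :
    plainTot r v (X.relabel e) (Sum.elim (z ∘ e.symm) lam) = plainTot r v X (Sum.elim z lam) := by
  unfold plainTot
  congr 1
  funext m
  unfold plainSum
  rw [← (Cfg.relabelEquiv (e.sumCongr (Equiv.refl (Fin N)))).sum_comp]
  refine Finset.sum_congr rfl fun G _ => pif_congr (isGraph_relabel_iff e) fun _ => ?_
  have : Sum.elim (z ∘ e.symm) lam ∘ (e.sumCongr (Equiv.refl (Fin N))) ∘ G.deco =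
      Sum.elim z lam ∘ G.deco := by
    funext d
    rcases h : G.deco d with k | j <;> simp [h]
  unfold wt
  change eprod r v G.opp (Sum.elim (z ∘ e.symm) lam ∘ (e.sumCongr (Equiv.refl (Fin N))) ∘ G.deco) *
    vprod r v G.rot G.ty (Sum.elim (z ∘ e.symm) lam ∘ (e.sumCongr (Equiv.refl (Fin N))) ∘ G.deco) = _
  rw [this]

end Relabel

/-! ### Sums over representatives -/

section Representatives

variable {n : ℕ} {K K₂ : Type} [Fintype K] [Fintype K₂]

/-- The kernel `∏ 1 / (F(z_{s_i}) - F(z_k))`, where `k` runs over the elements not chosen by `s`. -/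
def repKer (tp : K → Fin n) (F : ℂ → ℂ) (z : K → ℂ) (s : Fin n → K) : ℂ :=
  ∏ k, pif (k = s (tp k)) 1 (F (z (s (tp k))) - F (z k))⁻¹

/-- The sections `s` of `tp` choose one of the faces around each white vertex. -/
def repSum (tp : K → Fin n) (W : (Fin n → ℂ) → ℂ) (F : ℂ → ℂ) (z : K → ℂ) : ℂ :=
  ∑ s : Fin n → K, pif (∀ i, tp (s i) = i) (W (z ∘ s) * repKer tp F z s) 0

theorem repSum_relabel (e : K ≃ K₂) (tp : K → Fin n) (W : (Fin n → ℂ) → ℂ) (F : ℂ → ℂ)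
    (z : K → ℂ) : repSum (tp ∘ e.symm) W F (z ∘ e.symm) = repSum tp W F z := by
  unfold repSum
  rw [← (Equiv.arrowCongr (Equiv.refl (Fin n)) e).sum_comp]
  refine Finset.sum_congr rfl fun s _ => pif_congr (by simp) fun _ => ?_
  congr 1
  · congr 1
    funext i
    simp
  · unfold repKer
    rw [← e.prod_comp]
    refine Finset.prod_congr rfl fun k _ => ?_
    rw [Function.comp_apply, symm_apply_apply]
    change pif (e k = e (s (tp k))) 1 _ = _
    rw [show (e k = e (s (tp k))) = (k = s (tp k)) from propext e.apply_eq_iff_eq]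
    simp

theorem repSum_bijective {tp : K → Fin n} (htp : Function.Bijective tp) (W : (Fin n → ℂ) → ℂ)
    (F : ℂ → ℂ) (z : K → ℂ) :
    repSum tp W F z = W (z ∘ (Equiv.ofBijective tp htp).symm) := by
  unfold repSum
  have h : ∀ s : Fin n → K, (∀ i, tp (s i) = i) ↔ s = (Equiv.ofBijective tp htp).symm := fun s => by
    constructor
    · intro h
      funext i
      rw [eq_symm_apply]
      exact h i
    · rintro rfl i
      exact (Equiv.ofBijective tp htp).apply_symm_apply i
  rw [sum_pif_unique _ _ h, repKer, Finset.prod_eq_one, mul_one]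
  intro k _
  rw [pif_pos]
  exact ((Equiv.ofBijective tp htp).symm_apply_apply k).symm

variable {tp : Option K → Fin n} {a : K}

/-- A section either avoids `none`, or takes the value `none` on its class; in the second case it
comes from a unique section choosing `a` there. -/
theorem sum_option (htp : tp none = tp (some a)) (g : (Fin n → Option K) → ℂ) :
    ∑ s : Fin n → Option K, pif (∀ i, tp (s i) = i) (g s) 0 =
      ∑ t : Fin n → K, pif (∀ i, tp (some (t i)) = i) (g (some ∘ t) +
        pif (t (tp none) = a) (g (Function.update (some ∘ t) (tp none) none)) 0) 0 := by
  classical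
  have h1 : ∑ s : Fin n → Option K, pif (∀ i, tp (s i) = i) (g s) 0 =
      ∑ s : Fin n → Option K, pif ((∀ i, tp (s i) = i) ∧ s (tp none) ≠ none) (g s) 0 +
      ∑ s : Fin n → Option K, pif ((∀ i, tp (s i) = i) ∧ s (tp none) = none) (g s) 0 := by
    rw [← Finset.sum_add_distrib]
    refine Finset.sum_congr rfl fun s _ => ?_
    unfold pif
    by_cases h1 : ∀ i, tp (s i) = i <;> by_cases h2 : s (tp none) = none <;> simp [h1, h2]
  have h2 : ∑ t : Fin n → K, pif (∀ i, tp (some (t i)) = i) (g (some ∘ t) +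
        pif (t (tp none) = a) (g (Function.update (some ∘ t) (tp none) none)) 0) 0 =
      ∑ t : Fin n → K, pif (∀ i, tp (some (t i)) = i) (g (some ∘ t)) 0 +
      ∑ t : Fin n → K, pif ((∀ i, tp (some (t i)) = i) ∧ t (tp none) = a)
        (g (Function.update (some ∘ t) (tp none) none)) 0 := by
    rw [← Finset.sum_add_distrib]
    refine Finset.sum_congr rfl fun s _ => ?_
    unfold pif
    by_cases h1 : ∀ i, tp (some (s i)) = i <;> by_cases h2 : s (tp none) = a <;> simp [h1, h2]
  have hsome : ∀ s : Fin n → Option K, (∀ i, tp (s i) = i) → ∀ i, i ≠ tp none → s i ≠ none :=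
    fun s hs i hi h => hi (by rw [← hs i, h])
  rw [h1, h2]
  congr 1
  · refine sum_pif_bij (fun t => some ∘ t) ?_ ?_ ?_ ?_
    · exact fun t ht => ⟨ht, by simp⟩
    · exact fun t t' _ _ h => funext fun i => Option.some_injective _ (congrFun h i)
    · rintro s ⟨hs1, hs2⟩
      have : ∀ i, ∃ k, s i = some k := fun i => by
        by_cases hi : i = tp none
        · rw [hi]; exact Option.ne_none_iff_exists'.1 hs2
        · exact Option.ne_none_iff_exists'.1 (hsome s hs1 i hi)
      choose t ht using this
      exact ⟨t, fun i => by rw [← ht, hs1], funext fun i => (ht i).symm⟩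
    · exact fun _ _ => rfl
  · refine sum_pif_bij (fun t => Function.update (some ∘ t) (tp none) none) ?_ ?_ ?_ ?_
    · rintro t ⟨ht, -⟩
      refine ⟨fun i => ?_, by simp⟩
      by_cases hi : i = tp none
      · rw [hi, Function.update_self]
      · rw [Function.update_of_ne hi]; exact ht i
    · rintro t t' ⟨-, ht⟩ ⟨-, ht'⟩ h
      funext i
      by_cases hi : i = tp none
      · rw [hi, ht, ht']
      · have := congrFun h i
        rw [Function.update_of_ne hi, Function.update_of_ne hi] at this
        exact Option.some_injective _ this
    · rintro s ⟨hs1, hs2⟩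
      have : ∀ i, ∃ k, Function.update s (tp none) (some a) i = some k := fun i => by
        by_cases hi : i = tp none
        · rw [hi, Function.update_self]; exact ⟨a, rfl⟩
        · rw [Function.update_of_ne hi]
          exact Option.ne_none_iff_exists'.1 (hsome s hs1 i hi)
      choose t ht using this
      refine ⟨t, ⟨fun i => ?_, ?_⟩, ?_⟩
      · rw [← ht]
        by_cases hi : i = tp none
        · rw [hi, Function.update_self, htp]
        · rw [Function.update_of_ne hi, hs1]
      · have := ht (tp none)
        rw [Function.update_self] at this
        exact (Option.some_injective _ this).symm
      · funext i
        by_cases hi : i = tp none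
        · rw [hi, Function.update_self, hs2]
        · rw [Function.update_of_ne hi, Function.comp_apply, ← ht, Function.update_of_ne hi]
    · exact fun _ _ => rfl

/-- The same recursion as in `plainTot_merge`, checked for each section of the merged classes. If it
chooses `a`, the two terms on the right are those of the choices `none` and `a`. If it chooses
another element `b`, the identity is the partial fraction decomposition of the product of `1 /
(F(z_b) - F(z_none))` and `1 / (F(z_b) - F(z_a))`. -/
theorem repSum_option [DecidableEq K] (htp : tp none = tp (some a)) (W : (Fin n → ℂ) → ℂ)
    (F : ℂ → ℂ) (z : Option K → ℂ)
    (hF : ∀ k k', tp k = tp k' → k ≠ k' → F (z k) ≠ F (z k')) :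
    repSum tp W F z = (F (z none) - F (z (some a)))⁻¹ *
      (repSum (tp ∘ some) W F (Function.update (z ∘ some) a (z none)) -
        repSum (tp ∘ some) W F (z ∘ some)) := by
  classical
  have hna : F (z none) - F (z (some a)) ≠ 0 := sub_ne_zero.2 (hF _ _ htp (by simp))
  rw [eq_inv_mul_iff_mul_eq₀ hna]
  unfold repSum
  rw [sum_option htp, Finset.mul_sum, ← Finset.sum_sub_distrib]
  refine Finset.sum_congr rfl fun t _ => ?_
  by_cases ht : ∀ i, tp (some (t i)) = i
  swap
  · rw [pif_neg ht, pif_neg (p := ∀ i, (tp ∘ some) (t i) = i) ht, pif_neg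
      (p := ∀ i, (tp ∘ some) (t i) = i) ht]
    simp
  rw [pif_pos ht, pif_pos (p := ∀ i, (tp ∘ some) (t i) = i) ht, pif_pos
      (p := ∀ i, (tp ∘ some) (t i) = i) ht]
  have hta : ∀ i, i ≠ tp none → t i ≠ a := fun i hi h => hi (by rw [← ht i, h, htp])
  set zn := Function.update (z ∘ some) a (z none) with hzn
  have hza : zn a = z none := Function.update_self _ _ _
  have hzk : ∀ k, k ≠ a → zn k = z (some k) := fun k hk => Function.update_of_ne hk _ _
  have hker : repKer tp F z (some ∘ t) =
      (F (z (some (t (tp none)))) - F (z none))⁻¹ * repKer (tp ∘ some) F (z ∘ some) t := by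
    unfold repKer
    rw [Fintype.prod_option, pif_neg (by simp)]
    congr 1
    refine Finset.prod_congr rfl fun k _ => ?_
    unfold pif
    simp
  by_cases hb : t (tp none) = a
  · have hk1 : repKer tp F z (Function.update (some ∘ t) (tp none) none) =
        (F (z none) - F (z (some a)))⁻¹ * repKer (tp ∘ some) F zn t := by
      unfold repKer
      rw [Fintype.prod_option, pif_pos (by simp), one_mul,
        ← Finset.mul_prod_erase _ _ (Finset.mem_univ a),
        ← Finset.mul_prod_erase _ (fun k => pif (k = t _) _ _) (Finset.mem_univ a),
        pif_neg (by rw [← htp]; simp), ← htp, Function.update_self, pif_pos (p := a = _), one_mul]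
      · congr 1
        refine Finset.prod_congr rfl fun k hk => ?_
        have hka := (Finset.mem_erase.1 hk).1
        rw [Function.comp_apply, hzk k hka]
        by_cases hi : tp (some k) = tp none
        · rw [hi, Function.update_self, pif_neg (by simp), hb, pif_neg hka, hza]
        · rw [Function.update_of_ne hi, hzk _ (hta _ hi)]
          unfold pif
          simp
      · rw [Function.comp_apply, ← htp, hb]
    have hzt : z ∘ Function.update (some ∘ t) (tp none) none = zn ∘ t := by
      funext i
      by_cases hi : i = tp none
      · rw [Function.comp_apply, Function.comp_apply, hi, Function.update_self, hb, hza]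
      · rw [Function.comp_apply, Function.comp_apply, Function.update_of_ne hi, hzk _ (hta i hi)]
        rfl
    rw [pif_pos hb, hker, hk1, hzt, hb]
    have hna' : F (z (some a)) - F (z none) ≠ 0 := fun h => hna (by rw [← neg_sub, h, neg_zero])
    change _ = W (zn ∘ t) * _ - W (z ∘ some ∘ t) * _
    field_simp
    ring
  · have hne : ∀ i, t i ≠ a := fun i => by
      by_cases hi : i = tp none
      · rw [hi]; exact hb
      · exact hta i hi
    have hzt : zn ∘ t = z ∘ some ∘ t := by
      funext i
      exact hzk _ (hne i)
    set b := t (tp none) with hbdef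
    have htb : tp (some b) = tp none := ht _
    have h1 : F (z (some b)) - F (z none) ≠ 0 := sub_ne_zero.2 (hF _ _ htb (by simp))
    have h2 : F (z (some b)) - F (z (some a)) ≠ 0 :=
      sub_ne_zero.2 (hF _ _ (htb.trans htp) (by simpa using hb))
    have h3 : repKer (tp ∘ some) F zn t = (F (z (some b)) - F (z none))⁻¹ *
        ∏ k ∈ Finset.univ.erase a, pif (k = t (tp (some k))) 1
          (F (z (some (t (tp (some k))))) - F (z (some k)))⁻¹ := by
      unfold repKer
      rw [← Finset.mul_prod_erase _ _ (Finset.mem_univ a), Function.comp_apply, ← htp, ← hbdef,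
        pif_neg (fun h => hb h.symm), hza, hzk b hb]
      congr 1
      refine Finset.prod_congr rfl fun k hk => ?_
      rw [Function.comp_apply, hzk _ (Finset.mem_erase.1 hk).1, hzk _ (hne _)]
    have h4 : repKer (tp ∘ some) F (z ∘ some) t = (F (z (some b)) - F (z (some a)))⁻¹ *
        ∏ k ∈ Finset.univ.erase a, pif (k = t (tp (some k))) 1
          (F (z (some (t (tp (some k))))) - F (z (some k)))⁻¹ := by
      unfold repKer
      rw [← Finset.mul_prod_erase _ _ (Finset.mem_univ a), Function.comp_apply, ← htp, ← hbdef,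
        pif_neg (fun h => hb h.symm)]
      rfl
    rw [pif_neg hb, add_zero, hker, hzt, h3, h4]
    change _ = W (z ∘ some ∘ t) * _ - W (z ∘ some ∘ t) * _
    field_simp
    ring

end Representatives

/-! ### Graphs with white vertices of arbitrary degrees -/

section Star

variable {r : ℕ} {v : ℕ → ℂ} {n N : ℕ} {K K₂ : Type} [Fintype K] [Fintype K₂]

/-- All marked faces are adjacent to white vertices, and for each label there is a white vertex. -/
structure Spec.IsStar (X : Spec n K) : Prop where
  cil : ∀ k, X.cil k
  inj : Function.Injective X.next
  tp_next : ∀ k, X.tp (X.next k) = X.tp k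
  trans : ∀ k k', X.tp k = X.tp k' → ∃ i : ℕ, (X.next^[i]) k = k'
  surj : Function.Surjective X.tp

theorem Spec.IsStar.relabel {X : Spec n K} (h : X.IsStar) (e : K ≃ K₂) : (X.relabel e).IsStar where
  cil k := h.cil _
  inj := e.injective.comp (h.inj.comp e.symm.injective)
  tp_next k := by simp [Spec.relabel, h.tp_next]
  trans k k' hk := by
    obtain ⟨i, hi⟩ := h.trans (e.symm k) (e.symm k') hk
    refine ⟨i, ?_⟩
    have : ∀ j, ((X.relabel e).next^[j]) k = e ((X.next^[j]) (e.symm k)) := fun j => by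
      induction j with
      | zero => simp
      | succ j ih => rw [Function.iterate_succ_apply', ih, Function.iterate_succ_apply']
                     simp [Spec.relabel]
    rw [this, hi, apply_symm_apply]
  surj := h.surj.comp e.symm.surjective

theorem Spec.IsStar.mergeable {X : Spec n (Option K)} (h : X.IsStar) {a : K}
    (ha : X.next none = some a) : X.Mergeable a :=
  ⟨h.cil, ha, h.inj, by rw [← ha, h.tp_next]⟩

/-- The merged clockwise order skips `none`; reading `none` as `a` projects the orbits of the old
order onto those of the new one. -/
theorem Spec.IsStar.merge {X : Spec n (Option K)} (h : X.IsStar) {a : K}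
    (ha : X.next none = some a) : (X.merge a).IsStar := by
  have hX := h.mergeable ha
  have hpath : ∀ (k : K) (i : ℕ),
      ∃ j : ℕ, ((X.merge a).next^[j]) k = ((X.next^[i]) (some k)).getD a := fun k i => by
    induction i with
    | zero => exact ⟨0, rfl⟩
    | succ i ih =>
      obtain ⟨j, hj⟩ := ih
      rw [Function.iterate_succ_apply']
      rcases hu : (X.next^[i]) (some k) with _ | k₁
      · rw [hu] at hj
        exact ⟨j, by rw [hj, ha]; rfl⟩
      · rw [hu] at hj
        exact ⟨j + 1, by rw [Function.iterate_succ_apply', hj]; rfl⟩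
  refine ⟨fun _ => trivial, ?_, ?_, ?_, ?_⟩
  · intro k k' hk
    have h1 := hX.next_eq k
    have h2 := hX.next_eq k'
    rcases h1 with h1 | h1 <;> rcases h2 with h2 | h2
    · exact Option.some_injective _ (h.inj (h1.1.trans h2.1.symm))
    · exact absurd (hk ▸ h1.2) h2.2
    · exact absurd (hk ▸ h2.2) h1.2
    · exact Option.some_injective _ (h.inj (h1.1.trans (hk ▸ h2.1.symm)))
  · intro k
    have h2 := h.tp_next (some k)
    rcases hX.next_eq k with h1 | h1
    · rw [h1.1] at h2
      rw [h1.2]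
      exact hX.tp_none.symm.trans h2
    · rw [h1.1] at h2
      exact h2
  · intro k k' hk
    obtain ⟨i, hi⟩ := h.trans (some k) (some k') hk
    obtain ⟨j, hj⟩ := hpath k i
    exact ⟨j, by rw [hj, hi]; rfl⟩
  · intro i
    obtain ⟨k, hk⟩ := h.surj i
    rcases k with _ | k
    · exact ⟨a, hX.tp_none.symm.trans hk⟩
    · exact ⟨k, hk⟩

theorem Regular.comp {lam : Fin N → ℂ} {z : K → ℂ} (h : Regular r v lam z) (σ : K₂ → K) :
    Regular r v lam (z ∘ σ) := fun p q => by
  have : ∀ p, Sum.elim (z ∘ σ) lam p = Sum.elim z lam (Sum.map σ id p) := fun p => by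
    rcases p with k | j <;> rfl
  rw [this, this]
  exact h _ _

/-- Induction on the number `m` of marked faces. If `next` is the identity, all white vertices are
univalent and there is one section. Otherwise some face is merged with its clockwise successor, and
both sides obey the same recursion. Each merging lowers `e`, `f` and `m` by one, whence the shift by
`n - m` and the invariance of the genus condition. -/
theorem plainTot_star (lam : Fin N → ℂ) (m : ℕ) :
    ∀ (K : Type) [Fintype K] (_ : Fintype.card K = m) (X : Spec n K) (_ : X.IsStar)
      (_ : X.e + 2 = X.f → ∀ i : Fin n, ∃ i', i' ≠ i) (z : K → ℂ) (_ : Regular r v lam z)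
      (_ : ∀ k k', X.tp k = X.tp k' → k ≠ k' → z k ≠ z k'),
      plainTot r v X (Sum.elim z lam) = repSum X.tp (fun w => plainTot r v
        (stdSpec n (X.e - m + n) (X.f - m + n) 0) (Sum.elim w lam)) (dV r v) z := by
  classical
  induction m using Nat.strong_induction_on with
  | _ m ih =>
  intro K _ hm X hX hX2 z hz hdist
  by_cases hid : ∀ k, X.next k = k
  · have hbij : Function.Bijective X.tp := by
      refine ⟨fun k k' hk => ?_, hX.surj⟩
      obtain ⟨i, hi⟩ := hX.trans k k' hk
      rw [← hi, Function.iterate_fixed (hid k)]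
    have hmn : m = n := by
      rw [← hm, Fintype.card_of_bijective hbij, Fintype.card_fin]
    rw [repSum_bijective hbij, ← plainTot_relabel (Equiv.ofBijective X.tp hbij)]
    congr 1
    have h1 : ∀ i, X.tp ((Equiv.ofBijective X.tp hbij).symm i) = i := fun i =>
      (Equiv.ofBijective X.tp hbij).apply_symm_apply i
    unfold Spec.relabel stdSpec
    congr 1
    · funext i
      exact propext ⟨fun _ => Nat.zero_le _, fun _ => hX.cil _⟩
    · funext i
      simpa [hid] using h1 i
    · funext i
      exact h1 i
    · rw [hmn]; ring
    · rw [hmn]; ring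
  · push Not at hid
    obtain ⟨k₀, hk₀⟩ := hid
    set e := (Equiv.optionSubtypeNe k₀).symm with he
    have hen : e.symm none = k₀ := rfl
    rw [← plainTot_relabel e, ← repSum_relabel e]
    have hX' := hX.relabel e
    have ha : (X.relabel e).next none = some ⟨X.next k₀, hk₀⟩ := by
      change e (X.next (e.symm none)) = _
      rw [hen]
      exact Equiv.optionSubtypeNe_symm_of_ne hk₀
    set a : {k // k ≠ k₀} := ⟨X.next k₀, hk₀⟩ with hadef
    set X₁ := X.relabel e with hX₁
    set z₁ := z ∘ e.symm with hz₁
    have hmer := hX'.mergeable ha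
    have hcard : Fintype.card {k // k ≠ k₀} + 1 = m := by
      rw [← hm, ← Fintype.card_option]
      exact Fintype.card_congr (Equiv.optionSubtypeNe k₀)
    have hz₁r : Regular r v lam z₁ := hz.comp e.symm
    have hdist₁ : ∀ k k', X₁.tp k = X₁.tp k' → k ≠ k' → z₁ k ≠ z₁ k' := fun k k' h1 h2 =>
      hdist _ _ h1 (fun h => h2 (e.symm.injective h))
    have hdV : ∀ k k', X₁.tp k = X₁.tp k' → k ≠ k' → dV r v (z₁ k) ≠ dV r v (z₁ k') :=
      fun k k' h1 h2 =>
        ((vw_pair_ne_zero_iff _ _).1 (hz₁r (.inl k) (.inl k'))).2 (hdist₁ k k' h1 h2)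
    have h2 : ∀ i : Fin n, X₁.e + 2 = X₁.f → ∃ i', i' ≠ i := fun i h => hX2 h i
    rw [plainTot_merge hmer (fun h => by
        obtain ⟨i, hi⟩ := h2 (X₁.tp none) h
        obtain ⟨k, hk⟩ := hX'.surj i
        exact ⟨k, by rw [hk]; exact hi⟩) _ hz₁r (hdist₁ _ _ hmer.tp_none (by simp)),
      show X.tp ∘ e.symm = X₁.tp from rfl, repSum_option hmer.tp_none _ _ _ hdV]
    have hval : Sum.elim z₁ lam ∘ Sum.map some id = Sum.elim (z₁ ∘ some) lam := by
      funext p; rcases p with k | j <;> rfl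
    have hσ : Function.update (z₁ ∘ some) a (z₁ none) =
        z₁ ∘ Function.update some a none := by
      funext k
      by_cases hk : k = a
      · rw [hk]; simp
      · simp [hk]
    -- Both decorations in the recursion are restrictions of `z₁` along injections respecting the
    -- white vertices, so admissibility and distinctness are inherited.
    have key : ∀ σ : {k // k ≠ k₀} → Option {k // k ≠ k₀}, Function.Injective σ →
        (∀ k, X₁.tp (σ k) = X₁.tp (some k)) →
        plainTot r v (X₁.merge a) (Sum.elim (z₁ ∘ σ) lam) = repSum (X₁.tp ∘ some)
          (fun w => plainTot r v (stdSpec n (X.e - m + n) (X.f - m + n) 0) (Sum.elim w lam))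
          (dV r v) (z₁ ∘ σ) := fun σ hσ1 hσ2 => by
      have := ih (Fintype.card {k // k ≠ k₀}) (by omega) _ rfl (X₁.merge a) (hX'.merge ha)
        (fun h => hX2 (by
          change X.e - 1 + 2 = X.f - 1 at h
          linarith)) (z₁ ∘ σ) (hz₁r.comp σ) (fun k k' h1 h2 => hdist₁ _ _ (by
            rw [hσ2, hσ2]; exact h1) (fun h => h2 (hσ1 h)))
      rw [this]
      have hc : (m : ℤ) = Fintype.card {k // k ≠ k₀} + 1 := by exact_mod_cast hcard.symm
      have e1 : (X₁.merge a).e - Fintype.card {k // k ≠ k₀} + n = X.e - m + n := by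
        change X.e - 1 - _ + _ = _
        rw [hc]; ring
      have e2 : (X₁.merge a).f - Fintype.card {k // k ≠ k₀} + n = X.f - m + n := by
        change X.f - 1 - _ + _ = _
        rw [hc]; ring
      rw [e1, e2]
      rfl
    rw [hval, Sum.update_elim_inl]
    simp only [Sum.elim_inl]
    rw [hσ, key _ ?_ ?_, key some (Option.some_injective _) (fun _ => rfl)]
    · intro k k' hk
      by_cases h1 : k = a <;> by_cases h2 : k' = a
      · rw [h1, h2]
      · rw [h1, Function.update_self, Function.update_of_ne h2] at hk
        simp at hk
      · rw [h2, Function.update_self, Function.update_of_ne h1] at hk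
        simp at hk
      · rw [Function.update_of_ne h1, Function.update_of_ne h2] at hk
        exact Option.some_injective _ hk
    · intro k
      by_cases h1 : k = a
      · rw [h1, Function.update_self]; exact hmer.tp_none
      · rw [Function.update_of_ne h1]

end Star

open DecoratedMap

/-! ### Isomorphism classes of maps and labelled graphs -/

section Counting

variable {n N : ℕ} {M L D E E' : Type}

theorem Cfg.map_map (e : D ≃ E) (e' : E ≃ E') (G : Cfg n L D) :
    (G.map e).map e' = G.map (e.trans e') := by
  ext <;> simp

theorem Cfg.map_refl (G : Cfg n L D) : G.map (Equiv.refl D) = G := by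
  ext <;> simp

theorem card_stab_eq {m : ℕ} (G₀ : Cfg n L (Fin m)) {G : Cfg n L (Fin m)} {e : Perm (Fin m)}
    (h : G = G₀.map e) :
    Nat.card {τ : Perm (Fin m) // G₀.map τ = G} = Nat.card {τ : Perm (Fin m) // G₀.map τ = G₀} := by
  subst h
  refine Nat.card_congr
    { toFun := fun τ => ⟨τ.1.trans e.symm, ?_⟩
      invFun := fun τ => ⟨τ.1.trans e, ?_⟩
      left_inv := fun τ => ?_
      right_inv := fun τ => ?_ }
  · rw [← Cfg.map_map, τ.2, Cfg.map_map, self_trans_symm, Cfg.map_refl]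
  · rw [← Cfg.map_map, τ.2]
  · ext1; ext1 d; simp
  · ext1; ext1 d; simp

/-- The orbit–stabilizer theorem for relabellings: `G₀` has `m!` divided by the number of its
automorphisms distinct labelled copies. -/
theorem sum_orbit [Finite L] {m : ℕ} (G₀ : Cfg n L (Fin m)) (w : ℂ) :
    ∑ G : Cfg n L (Fin m), pif (∃ e : Perm (Fin m), G = G₀.map e) w 0 =
      m.factorial * (w / Nat.card {τ : Perm (Fin m) // G₀.map τ = G₀}) := by
  classical
  set A := Nat.card {τ : Perm (Fin m) // G₀.map τ = G₀} with hA
  have hA0 : (A : ℂ) ≠ 0 := by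
    have : Nonempty {τ : Perm (Fin m) // G₀.map τ = G₀} := ⟨⟨Equiv.refl _, G₀.map_refl⟩⟩
    exact_mod_cast Nat.card_pos.ne'
  have h1 := Finset.card_eq_sum_card_fiberwise (s := (Finset.univ : Finset (Perm (Fin m))))
    (t := (Finset.univ : Finset (Cfg n L (Fin m)))) (f := fun τ => G₀.map τ)
    (fun _ _ => Finset.mem_coe.2 (Finset.mem_univ _))
  rw [Finset.card_univ, Fintype.card_perm, Fintype.card_fin] at h1
  have h2 : ∀ G : Cfg n L (Fin m), pif (∃ e : Perm (Fin m), G = G₀.map e) w 0 =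
      (((Finset.univ.filter fun τ : Perm (Fin m) => G₀.map τ = G).card : ℕ) : ℂ) * (w / A) := by
    intro G
    by_cases h : ∃ e : Perm (Fin m), G = G₀.map e
    · obtain ⟨e, he⟩ := h
      rw [pif_pos ⟨e, he⟩, ← Fintype.card_subtype, ← Nat.card_eq_fintype_card, card_stab_eq G₀ he,
        ← hA]
      field_simp
    · rw [pif_neg h, Finset.filter_eq_empty_iff.2, Finset.card_empty, Nat.cast_zero, zero_mul]
      exact fun τ _ hτ => h ⟨τ, hτ.symm⟩
  rw [Finset.sum_congr rfl fun G _ => h2 G, ← Finset.sum_mul, h1]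
  push_cast
  rfl

/-- The combinatorial data of a map. -/
def toCfg (G : DecoratedMap n M N) : Cfg n (M ⊕ Fin N) (Fin G.size) :=
  ⟨G.rot, G.opp, G.vtype, G.deco⟩

theorem toCfg_map_eq_iff {G H : DecoratedMap n M N} (e : Fin G.size ≃ Fin H.size) :
    (toCfg G).map e = toCfg H ↔ ∃ φ : Iso G H, φ.toEquiv = e := by
  constructor
  · intro h
    have h1 := congrArg Cfg.rot h
    have h2 := congrArg Cfg.opp h
    have h3 := congrArg Cfg.ty h
    have h4 := congrArg Cfg.deco h
    refine ⟨⟨e, fun d => ?_, fun d => ?_, fun d => ?_, fun d => ?_⟩, rfl⟩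
    · have := Equiv.congr_fun h1 (e d)
      simpa [toCfg] using this
    · have := Equiv.congr_fun h2 (e d)
      simpa [toCfg] using this
    · have := congrFun h3 (e d)
      simpa [toCfg] using this.symm
    · have := congrFun h4 (e d)
      simpa [toCfg] using this.symm
  · rintro ⟨φ, rfl⟩
    refine Cfg.ext ?_ ?_ ?_ ?_
    · ext1 d
      simp [toCfg, φ.map_rot]
    · ext1 d
      simp [toCfg, φ.map_opp]
    · funext d
      simp [toCfg, ← φ.map_vtype]
    · funext d
      simp [toCfg, ← φ.map_deco]

theorem autCard_eq (G : DecoratedMap n M N) :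
    G.autCard = Nat.card {τ : Perm (Fin G.size) // (toCfg G).map τ = toCfg G} := by
  unfold autCard
  refine Nat.card_congr (Equiv.ofBijective
    (fun φ => ⟨φ.toEquiv, (toCfg_map_eq_iff _).2 ⟨φ, rfl⟩⟩) ⟨?_, ?_⟩)
  · intro φ ψ h
    exact Iso.ext (Subtype.ext_iff.1 h)
  · rintro ⟨τ, hτ⟩
    obtain ⟨φ, hφ⟩ := (toCfg_map_eq_iff _).1 hτ
    exact ⟨φ, Subtype.ext hφ⟩

/-- A labelled graph representing a map of a given class. -/
def IsLabelled (𝒞 : Set (DecoratedMap n M N)) {m : ℕ} (G : Cfg n (M ⊕ Fin N) (Fin m)) : Prop :=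
  ∃ H ∈ 𝒞, ∃ e : Fin H.size ≃ Fin m, G = (toCfg H).map e

theorem finite_isoClasses [Finite M] {r : ℕ} {𝒢 : Set (DecoratedMap n M N)} {d : ℤ} {B : ℕ}
    (hB : ∀ G ∈ 𝒢, G.deg r = d → G.size < B) : (isoClasses r 𝒢 d).Finite := by
  refine Set.Finite.image _ ?_
  have hinj : Function.Injective
      (fun G : DecoratedMap n M N => (⟨G.size, toCfg G⟩ : Σ m, Cfg n (M ⊕ Fin N) (Fin m))) := by
    rintro ⟨m, rot, opp, h1, h2, ty, h3, deco, h4⟩ ⟨m', rot', opp', h1', h2', ty', h3', deco', h4'⟩ h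
    obtain rfl : m = m' := congrArg Sigma.fst h
    have h' := eq_of_heq (Sigma.mk.inj h).2
    simp only [toCfg, Cfg.mk.injEq] at h'
    obtain ⟨rfl, rfl, rfl, rfl⟩ := h'
    rfl
  refine Set.Finite.of_finite_image (f := fun G => (⟨G.size, toCfg G⟩ :
    Σ m, Cfg n (M ⊕ Fin N) (Fin m))) ?_ hinj.injOn
  refine Set.Finite.subset (s := Set.range fun x : Σ m : Fin B, Cfg n (M ⊕ Fin N) (Fin m) =>
    (⟨x.1, x.2⟩ : Σ m, Cfg n (M ⊕ Fin N) (Fin m))) (Set.finite_range _) ?_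
  rintro _ ⟨G, ⟨hG, hd⟩, rfl⟩
  exact ⟨⟨⟨G.size, hB G hG hd⟩, toCfg G⟩, rfl⟩

variable (r : ℕ) (v : ℕ → ℂ)

/-- The weight of labelled graphs with square vertices. -/
def fullWt [Fintype D] (val : L → ℂ) (u : ℂ) (G : Cfg n L D) : ℂ :=
  eprod r v G.opp (val ∘ G.deco) * ∏ s ∈ orbs G.rot,
    pif (∀ d ∈ s, G.ty d = .black) (vw r v (s.val.map (val ∘ G.deco)))
      (pif (∀ d ∈ s, G.ty d = .square) (sqw u (s.val.map (val ∘ G.deco))) 1)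

theorem fullWt_map [Fintype D] [Fintype E] (e : D ≃ E) (val : L → ℂ) (u : ℂ) (G : Cfg n L D) :
    fullWt r v val u (G.map e) = fullWt r v val u G := by
  unfold fullWt
  rw [Cfg.map_opp, Cfg.map_rot, eprod_permCongr, prod_orbs_permCongr]
  simp only [forall_mem_map_equiv]
  simp [Multiset.map_map, Function.comp_def]

theorem prod_quotient [Fintype D] (σ : Perm D) [Fintype (Quotient (Perm.SameCycle.setoid σ))]
    (f : Finset D → ℂ) (g : Quotient (Perm.SameCycle.setoid σ) → ℂ)
    (h : ∀ x, g x = f (orb σ x.out)) : ∏ x, g x = ∏ s ∈ orbs σ, f s := by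
  refine Finset.prod_bij (fun x _ => orb σ x.out) (fun x _ => orb_mem_orbs σ _) ?_ ?_ ?_
  · intro x _ y _ hxy
    rw [← x.out_eq, ← y.out_eq]
    exact Quotient.sound (orb_eq_orb.1 hxy)
  · intro s hs
    obtain ⟨d, rfl⟩ := mem_orbs.1 hs
    refine ⟨Quotient.mk _ d, Finset.mem_univ _, orb_eq_orb.2 ?_⟩
    exact Quotient.exact (Quotient.out_eq (Quotient.mk (Perm.SameCycle.setoid σ) d))
  · intro x _
    exact h x

theorem card_quotient [Fintype D] (σ : Perm D) [Fintype (Quotient (Perm.SameCycle.setoid σ))] :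
    Fintype.card (Quotient (Perm.SameCycle.setoid σ)) = (orbs σ).card := by
  rw [← Finset.card_univ]
  refine Finset.card_bij (fun x _ => orb σ x.out) (fun x _ => orb_mem_orbs σ _) ?_ ?_
  · intro x _ y _ hxy
    rw [← x.out_eq, ← y.out_eq]
    exact Quotient.sound (orb_eq_orb.1 hxy)
  · intro s hs
    obtain ⟨d, rfl⟩ := mem_orbs.1 hs
    refine ⟨Quotient.mk _ d, Finset.mem_univ _, orb_eq_orb.2 ?_⟩
    exact Quotient.exact (Quotient.out_eq (Quotient.mk (Perm.SameCycle.setoid σ) d))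

theorem mk_eq_iff [Fintype D] (σ : Perm D) (x : Quotient (Perm.SameCycle.setoid σ)) (d : D) :
    Quotient.mk _ d = x ↔ d ∈ orb σ x.out := by
  rw [mem_orb]
  constructor
  · intro h
    exact (Quotient.exact (h.trans x.out_eq.symm)).symm
  · intro h
    rw [← x.out_eq]
    exact Quotient.sound h.symm

theorem map_corners [Fintype D] (σ : Perm D) (x : Quotient (Perm.SameCycle.setoid σ))
    [Fintype {d : D // Quotient.mk _ d = x}] (f : D → ℂ) :
    (Finset.univ : Finset {d : D // Quotient.mk _ d = x}).val.map (fun c => f c.1) =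
      (orb σ x.out).val.map f := by
  classical
  have : (Finset.univ : Finset {d : D // Quotient.mk _ d = x}).map
      (Function.Embedding.subtype _) = orb σ x.out := by
    ext d
    rw [← mk_eq_iff]
    simp
  rw [← this, Finset.map_val, Multiset.map_map]
  rfl

theorem DecoratedMap.vtype_eq (G : DecoratedMap n M N) {d d' : Fin G.size}
    (h : G.rot.SameCycle d d') : G.vtype d = G.vtype d' := SameCycle.invariant G.vtype_rot h

theorem weight_eq_fullWt (val : M ⊕ Fin N → ℂ) (u : ℂ) (G : DecoratedMap n M N) :
    G.weight r v val u = fullWt r v val u (toCfg G) := by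
  classical
  unfold weight fullWt eprod
  congr 1
  · refine prod_quotient G.opp (fun s => -(vw r v (s.val.map (val ∘ (toCfg G).deco)))⁻¹) _
      fun e => ?_
    rw [propagator_eq, orb_involution G.opp G.opp_opp,
      Finset.insert_val_of_notMem (by simpa using (G.opp_ne _).symm)]
    rfl
  · refine prod_quotient G.rot (fun s => pif (∀ d ∈ s, (toCfg G).ty d = .black)
      (vw r v (s.val.map (val ∘ (toCfg G).deco)))
      (pif (∀ d ∈ s, (toCfg G).ty d = .square) (sqw u (s.val.map (val ∘ (toCfg G).deco))) 1)) _
      fun x => ?_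
    have hty : ∀ t, (∀ d ∈ orb G.rot x.out, (toCfg G).ty d = t) ↔ G.vertexType x = t := fun t => by
      constructor
      · exact fun h => h _ (mem_orb_self _ _)
      · exact fun h d hd => (G.vtype_eq (mem_orb.1 hd)).symm.trans h
    have hmap := map_corners G.rot x (val ∘ G.deco)
    rw [hty, hty]
    rcases h : G.vertexType x with _ | i | _
    · dsimp only
      rw [pif_pos rfl, vertexWeight_eq]
      exact congrArg (vw r v) hmap
    · dsimp only
      rw [pif_neg (by simp), pif_neg (by simp)]
    · dsimp only
      rw [pif_neg (by simp), pif_pos rfl]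
      change _ = sqw u ((orb G.rot x.out).val.map (val ∘ G.deco))
      rw [← hmap, sqw, Multiset.map_map]
      rfl

/-- Labelled graphs are grouped by isomorphism class; the weight is constant on a class, and
`sum_orbit` converts `1 / m!` into `1 / #Aut`. -/
theorem degreeSum_eq_total [Finite M] {𝒢 : Set (DecoratedMap n M N)} {d : ℤ} {B : ℕ}
    (hB : ∀ G ∈ 𝒢, G.deg r = d → G.size < B) (val : M ⊕ Fin N → ℂ) (u : ℂ) :
    degreeSum r v val u 𝒢 d = total (fun m => ∑ G : Cfg n (M ⊕ Fin N) (Fin m),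
      pif (IsLabelled {G | G ∈ 𝒢 ∧ G.deg r = d} G) (fullWt r v val u G) 0) := by
  classical
  have hfin := finite_isoClasses hB
  set 𝒞 := {G | G ∈ 𝒢 ∧ G.deg r = d} with h𝒞
  have hout : ∀ c ∈ isoClasses r 𝒢 d, ∃ H ∈ 𝒞, ∃ e : Fin H.size ≃ Fin c.out.size,
      (toCfg H).map e = toCfg c.out := by
    rintro _ ⟨H, hH, rfl⟩
    have : Nonempty (Iso H (Quotient.mk (isoSetoid n M N) H).out) :=
      Quotient.exact (Quotient.out_eq (Quotient.mk (isoSetoid n M N) H)).symm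
    obtain ⟨φ⟩ := this
    exact ⟨H, hH, φ.toEquiv, (toCfg_map_eq_iff _).2 ⟨φ, rfl⟩⟩
  have hlab : ∀ {m : ℕ} (G : Cfg n (M ⊕ Fin N) (Fin m)), pif (IsLabelled 𝒞 G)
      (fullWt r v val u G) 0 = ∑ c ∈ hfin.toFinset,
        pif (∃ e : Fin c.out.size ≃ Fin m, G = (toCfg c.out).map e)
          (c.out.weight r v val u) 0 := by
    intro m G
    by_cases h : IsLabelled 𝒞 G
    · obtain ⟨H, hH, e, rfl⟩ := h
      set c₀ : Quotient (isoSetoid n M N) := Quotient.mk _ H with hc₀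
      have hc₀m : c₀ ∈ isoClasses r 𝒢 d := ⟨H, hH, rfl⟩
      have : Nonempty (Iso H c₀.out) := Quotient.exact (Quotient.out_eq c₀).symm
      obtain ⟨φ⟩ := this
      have hφ := (toCfg_map_eq_iff φ.toEquiv).2 ⟨φ, rfl⟩
      rw [pif_pos ⟨H, hH, e, rfl⟩, Finset.sum_eq_single c₀, pif_pos]
      · rw [weight_eq_fullWt, ← hφ, fullWt_map, fullWt_map]
      · refine ⟨φ.toEquiv.symm.trans e, ?_⟩
        rw [← hφ, Cfg.map_map, ← Equiv.trans_assoc, self_trans_symm, Equiv.refl_trans]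
      · intro c hc hcc
        refine pif_neg ?_ _ _
        rintro ⟨e', he'⟩
        apply hcc
        rw [hc₀, ← c.out_eq]
        symm
        refine Quotient.sound ?_
        obtain ⟨ψ, -⟩ := (toCfg_map_eq_iff (G := H) (H := c.out) (e.trans e'.symm)).1 (by
          rw [← Cfg.map_map, he', Cfg.map_map, self_trans_symm, Cfg.map_refl])
        exact ⟨ψ⟩
      · exact fun h => absurd (hfin.mem_toFinset.2 hc₀m) h
    · rw [pif_neg h, Finset.sum_eq_zero]
      intro c hc
      refine pif_neg ?_ _ _
      rintro ⟨e, rfl⟩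
      obtain ⟨H, hH, e', he'⟩ := hout c (hfin.mem_toFinset.1 hc)
      exact h ⟨H, hH, e'.trans e, by rw [← he', Cfg.map_map]⟩
  unfold degreeSum
  rw [finsum_mem_eq_finite_toFinset_sum _ hfin, total_eq_sum (B := B) ?_]
  · simp only [hlab]
    have hswap : ∀ m, ∑ G : Cfg n (M ⊕ Fin N) (Fin m), ∑ c ∈ hfin.toFinset,
        pif (∃ e : Fin c.out.size ≃ Fin m, G = (toCfg c.out).map e)
          (c.out.weight r v val u) 0 = ∑ c ∈ hfin.toFinset, ∑ G : Cfg n (M ⊕ Fin N) (Fin m),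
        pif (∃ e : Fin c.out.size ≃ Fin m, G = (toCfg c.out).map e)
          (c.out.weight r v val u) 0 := fun m => Finset.sum_comm
    simp only [hswap, Finset.mul_sum]
    rw [Finset.sum_comm]
    refine Finset.sum_congr rfl fun c hc => ?_
    rw [Finset.sum_eq_single c.out.size, ← Finset.mul_sum, sum_orbit, ← autCard_eq]
    · have : (c.out.size.factorial : ℂ) ≠ 0 := by exact_mod_cast Nat.factorial_ne_zero _
      field_simp
    · intro m _ hm
      refine Finset.sum_eq_zero fun G _ => ?_
      rw [pif_neg, mul_zero]
      rintro ⟨e, -⟩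
      have := Fintype.card_congr e
      simp only [Fintype.card_fin] at this
      exact hm this.symm
    · intro hc'
      exfalso
      obtain ⟨H, hH, e, -⟩ := hout c (hfin.mem_toFinset.1 hc)
      have h1 := Fintype.card_congr e
      simp only [Fintype.card_fin] at h1
      exact hc' (Finset.mem_range.2 (h1 ▸ hB H hH.1 hH.2))
  · intro m hm
    refine Finset.sum_eq_zero fun G _ => pif_neg ?_ _ _
    rintro ⟨H, hH, e, -⟩
    have h1 := Fintype.card_congr e
    simp only [Fintype.card_fin] at h1
    have := hB H hH.1 hH.2
    omega

end Counting

/-! ### Maps and labelled graphs -/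

section Conversion

variable {n N : ℕ} {M L D E : Type}

/-- A set of darts stable under `rot` and `opp` is stable under the group they generate;
connectedness in this form is easy to follow through surgery. -/
theorem connected_iff (G : DecoratedMap n M N) : G.Connected ↔ 0 < G.size ∧
    ∀ p : Fin G.size → Prop, (∀ d, p (G.rot d) ↔ p d) → (∀ d, p (G.opp d) ↔ p d) →
      ∀ d d', p d → p d' := by
  unfold Connected
  refine and_congr_right fun _ => ⟨fun h p h1 h2 d d' hd => ?_, fun h d d' => ?_⟩
  · obtain ⟨q, hq, rfl⟩ := h d d'
    have key : ∀ x, p (q x) ↔ p x := by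
      induction hq using Subgroup.closure_induction with
      | mem q hq =>
        rcases hq with rfl | rfl
        · exact h1
        · exact h2
      | one => exact fun x => Iff.rfl
      | mul a b _ _ ha hb => exact fun x => (ha _).trans (hb x)
      | inv a _ ha => exact fun x => by rw [← ha (a⁻¹ x)]; simp
    exact (key d).2 hd
  · refine h (fun x => ∃ q ∈ Subgroup.closure ({G.rot, G.opp} : Set (Perm (Fin G.size))), q d = x)
      ?_ ?_ d d' ⟨1, Subgroup.one_mem _, rfl⟩
    · have hm : G.rot ∈ Subgroup.closure ({G.rot, G.opp} : Set (Perm (Fin G.size))) :=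
        Subgroup.subset_closure (by simp)
      intro x
      constructor
      · rintro ⟨q, hq, hx⟩
        exact ⟨G.rot⁻¹ * q, Subgroup.mul_mem _ (Subgroup.inv_mem _ hm) hq, by simp [hx]⟩
      · rintro ⟨q, hq, rfl⟩
        exact ⟨G.rot * q, Subgroup.mul_mem _ hm hq, rfl⟩
    · have hm : G.opp ∈ Subgroup.closure ({G.rot, G.opp} : Set (Perm (Fin G.size))) :=
        Subgroup.subset_closure (by simp)
      intro x
      constructor
      · rintro ⟨q, hq, hx⟩
        exact ⟨G.opp⁻¹ * q, Subgroup.mul_mem _ (Subgroup.inv_mem _ hm) hq, by simp [hx]⟩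
      · rintro ⟨q, hq, rfl⟩
        exact ⟨G.opp * q, Subgroup.mul_mem _ hm hq, rfl⟩

theorem card_eq_two_mul_orbs [Fintype D] (σ : Perm D) (h : ∀ d, σ (σ d) = d) (h' : ∀ d, σ d ≠ d) :
    Fintype.card D = 2 * (orbs σ).card := by
  rw [← sum_card_orbs σ, Finset.sum_congr rfl (g := fun _ => 2)]
  · simp [mul_comm]
  · intro s hs
    obtain ⟨d, rfl⟩ := mem_orbs.1 hs
    rw [card_orb_eq_two_iff]
    exact ⟨h' d, h d⟩

/-- There are twice as many darts as edges, so degree and genus amount to `#E - #V = e` and `#F = e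
+ 2 - 2 g`. -/
theorem euler_iff {r g : ℕ} {e : ℤ} (G : DecoratedMap n M N) :
    (G.HasGenus g ∧ G.deg r = (r + 1) * e) ↔
      (Fintype.card (Fin G.size) : ℤ) = 2 * ((orbs G.rot).card + e) ∧
        ((orbs G.face).card : ℤ) = e + 2 - 2 * g := by
  unfold HasGenus deg
  rw [card_quotient, card_quotient, card_quotient, card_eq_two_mul_orbs G.opp G.opp_opp G.opp_ne,
    mul_right_inj' (by positivity)]
  push_cast
  constructor
  · rintro ⟨h1, h2⟩; constructor <;> linarith
  · rintro ⟨h1, h2⟩; constructor <;> linarith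

theorem deg_eq_mul {r : ℕ} (G : DecoratedMap n M N) : ∃ e : ℤ, G.deg r = (r + 1) * e := ⟨_, rfl⟩

theorem vdeg_eq (G : DecoratedMap n M N) (x : G.Vertices) :
    G.vdeg x = (orb G.rot x.out).card := by
  unfold vdeg
  rw [← Finset.card_val, ← Multiset.card_map (fun _ => (0 : ℂ)), ← map_corners G.rot x (fun _ => 0)]
  simp

theorem mk_out_sameCycle (G : DecoratedMap n M N) (d : Fin G.size) :
    G.rot.SameCycle (Quotient.mk _ d : G.Vertices).out d :=
  Quotient.exact (Quotient.out_eq (Quotient.mk (Perm.SameCycle.setoid G.rot) d))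

theorem vdeg_mk (G : DecoratedMap n M N) (d : Fin G.size) :
    G.vdeg (Quotient.mk _ d) = (orb G.rot d).card := by
  rw [vdeg_eq, orb_eq_orb.2 (mk_out_sameCycle G d)]

theorem vertexType_mk (G : DecoratedMap n M N) (d : Fin G.size) :
    G.vertexType (Quotient.mk _ d) = G.vtype d := G.vtype_eq (mk_out_sameCycle G d)

theorem black_degree_iff {r : ℕ} (G : DecoratedMap n M N) :
    (∀ x : G.Vertices, G.vertexType x = .black → 3 ≤ G.vdeg x ∧ G.vdeg x ≤ r + 1) ↔
      ∀ d, G.vtype d = .black → 3 ≤ (orb G.rot d).card ∧ (orb G.rot d).card ≤ r + 1 := by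
  constructor
  · intro h d hd
    have := h (Quotient.mk _ d) (by rw [vertexType_mk, hd])
    rwa [vdeg_mk] at this
  · intro h x hx
    rw [vdeg_eq]
    exact h _ hx

theorem hasWhiteVertices_iff (G : DecoratedMap n M N) (k : Fin n → ℕ) :
    G.HasWhiteVertices k ↔ ∀ i, ∃ d, G.vtype d = .white i ∧
      (∀ d', G.vtype d' = .white i → G.rot.SameCycle d d') ∧ (orb G.rot d).card = k i := by
  refine forall_congr' fun i => ⟨?_, ?_⟩
  · rintro ⟨x, h1, h2⟩
    refine ⟨x.out, (h1 x).2 rfl, fun d' hd' => ?_, by rw [← vdeg_eq, h2]⟩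
    have := (h1 (Quotient.mk _ d')).1 (by rw [vertexType_mk, hd'])
    rw [← this]
    exact mk_out_sameCycle G d'
  · rintro ⟨d, h1, h2, h3⟩
    refine ⟨Quotient.mk _ d, fun y => ⟨fun hy => ?_, ?_⟩, by rw [vdeg_mk, h3]⟩
    · rw [← y.out_eq]
      exact Quotient.sound (h2 _ hy).symm
    · rintro rfl
      rw [vertexType_mk, h1]

/-- An upper bound for the degrees of the black vertices. -/
def DegLE (r : ℕ) [Fintype D] (G : Cfg n L D) : Prop :=
  ∀ d, G.ty d = .black → (orb G.rot d).card ≤ r + 1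

theorem card_orb_map [Fintype D] [Fintype E] (e : D ≃ E) (σ : Perm D) (d : D) :
    (orb (e.permCongr σ) (e d)).card = (orb σ d).card := by
  rw [← Finset.card_map e.toEmbedding]
  congr 1
  ext x
  rw [mem_orb, Finset.mem_map_equiv, mem_orb]
  have := sameCycle_permCongr σ e (a := d) (b := e.symm x)
  rwa [apply_symm_apply] at this

theorem degLE_map_iff {r : ℕ} [Fintype D] [Fintype E] (e : D ≃ E) (G : Cfg n L D) :
    DegLE r (G.map e) ↔ DegLE r G := by
  unfold DegLE
  rw [← e.forall_congr_right]
  simp [card_orb_map]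

theorem exists_toCfg_eq {m : ℕ} (G : Cfg n (M ⊕ Fin N) (Fin m)) (h1 : ∀ d, G.opp (G.opp d) = d)
    (h2 : ∀ d, G.opp d ≠ d) (h3 : ∀ d, G.ty (G.rot d) = G.ty d)
    (h4 : ∀ d, G.deco (G.face d) = G.deco d) :
    ∃ (H : DecoratedMap n M N) (e : Fin H.size ≃ Fin m), G = (toCfg H).map e :=
  ⟨⟨m, G.rot, G.opp, h1, h2, G.ty, h3, G.deco, h4⟩, Equiv.refl _, by
    rw [Cfg.map_refl]; rfl⟩

variable {r : ℕ} {v : ℕ → ℂ}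

theorem fullWt_eq_wt [Fintype D] (val : L → ℂ) (u : ℂ) (G : Cfg n L D)
    (h : ∀ d, G.ty d ≠ .square) : fullWt r v val u G = wt r v val G := by
  unfold fullWt wt vprod
  congr 1
  refine Finset.prod_congr rfl fun s hs => ?_
  rw [pif_neg (p := ∀ d ∈ s, G.ty d = .square)]
  intro h'
  obtain ⟨d, rfl⟩ := mem_orbs.1 hs
  exact h d (h' d (mem_orb_self _ _))

theorem wt_eq_zero [Fintype D] (val : L → ℂ) {G : Cfg n L D} (hty : ∀ d, G.ty (G.rot d) = G.ty d)
    (h : ¬ DegLE r G) : wt r v val G = 0 := by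
  unfold DegLE at h
  push Not at h
  obtain ⟨d, h1, h2⟩ := h
  unfold wt vprod
  rw [Finset.prod_eq_zero (orb_mem_orbs G.rot d), mul_zero]
  rw [pif_pos, vw_eq_zero]
  · rw [Multiset.card_map, Finset.card_val]; exact h2
  · intro d' hd'
    rw [← h1]
    exact (SameCycle.invariant hty (mem_orb.1 hd')).symm

/-- The graphs counted by `plainTot` but violating the upper bound on degrees have weight zero, and
no graph in `IsPlain` has a square vertex. -/
theorem degreeSum_eq_plainTot [Fintype M] {𝒢 : Set (DecoratedMap n M N)} {d : ℤ} {X : Spec n M}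
    (h : ∀ H : DecoratedMap n M N, (H ∈ 𝒢 ∧ H.deg r = d) ↔
      IsPlain X (toCfg H) ∧ DegLE r (toCfg H)) (val : M ⊕ Fin N → ℂ) (u : ℂ) :
    degreeSum r v val u 𝒢 d = plainTot r v X val := by
  have hB : ∀ G ∈ 𝒢, G.deg r = d → G.size < X.bound := fun G hG hd => by
    have := ((h G).1 ⟨hG, hd⟩).1.card_lt_bound fun _ _ h => h.elim
    rwa [Fintype.card_fin] at this
  rw [degreeSum_eq_total r v hB]
  unfold plainTot plainSum
  congr 1
  funext m
  refine Finset.sum_congr rfl fun G _ => ?_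
  have hiff : IsLabelled {G | G ∈ 𝒢 ∧ G.deg r = d} G ↔ IsPlain X G ∧ DegLE r G := by
    constructor
    · rintro ⟨H, hH, e, rfl⟩
      rw [isPlain_map_iff, degLE_map_iff]
      exact (h H).1 hH
    · rintro ⟨h1, h2⟩
      obtain ⟨H, e, rfl⟩ := exists_toCfg_eq G h1.opp_opp h1.opp_ne h1.ty_rot h1.deco_face
      rw [isPlain_map_iff] at h1
      rw [degLE_map_iff] at h2
      exact ⟨H, (h H).2 ⟨h1, h2⟩, e, rfl⟩
  by_cases hp : IsPlain X G
  · have hsq : ∀ d, G.ty d ≠ .square := fun d hd => by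
      obtain ⟨k, -, -, -, hk⟩ := hp.white d (by rw [hd]; simp)
      rw [hd] at hk
      simp at hk
    by_cases hd : DegLE r G
    · rw [pif_pos (hiff.2 ⟨hp, hd⟩), pif_pos hp, fullWt_eq_wt _ _ _ hsq]
    · rw [pif_neg (fun h' => hd (hiff.1 h').2), pif_pos hp, wt_eq_zero val hp.ty_rot hd]
  · rw [pif_neg (fun h' => hp (hiff.1 h').1), pif_neg hp]

/-- Unciliated maps as labelled graphs. -/
theorem isUnciliated_iff {g : ℕ} {e : ℤ} [NeZero n] (H : DecoratedMap n (Fin n) N) :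
    (H ∈ {G : DecoratedMap n (Fin n) N | G.IsUnciliated r g} ∧ H.deg r = (r + 1) * e) ↔
      IsPlain (stdSpec n e (e + 2 - 2 * g) n) (toCfg H) ∧ DegLE r (toCfg H) := by
  have hcil : ∀ k, ¬ (stdSpec n e (e + 2 - 2 * g) n).cil k := fun k => by
    simp [stdSpec]
  constructor
  · rintro ⟨h, hd⟩
    have hE := (euler_iff H).1 ⟨h.genus, hd⟩
    have hbd := (black_degree_iff H).1 h.black_degree
    refine ⟨⟨H.opp_opp, H.opp_ne, H.vtype_rot, H.deco_face, ((connected_iff H).1 h.connected).2,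
      hE.1, hE.2, ?_, ?_, ?_, fun _ h => h.elim, ?_, ?_, ?_⟩, fun d hd => (hbd d hd).2⟩
    · exact fun d hd => absurd (h.only_black d) hd
    · exact fun k hk => absurd hk (hcil k)
    · exact fun d _ hd => absurd (h.only_black d) hd
    · exact fun d hd _ => (three_le_card_orb_iff H.rot d).1 (hbd d hd).1
    · intro k
      obtain ⟨f, hf⟩ := h.marked k
      exact ⟨f.out, (hf _).2 f.out_eq⟩
    · intro k d d' h1 h2
      obtain ⟨f, hf⟩ := h.marked k
      exact Quotient.exact (((hf d).1 h1).trans ((hf d').1 h2).symm)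
  · rintro ⟨h, hd⟩
    have hE := (euler_iff (r := r) (g := g) (e := e) H).2 ⟨h.vert, h.fac⟩
    have hb : ∀ d, H.vtype d = .black := fun d => by
      by_contra hb
      obtain ⟨k, hk, -⟩ := h.white d hb
      exact hcil k hk
    refine ⟨?_, hE.2⟩
    refine ⟨⟨(connected_iff H).2 ⟨?_, h.conn⟩, hE.1, (black_degree_iff H).2 fun d hd' =>
      ⟨(three_le_card_orb_iff H.rot d).2 (h.deg d hd' id), hd d hd'⟩, ?_⟩, hb, ?_⟩
    · obtain ⟨d, -⟩ := h.mark_ex 0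
      exact d.pos
    · intro d d' i j _ h1
      rw [hb d] at h1
      simp at h1
    · intro i
      obtain ⟨d, hd⟩ := h.mark_ex i
      refine ⟨Quotient.mk _ d, fun d' => ⟨fun h' => Quotient.sound (h.mark_unique i d' d h' hd),
        fun h' => ?_⟩⟩
      have := h.deco_sameCycle (d := d') (d' := d) (Quotient.exact h')
      exact this.trans hd

/-- Square vertices as black vertices. -/
def Cfg.unsq (G : Cfg n L D) : Cfg n L D where
  rot := G.rot
  opp := G.opp
  ty d := match G.ty d with
    | .square => .black
    | t => t
  deco := G.deco

theorem unsq_ty_ne_black {G : Cfg n L D} {d : D} :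
    G.unsq.ty d ≠ .black ↔ ∃ i, G.ty d = .white i := by
  unfold Cfg.unsq
  rcases h : G.ty d <;> simp [h]

theorem unsq_ty_eq_white {G : Cfg n L D} {d : D} {i : Fin n} :
    G.unsq.ty d = .white i ↔ G.ty d = .white i := by
  unfold Cfg.unsq
  rcases h : G.ty d <;> simp [h]

theorem unsq_ty_eq_black {G : Cfg n L D} {d : D} :
    G.unsq.ty d = .black ↔ G.ty d = .black ∨ G.ty d = .square := by
  unfold Cfg.unsq
  rcases h : G.ty d <;> simp [h]

theorem unsq_eq_self {G : Cfg n L D} (h : ∀ d, G.ty d ≠ .square) : G.unsq = G := by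
  refine Cfg.ext rfl rfl ?_ rfl
  funext d
  unfold Cfg.unsq
  rcases h' : G.ty d <;> simp [h']
  exact h d h'

/-- Maps with univalent white vertices as labelled graphs. -/
theorem isGraph_unsq_iff {g : ℕ} {e : ℤ} [NeZero n] (H : DecoratedMap n (Fin n) N) :
    IsGraph (stdSpec n e (e + 2 - 2 * g) 0) (fun d => H.vtype d = .square) (toCfg H).unsq ∧
        DegLE r (toCfg H) ↔
      (H.IsKontsevich r g ∧ H.deg r = (r + 1) * e) ∧ H.HasWhiteVertices (fun _ => 1) ∧
      ∀ (i : Fin n) (d : Fin H.size), H.deco d = .inl i ↔ H.AdjWhite d i := by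
  constructor
  · rintro ⟨h, hd⟩
    have hE := (euler_iff (r := r) (g := g) (e := e) H).2 ⟨h.vert, h.fac⟩
    have hw : ∀ d i, H.vtype d = .white i → H.deco d = .inl i := fun d i hdi => by
      obtain ⟨k, -, h1, -, h2⟩ := h.white d (unsq_ty_ne_black.2 ⟨i, hdi⟩)
      have := hdi.symm.trans (unsq_ty_eq_white.1 h2)
      rw [VertexType.white.inj this]
      exact h1
    have huniq : ∀ d d' i, H.vtype d = .white i → H.vtype d' = .white i → d = d' :=
      fun d d' i h1 h2 => h.white_unique d d' (unsq_ty_ne_black.2 ⟨i, h1⟩)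
        (unsq_ty_ne_black.2 ⟨i, h2⟩) ((hw d i h1).trans (hw d' i h2).symm)
    have hex : ∀ i, ∃ d, H.vtype d = .white i := fun i => by
      obtain ⟨d, h1, h2⟩ := h.white_ex i (Nat.zero_le _)
      obtain ⟨j, hj⟩ := unsq_ty_ne_black.1 h1
      have := (hw d j hj).symm.trans h2
      rw [← Sum.inl_injective this]
      exact ⟨d, hj⟩
    refine ⟨⟨⟨(connected_iff H).2 ⟨?_, h.conn⟩, hE.1, (black_degree_iff H).2 fun d hd' =>
      ⟨(three_le_card_orb_iff H.rot d).2 (h.deg d (unsq_ty_eq_black.2 (Or.inl hd')) ?_),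
        hd d hd'⟩, ?_⟩, hE.2⟩, ?_, ?_⟩
    · obtain ⟨d, -⟩ := h.mark_ex 0
      exact d.pos
    · simp [hd']
    · intro d d' i j hs h1 h2
      have h3 := h.deco_sameCycle (d := d) (d' := d') hs
      have : i = j := Sum.inl_injective ((hw d i h1).symm.trans (h3.trans (hw d' j h2)))
      rw [huniq d d' i h1 (this ▸ h2)]
    · rw [hasWhiteVertices_iff]
      intro i
      obtain ⟨d, hdi⟩ := hex i
      refine ⟨d, hdi, fun d' hd' => ?_, ?_⟩
      · rw [huniq d d' i hdi hd']
      · rw [card_orb_eq_one_iff]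
        exact huniq _ _ i (by rw [H.vtype_rot, hdi]) hdi
    · intro i d
      constructor
      · intro hdi
        obtain ⟨d', hd'⟩ := hex i
        exact ⟨d', h.mark_unique i d d' hdi (hw d' i hd'), hd'⟩
      · rintro ⟨d', h1, h2⟩
        have := h.deco_sameCycle (d := d) (d' := d') h1
        exact this.trans (hw d' i h2)
  · rintro ⟨⟨h, hd⟩, hW, hmk⟩
    rw [hasWhiteVertices_iff] at hW
    have hE := (euler_iff H).1 ⟨h.genus, hd⟩
    have hbd := (black_degree_iff H).1 h.black_degree
    have hw : ∀ d i, H.vtype d = .white i → H.deco d = .inl i := fun d i hdi =>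
      (hmk i d).2 ⟨d, Perm.SameCycle.refl _ _, hdi⟩
    have huniq : ∀ d d' i, H.vtype d = .white i → H.vtype d' = .white i → d = d' := by
      intro d d' i h1 h2
      obtain ⟨d₀, h3, h4, h5⟩ := hW i
      have key : ∀ x, H.vtype x = .white i → x = d₀ := fun x hx => by
        have h6 := mem_orb.2 (h4 x hx)
        have h7 := mem_orb_self H.rot d₀
        exact (Finset.card_le_one.1 h5.le) _ h6 _ h7
      rw [key d h1, key d' h2]
    refine ⟨⟨H.opp_opp, H.opp_ne, ?_, H.deco_face, ((connected_iff H).1 h.connected).2,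
      hE.1, hE.2, ?_, ?_, ?_, fun d hd => unsq_ty_eq_black.2 (Or.inr hd), ?_, ?_, ?_⟩,
      fun d hd => (hbd d hd).2⟩
    · intro d
      unfold Cfg.unsq
      dsimp only
      rw [show (toCfg H).ty ((toCfg H).rot d) = (toCfg H).ty d from H.vtype_rot d]
    · intro d hd
      obtain ⟨i, hi⟩ := unsq_ty_ne_black.1 hd
      refine ⟨i, Nat.zero_le _, hw d i hi, hw _ i ?_, unsq_ty_eq_white.2 hi⟩
      rw [← H.vtype_rot]
      exact (congrArg H.vtype (H.rot.apply_symm_apply d)).trans hi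
    · intro k _
      obtain ⟨d, h1, -⟩ := hW k
      exact ⟨d, unsq_ty_ne_black.2 ⟨k, h1⟩, hw d k h1⟩
    · intro d d' h1 h2 h3
      obtain ⟨i, hi⟩ := unsq_ty_ne_black.1 h1
      obtain ⟨j, hj⟩ := unsq_ty_ne_black.1 h2
      have : i = j := Sum.inl_injective ((hw d i hi).symm.trans (h3.trans (hw d' j hj)))
      exact huniq d d' i hi (this ▸ hj)
    · intro d h1 h2
      have h3 := (unsq_ty_eq_black.1 h1).resolve_right h2
      exact (three_le_card_orb_iff H.rot d).1 (hbd d h3).1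
    · intro k
      obtain ⟨d, h1, -⟩ := hW k
      exact ⟨d, hw d k h1⟩
    · intro k d d' h1 h2
      obtain ⟨b, hb1, hb2⟩ := (hmk k d).1 h1
      obtain ⟨b', hb1', hb2'⟩ := (hmk k d').1 h2
      rw [huniq b' b k hb2' hb2] at hb1'
      exact hb1.trans hb1'.symm

/-- Ciliated maps as labelled graphs. -/
theorem isCiliated_iff {g : ℕ} {e : ℤ} [NeZero n] (H : DecoratedMap n (Fin n) N) :
    (H ∈ {G : DecoratedMap n (Fin n) N | G.IsCiliated r g} ∧ H.deg r = (r + 1) * e) ↔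
      IsPlain (stdSpec n e (e + 2 - 2 * g) 0) (toCfg H) ∧ DegLE r (toCfg H) := by
  have key := isGraph_unsq_iff (r := r) (g := g) (e := e) H
  have hS : (∀ d, H.vtype d ≠ .square) → (fun d => H.vtype d = .square) = fun _ => False :=
    fun h => funext fun d => propext ⟨h d, False.elim⟩
  constructor
  · rintro ⟨h, hd⟩
    have := key.2 ⟨⟨h.toIsKontsevich, hd⟩, h.white, h.marked⟩
    rwa [hS h.no_square, unsq_eq_self (G := toCfg H) h.no_square] at this
  · rintro ⟨h, hd⟩
    have hsq : ∀ d, H.vtype d ≠ .square := fun d hd => by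
      obtain ⟨k, -, -, -, hk⟩ := h.white d (by
        change H.vtype d ≠ _
        rw [hd]; simp)
      have := hd.symm.trans hk
      simp at this
    rw [hS hsq, unsq_eq_self (G := toCfg H) hsq] at key
    obtain ⟨⟨h1, h2⟩, h3, h4⟩ := key.1 ⟨h, hd⟩
    exact ⟨⟨h1, hsq, h3, h4⟩, h2⟩

end Conversion

/-! ### Multi-ciliated maps as labelled graphs -/

section MultiCiliated

variable {n N r : ℕ} {M : Type}

/-- The kind of the graphs underlying multi-ciliated maps. -/
def multiSpec (k : Fin n → ℕ) (e f : ℤ) : Spec n (Σ i : Fin n, Fin (k i)) :=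
  ⟨fun _ => True, fun p => ⟨p.1, finRotate (k p.1) p.2⟩, Sigma.fst, e, f⟩

theorem val_iterate_finRotate {m : ℕ} (j : Fin (m + 1)) (t : ℕ) :
    ((finRotate (m + 1))^[t] j).val = (j.val + t) % (m + 1) := by
  induction t with
  | zero => simp [Nat.mod_eq_of_lt j.2]
  | succ t ih =>
    rw [Function.iterate_succ_apply', finRotate_apply, Fin.val_add, ih, Fin.val_one',
      ← Nat.add_mod, add_assoc]

theorem exists_iterate_finRotate {m : ℕ} (j j' : Fin m) : ∃ t, (finRotate m)^[t] j = j' := by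
  obtain _ | m := m
  · exact j.elim0
  · refine ⟨m + 1 - j.val + j'.val, Fin.ext ?_⟩
    rw [val_iterate_finRotate, show j.val + (m + 1 - j.val + j'.val) = j'.val + (m + 1) by omega,
      Nat.add_mod_right, Nat.mod_eq_of_lt j'.2]

theorem multiSpec_isStar {k : Fin n → ℕ} (hk : ∀ i, 1 ≤ k i) (e f : ℤ) :
    (multiSpec k e f).IsStar where
  cil _ := trivial
  inj := by
    rintro ⟨i, j⟩ ⟨i', j'⟩ h
    obtain rfl : i = i' := congrArg Sigma.fst h
    have h' := eq_of_heq (Sigma.mk.inj h).2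
    exact congrArg (Sigma.mk i) ((finRotate (k i)).injective h')
  tp_next _ := rfl
  trans := by
    rintro ⟨i, j⟩ ⟨i', j'⟩ (rfl : i = i')
    obtain ⟨t, ht⟩ := exists_iterate_finRotate j j'
    refine ⟨t, ?_⟩
    rw [← ht]
    clear ht
    induction t with
    | zero => rfl
    | succ t ih => rw [Function.iterate_succ_apply', ih, Function.iterate_succ_apply']; rfl
  surj i := ⟨⟨i, ⟨0, hk i⟩⟩, rfl⟩

theorem exists_white_deco {k : Fin n → ℕ} (H : DecoratedMap n (Σ i : Fin n, Fin (k i)) N) {i : Fin n}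
    (h : ∀ d, H.vtype d = .white i → ∃ j : Fin (k i), H.deco d = .inl ⟨i, j⟩ ∧
      H.deco (H.rot.symm d) = .inl ⟨i, finRotate (k i) j⟩) {d : Fin H.size}
    (hd : H.vtype d = .white i) (j' : Fin (k i)) :
    ∃ d', H.vtype d' = .white i ∧ H.deco d' = .inl ⟨i, j'⟩ ∧ H.rot.SameCycle d d' := by
  obtain ⟨j, hj, -⟩ := h d hd
  obtain ⟨t, rfl⟩ := exists_iterate_finRotate j j'
  induction t with
  | zero => exact ⟨d, hd, hj, Perm.SameCycle.refl _ _⟩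
  | succ t ih =>
    obtain ⟨d', h1, h2, h3⟩ := ih
    obtain ⟨j₁, h4, h5⟩ := h d' h1
    have h6 : H.rot (H.rot.symm d') = d' := H.rot.apply_symm_apply d'
    refine ⟨H.rot.symm d', ?_, ?_, ?_⟩
    · rw [← H.vtype_rot, h6, h1]
    · have h7 := h2.symm.trans h4
      simp only [Sum.inl.injEq, Sigma.mk.injEq, heq_eq_eq, true_and] at h7
      rw [h5, Function.iterate_succ_apply', h7]
    · rw [← Perm.sameCycle_apply_right, h6]
      exact h3

/-- Turning around the vertex advances the label by `finRotate`, so all `k i` labels occur. For a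
vertex of degree `k i` the corners then have distinct labels; conversely, distinct labels give the
degree. -/
theorem image_deco_orb {k : Fin n → ℕ} (H : DecoratedMap n (Σ i : Fin n, Fin (k i)) N) {i : Fin n}
    (h : ∀ d, H.vtype d = .white i → ∃ j : Fin (k i), H.deco d = .inl ⟨i, j⟩ ∧
      H.deco (H.rot.symm d) = .inl ⟨i, finRotate (k i) j⟩) {d : Fin H.size}
    (hd : H.vtype d = .white i) :
    open Classical in ((orb H.rot d).image H.deco).card = k i := by
  classical
  have : (orb H.rot d).image H.deco =
      Finset.univ.image (fun j : Fin (k i) => (Sum.inl ⟨i, j⟩ : (Σ i, Fin (k i)) ⊕ Fin N)) := by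
    ext x
    simp only [Finset.mem_image, mem_orb, Finset.mem_univ, true_and]
    constructor
    · rintro ⟨d', h1, rfl⟩
      obtain ⟨j, h2, -⟩ := h d' ((H.vtype_eq h1).symm.trans hd)
      exact ⟨j, h2.symm⟩
    · rintro ⟨j, rfl⟩
      obtain ⟨d', -, h2, h3⟩ := exists_white_deco H h hd j
      exact ⟨d', h3, h2⟩
  rw [this, Finset.card_image_of_injective, Finset.card_fin]
  intro j j' hj
  simpa using hj

/-- Multi-ciliated maps as labelled graphs. -/
theorem isMultiCiliated_iff {g : ℕ} {e : ℤ} [NeZero n] {k : Fin n → ℕ} (hk : ∀ i, 1 ≤ k i)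
    (H : DecoratedMap n (Σ i : Fin n, Fin (k i)) N) :
    (H ∈ {G : DecoratedMap n (Σ i : Fin n, Fin (k i)) N | G.IsMultiCiliated k r g} ∧
      H.deg r = (r + 1) * e) ↔
      IsPlain (multiSpec k e (e + 2 - 2 * g)) (toCfg H) ∧ DegLE r (toCfg H) := by
  classical
  constructor
  · rintro ⟨h, hd⟩
    have hE := (euler_iff H).1 ⟨h.genus, hd⟩
    have hbd := (black_degree_iff H).1 h.black_degree
    have hW := (hasWhiteVertices_iff H k).1 h.white
    have hex : ∀ i (j : Fin (k i)), ∃ d, H.vtype d = .white i ∧ H.deco d = .inl ⟨i, j⟩ := by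
      intro i j
      obtain ⟨d, h1, -⟩ := hW i
      obtain ⟨d', h2, h3, -⟩ := exists_white_deco H (h.clockwise i) h1 j
      exact ⟨d', h2, h3⟩
    have hty : ∀ d, H.vtype d ≠ .black → ∃ i, H.vtype d = .white i := by
      intro d hd
      rcases h' : H.vtype d with _ | i | _
      · exact absurd h' hd
      · exact ⟨i, rfl⟩
      · exact absurd h' (h.no_square d)
    have huniq : ∀ d d', H.vtype d ≠ .black → H.vtype d' ≠ .black → H.deco d = H.deco d' →
        d = d' := by
      intro d d' h1 h2 h3
      obtain ⟨i, hi⟩ := hty d h1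
      obtain ⟨i', hi'⟩ := hty d' h2
      obtain ⟨j, hj, -⟩ := h.clockwise i d hi
      obtain ⟨j', hj', -⟩ := h.clockwise i' d' hi'
      obtain rfl : i = i' := by
        have := hj.symm.trans (h3.trans hj')
        exact congrArg Sigma.fst (Sum.inl_injective this)
      obtain ⟨d₀, h4, h5, h6⟩ := hW i
      have h7 := image_deco_orb H (h.clockwise i) h4
      rw [← h6] at h7
      exact Finset.injOn_of_card_image_eq h7 (mem_orb.2 (h5 d hi)) (mem_orb.2 (h5 d' hi')) h3
    refine ⟨⟨H.opp_opp, H.opp_ne, H.vtype_rot, H.deco_face, ((connected_iff H).1 h.connected).2,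
      hE.1, hE.2, ?_, ?_, huniq, fun _ h => h.elim, ?_, ?_, ?_⟩, fun d hd => (hbd d hd).2⟩
    · intro d hd
      obtain ⟨i, hi⟩ := hty d hd
      obtain ⟨j, h1, h2⟩ := h.clockwise i d hi
      exact ⟨⟨i, j⟩, trivial, h1, h2, hi⟩
    · rintro ⟨i, j⟩ -
      obtain ⟨d, h1, h2⟩ := hex i j
      exact ⟨d, fun h' => by have := h1.symm.trans h'; simp at this, h2⟩
    · exact fun d hd _ => (three_le_card_orb_iff H.rot d).1 (hbd d hd).1
    · rintro ⟨i, j⟩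
      obtain ⟨d, -, h2⟩ := hex i j
      exact ⟨d, h2⟩
    · rintro ⟨i, j⟩ d d' h1 h2
      obtain ⟨b, h3, h4⟩ := h.marked i j d h1
      obtain ⟨b', h3', h4'⟩ := h.marked i j d' h2
      have h5 : H.deco d = H.deco b := SameCycle.invariant (σ := H.face) H.deco_face h3
      have h6 : H.deco d' = H.deco b' := SameCycle.invariant (σ := H.face) H.deco_face h3'
      have h7 := huniq b b' (by rw [h4]; simp) (by rw [h4']; simp)
        (h5.symm.trans (h1.trans (h2.symm.trans h6)))
      rw [← h7] at h3'
      exact h3.trans h3'.symm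
  · rintro ⟨h, hd⟩
    have hE := (euler_iff (r := r) (g := g) (e := e) H).2 ⟨h.vert, h.fac⟩
    have hw : ∀ d, H.vtype d ≠ .black → ∃ i, H.vtype d = .white i ∧ ∃ j : Fin (k i),
        H.deco d = .inl ⟨i, j⟩ ∧ H.deco (H.rot.symm d) = .inl ⟨i, finRotate (k i) j⟩ := by
      intro d hd
      obtain ⟨⟨i, j⟩, -, h1, h2, h3⟩ := h.white d hd
      exact ⟨i, h3, j, h1, h2⟩
    have hcw : ∀ i d, H.vtype d = .white i → ∃ j : Fin (k i),
        H.deco d = .inl ⟨i, j⟩ ∧ H.deco (H.rot.symm d) = .inl ⟨i, finRotate (k i) j⟩ := by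
      intro i d hi
      obtain ⟨i', h1, h2⟩ := hw d (by rw [hi]; simp)
      obtain rfl : i = i' := VertexType.white.inj (hi.symm.trans h1)
      exact h2
    have hne : ∀ {d i}, H.vtype d = .white i → (toCfg H).ty d ≠ .black := fun {d i} hi => by
      change H.vtype d ≠ _
      rw [hi]; simp
    have huniq : ∀ d d' i i', H.vtype d = .white i → H.vtype d' = .white i' →
        H.deco d = H.deco d' → d = d' :=
      fun d d' i i' h1 h2 h3 => h.white_unique d d' (hne h1) (hne h2) h3
    have hex : ∀ i (j : Fin (k i)), ∃ d, H.vtype d = .white i ∧ H.deco d = .inl ⟨i, j⟩ := by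
      intro i j
      obtain ⟨d, h1, h2⟩ := h.white_ex ⟨i, j⟩ trivial
      obtain ⟨i', h3, j', h4, -⟩ := hw d h1
      have h5 : i' = i := congrArg Sigma.fst (Sum.inl_injective (h4.symm.trans h2))
      exact ⟨d, h5 ▸ h3, h2⟩
    refine ⟨?_, hE.2⟩
    refine ⟨⟨(connected_iff H).2 ⟨?_, h.conn⟩, hE.1, (black_degree_iff H).2 fun d hd' =>
      ⟨(three_le_card_orb_iff H.rot d).2 (h.deg d hd' id), hd d hd'⟩, ?_⟩, ?_, ?_, ?_, hcw, ?_⟩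
    · obtain ⟨d, -⟩ := hex 0 ⟨0, hk 0⟩
      exact d.pos
    · intro d d' i j h1 h2 h3
      rw [huniq d d' i j h2 h3 (SameCycle.invariant (σ := H.face) H.deco_face h1)]
    · intro d hd'
      obtain ⟨i, hi, -⟩ := hw d (by rw [hd']; simp)
      simp [hd'] at hi
    · rw [hasWhiteVertices_iff]
      intro i
      obtain ⟨d, h1, -⟩ := hex i ⟨0, hk i⟩
      refine ⟨d, h1, fun d' h2 => ?_, ?_⟩
      · obtain ⟨j, h3, -⟩ := hcw i d' h2
        obtain ⟨d₁, h4, h5, h6⟩ := exists_white_deco H (hcw i) h1 j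
        rwa [← huniq d₁ d' i i h4 h2 (h5.trans h3.symm)]
      · rw [← image_deco_orb H (hcw i) h1, Finset.card_image_of_injOn]
        intro a ha b hb hab
        exact huniq a b i i ((H.vtype_eq (mem_orb.1 ha)).symm.trans h1)
          ((H.vtype_eq (mem_orb.1 hb)).symm.trans h1) hab
    · intro i d d' h1 h2 h3
      exact huniq d d' i i h1 h2 (SameCycle.invariant (σ := H.face) H.deco_face h3)
    · intro i j d h1
      obtain ⟨d', h2, h3⟩ := hex i j
      exact ⟨d', h.mark_unique _ d d' h1 h3, h2⟩

theorem isMultiCiliated_pos {g : ℕ} {k : Fin n → ℕ} {H : DecoratedMap n (Σ i : Fin n, Fin (k i)) N}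
    (h : H.IsMultiCiliated k r g) (i : Fin n) : 1 ≤ k i := by
  obtain ⟨d, -, -, h3⟩ := (hasWhiteVertices_iff H k).1 h.white i
  rw [← h3]
  exact card_orb_pos H.rot d

theorem finite_isoClasses_of_isPlain [Finite M] {𝒢 : Set (DecoratedMap n M N)} {d : ℤ}
    {X : Spec n M} (h : ∀ H : DecoratedMap n M N, (H ∈ 𝒢 ∧ H.deg r = d) →
      IsPlain X (toCfg H) ∧ DegLE r (toCfg H)) : (isoClasses r 𝒢 d).Finite := by
  have := Fintype.ofFinite M
  refine finite_isoClasses (B := X.bound) fun G hG hd => ?_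
  have := (h G ⟨hG, hd⟩).1.card_lt_bound fun _ _ h => h.elim
  rwa [Fintype.card_fin] at this

theorem isoClasses_eq_empty (𝒢 : Set (DecoratedMap n M N)) {d : ℤ}
    (h : ¬ ∃ e : ℤ, d = (r + 1) * e) : isoClasses r 𝒢 d = ∅ := by
  rw [isoClasses, Set.image_eq_empty, Set.eq_empty_iff_forall_notMem]
  rintro G ⟨-, hG⟩
  obtain ⟨e, he⟩ := deg_eq_mul (r := r) G
  exact h ⟨e, hG.symm.trans he⟩

theorem degreeSum_eq_zero (𝒢 : Set (DecoratedMap n M N)) {d : ℤ} (h : ¬ ∃ e : ℤ, d = (r + 1) * e)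
    (v : ℕ → ℂ) (val : M ⊕ Fin N → ℂ) (u : ℂ) : degreeSum r v val u 𝒢 d = 0 := by
  unfold degreeSum
  rw [isoClasses_eq_empty 𝒢 h]
  simp

end MultiCiliated

/-! ### Square-ciliated maps as labelled graphs -/

section SquareCiliated

variable {n N r : ℕ} {L D E : Type}

/-- The labelled graphs with a single square vertex, joined to the first white vertex. -/
structure IsSquareGraph [Fintype D] [NeZero n] (X : Spec n (Fin n))
    (G : Cfg n (Fin n ⊕ Fin N) D) : Prop where
  graph : IsGraph X (fun d => G.ty d = .square) G.unsq
  one : ∃ s, ∀ d, G.ty d = .square ↔ G.rot.SameCycle s d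
  first : ∀ d, G.ty d = .white 0 → G.ty (G.opp d) = .square

theorem unsq_map (e : D ≃ E) (G : Cfg n L D) : (G.map e).unsq = G.unsq.map e := rfl

theorem isSquareGraph_map_iff [Fintype D] [Fintype E] [NeZero n] {X : Spec n (Fin n)} (e : D ≃ E)
    (G : Cfg n (Fin n ⊕ Fin N) D) : IsSquareGraph X (G.map e) ↔ IsSquareGraph X G := by
  have h1 : IsGraph X (fun d => (G.map e).ty d = .square) (G.map e).unsq ↔
      IsGraph X (fun d => G.ty d = .square) G.unsq := by
    rw [unsq_map]
    exact IsGraph.map_iff e fun d => by simp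
  have h2 : (∃ s, ∀ d, (G.map e).ty d = .square ↔ (G.map e).rot.SameCycle s d) ↔
      ∃ s, ∀ d, G.ty d = .square ↔ G.rot.SameCycle s d := by
    rw [← e.exists_congr_right]
    refine exists_congr fun s => ?_
    rw [← e.forall_congr_right]
    refine forall_congr' fun d => ?_
    rw [Cfg.map_rot, sameCycle_permCongr]
    simp
  have h3 : (∀ d, (G.map e).ty d = .white 0 → (G.map e).ty ((G.map e).opp d) = .square) ↔
      ∀ d, G.ty d = .white 0 → G.ty (G.opp d) = .square := by
    rw [← e.forall_congr_right]
    simp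
  exact ⟨fun h => ⟨h1.1 h.graph, h2.1 h.one, h3.1 h.first⟩,
    fun h => ⟨h1.2 h.graph, h2.2 h.one, h3.2 h.first⟩⟩

theorem isSquareCiliated_iff {g : ℕ} {e : ℤ} [NeZero n] (H : DecoratedMap n (Fin n) N) :
    (H ∈ {G : DecoratedMap n (Fin n) N | G.IsSquareCiliated r g} ∧ H.deg r = (r + 1) * e) ↔
      IsSquareGraph (stdSpec n e (e + 2 - 2 * g) 0) (toCfg H) ∧ DegLE r (toCfg H) := by
  have key := isGraph_unsq_iff (r := r) (g := g) (e := e) H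
  constructor
  · rintro ⟨h, hd⟩
    obtain ⟨h1, h2⟩ := key.2 ⟨⟨h.toIsKontsevich, hd⟩, h.white, h.marked⟩
    refine ⟨⟨h1, ?_, h.first_white⟩, h2⟩
    obtain ⟨x, hx⟩ := h.one_square
    refine ⟨x.out, fun d => ?_⟩
    have := hx (Quotient.mk _ d)
    rw [vertexType_mk] at this
    refine this.trans ((mk_eq_iff H.rot x d).trans mem_orb)
  · rintro ⟨⟨h1, ⟨s, hs⟩, h3⟩, h4⟩
    obtain ⟨⟨h5, h6⟩, h7, h8⟩ := key.1 ⟨h1, h4⟩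
    refine ⟨⟨h5, ⟨Quotient.mk _ s, fun y => ?_⟩, h7, h8, h3⟩, h6⟩
    refine (hs y.out).trans ⟨fun h => ?_, ?_⟩
    · rw [← y.out_eq]
      exact Quotient.sound h.symm
    · rintro rfl
      exact (mk_out_sameCycle H s).symm

/-- The vertex of `j` is turned into a square vertex. -/
def Cfg.sqAt (G : Cfg n L D) (j : D) : Cfg n L D where
  rot := G.rot
  opp := G.opp
  ty d := open Classical in if G.rot.SameCycle j d then .square else G.ty d
  deco := G.deco

theorem sqAt_ty_of_sameCycle {G : Cfg n L D} {j d : D} (h : G.rot.SameCycle j d) :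
    (G.sqAt j).ty d = .square := if_pos h

theorem sqAt_ty_of_not_sameCycle {G : Cfg n L D} {j d : D} (h : ¬ G.rot.SameCycle j d) :
    (G.sqAt j).ty d = G.ty d := if_neg h

theorem ty_ne_square_of_isGraph [Fintype D] {K : Type} {X : Spec n K} {S : D → Prop}
    {G : Cfg n (K ⊕ Fin N) D} (h : IsGraph X S G) (d : D) : G.ty d ≠ .square := fun hd => by
  obtain ⟨k, -, -, -, hk⟩ := h.white d (by rw [hd]; simp)
  rw [hd] at hk
  simp at hk

theorem sqAt_ty_eq_square_iff [Fintype D] {K : Type} {X : Spec n K} {S : D → Prop}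
    {G : Cfg n (K ⊕ Fin N) D} (h : IsGraph X S G) {j d : D} :
    (G.sqAt j).ty d = .square ↔ G.rot.SameCycle j d := by
  refine ⟨fun h' => ?_, sqAt_ty_of_sameCycle⟩
  by_contra hd
  rw [sqAt_ty_of_not_sameCycle hd] at h'
  exact ty_ne_square_of_isGraph h d h'

theorem unsq_sqAt [Fintype D] {K : Type} {X : Spec n K}
    {G : Cfg n (K ⊕ Fin N) D} {j : D} (h : IsRooted X G j) : (G.sqAt j).unsq = G := by
  refine Cfg.ext rfl rfl (funext fun d => ?_) rfl
  by_cases hd : G.rot.SameCycle j d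
  · rw [h.special d hd, unsq_ty_eq_black, sqAt_ty_of_sameCycle hd]
    exact Or.inr rfl
  · have h1 := ty_ne_square_of_isGraph h d
    rcases h2 : G.ty d with _ | i | _
    · rw [unsq_ty_eq_black, sqAt_ty_of_not_sameCycle hd]
      exact Or.inl h2
    · rw [unsq_ty_eq_white, sqAt_ty_of_not_sameCycle hd, h2]
    · exact absurd h2 h1

variable {v : ℕ → ℂ}

theorem fullWt_sqAt [Fintype D] {K : Type} {X : Spec n K} {G : Cfg n (K ⊕ Fin N) D} {j : D}
    (h : IsRooted X G j) (val : K ⊕ Fin N → ℂ) (u : ℂ) :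
    fullWt r v val u (G.sqAt j) = rwt r v val (sqw u) G j := by
  unfold fullWt rwt rprod
  refine congrArg (eprod r v G.opp (val ∘ G.deco) * ·) (Finset.prod_congr rfl fun s hs => ?_)
  obtain ⟨d, rfl⟩ := mem_orbs.1 hs
  by_cases hj : j ∈ orb G.rot d
  · have hd : ∀ d' ∈ orb G.rot d, (G.sqAt j).ty d' = .square := fun d' hd' =>
      sqAt_ty_of_sameCycle ((mem_orb.1 hj).symm.trans (mem_orb.1 hd'))
    rw [pif_pos hj, pif_neg, pif_pos hd]
    · rfl
    · intro h'
      have h1 := h' d (mem_orb_self _ _)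
      rw [hd d (mem_orb_self _ _)] at h1
      simp at h1
  · have hd : ∀ d' ∈ orb G.rot d, ¬ G.rot.SameCycle j d' := fun d' hd' h1 =>
      hj (mem_orb.2 ((mem_orb.1 hd').trans h1.symm))
    have hty : (∀ d' ∈ orb G.rot d, (G.sqAt j).ty d' = .black) ↔
        ∀ d' ∈ orb G.rot d, G.ty d' = .black := forall₂_congr fun d' hd' => by
      rw [sqAt_ty_of_not_sameCycle (hd d' hd')]
    rw [pif_neg hj, pif_neg (p := ∀ d' ∈ orb G.rot d, (G.sqAt j).ty d' = .square)]
    · exact congrArg (fun p => pif p _ _) (propext hty)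
    · intro h'
      have h1 := h' d (mem_orb_self _ _)
      exact hd d (mem_orb_self _ _) ((sqAt_ty_eq_square_iff h).1 h1)

theorem fullWt_eq_zero [Fintype D] (val : L → ℂ) (u : ℂ) {G : Cfg n L D}
    (hty : ∀ d, G.ty (G.rot d) = G.ty d) (h : ¬ DegLE r G) : fullWt r v val u G = 0 := by
  unfold DegLE at h
  push Not at h
  obtain ⟨d, h1, h2⟩ := h
  unfold fullWt
  rw [Finset.prod_eq_zero (orb_mem_orbs G.rot d), mul_zero]
  rw [pif_pos, vw_eq_zero]
  · rw [Multiset.card_map, Finset.card_val]; exact h2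
  · intro d' hd'
    rw [← h1]
    exact (SameCycle.invariant hty (mem_orb.1 hd')).symm

theorem ty_rot_of_unsq {G : Cfg n L D} (h : ∀ d, G.unsq.ty (G.rot d) = G.unsq.ty d)
    (hs : ∀ d, G.ty (G.rot d) = .square ↔ G.ty d = .square) (d : D) : G.ty (G.rot d) = G.ty d := by
  by_cases h1 : G.ty d = .square
  · rw [h1, (hs d).2 h1]
  · have h2 := mt (hs d).1 h1
    have h3 : ∀ d, G.ty d ≠ .square → G.unsq.ty d = G.ty d := fun d hd => by
      unfold Cfg.unsq
      rcases h' : G.ty d <;> simp [h']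
      exact hd h'
    rw [← h3 _ h1, ← h3 _ h2, h]

theorem IsSquareGraph.ty_rot [Fintype D] [NeZero n] {X : Spec n (Fin n)}
    {G : Cfg n (Fin n ⊕ Fin N) D} (h : IsSquareGraph X G) (d : D) : G.ty (G.rot d) = G.ty d := by
  obtain ⟨s, hs⟩ := h.one
  refine ty_rot_of_unsq h.graph.ty_rot (fun d => ?_) d
  rw [hs, hs, Perm.sameCycle_apply_right]

variable [NeZero n] {e f : ℤ}

theorem stdSpec_one_addCil : (stdSpec n e f 1).addCil 0 = stdSpec n e f 0 := by
  have := stdSpec_addCil e f (0 : Fin n)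
  simpa using this

theorem eq_inl_of_white [Fintype D] {S : D → Prop} {G : Cfg n (Fin n ⊕ Fin N) D}
    (h : IsGraph (stdSpec n e f 0) S G) {d : D} {i : Fin n} (hd : G.ty d = .white i) :
    G.deco d = .inl i := by
  obtain ⟨k, -, h1, -, h2⟩ := h.white d (by rw [hd]; simp)
  rw [h1, VertexType.white.inj (hd.symm.trans h2)]
  rfl

theorem exists_white [Fintype D] {S : D → Prop} {G : Cfg n (Fin n ⊕ Fin N) D}
    (h : IsGraph (stdSpec n e f 0) S G) (i : Fin n) : ∃ d, G.ty d = .white i := by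
  obtain ⟨d, h1, h2⟩ := h.white_ex i (Nat.zero_le _)
  obtain ⟨k, -, h3, -, h4⟩ := h.white d h1
  have : k = i := Sum.inl_injective (h3.symm.trans h2)
  exact ⟨d, by rw [h4, this]; rfl⟩

/-- The square vertex is a black root weighted by `sqw u`. The first white vertex determines the two
darts `i` and `j`, and conversely `j` tells which vertex to paint square. -/
theorem sum_isSquareGraph [Fintype D] (val : Fin n ⊕ Fin N → ℂ) (u : ℂ) :
    ∑ G : Cfg n (Fin n ⊕ Fin N) D, pif (IsSquareGraph (stdSpec n e f 0) G)
        (fullWt r v val u G) 0 =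
      cilSum r v D (stdSpec n e f 1) val 0 (sqw u) := by
  classical
  unfold cilSum
  rw [← Finset.sum_congr rfl fun G _ => Fintype.sum_prod_type' (fun i j =>
      pif (IsCilRooted (stdSpec n e f 1) 0 G i j) (rwt r v val (sqw u) G j) 0),
    ← Fintype.sum_prod_type' (fun G (p : D × D) =>
      pif (IsCilRooted (stdSpec n e f 1) 0 G p.1 p.2) (rwt r v val (sqw u) G p.2) 0)]
  unfold IsCilRooted
  rw [stdSpec_one_addCil]
  refine sum_pif_bij (fun x => x.1.sqAt x.2.2) ?_ ?_ ?_ ?_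
  · rintro ⟨G, i, j⟩ ⟨h1, h2, h3, h4⟩
    dsimp only at h1 h2 h3 h4 ⊢
    refine ⟨?_, ⟨j, fun d => sqAt_ty_eq_square_iff h1⟩, fun d hd => ?_⟩
    · rw [unsq_sqAt h1, show (fun d => (G.sqAt j).ty d = .square) = G.rot.SameCycle j from
        funext fun d => propext (sqAt_ty_eq_square_iff h1)]
      exact h1
    · have h5 : G.ty d = .white 0 := by
        rw [← hd, sqAt_ty_of_not_sameCycle]
        intro h'
        rw [sqAt_ty_of_sameCycle h'] at hd
        simp at hd
      have h6 := h1.white_unique d i (by rw [h5]; simp) h2 ((eq_inl_of_white h1 h5).trans h3.symm)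
      rw [sqAt_ty_eq_square_iff h1, h6]
      change G.rot.SameCycle j (G.opp i)
      rw [h4]
  · rintro ⟨G, i, j⟩ ⟨G', i', j'⟩ ⟨h1, h2, h3, h4⟩ ⟨h1', h2', h3', h4'⟩ h
    dsimp only at h1 h2 h3 h4 h1' h2' h3' h4' h
    obtain rfl : G = G' := by rw [← unsq_sqAt h1, h, unsq_sqAt h1']
    obtain rfl := h1.white_unique i i' h2 h2' (h3.trans h3'.symm)
    rw [← h4, ← h4']
  · intro G h
    obtain ⟨i, hi⟩ := exists_white h.graph 0
    have hi' : G.ty i = .white 0 := unsq_ty_eq_white.1 hi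
    obtain ⟨s, hs⟩ := h.one
    have hj : ∀ d, G.ty d = .square ↔ G.rot.SameCycle (G.opp i) d := fun d => by
      have := (hs _).1 (h.first i hi')
      exact (hs d).trans ⟨fun h' => this.symm.trans h', fun h' => this.trans h'⟩
    refine ⟨(G.unsq, i, G.opp i), ⟨?_, ?_, eq_inl_of_white h.graph hi, rfl⟩, ?_⟩
    · have := h.graph
      rwa [show (fun d => G.ty d = .square) = G.unsq.rot.SameCycle (G.opp i) from
        funext fun d => propext (hj d)] at this
    · dsimp only
      rw [hi]
      simp
    · refine Cfg.ext rfl rfl (funext fun d => ?_) rfl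
      by_cases hd : G.rot.SameCycle (G.opp i) d
      · rw [(hj d).2 hd]
        exact sqAt_ty_of_sameCycle hd
      · refine (sqAt_ty_of_not_sameCycle (G := G.unsq) hd).trans ?_
        have := mt (hj d).1 hd
        unfold Cfg.unsq
        rcases h' : G.ty d <;> simp [h']
        exact this h'
  · rintro ⟨G, i, j⟩ h
    exact fullWt_sqAt h.1 val u

theorem size_lt_of_isSquareCiliated {g : ℕ} {H : DecoratedMap n (Fin n) N}
    (h : IsSquareGraph (stdSpec n e (e + 2 - 2 * g) 0) (toCfg H)) :
    H.size < (stdSpec n e (e + 2 - 2 * g) 0).bound := by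
  obtain ⟨s, hs⟩ := h.one
  have := h.graph.card_lt_bound fun d d' h1 h2 => ((hs d).1 h1).symm.trans ((hs d').1 h2)
  rwa [Fintype.card_fin] at this

theorem degreeSum_isSquareCiliated (v : ℕ → ℂ) (g : ℕ) (e : ℤ) (val : Fin n ⊕ Fin N → ℂ) (u : ℂ) :
    degreeSum r v val u {G : DecoratedMap n (Fin n) N | G.IsSquareCiliated r g} ((r + 1) * e) =
      cilTot r v (stdSpec n e (e + 2 - 2 * g) 1) val 0 (sqw u) := by
  rw [degreeSum_eq_total r v (B := (stdSpec n e (e + 2 - 2 * g) 0).bound) fun G hG hd =>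
    size_lt_of_isSquareCiliated ((isSquareCiliated_iff G).1 ⟨hG, hd⟩).1]
  unfold cilTot
  congr 1
  funext m
  rw [← sum_isSquareGraph]
  refine Finset.sum_congr rfl fun G _ => ?_
  have hiff : IsLabelled {G : DecoratedMap n (Fin n) N |
      G ∈ {G : DecoratedMap n (Fin n) N | G.IsSquareCiliated r g} ∧ G.deg r = (r + 1) * e} G ↔
      IsSquareGraph (stdSpec n e (e + 2 - 2 * g) 0) G ∧ DegLE r G := by
    constructor
    · rintro ⟨H, hH, e', rfl⟩
      rw [isSquareGraph_map_iff, degLE_map_iff]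
      exact (isSquareCiliated_iff H).1 hH
    · rintro ⟨h1, h2⟩
      obtain ⟨H, e', rfl⟩ := exists_toCfg_eq G h1.graph.opp_opp h1.graph.opp_ne h1.ty_rot
        h1.graph.deco_face
      rw [isSquareGraph_map_iff] at h1
      rw [degLE_map_iff] at h2
      exact ⟨H, (isSquareCiliated_iff H).2 ⟨h1, h2⟩, e', rfl⟩
  by_cases hp : IsSquareGraph (stdSpec n e (e + 2 - 2 * g) 0) G
  · by_cases hd : DegLE r G
    · rw [pif_pos (hiff.2 ⟨hp, hd⟩), pif_pos hp]
    · rw [pif_neg (fun h' => hd (hiff.1 h').2), pif_pos hp, fullWt_eq_zero val u hp.ty_rot hd]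
  · rw [pif_neg (fun h' => hp (hiff.1 h').1), pif_neg hp]

end SquareCiliated

/-! ### The coefficients of the generating functions -/

section Coefficients

theorem coeff_const (c : ℂ) (d : ℤ) : (const c).coeff d = pif (d = 0) c 0 := by
  classical
  unfold pif const
  rw [HahnSeries.C_apply, HahnSeries.coeff_single]

theorem coeff_const_mul (c : ℂ) (x : LaurentSeries ℂ) (d : ℤ) :
    (const c * x).coeff d = c * x.coeff d := by
  unfold const
  rw [HahnSeries.C_mul_eq_smul, HahnSeries.coeff_smul, smul_eq_mul]

theorem coeff_div_const (c : ℂ) (x : LaurentSeries ℂ) (d : ℤ) :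
    (x / const c).coeff d = x.coeff d / c := by
  rw [div_eq_inv_mul, div_eq_inv_mul, ← coeff_const_mul]
  unfold const
  rw [map_inv₀]

theorem alpha_pow (k : ℕ) : alpha ^ k = HahnSeries.single (-(k : ℤ)) 1 := by
  rw [alpha, HahnSeries.single_pow, one_pow]
  simp

theorem coeff_alpha_pow (k : ℕ) (d : ℤ) : (alpha ^ k).coeff d = pif (d = -(k : ℤ)) 1 0 := by
  classical
  rw [alpha_pow, HahnSeries.coeff_single]
  unfold pif
  congr

/-- Exponents count powers of `α⁻¹`, so division by `α ^ k` moves coefficients up by `k`. -/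
theorem coeff_div_alpha_pow_mul (k : ℕ) (c : ℂ) (x : LaurentSeries ℂ) (d : ℤ) :
    (x / (alpha ^ k * const c)).coeff d = x.coeff (d - k) * c⁻¹ := by
  have h1 : (alpha ^ k)⁻¹ = HahnSeries.single (k : ℤ) (1 : ℂ) := by
    rw [alpha_pow, HahnSeries.inv_single, neg_neg, inv_one]
  rw [div_mul_eq_div_div, coeff_div_const, div_eq_mul_inv x, h1, div_eq_mul_inv]
  have := HahnSeries.coeff_mul_single_add (x := x) (r := (1 : ℂ)) (a := d - k) (b := (k : ℤ))
  rw [sub_add_cancel, mul_one] at this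
  rw [this]

variable {r : ℕ} {v : ℕ → ℂ} {N : ℕ} {lam : Fin N → ℂ} {g n : ℕ}

theorem dOpAll_const_zero (z : Fin n → ℂ) : dOpAll r v (fun _ => 0) z = 0 := by
  have h : ∀ l : List (Fin n), l.foldr (dOp r v) (fun _ => 0) = fun _ => 0 := fun l => by
    induction l with
    | nil => rfl
    | cons i l ih =>
      rw [List.foldr_cons, ih]
      funext z
      simp [dOp]
  unfold dOpAll
  rw [h]

variable [NeZero n]

theorem coeff_genF (z : Fin n → ℂ) (e : ℤ) : (genF r v lam g z).coeff ((r + 1) * e) =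
    plainTot r v (stdSpec n e (e + 2 - 2 * g) n) (Sum.elim z lam) :=
  degreeSum_eq_plainTot isUnciliated_iff _ _

theorem coeff_genW (z : Fin n → ℂ) (e : ℤ) : (genW r v lam g z).coeff ((r + 1) * e) =
    plainTot r v (stdSpec n e (e + 2 - 2 * g) 0) (Sum.elim z lam) :=
  degreeSum_eq_plainTot isCiliated_iff _ _

theorem coeff_genU (u : ℂ) (z : Fin n → ℂ) (e : ℤ) : (genU r v lam g u z).coeff ((r + 1) * e) =
    cilTot r v (stdSpec n e (e + 2 - 2 * g) 1) (Sum.elim z lam) 0 (sqw u) :=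
  degreeSum_isSquareCiliated _ _ _ _ _

theorem coeff_genS {k : Fin n → ℕ} (hk : ∀ i, 1 ≤ k i) (z : (i : Fin n) → Fin (k i) → ℂ) (e : ℤ) :
    (genS r v lam g k z).coeff ((r + 1) * e) = plainTot r v (multiSpec k e (e + 2 - 2 * g))
      (Sum.elim (fun p : Σ i : Fin n, Fin (k i) => z p.1 p.2) lam) :=
  degreeSum_eq_plainTot (isMultiCiliated_iff hk) _ _

theorem coeff_genF_eq_zero {d : ℤ} (h : ¬ ∃ e : ℤ, d = (r + 1) * e) (z : Fin n → ℂ) :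
    (genF r v lam g z).coeff d = 0 := degreeSum_eq_zero _ h _ _ _

theorem coeff_genW_eq_zero {d : ℤ} (h : ¬ ∃ e : ℤ, d = (r + 1) * e) (z : Fin n → ℂ) :
    (genW r v lam g z).coeff d = 0 := degreeSum_eq_zero _ h _ _ _

theorem coeff_genU_eq_zero {d : ℤ} (h : ¬ ∃ e : ℤ, d = (r + 1) * e) (u : ℂ) (z : Fin n → ℂ) :
    (genU r v lam g u z).coeff d = 0 := degreeSum_eq_zero _ h _ _ _

theorem coeff_genS_eq_zero {d : ℤ} (h : ¬ ∃ e : ℤ, d = (r + 1) * e) (k : Fin n → ℕ)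
    (z : (i : Fin n) → Fin (k i) → ℂ) : (genS r v lam g k z).coeff d = 0 :=
  degreeSum_eq_zero _ h _ _ _

/-- There are finitely many maps of each degree. -/
theorem finite_isoClasses_all (r g n N : ℕ) [NeZero n] (d : ℤ) :
    (isoClasses r {G : DecoratedMap n (Fin n) N | G.IsUnciliated r g} d).Finite ∧
      (isoClasses r {G : DecoratedMap n (Fin n) N | G.IsCiliated r g} d).Finite ∧
      (isoClasses r {G : DecoratedMap n (Fin n) N | G.IsSquareCiliated r g} d).Finite ∧
      ∀ k : Fin n → ℕ, (isoClasses r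
        {G : DecoratedMap n (Σ i : Fin n, Fin (k i)) N | G.IsMultiCiliated k r g} d).Finite := by
  by_cases h : ∃ e : ℤ, d = (r + 1) * e
  · obtain ⟨e, rfl⟩ := h
    refine ⟨finite_isoClasses_of_isPlain fun H => (isUnciliated_iff H).1,
      finite_isoClasses_of_isPlain fun H => (isCiliated_iff H).1,
      finite_isoClasses fun H hH hd =>
        size_lt_of_isSquareCiliated ((isSquareCiliated_iff H).1 ⟨hH, hd⟩).1, fun k => ?_⟩
    by_cases hk : ∀ i, 1 ≤ k i
    · exact finite_isoClasses_of_isPlain fun H => (isMultiCiliated_iff hk H).1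
    · refine Set.Finite.image _ (Set.Finite.subset Set.finite_empty fun H hH => ?_)
      exact hk fun i => isMultiCiliated_pos hH.1 i
  · refine ⟨?_, ?_, ?_, fun k => ?_⟩ <;> rw [isoClasses_eq_empty _ h] <;> exact Set.finite_empty

/-- Degree zero on the sphere is the numerical type of the loop; the next lemma treats in the same
way the type of the segment. -/
theorem eq_zero_and_iff {e : ℤ} : (g = 0 ∧ (r + 1 : ℤ) * e = 0) ↔
    e = 0 ∧ e + 2 - 2 * (g : ℤ) = 2 := by
  rw [mul_eq_zero, or_iff_right (by positivity)]
  constructor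
  · rintro ⟨rfl, rfl⟩; simp
  · rintro ⟨rfl, h⟩; omega

theorem eq_neg_one_and_iff {e : ℤ} : (g = 0 ∧ (r + 1 : ℤ) * e = -((r + 1 : ℕ) : ℤ)) ↔
    e = -1 ∧ e + 2 - 2 * (g : ℤ) = 1 := by
  have : ((r + 1 : ℤ) * e = -((r + 1 : ℕ) : ℤ)) ↔ e = -1 := by
    push_cast
    rw [show (-((r : ℤ) + 1)) = (r + 1) * (-1) by ring, mul_right_inj' (by positivity)]
  rw [this]
  constructor
  · rintro ⟨rfl, rfl⟩; simp
  · rintro ⟨rfl, h⟩; omega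

theorem coeff_ite_const (p : Prop) [Decidable p] (c : ℂ) (d : ℤ) :
    (if p then const c else 0).coeff d = pif (p ∧ d = 0) c 0 := by
  by_cases hp : p
  · rw [if_pos hp, coeff_const]
    exact pif_congr (by simp [hp]) fun _ => rfl
  · rw [if_neg hp, pif_neg fun h => hp h.1]
    rfl

/-- From unciliated to ciliated maps. -/
theorem coeff_genW_eq (z : Fin n → ℂ) (hz : Admissible r v z lam)
    (h2 : g = 0 → n = 2 → z 0 ≠ z 1) (h1 : g = 0 → n = 1 → ∀ j, z 0 ≠ lam j) (d : ℤ) :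
    AnalyticAt ℂ (fun y : Fin n → ℂ => (genF r v lam g y).coeff d) z ∧
      (genW r v lam g z).coeff d =
        dOpAll r v (fun y : Fin n → ℂ => (genF r v lam g y).coeff d) z +
        pif ((g = 0 ∧ n = 2) ∧ d = 0) (1 / (ddV r v (z 0) * ddV r v (z 1) * (z 0 - z 1) ^ 2)
            - 1 / (dV r v (z 0) - dV r v (z 1)) ^ 2) 0 +
        pif ((g = 0 ∧ n = 1) ∧ d = 0) (∑ j : Fin N, (1 / (ddV r v (z 0) * (z 0 - lam j))
            - 1 / (dV r v (z 0) - dV r v (lam j)))) 0 := by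
  by_cases h : ∃ e : ℤ, d = (r + 1) * e
  · obtain ⟨e, rfl⟩ := h
    have hreg := (regular_iff lam z).2 hz
    simp only [coeff_genF, coeff_genW]
    refine ⟨analyticAt_plainTot _ lam z hreg, ?_⟩
    by_cases hn2 : (g = 0 ∧ n = 2) ∧ (r + 1 : ℤ) * e = 0
    · have hn1 : n ≠ 1 := by omega
      rw [pif_pos hn2, pif_neg fun h => hn1 h.1.2, add_zero]
      refine dOpAll_two e _ hn2.1.2 (eq_zero_and_iff.1 ⟨hn2.1.1, hn2.2⟩) lam 0 1 (by simp) ?_ hreg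
        (h2 hn2.1.1 hn2.1.2)
      rw [Fin.val_one', hn2.1.2]
    · rw [pif_neg hn2, add_zero]
      by_cases hn1 : (g = 0 ∧ n = 1) ∧ (r + 1 : ℤ) * e = 0
      · rw [pif_pos hn1]
        exact dOpAll_one e _ hn1.1.2 (eq_zero_and_iff.1 ⟨hn1.1.1, hn1.2⟩) lam 0 hreg
          (h1 hn1.1.1 hn1.1.2)
      · rw [pif_neg hn1, add_zero, ← dOpFrom_zero, dOpFrom_eq e _ lam ?_ (Nat.zero_le _) hreg]
        rintro ⟨h3, h4, h5⟩
        obtain ⟨h6, h7⟩ := (eq_zero_and_iff (r := r)).2 ⟨h3, h4⟩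
        have := NeZero.ne n
        rcases (show n = 1 ∨ n = 2 by omega) with h8 | h8
        · exact hn1 ⟨⟨h6, h8⟩, h7⟩
        · exact hn2 ⟨⟨h6, h8⟩, h7⟩
  · have hd : d ≠ 0 := fun h0 => h ⟨0, by simp [h0]⟩
    simp only [coeff_genF_eq_zero h, coeff_genW_eq_zero h, dOpAll_const_zero]
    rw [pif_neg fun h => hd h.2, pif_neg fun h => hd h.2]
    exact ⟨analyticAt_const, by simp⟩

/-- In each loop the propagator and the bivalent weight multiply to `-1`, and the unmarked face has
`N` possible decorations. With two marks the loop is excluded, since here all faces but the first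
are ciliated. -/
theorem loopSum_vw {e f : ℤ} {z : Fin n → ℂ} (hz : Regular r v lam z) :
    loopSum r v (stdSpec n e f 1) (Sum.elim z lam) 0 (vw r v) =
      pif (e = 0 ∧ f = 2 ∧ n = 1) (-N) 0 := by
  by_cases h : e = 0 ∧ f = 2 ∧ n = 1
  · have hk : ∀ k : Fin n, k = 0 := by
      obtain ⟨-, -, rfl⟩ := h
      exact fun k => Subsingleton.elim _ _
    rw [pif_pos h, loopSum, Fintype.sum_sum_type, Finset.sum_eq_zero, zero_add,
      Finset.sum_congr rfl (g := fun _ => (-1 : ℂ))]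
    · simp
    · intro j _
      rw [pif_pos, propagator_eq, neg_mul, inv_mul_cancel₀ (hz (.inl 0) (.inr j))]
      exact ⟨h.1, h.2.1, fun k => by simp [stdSpec, hk k], by simp, fun k => Or.inl (hk k)⟩
    · intro k _
      exact pif_neg (fun h => h.2.2.2.1 (by rw [hk k])) _ _
  · rw [pif_neg h]
    have := loopSum_stdSpec_eq_zero (r := r) (v := v) (e := e) (f := f) (i := (0 : Fin n))
      (val := Sum.elim z lam) (φ := vw r v) (fun h' => h ⟨h'.1, h'.2.1, by simpa using h'.2.2.2.symm⟩)
    simpa using this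

theorem forall_eq_zero_iff : (∀ k : Fin n, k = 0) ↔ n = 1 := by
  constructor
  · intro h
    by_contra hn
    have hn0 := NeZero.ne n
    have := congrArg Fin.val (h ⟨1, by omega⟩)
    simp at this
  · rintro rfl k
    exact Subsingleton.elim _ _

/-- The first residue of square ciliated maps. -/
theorem coeff_genU_residue (z : Fin n → ℂ) (hz : Admissible r v z lam) (d : ℤ) :
    HasResidueAtInfinity (fun u => dV r v u * (genU r v lam g u z).coeff d)
      (pif ((g = 0 ∧ n = 1) ∧ d = -((r + 1 : ℕ) : ℤ)) (-(dV r v (z 0) / ddV r v (z 0))) 0) := by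
  by_cases h : ∃ e : ℤ, d = (r + 1) * e
  · obtain ⟨e, rfl⟩ := h
    simp only [coeff_genU]
    have := cilTot_residue (stdSpec n e (e + 2 - 2 * g) 1) (Sum.elim z lam) 0 (by simp [stdSpec]) rfl
      ((regular_iff lam z).2 hz)
    convert this using 1
    refine pif_congr ?_ fun _ => rfl
    change _ ↔ e = -1 ∧ e + 2 - 2 * (g : ℤ) = 1 ∧ _
    rw [forall_eq_zero_iff, ← and_assoc, ← eq_neg_one_and_iff (r := r)]
    tauto
  · simp only [coeff_genU_eq_zero h, mul_zero]
    rw [pif_neg]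
    · exact hasResidueAtInfinity_zero
    · exact fun h' => h ⟨-1, by rw [h'.2]; push_cast; ring⟩

/-- The second residue of square ciliated maps. -/
theorem coeff_genU_residue_mul (z : Fin n → ℂ) (hz : Admissible r v z lam) (d : ℤ) :
    HasResidueAtInfinity (fun u => dV r v u * (u - z 0) * (genU r v lam g u z).coeff d)
      (-(dV r v (z 0) / ddV r v (z 0) * (genW r v lam g z).coeff d +
        pif ((g = 0 ∧ n = 1) ∧ d = 0) (N / ddV r v (z 0)) 0)) := by
  by_cases h : ∃ e : ℤ, d = (r + 1) * e
  · obtain ⟨e, rfl⟩ := h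
    simp only [coeff_genU, coeff_genW]
    have hreg := (regular_iff lam z).2 hz
    have := cilTot_residue_mul (stdSpec n e (e + 2 - 2 * g) 1) (Sum.elim z lam) 0
      (by simp [stdSpec]) rfl hreg
    rw [loopSum_vw hreg, stdSpec_one_addCil, propagator, if_pos rfl] at this
    simp only [Sum.elim_inl] at this
    refine (congrArg (HasResidueAtInfinity _) ?_).mp this
    have hiff : ((g = 0 ∧ n = 1) ∧ (r + 1 : ℤ) * e = 0) ↔
        e = 0 ∧ e + 2 - 2 * (g : ℤ) = 2 ∧ n = 1 := by
      rw [← and_assoc, ← eq_zero_and_iff (r := r)]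
      tauto
    by_cases hp : e = 0 ∧ e + 2 - 2 * (g : ℤ) = 2 ∧ n = 1
    · rw [pif_pos hp, pif_pos (hiff.2 hp)]
      ring
    · rw [pif_neg hp, pif_neg (mt hiff.1 hp)]
      ring
  · simp only [coeff_genU_eq_zero h, coeff_genW_eq_zero h, mul_zero]
    rw [pif_neg, add_zero, neg_zero]
    · exact hasResidueAtInfinity_zero
    · exact fun h' => h ⟨0, by rw [h'.2]; simp⟩

/-- The behaviour at infinity of square ciliated maps. -/
theorem coeff_genU_tendsto (z : Fin n → ℂ) (d : ℤ) :
    Filter.Tendsto (fun u : ℂ => u ^ 2 * ((genU r v lam g u z).coeff d -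
      pif ((g = 0 ∧ n = 1) ∧ d = -((r + 1 : ℕ) : ℤ)) (1 / (ddV r v (z 0) * (u - z 0))) 0))
      (Bornology.cobounded ℂ) (𝓝 ((genW r v lam g z).coeff d / ddV r v (z 0))) := by
  by_cases h : ∃ e : ℤ, d = (r + 1) * e
  · obtain ⟨e, rfl⟩ := h
    simp only [coeff_genU, coeff_genW]
    have := cilTot_tendsto (r := r) (v := v) (stdSpec n e (e + 2 - 2 * g) 1) (Sum.elim z lam) 0
      (by simp [stdSpec]) rfl
    rw [stdSpec_one_addCil] at this
    refine this.congr fun u => congrArg (fun x => u ^ 2 * (_ - x)) (pif_congr ?_ fun _ => rfl)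
    change e = -1 ∧ e + 2 - 2 * (g : ℤ) = 1 ∧ _ ↔ _
    rw [forall_eq_zero_iff, ← and_assoc, ← eq_neg_one_and_iff (r := r)]
    tauto
  · have hd : d ≠ -((r + 1 : ℕ) : ℤ) := fun h' => h ⟨-1, by rw [h']; push_cast; ring⟩
    simp only [coeff_genU_eq_zero h, coeff_genW_eq_zero h, pif_neg fun h => hd (And.right h)]
    simp

theorem repSum_sigma (k : Fin n → ℕ) (W : (Fin n → ℂ) → ℂ) (F : ℂ → ℂ)
    (z : (i : Fin n) → Fin (k i) → ℂ) :
    repSum (Sigma.fst : (Σ i : Fin n, Fin (k i)) → Fin n) W F (fun p => z p.1 p.2) =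
      ∑ j : (i : Fin n) → Fin (k i), W (fun m => z m (j m)) *
        (∏ m, ∏ i ∈ Finset.univ.erase (j m), (F (z m (j m)) - F (z m i)))⁻¹ := by
  have h := sum_pif_bij (α := Fin n → Σ i : Fin n, Fin (k i)) (β := (i : Fin n) → Fin (k i))
    (P := fun s => ∀ i, (s i).1 = i) (Q := fun _ => True)
    (f := fun s => W ((fun p => z p.1 p.2) ∘ s) * repKer Sigma.fst F (fun p => z p.1 p.2) s)
    (g := fun j => W (fun m => z m (j m)) *
        (∏ m, ∏ i ∈ Finset.univ.erase (j m), (F (z m (j m)) - F (z m i)))⁻¹)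
    (fun j i => ⟨i, j i⟩) (fun _ _ _ => rfl) ?_ ?_ ?_
  · unfold repSum
    rw [h]
    exact Finset.sum_congr rfl fun j _ => pif_pos trivial _ _
  · intro j j' _ _ h
    funext i
    have := congrFun h i
    simpa using this
  · intro s hs
    refine ⟨fun i => hs i ▸ (s i).2, trivial, funext fun i => ?_⟩
    have := hs i
    refine Sigma.ext this.symm ?_
    simp
  · intro j _
    refine congrArg (W (fun m => z m (j m)) * ·) ?_
    rw [repKer, Fintype.prod_sigma, ← Finset.prod_inv_distrib]
    refine Finset.prod_congr rfl fun m _ => ?_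
    rw [← Finset.prod_inv_distrib, ← Finset.mul_prod_erase _ _ (Finset.mem_univ (j m)),
      pif_pos rfl, one_mul]
    refine Finset.prod_congr rfl fun i hi => pif_neg ?_ _ _
    intro h
    exact Finset.ne_of_mem_erase hi (by simpa using h)

theorem weight_denominator (k : Fin n → ℕ) (q : Fin n → ℕ) (F : (m : Fin n) → Fin (k m) → ℂ)
    (s : (m : Fin n) → Finset (Fin (k m))) :
    ∏ m : Fin n, (alpha ^ q m * ∏ i ∈ s m, const (F m i)) =
      alpha ^ (∑ m, q m) * const (∏ m, ∏ i ∈ s m, F m i) := by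
  rw [Finset.prod_mul_distrib, Finset.prod_pow_eq_pow_sum]
  unfold const
  simp only [map_prod]

/-- From ciliated to multi-ciliated maps. -/
theorem genS_eq (hg : ¬ (g = 0 ∧ n = 1)) (k : Fin n → ℕ) (hk : ∀ i, 1 ≤ k i)
    (z : (i : Fin n) → Fin (k i) → ℂ)
    (hz : Admissible r v (fun p : Σ i : Fin n, Fin (k i) => z p.1 p.2) lam)
    (hinj : ∀ i, Function.Injective (z i)) :
    genS r v lam g k z =
      ∑ j : (i : Fin n) → Fin (k i), genW r v lam g (fun m => z m (j m)) /
        ∏ m : Fin n, (alpha ^ ((k m - 1) * (r + 1)) *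
          ∏ i ∈ Finset.univ.erase (j m), const (dV r v (z m (j m)) - dV r v (z m i))) := by
  ext d
  rw [HahnSeries.coeff_sum]
  simp only [weight_denominator k (fun m => (k m - 1) * (r + 1))
    (fun m i => dV r v (z m (_ : Fin (k m))) - dV r v (z m i)), coeff_div_alpha_pow_mul]
  -- The total power of `α` is the loss of degree when every white vertex is reduced to degree one,
  -- namely `r + 1` for each edge removed.
  have hsum : ((∑ m, (k m - 1) * (r + 1) : ℕ) : ℤ) = (r + 1) * ((∑ m, k m : ℕ) - n) := by
    push_cast
    rw [← Finset.sum_mul, mul_comm]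
    congr 1
    rw [Finset.sum_congr rfl fun m _ => (Nat.cast_sub (hk m) : ((k m - 1 : ℕ) : ℤ) = k m - (1 : ℕ)),
      Finset.sum_sub_distrib]
    simp
  rw [hsum]
  by_cases h : ∃ e : ℤ, d = (r + 1) * e
  · obtain ⟨e, rfl⟩ := h
    rw [coeff_genS hk, plainTot_star lam (∑ m, k m) _ (by simp) _ (multiSpec_isStar hk e _) ?_ _
      ((regular_iff lam _).2 hz)]
    · change repSum Sigma.fst _ _ (fun p : Σ i : Fin n, Fin (k i) => z p.1 p.2) = _
      rw [repSum_sigma]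
      refine Finset.sum_congr rfl fun j _ => congrArg (· * _) ?_
      rw [← mul_sub, coeff_genW]
      change plainTot r v (stdSpec n (e - (∑ m, k m : ℕ) + n)
        (e + 2 - 2 * (g : ℤ) - (∑ m, k m : ℕ) + n) 0) _ = _
      congr 2 <;> ring
    · rintro ⟨i, j⟩ ⟨i', j'⟩ (rfl : i = i') hne heq
      exact hne (congrArg (Sigma.mk i) (hinj i heq))
    -- The equation `e + 2 = f` forces genus zero, and then `hg` provides a second white vertex.
    · intro h i
      have hg0 : g = 0 := by
        change e + 2 = e + 2 - 2 * (g : ℤ) at h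
        omega
      have hn0 := NeZero.ne n
      have hn : 1 < n := by
        have : n ≠ 1 := fun h' => hg ⟨hg0, h'⟩
        omega
      have : Nontrivial (Fin n) := Fin.nontrivial_iff_two_le.2 hn
      exact exists_ne i
  · rw [coeff_genS_eq_zero h, Finset.sum_eq_zero]
    intro j _
    rw [coeff_genW_eq_zero, zero_mul]
    rintro ⟨e, he⟩
    exact h ⟨e + ((∑ m, k m : ℕ) - n), by rw [mul_add, ← he]; ring⟩

end Coefficients

end Kontsevich

end

/-! ### The theorem, coefficient by coefficient -/

open Kontsevich DecoratedMap in
theorem mainTheorem4 (r : ℕ) (hr : 2 ≤ r) (v : ℕ → ℂ) (hv : v (r + 1) ≠ 0)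
    (N : ℕ) (lam : Fin N → ℂ) (g n : ℕ) [NeZero n] :
    -- there are finitely many graphs of each degree, so that the generating functions make sense
    (∀ d : ℤ,
      (isoClasses r {G : DecoratedMap n (Fin n) N | G.IsUnciliated r g} d).Finite ∧
      (isoClasses r {G : DecoratedMap n (Fin n) N | G.IsCiliated r g} d).Finite ∧
      (isoClasses r {G : DecoratedMap n (Fin n) N | G.IsSquareCiliated r g} d).Finite ∧
      ∀ k : Fin n → ℕ, (isoClasses r
        {G : DecoratedMap n (Σ i : Fin n, Fin (k i)) N | G.IsMultiCiliated k r g} d).Finite) ∧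
    -- from `F` to `W`
    (∀ z : Fin n → ℂ, Admissible r v z lam →
      (g = 0 → n = 2 → z 0 ≠ z 1) → (g = 0 → n = 1 → ∀ j, z 0 ≠ lam j) →
      ∀ d : ℤ,
        AnalyticAt ℂ (fun y : Fin n → ℂ => (genF r v lam g y).coeff d) z ∧
        (genW r v lam g z).coeff d =
          dOpAll r v (fun y : Fin n → ℂ => (genF r v lam g y).coeff d) z +
          (if g = 0 ∧ n = 2 then
            const (1 / (ddV r v (z 0) * ddV r v (z 1) * (z 0 - z 1) ^ 2)
              - 1 / (dV r v (z 0) - dV r v (z 1)) ^ 2)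
          else 0).coeff d +
          (if g = 0 ∧ n = 1 then
            const (∑ j : Fin N, (1 / (ddV r v (z 0) * (z 0 - lam j))
              - 1 / (dV r v (z 0) - dV r v (lam j))))
          else 0).coeff d) ∧
    -- from `W` to `S`
    (¬ (g = 0 ∧ n = 1) → ∀ (k : Fin n → ℕ), (∀ i, 1 ≤ k i) →
      ∀ z : (i : Fin n) → Fin (k i) → ℂ,
      Admissible r v (fun p : Σ i : Fin n, Fin (k i) => z p.1 p.2) lam →
      (∀ i, Function.Injective (z i)) →
      genS r v lam g k z =
        ∑ j : (i : Fin n) → Fin (k i),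
          genW r v lam g (fun m => z m (j m)) /
            ∏ m : Fin n, (alpha ^ ((k m - 1) * (r + 1)) *
              ∏ i ∈ Finset.univ.erase (j m), const (dV r v (z m (j m)) - dV r v (z m i)))) ∧
    -- from `U` to `W`
    (∀ z : Fin n → ℂ, Admissible r v z lam → ∀ d : ℤ,
      HasResidueAtInfinity (fun u => dV r v u * (genU r v lam g u z).coeff d)
        (-(if g = 0 ∧ n = 1 then const (dV r v (z 0) / ddV r v (z 0)) * alpha ^ (r + 1)
          else 0).coeff d) ∧
      HasResidueAtInfinity (fun u => dV r v u * (u - z 0) * (genU r v lam g u z).coeff d)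
        (-(const (dV r v (z 0) / ddV r v (z 0)) * genW r v lam g z +
          (if g = 0 ∧ n = 1 then const ((N : ℂ) / ddV r v (z 0)) else 0)).coeff d) ∧
      Filter.Tendsto
        (fun u : ℂ => (const (u ^ 2) * (genU r v lam g u z -
          (if g = 0 ∧ n = 1 then alpha ^ (r + 1) / const (ddV r v (z 0) * (u - z 0))
            else 0))).coeff d)
        (Bornology.cobounded ℂ)
        (𝓝 ((genW r v lam g z / const (ddV r v (z 0))).coeff d))) := by
  refine ⟨finite_isoClasses_all r g n N, fun z hz h2 h1 d => ?_, fun hg k hk z hz hinj =>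
    genS_eq hg k hk z hz hinj, fun z hz d => ⟨?_, ?_, ?_⟩⟩
  · rw [coeff_ite_const, coeff_ite_const]
    exact coeff_genW_eq z hz h2 h1 d
  · convert coeff_genU_residue z hz d using 1
    by_cases h : g = 0 ∧ n = 1
    · rw [if_pos h, coeff_const_mul, coeff_alpha_pow]
      by_cases hd : d = -((r + 1 : ℕ) : ℤ)
      · rw [pif_pos hd, pif_pos ⟨h, hd⟩, mul_one]
      · rw [pif_neg hd, pif_neg fun h' => hd h'.2, mul_zero, neg_zero]
    · rw [if_neg h, pif_neg fun h' => h h'.1]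
      exact neg_zero
  · convert coeff_genU_residue_mul z hz d using 1
    rw [HahnSeries.coeff_add, coeff_const_mul, coeff_ite_const]
  · rw [coeff_div_const]
    refine (coeff_genU_tendsto z d).congr fun u => ?_
    rw [coeff_const_mul, HahnSeries.coeff_sub]
    congr 2
    by_cases h : g = 0 ∧ n = 1
    · rw [if_pos h, coeff_div_const, coeff_alpha_pow]
      by_cases hd : d = -((r + 1 : ℕ) : ℤ)
      · rw [pif_pos hd, pif_pos ⟨h, hd⟩]
      · rw [pif_neg hd, pif_neg fun h' => hd h'.2, zero_div]
    · rw [if_neg h, pif_neg fun h' => h h'.1]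
      rfl
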